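/- Let $\mathcal M$ be a compact connected $d$-dimensional manifold with (possibly empty) boundary of class $\mathscr C^2$, $d\ge 1$, with a $\mathscr C^1$ Riemannian metric $g$; set $\mathcal L=\mathbb R\times\mathcal M$ and write points of $T^*\mathcal L$ as $\varrho=(t,x,\tau,\xi)$, $\xi\in T_x^*\mathcal M$. Let $p(\varrho)=-\tau^2+g^*_x(\xi,\xi)$, where $g^*_x$ is the dual metric, let $\mathrm{Char}\,p=\{p=0\}$, and let $H_f$ be the Hamiltonian vector field of $f$, in coordinates $H_f=\partial_\tau f\,\partial_t+\nabla_\xi f\cdot\nabla_x-\partial_t f\,\partial_\tau-\nabla_x f\cdot\nabla_\xi$. Near a boundary point use $\mathscr C^2$ coordinates in which $\mathcal M=\{z\ge 0\}$, $z$ being one of the coordinates, and let $\partial(T^*\mathcal L)$ be the set of points with $x\in\partial\mathcal M$. On $\mathrm{Char}\,p\cap\partial(T^*\mathcal L)$ set $\mathcal H^\pm=\{\pm H_pz>0\}$, $\mathcal H=\mathcal H^+\cup\mathcal H^-$, $\mathcal G=\{H_pz=0\}$ and $\mathcal G^{g}=\mathcal G\cap\{H_p^2z<0\}$; these sets do not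 depend on the coordinates. For $x\in\partial\mathcal M$ let $n_x^*=g_x^*(dz,dz)^{-1/2}dz$ be the unit conormal, and set $\Sigma(t,x,\tau,\xi)=(t,x,\tau,\xi-2g_x^*(\xi,n_x^*)n_x^*)$. Let ${}^{G}X=H_p+\frac{H_p^2z}{H_z^2p}H_z$ on $\mathcal G^{g}$ and ${}^{G}X=H_p$ on $T^*\mathcal L\setminus\mathcal G^{g}$. A generalized bicharacteristic is a map $\gamma:J\setminus B\to \mathrm{Char}\,p\cap T^*\mathcal L$, where $J\subset\mathbb R$ is an interval of positive length and $B\subset J$ consists of isolated points, such that: 1. for $s\in J\setminus B$, $\gamma(s)\notin\mathcal H$ and $\gamma$ is differentiable at $s$ with $\gamma'(s)={}^{G}X(\gamma(s))$; 2. if $S\in B$, then $\gamma(s)\notin\partial(T^*\mathcal L)$ for $s\in J\setminus B$ close to $S$, and for $\varepsilon>0$: if $[S-\varepsilon,S]\subset J$ then $\gamma(S^-)=\lim_{s\to S^-}\gamma(s)$ exists and lies in $\mathcal H^-$; if $[S,S+\varepsilon]\subset J$ then $\gamma(S^+)=\lim_{s\to S^+}\gamma(s)$ exists and lies in $\mathcal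 H^+$; if $[S-\varepsilon,S+\varepsilon]\subset J$ then $\gamma(S^+)=\Sigma(\gamma(S^-))$. It is maximal if it cannot be extended to a generalized bicharacteristic on a strictly larger interval. Theorem. (i) Let $\gamma(s)=(t(s),x(s),\tau(s),\xi(s))$, $s\in J\setminus B$, be a maximal generalized bicharacteristic. Then $J=\mathbb R$, and $\tau(s)$ is constant; if this constant is nonzero, then $t$ extends continuously to $\mathbb R$ and $t(\mathbb R)=\mathbb R$. (ii) For every $\varrho^0\in\mathrm{Char}\,p\cap T^*\mathcal L$ there is a maximal generalized bicharacteristic $\gamma$ on $\mathbb R\setminus B$, for some such $B$, with $\gamma(0)=\varrho^0$ (and $0\notin B$) if $\varrho^0\notin\mathcal H$; with $0\in B$ and $\gamma(0^+)=\varrho^0$ if $\varrho^0\in\mathcal H^+$; and with $0\in B$ and $\gamma(0^-)=\varrho^0$ if $\varrho^0\in\mathcal H^-$. -/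

import Mathlib

open Set Filter Topology Manifold Bundle

noncomputable section

namespace GenBichar

/-- The model vector space `ℝᵈ`. -/
abbrev Model (d : ℕ) : Type := EuclideanSpace ℝ (Fin d)

/-! ### Hamiltonian formalism in local coordinates

The normal coordinate, which is `≥ 0` in a chart, is the coordinate of index `0`
(this is the convention of `EuclideanHalfSpace`). -/

/-- Local phase space, with coordinates `(t, x, τ, ξ)`. -/
abbrev LocalPhase (d : ℕ) : Type := ℝ × Model d × ℝ × Model d

/-- The part `{z ≥ 0}` of the local phase space. All the derivatives below are taken within this
set: they are ordinary derivatives if `z > 0` and derivatives up to the boundary if `z = 0`. -/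
def halfPhase (d : ℕ) [NeZero d] : Set (LocalPhase d) := {q | 0 ≤ q.2.1 0}

/-- The coordinate function `z`. -/
def zCoord (d : ℕ) [NeZero d] (q : LocalPhase d) : ℝ := q.2.1 0

/-- The Hamiltonian vector field of `f` on the local phase space,
`H_f = ∂_τ f ∂_t + ∇_ξ f · ∇_x - ∂_t f ∂_τ - ∇_x f · ∇_ξ`. -/
def hamField {d : ℕ} [NeZero d] (f : LocalPhase d → ℝ) (q : LocalPhase d) : LocalPhase d :=
  let D := fderivWithin ℝ f (halfPhase d) q
  (D (0, 0, 1, 0),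
    WithLp.toLp 2 (fun i => D (0, 0, 0, EuclideanSpace.single i 1)),
    - D (1, 0, 0, 0),
    WithLp.toLp 2 (fun i => - D (0, EuclideanSpace.single i 1, 0, 0)))

/-- The Poisson bracket `{f, h} = H_f h`. -/
def poisson {d : ℕ} [NeZero d] (f h : LocalPhase d → ℝ) (q : LocalPhase d) : ℝ :=
  fderivWithin ℝ h (halfPhase d) q (hamField f q)

/-! ### The manifold, its metric, and the cotangent bundle -/

section Geometry

variable {d : ℕ} [NeZero d] {M : Type*} [TopologicalSpace M]
  [ChartedSpace (EuclideanHalfSpace d) M] [IsManifold (𝓡∂ d) 2 M]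

variable (d M) in
/-- A `C¹` Riemannian metric on the `C²` manifold with boundary `M`. -/
abbrev Metric : Type _ :=
  ContMDiffRiemannianMetric (𝓡∂ d) 1 (Model d) (fun x : M => TangentSpace (𝓡∂ d) x)

variable (d) in
/-- The cotangent space `T*ₓM`. -/
abbrev Cotangent (x : M) : Type := TangentSpace (𝓡∂ d) x →L[ℝ] Trivial M ℝ x

variable (d M) in
/-- The cotangent bundle `T*M`, with the topology of a vector bundle. -/
abbrev CotangentBundle : Type _ := TotalSpace (Model d →L[ℝ] ℝ) (fun x : M => Cotangent d x)

variable (d M) in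
/-- The bundle `T*L` of `L = ℝ × M`. A point `ϱ = (t, x, τ, ξ)` is stored as `(t, τ, (x, ξ))`. -/
abbrev Phase : Type _ := ℝ × ℝ × CotangentBundle d M

/-- The time component `t` of a point of `T*L`. -/
def Phase.time (ρ : Phase d M) : ℝ := ρ.1

/-- The component `τ` of a point of `T*L`. -/
def Phase.tau (ρ : Phase d M) : ℝ := ρ.2.1

/-- The base point `x ∈ M` of a point of `T*L`. -/
def Phase.base (ρ : Phase d M) : M := ρ.2.2.proj

/-- The boundary `∂(T*L)`. -/
def boundaryPhase : Set (Phase d M) := {ρ | Phase.base ρ ∈ (𝓡∂ d).boundary M}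

/-- The coordinate vector field `∂_{x_i}` of the chart at `x₀`, at the point `x`. -/
def coordVec (x₀ x : M) (i : Fin d) : TangentSpace (𝓡∂ d) x :=
  (trivializationAt (Model d) (TangentSpace (𝓡∂ d) (M := M)) x₀).symmL ℝ x
    (EuclideanSpace.single i 1)

/-- The components `ξ_i` of a covector at `x` in the chart at `x₀`. -/
def covecCoord (x₀ x : M) (ξ : Cotangent d x) : Model d :=
  WithLp.toLp 2 (fun i => (ξ (coordVec x₀ x i) : ℝ))

/-- The local coordinates `(t, x, τ, ξ)` of a point of `T*L` in the chart at `x₀`. -/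
def coord (x₀ : M) (ρ : Phase d M) : LocalPhase d :=
  (ρ.1, extChartAt (𝓡∂ d) x₀ ρ.2.2.proj, ρ.2.1, covecCoord x₀ ρ.2.2.proj ρ.2.2.snd)

/-- The matrix `(g_{ij})` of the metric in the chart at `x₀`, as a function of the
coordinates `y`. -/
def metricMatrix (g : Metric d M) (x₀ : M) (y : Model d) : Matrix (Fin d) (Fin d) ℝ :=
  let x := (extChartAt (𝓡∂ d) x₀).symm y
  Matrix.of fun i j => g.inner x (coordVec x₀ x i) (coordVec x₀ x j)

/-- The dual metric `g*(ξ, η) = g^{ij} ξ_i η_j` in the chart at `x₀`, with `(g^{ij})` the inverse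
of `(g_{ij})`. -/
def cometric (g : Metric d M) (x₀ : M) (y ξ η : Model d) : ℝ :=
  ∑ i, ∑ j, (metricMatrix g x₀ y)⁻¹ i j * ξ i * η j

/-- The wave symbol `p = -τ² + |ξ|²ₓ` in the chart at `x₀`. -/
def symbolLoc (g : Metric d M) (x₀ : M) (q : LocalPhase d) : ℝ :=
  - q.2.2.1 ^ 2 + cometric g x₀ q.2.1 q.2.2.2 q.2.2.2

/-- `H_p z` in the chart at `x₀`. -/
def HpzLoc (g : Metric d M) (x₀ : M) : LocalPhase d → ℝ :=
  poisson (symbolLoc g x₀) (zCoord d)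

/-- `H_p² z` in the chart at `x₀`. -/
def Hp2zLoc (g : Metric d M) (x₀ : M) : LocalPhase d → ℝ :=
  poisson (symbolLoc g x₀) (HpzLoc g x₀)

/-- `H_z² p` in the chart at `x₀`. -/
def Hz2pLoc (g : Metric d M) (x₀ : M) : LocalPhase d → ℝ :=
  poisson (zCoord d) (poisson (zCoord d) (symbolLoc g x₀))

/-- The gliding vector field `H_p + (H_p² z / H_z² p) H_z` in the chart at `x₀`. -/
def glidingLoc (g : Metric d M) (x₀ : M) (q : LocalPhase d) : LocalPhase d :=
  hamField (symbolLoc g x₀) q + (Hp2zLoc g x₀ q / Hz2pLoc g x₀ q) • hamField (zCoord d) q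

/-! ### The regions of `T*L`

At a point above `x` the chart at `x` is used. The value of `p`, and on `∂(T*L)` the signs of
`H_p z` and (where `z = H_p z = 0`) of `H_p² z`, do not depend on the chart. -/

/-- The wave symbol `p(ϱ) = -τ² + |ξ|²ₓ`. -/
def symbol (g : Metric d M) (ρ : Phase d M) : ℝ :=
  symbolLoc g (Phase.base ρ) (coord (Phase.base ρ) ρ)

/-- `H_p z` at `ϱ`. -/
def Hpz (g : Metric d M) (ρ : Phase d M) : ℝ :=
  HpzLoc g (Phase.base ρ) (coord (Phase.base ρ) ρ)

/-- `H_p² z` at `ϱ`. -/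
def Hp2z (g : Metric d M) (ρ : Phase d M) : ℝ :=
  Hp2zLoc g (Phase.base ρ) (coord (Phase.base ρ) ρ)

/-- The characteristic set `Char p ∩ T*L`. -/
def charSet (g : Metric d M) : Set (Phase d M) := {ρ | symbol g ρ = 0}

/-- The hyperbolic points that point strictly inward, `ℋ⁺`. -/
def hypPlus (g : Metric d M) : Set (Phase d M) :=
  {ρ | ρ ∈ boundaryPhase ∧ ρ ∈ charSet g ∧ 0 < Hpz g ρ}

/-- The hyperbolic points that point strictly outward, `ℋ⁻`. -/
def hypMinus (g : Metric d M) : Set (Phase d M) :=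
  {ρ | ρ ∈ boundaryPhase ∧ ρ ∈ charSet g ∧ Hpz g ρ < 0}

/-- The hyperbolic set `ℋ`. -/
def hyp (g : Metric d M) : Set (Phase d M) := hypPlus g ∪ hypMinus g

/-- The glancing set `𝒢`. -/
def glancing (g : Metric d M) : Set (Phase d M) :=
  {ρ | ρ ∈ boundaryPhase ∧ ρ ∈ charSet g ∧ Hpz g ρ = 0}

/-- The gliding set, the part of the glancing set where `H_p² z < 0`. -/
def gliding (g : Metric d M) : Set (Phase d M) := {ρ | ρ ∈ glancing g ∧ Hp2z g ρ < 0}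

open Classical in
/-- The vector field `ᴳX` at `ϱ`, in the coordinates of the chart at the base point of `ϱ`:
the gliding vector field on the gliding set, and `H_p` elsewhere. -/
def genField (g : Metric d M) (ρ : Phase d M) : LocalPhase d :=
  if ρ ∈ gliding g then glidingLoc g (Phase.base ρ) (coord (Phase.base ρ) ρ)
  else hamField (symbolLoc g (Phase.base ρ)) (coord (Phase.base ρ) ρ)

/-! ### The reflection at the boundary -/

/-- The dual metric on `T*ₓM`. -/
def dualInner (g : Metric d M) (x : M) (ξ η : Cotangent d x) : ℝ :=
  cometric g x (extChartAt (𝓡∂ d) x x) (covecCoord x x ξ) (covecCoord x x η)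

/-- The covector `dz` at `x`, where `z` is the normal coordinate of the chart at `x`. -/
def dz (x : M) : Cotangent d x :=
  (EuclideanSpace.proj (0 : Fin d) : Model d →L[ℝ] ℝ).comp
    ((trivializationAt (Model d) (TangentSpace (𝓡∂ d) (M := M)) x).continuousLinearMapAt ℝ x)

/-- The unit inward conormal `n*ₓ = g*(dz, dz)^{-1/2} dz`, meaningful for `x ∈ ∂M`. -/
def conormal (g : Metric d M) (x : M) : Cotangent d x :=
  (Real.sqrt (dualInner g x (dz x) (dz x)))⁻¹ • dz x

/-- The involution `Σ(t, x, τ, ξ) = (t, x, τ, ξ - 2 g*ₓ(ξ, n*ₓ) n*ₓ)` of `∂(T*L)`. -/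
def reflection (g : Metric d M) (ρ : Phase d M) : Phase d M :=
  (ρ.1, ρ.2.1, ⟨ρ.2.2.proj, ρ.2.2.snd -
    (2 * dualInner g ρ.2.2.proj ρ.2.2.snd (conormal g ρ.2.2.proj)) • conormal g ρ.2.2.proj⟩)

/-! ### Generalized bicharacteristics -/

/-- `γ` is a generalized bicharacteristic on `J \ B`. Only the values of `γ` on `J \ B` matter.
The derivative at `s` is computed in the chart at the base point of `γ s`; at an endpoint of `J`
it is one-sided. -/
structure IsGenBichar (g : Metric d M) (J B : Set ℝ) (γ : ℝ → Phase d M) : Prop where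
  /-- `J` is an interval of positive length. -/
  ordConnected : J.OrdConnected
  nontrivial : J.Nontrivial
  /-- `B` is a subset of `J` made of isolated points (it need not be closed in `J`). -/
  subset : B ⊆ J
  discrete : IsDiscrete B
  mem_char : ∀ s ∈ J \ B, γ s ∈ charSet g
  notMem_hyp : ∀ s ∈ J \ B, γ s ∉ hyp g
  continuousWithinAt : ∀ s ∈ J \ B, ContinuousWithinAt γ (J \ B) s
  hasDeriv : ∀ s ∈ J \ B,
    HasDerivWithinAt (fun r => coord (Phase.base (γ s)) (γ r)) (genField g (γ s)) (J \ B) s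
  interior_near : ∀ S ∈ B, ∀ᶠ s in 𝓝[J \ B] S, γ s ∉ boundaryPhase
  limit_left : ∀ S ∈ B, (∃ ε > 0, Icc (S - ε) S ⊆ J) →
    ∃ ρ ∈ hypMinus g, Tendsto γ (𝓝[(J \ B) ∩ Iio S] S) (𝓝 ρ)
  limit_right : ∀ S ∈ B, (∃ ε > 0, Icc S (S + ε) ⊆ J) →
    ∃ ρ ∈ hypPlus g, Tendsto γ (𝓝[(J \ B) ∩ Ioi S] S) (𝓝 ρ)
  reflect : ∀ S ∈ B, (∃ ε > 0, Icc (S - ε) (S + ε) ⊆ J) →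
    ∀ ρ₁ ρ₂ : Phase d M, Tendsto γ (𝓝[(J \ B) ∩ Iio S] S) (𝓝 ρ₁) →
      Tendsto γ (𝓝[(J \ B) ∩ Ioi S] S) (𝓝 ρ₂) → ρ₂ = reflection g ρ₁

/-- A generalized bicharacteristic is maximal if it has no proper extension: any generalized
bicharacteristic on a larger interval with the same jump set in `J` and the same values on `J \ B`
is defined on the same interval. -/
def IsMaximalGenBichar (g : Metric d M) (J B : Set ℝ) (γ : ℝ → Phase d M) : Prop :=
  IsGenBichar g J B γ ∧
    ∀ (J' B' : Set ℝ) (γ' : ℝ → Phase d M), IsGenBichar g J' B' γ' →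
      J ⊆ J' → B' ∩ J = B → EqOn γ' γ (J \ B) → J' = J

end Geometry

end GenBichar

end

/-! Work in a chart where the manifold is `z ≥ 0`, and write `ζ = H_p z` and `a = H_p² z`. The
metric is only `C¹`, so `H_p` is only continuous: solutions need not be unique, and existence is of
Peano type. But `ζ = 2 g^{0j} ξ_j` contains no derivative of the metric, so it can replace `ξ_0` as
a coordinate. The symbol is then `ζ² / (4 g^{00})` plus a function of the other coordinates, hence
even in `ζ`, and the reflection `Σ` is `ζ ↦ -ζ`. A generalized bicharacteristic solves `z' = ζ`,
with `ζ' = a` except at gliding points, where `ζ' = 0`; its components other than `ξ_0` follow `H_p`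
everywhere and do not feel the reflections.

Local existence. Glue a second copy of the half space, with the signs of `z` and `ζ` changed. A
reflection becomes a transversal crossing of `z = 0`, and the equation becomes `ζ' = sgn(z) a`. Its
Euler scheme has uniformly bounded increments, so it converges along an ultrafilter to a Lipschitz
curve (`exists_isEulerLimit`, `exists_isDoubledSol`). Crossings with `ζ ≠ 0` are isolated, though
they may accumulate at glancing points. Everything hinges on the derivative of the normal velocity
at a time `s₀` where `z = ζ = 0`, with `a₀ = a(s₀)` (`IsDoubledSol.hasDerivWithinAt_velocity`). If
`a₀ ≤ 0`, the energy `E = ζ²/2 - a₀ |z|` dominates `ζ²/2`, is continuous across reflections and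
satisfies `|E'| ≤ |ζ| |a - a₀|`; hence `√E = o(|s - s₀|)` and `ζ' = 0`, which is the gliding law
(`hasDerivWithinAt_zero_of_energy`). If `a₀ > 0`, a limit curve could stick to the boundary. It does
not, because the scheme takes the sign of `z` after the step: `ζ` then has to move at rate at least
`a₀/2` on one of any two successive short intervals, so by Rolle `z` has finitely many zeros near
`s₀` and `ζ' = a` follows by continuity of `a` (`discrete_nonsticking`, `finite_zeros_of_deriv`).

Globality. `τ` is constant and `p = 0`, so on a compact part of a chart `ξ` and `H_p` are bounded.
By compactness of `M` the base point has a cluster point at a finite end `b` of the interval; a bump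
function there is Lipschitz along the curve, so the curve finally stays in one chart
(`IsGenBichar.exists_chart`). All coordinates but `ξ_0` are Lipschitz and converge, `ζ²` is a
function of them on `Char p`, and the sign of `ζ` settles because reflections only turn negative `ζ`
into positive (`IsLocalCurve.exists_tendsto`). The limit is not in `ℋ⁺`: either it is in `ℋ⁻` and
`b` becomes a reflection time, or the equation extends to `b`. Local existence then continues the
curve, so a maximal one is unbounded to the right, and by changing the sign of the momenta also to
the left. Maximal curves come from Zorn's lemma. Finally `t' = -2τ` is constant, so `t` is affine.

Since the reflection times need not form a closed set, the mean value inequality is proved for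
functions differentiable off a discrete set (`sub_le_of_hasDerivWithinAt_diff`). -/

noncomputable section

set_option linter.unusedSectionVars false

namespace GenBichar

/-! ### Real analysis off a discrete set -/

/-- Induction along a real interval. -/
theorem real_induction {P : ℝ → Prop} {a b : ℝ} (h0 : P a)
    (hstep : ∀ t ∈ Ico a b, (∀ u ∈ Icc a t, P u) → ∃ δ > 0, ∀ u ∈ Ioo t (t + δ), u ≤ b → P u)
    (hlim : ∀ t ∈ Ioc a b, (∀ u ∈ Ico a t, P u) → P t) :
    ∀ u ∈ Icc a b, P u := by
  intro c hc
  by_contra hPc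
  set T : Set ℝ := {u | u ∈ Icc a b ∧ ¬ P u} with hT
  have hTne : T.Nonempty := ⟨c, hc, hPc⟩
  have hTbdd : BddBelow T := ⟨a, fun u hu => hu.1.1⟩
  set m := sInf T with hm
  have ham : a ≤ m := le_csInf hTne fun u hu => hu.1.1
  have hmb : m ≤ b := (csInf_le hTbdd ⟨hc, hPc⟩).trans hc.2
  have hbelow : ∀ u ∈ Ico a m, P u := by
    intro u hu
    by_contra h
    exact absurd (csInf_le hTbdd (show u ∈ T from ⟨⟨hu.1, hu.2.le.trans hmb⟩, h⟩))
      (not_le.2 hu.2)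
  have hPm : P m := by
    rcases ham.eq_or_lt with h | h
    · rw [← h]; exact h0
    · exact hlim m ⟨h, hmb⟩ hbelow
  have hmc : m < b := by
    refine lt_of_le_of_ne hmb fun h => hPc ?_
    rcases hc.2.eq_or_lt with h' | h'
    · rw [h', ← h]; exact hPm
    · exact hbelow c ⟨hc.1, h ▸ h'⟩
  obtain ⟨δ, hδ, hd⟩ := hstep m ⟨ham, hmc⟩ fun u hu => by
    rcases hu.2.eq_or_lt with h | h
    · rw [h]; exact hPm
    · exact hbelow u ⟨hu.1, h⟩
  obtain ⟨u, huT, hu⟩ := exists_lt_of_csInf_lt hTne (lt_add_of_pos_right m hδ)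
  have hmu : m ≤ u := csInf_le hTbdd huT
  rcases hmu.eq_or_lt with h | h
  · exact huT.2 (h ▸ hPm)
  · exact huT.2 (hd u ⟨h, hu⟩ huT.1.2)

/-- A discrete subspace of the line is countable, and a countable set has dense complement. So
one-sided limits along `J \ B` are meaningful even where `B` accumulates. -/
theorem dense_compl_of_isDiscrete {B : Set ℝ} (hB : IsDiscrete B) : Dense Bᶜ := by
  have : DiscreteTopology B := hB.to_subtype
  have : Countable B := TopologicalSpace.separableSpace_iff_countable.1 inferInstance
  exact (Set.to_countable B).dense_compl ℝ

theorem exists_isolated {B : Set ℝ} (hB : IsDiscrete B) {S : ℝ} (hS : S ∈ B) :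
    ∃ δ > 0, ∀ u, |u - S| < δ → u ∈ B → u = S := by
  obtain ⟨δ, hδ, h⟩ := Metric.exists_ball_inter_eq_singleton_of_mem_discrete hB hS
  refine ⟨δ, hδ, fun u hu huB => ?_⟩
  have : u ∈ Metric.ball S δ ∩ B := ⟨by rwa [Metric.mem_ball, Real.dist_eq], huB⟩
  rw [h] at this
  exact this

theorem nhdsWithin_diff_Iio_neBot {J B : Set ℝ} (hJ : J.OrdConnected) (hB : IsDiscrete B)
    {s t : ℝ} (hs : s ∈ J) (ht : t ∈ J) (hst : s < t) : (𝓝[(J \ B) ∩ Iio t] t).NeBot := by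
  rw [← mem_closure_iff_nhdsWithin_neBot, Metric.mem_closure_iff]
  intro ε hε
  obtain ⟨u, hu, huB⟩ := (dense_compl_of_isDiscrete hB).exists_mem_open isOpen_Ioo
    (nonempty_Ioo.2 (max_lt hst (sub_lt_self t hε)))
  refine ⟨u, ⟨⟨hJ.out hs ht ⟨?_, ?_⟩, hu⟩, huB.2⟩, ?_⟩
  · exact (le_max_left _ _).trans huB.1.le
  · exact huB.2.le
  · rw [Real.dist_eq, abs_of_pos (sub_pos.2 huB.2)]
    have := (le_max_right s (t - ε)).trans_lt huB.1
    linarith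

theorem nhdsWithin_diff_Ioi_neBot {J B : Set ℝ} (hJ : J.OrdConnected) (hB : IsDiscrete B)
    {s t : ℝ} (hs : s ∈ J) (ht : t ∈ J) (hst : t < s) : (𝓝[(J \ B) ∩ Ioi t] t).NeBot := by
  rw [← mem_closure_iff_nhdsWithin_neBot, Metric.mem_closure_iff]
  intro ε hε
  obtain ⟨u, hu, huB⟩ := (dense_compl_of_isDiscrete hB).exists_mem_open isOpen_Ioo
    (nonempty_Ioo.2 (lt_min hst (lt_add_of_pos_right t hε)))
  refine ⟨u, ⟨⟨hJ.out ht hs ⟨?_, ?_⟩, hu⟩, huB.1⟩, ?_⟩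
  · exact huB.1.le
  · exact huB.2.le.trans (min_le_left _ _)
  · rw [Real.dist_eq, abs_sub_comm, abs_of_pos (sub_pos.2 huB.1)]
    have := huB.2.trans_le (min_le_right s (t + ε))
    linarith

/-- The mean value inequality for a function that is differentiable off a discrete set, at the
points of which it may only jump downwards. -/
theorem sub_le_of_hasDerivWithinAt_diff {J B : Set ℝ} (hJ : J.OrdConnected) (hB : IsDiscrete B)
    {f f' : ℝ → ℝ} {C : ℝ} (hf : ∀ s ∈ J \ B, HasDerivWithinAt f (f' s) (J \ B) s)
    (hC : ∀ s ∈ J \ B, f' s ≤ C)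
    (hjump : ∀ S ∈ J ∩ B, ∃ l r, Tendsto f (𝓝[(J \ B) ∩ Iio S] S) (𝓝 l) ∧
      Tendsto f (𝓝[(J \ B) ∩ Ioi S] S) (𝓝 r) ∧ r ≤ l)
    {s r : ℝ} (hs : s ∈ J \ B) (hr : r ∈ J \ B) (hsr : s ≤ r) : f r - f s ≤ C * (r - s) := by
  have hsub : Icc s r ⊆ J := hJ.out hs.1 hr.1
  -- The slack `C' > C` turns the pointwise bound on the derivative into a strict bound on slopes,
  -- which persists to the right; it is removed by letting `C'` tend to `C`.
  suffices H : ∀ C' > C, f r - f s ≤ C' * (r - s) by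
    refine ge_of_tendsto (x := 𝓝[>] C) (f := fun C' => C' * (r - s)) ?_ ?_
    · exact ((continuous_id.mul continuous_const).tendsto C).mono_left nhdsWithin_le_nhds
    · filter_upwards [self_mem_nhdsWithin] with C' hC' using H C' hC'
  intro C' hC'
  -- The property is void on `B`, so the induction passes through jump times and through their
  -- accumulation points alike.
  refine real_induction (P := fun u => u ∉ B → f u - f s ≤ C' * (u - s)) (a := s) (b := r)
    (by simp) ?_ ?_ r ⟨hsr, le_rfl⟩ hr.2
  · intro t ht hP
    have htJ : t ∈ J := hsub ⟨ht.1, ht.2.le⟩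
    by_cases htB : t ∈ B
    -- At a jump the induction hypothesis bounds the left limit `l`, the right limit is at most `l`,
    -- and the ordinary mean value theorem applies on `(t, u]`, which is free of jumps.
    · obtain ⟨δ, hδ, hiso⟩ := exists_isolated hB htB
      obtain ⟨l, ρ, hl, hρ, hρl⟩ := hjump t ⟨htJ, htB⟩
      have hst : s < t := lt_of_le_of_ne ht.1 fun h => hs.2 (h ▸ htB)
      have hl' : l ≤ f s + C' * (t - s) := by
        have := nhdsWithin_diff_Iio_neBot hJ hB hs.1 htJ hst
        refine le_of_tendsto_of_tendsto hl (b := 𝓝[(J \ B) ∩ Iio t] t)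
          (g := fun u => f s + C' * (u - s)) ?_ ?_
        · exact (Continuous.tendsto (by fun_prop) t).mono_left nhdsWithin_le_nhds
        · filter_upwards [self_mem_nhdsWithin, mem_nhdsWithin_of_mem_nhds (Ioi_mem_nhds hst)]
            with u hu hsu
          have := hP u ⟨(mem_Ioi.1 hsu).le, (mem_Iio.1 hu.2).le⟩ hu.1.2
          linarith
      refine ⟨δ, hδ, fun u hu hur huB => ?_⟩
      have hI : Ioc t u ⊆ J \ B := by
        intro v hv
        refine ⟨hsub ⟨ht.1.trans hv.1.le, hv.2.trans hur⟩, fun hvB => ?_⟩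
        have := hiso v (by rw [abs_of_pos (sub_pos.2 hv.1)]; linarith [hu.2, hv.2]) hvB
        exact absurd this hv.1.ne'
      have hmvt : ∀ v ∈ Ioo t u, f u - f v ≤ C * (u - v) := by
        intro v hv
        have hder : ∀ w ∈ Ioo v u, HasDerivAt f (f' w) w := fun w hw =>
          (hf w (hI ⟨hv.1.trans hw.1, hw.2.le⟩)).hasDerivAt
            (mem_of_superset (Ioo_mem_nhds (hv.1.trans hw.1) hw.2)
              (Ioo_subset_Ioc_self.trans hI))
        refine Convex.image_sub_le_mul_sub_of_deriv_le (convex_Icc v u) ?_ ?_ ?_ v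
          ⟨le_rfl, hv.2.le⟩ u ⟨hv.2.le, le_rfl⟩ hv.2.le
        · intro w hw
          exact (hf w (hI ⟨hv.1.trans_le hw.1, hw.2⟩)).continuousWithinAt.mono
            fun x hx => hI ⟨hv.1.trans_le hx.1, hx.2⟩
        · intro w hw
          rw [interior_Icc] at hw
          exact (hder w hw).differentiableAt.differentiableWithinAt
        · intro w hw
          rw [interior_Icc] at hw
          rw [(hder w hw).deriv]
          exact hC w (hI ⟨hv.1.trans hw.1, hw.2.le⟩)
      have hfu : f u ≤ ρ + C * (u - t) := by
        have huJ : u ∈ J := (hI ⟨hu.1, le_rfl⟩).1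
        have := nhdsWithin_diff_Ioi_neBot hJ hB huJ htJ hu.1
        refine ge_of_tendsto (x := 𝓝[(J \ B) ∩ Ioi t] t) (f := fun v => f v + C * (u - v)) ?_ ?_
        · exact hρ.add ((Continuous.tendsto (by fun_prop) t).mono_left nhdsWithin_le_nhds)
        · filter_upwards [self_mem_nhdsWithin, mem_nhdsWithin_of_mem_nhds (Iio_mem_nhds hu.1)]
            with v hv hvu
          linarith [hmvt v ⟨hv.2, hvu⟩]
      nlinarith [hu.1]
    -- Jumps may accumulate at `t` here, so only the slope at `t` itself is used.
    · have hPt := hP t ⟨ht.1, le_rfl⟩ htB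
      have h2 : ∀ᶠ u in 𝓝[(J \ B) \ {t}] t, slope f t u < C' := by
        exact (tendsto_order.1 (hasDerivWithinAt_iff_tendsto_slope.1 (hf t ⟨htJ, htB⟩))).2 C'
          ((hC t ⟨htJ, htB⟩).trans_lt hC')
      rw [eventually_nhdsWithin_iff, Metric.eventually_nhds_iff] at h2
      obtain ⟨δ, hδ, h2⟩ := h2
      refine ⟨δ, hδ, fun u hu hur huB => ?_⟩
      have := h2 (y := u) (by rw [Real.dist_eq, abs_of_pos (sub_pos.2 hu.1)]; linarith [hu.2])
        ⟨⟨hsub ⟨ht.1.trans hu.1.le, hur⟩, huB⟩, hu.1.ne'⟩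
      rw [slope_def_field, div_lt_iff₀ (sub_pos.2 hu.1)] at this
      linarith
  · intro t ht hP htB
    have htJ : t ∈ J := hsub ⟨ht.1.le, ht.2⟩
    have := nhdsWithin_diff_Iio_neBot hJ hB hs.1 htJ ht.1
    have hc : Tendsto f (𝓝[(J \ B) ∩ Iio t] t) (𝓝 (f t)) :=
      (hf t ⟨htJ, htB⟩).continuousWithinAt.mono inter_subset_left
    refine le_of_tendsto_of_tendsto (b := 𝓝[(J \ B) ∩ Iio t] t) (hc.sub_const (f s))
      (g := fun u => C' * (u - s)) ?_ ?_
    · exact (Continuous.tendsto (by fun_prop) t).mono_left nhdsWithin_le_nhds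
    · filter_upwards [self_mem_nhdsWithin, mem_nhdsWithin_of_mem_nhds (Ioi_mem_nhds ht.1)]
        with u hu hsu
      exact hP u ⟨(mem_Ioi.1 hsu).le, hu.2⟩ hu.1.2

/-- Both `f` and `-f` satisfy the one-sided jump condition when the limits at a jump agree. This
serves the quantities that a reflection leaves unchanged. -/
theorem abs_sub_le_of_hasDerivWithinAt_diff {J B : Set ℝ} (hJ : J.OrdConnected)
    (hB : IsDiscrete B) {f f' : ℝ → ℝ} {C : ℝ}
    (hf : ∀ s ∈ J \ B, HasDerivWithinAt f (f' s) (J \ B) s) (hC : ∀ s ∈ J \ B, |f' s| ≤ C)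
    (hjump : ∀ S ∈ J ∩ B, ∃ l, Tendsto f (𝓝[J \ B] S) (𝓝 l))
    {s r : ℝ} (hs : s ∈ J \ B) (hr : r ∈ J \ B) : |f r - f s| ≤ C * |r - s| := by
  have key : ∀ {s r : ℝ}, s ∈ J \ B → r ∈ J \ B → s ≤ r → |f r - f s| ≤ C * |r - s| := by
    intro s r hs hr hsr
    rw [abs_of_nonneg (sub_nonneg.2 hsr), abs_le]
    constructor
    · have := sub_le_of_hasDerivWithinAt_diff hJ hB (f := fun u => - f u) (f' := fun u => - f' u)
        (C := C) (fun u hu => (hf u hu).neg) (fun u hu => by linarith [(abs_le.1 (hC u hu)).1])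
        (fun S hS => by
          obtain ⟨l, hl⟩ := hjump S hS
          exact ⟨-l, -l, (hl.mono_left (nhdsWithin_mono _ inter_subset_left)).neg,
            (hl.mono_left (nhdsWithin_mono _ inter_subset_left)).neg, le_rfl⟩) hs hr hsr
      linarith
    · exact sub_le_of_hasDerivWithinAt_diff hJ hB hf (fun u hu => (abs_le.1 (hC u hu)).2)
        (fun S hS => by
          obtain ⟨l, hl⟩ := hjump S hS
          exact ⟨l, l, hl.mono_left (nhdsWithin_mono _ inter_subset_left),
            hl.mono_left (nhdsWithin_mono _ inter_subset_left), le_rfl⟩) hs hr hsr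
  rcases le_total s r with h | h
  · exact key hs hr h
  · rw [abs_sub_comm, abs_sub_comm r]; exact key hr hs h

/-- A function that is differentiable off a discrete set, except perhaps at `s₀`, with a bounded
derivative, is Lipschitz at `s₀`. -/
theorem abs_sub_le_of_hasDerivWithinAt_diff_ball {J B : Set ℝ} (hJ : J.OrdConnected)
    (hB : IsDiscrete B) {f f' : ℝ → ℝ} {s₀ C δ : ℝ} (hs₀ : s₀ ∈ J \ B)
    (hfc : ContinuousWithinAt f (J \ B) s₀)
    (h1 : ∀ s ∈ J \ B, |s - s₀| < δ → s ≠ s₀ →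
      HasDerivWithinAt f (f' s) (J \ B) s ∧ |f' s| ≤ C)
    (h2 : ∀ S ∈ J ∩ B, |S - s₀| < δ → ∃ l, Tendsto f (𝓝[J \ B] S) (𝓝 l)) :
    ∀ s ∈ J \ B, |s - s₀| < δ → |f s - f s₀| ≤ C * |s - s₀| := by
  -- Nothing is known about the derivative at `s₀`: the estimate is used on a piece `K` on one side
  -- of `s₀`, and the second point then tends to `s₀` by continuity.
  have main : ∀ K : Set ℝ, K.OrdConnected → K ⊆ J → K ⊆ Metric.ball s₀ δ → s₀ ∉ K →
      (𝓝[K \ B] s₀).NeBot → ∀ s ∈ K \ B, |f s - f s₀| ≤ C * |s - s₀| := by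
    intro K hK hKJ hKδ hsK hne s hs
    have hsub : K \ B ⊆ J \ B := sdiff_subset_sdiff_left hKJ
    have hmem : ∀ u ∈ K, |u - s₀| < δ := fun u hu => hKδ hu
    have hlip : ∀ r ∈ K \ B, |f s - f r| ≤ C * |s - r| := by
      intro r hr
      refine abs_sub_le_of_hasDerivWithinAt_diff hK hB (f := f) (f' := f') ?_ ?_ ?_ hr hs
      · intro u hu
        exact (h1 u (hsub hu) (hmem u hu.1) (fun h => hsK (h ▸ hu.1))).1.mono hsub
      · intro u hu
        exact (h1 u (hsub hu) (hmem u hu.1) (fun h => hsK (h ▸ hu.1))).2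
      · intro S hS
        obtain ⟨l, hl⟩ := h2 S ⟨hKJ hS.1, hS.2⟩ (hmem S hS.1)
        exact ⟨l, hl.mono_left (nhdsWithin_mono _ hsub)⟩
    have hc : Tendsto f (𝓝[K \ B] s₀) (𝓝 (f s₀)) := hfc.mono hsub
    refine le_of_tendsto_of_tendsto (b := 𝓝[K \ B] s₀) (f := fun r => |f s - f r|)
      (g := fun r => C * |s - r|) (hc.const_sub (f s)).abs ?_ ?_
    · exact (Continuous.tendsto (by fun_prop) s₀).mono_left nhdsWithin_le_nhds
    · filter_upwards [self_mem_nhdsWithin] with r hr using hlip r hr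
  intro s hsJ hs
  rw [abs_lt] at hs
  rcases lt_trichotomy s s₀ with h | h | h
  · refine main (J ∩ Ioo (s₀ - δ) s₀) (hJ.inter ordConnected_Ioo) inter_subset_left ?_
      (fun h => h.2.2.false) ?_ s ⟨⟨hsJ.1, by linarith, h⟩, hsJ.2⟩
    · intro u hu
      rw [Metric.mem_ball, Real.dist_eq, abs_lt]
      exact ⟨by linarith [hu.2.1], by linarith [hu.2.2]⟩
    · refine (nhdsWithin_diff_Iio_neBot hJ hB hsJ.1 hs₀.1 h).mono ?_
      rw [nhdsWithin, nhdsWithin]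
      refine le_inf inf_le_left ?_
      rw [le_principal_iff]
      refine mem_of_superset (inter_mem (mem_inf_of_left (Ioi_mem_nhds (show s₀ - δ < s₀ by
        linarith))) (mem_inf_of_right (mem_principal_self _))) ?_
      rintro u ⟨hu1, ⟨hu2, hu3⟩, hu4⟩
      exact ⟨⟨hu2, hu1, hu4⟩, hu3⟩
  · simp [h]
  · refine main (J ∩ Ioo s₀ (s₀ + δ)) (hJ.inter ordConnected_Ioo) inter_subset_left ?_
      (fun h => h.2.1.false) ?_ s ⟨⟨hsJ.1, h, by linarith⟩, hsJ.2⟩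
    · intro u hu
      rw [Metric.mem_ball, Real.dist_eq, abs_lt]
      exact ⟨by linarith [hu.2.1], by linarith [hu.2.2]⟩
    · refine (nhdsWithin_diff_Ioi_neBot hJ hB hsJ.1 hs₀.1 h).mono ?_
      rw [nhdsWithin, nhdsWithin]
      refine le_inf inf_le_left ?_
      rw [le_principal_iff]
      refine mem_of_superset (inter_mem (mem_inf_of_left (Iio_mem_nhds (show s₀ < s₀ + δ by
        linarith))) (mem_inf_of_right (mem_principal_self _))) ?_
      rintro u ⟨hu1, ⟨hu2, hu3⟩, hu4⟩
      exact ⟨⟨hu2, hu4, hu1⟩, hu3⟩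

theorem eventually_abs_sub_le_of_hasDerivWithinAt_diff {J B : Set ℝ} (hJ : J.OrdConnected)
    (hB : IsDiscrete B) {f f' : ℝ → ℝ} {s₀ C : ℝ} (hs₀ : s₀ ∈ J \ B)
    (hfc : ContinuousWithinAt f (J \ B) s₀)
    (hf : ∀ᶠ s in 𝓝[J \ B] s₀, s ≠ s₀ → HasDerivWithinAt f (f' s) (J \ B) s)
    (hC : ∀ᶠ s in 𝓝[J \ B] s₀, s ≠ s₀ → |f' s| ≤ C)
    (hjump : ∀ᶠ S in 𝓝[J ∩ B] s₀, ∃ l, Tendsto f (𝓝[J \ B] S) (𝓝 l)) :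
    ∀ᶠ s in 𝓝[J \ B] s₀, |f s - f s₀| ≤ C * |s - s₀| := by
  have h1 := hf.and hC
  rw [eventually_nhdsWithin_iff, Metric.eventually_nhds_iff] at h1 hjump ⊢
  obtain ⟨δ₁, hδ₁, h1⟩ := h1
  obtain ⟨δ₂, hδ₂, h2⟩ := hjump
  refine ⟨min δ₁ δ₂, lt_min hδ₁ hδ₂, fun s hs hsJ => ?_⟩
  exact abs_sub_le_of_hasDerivWithinAt_diff_ball hJ hB hs₀ hfc
    (fun u hu hud hne => ⟨(h1 (hud.trans_le (min_le_left _ _)) hu).1 hne,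
      (h1 (hud.trans_le (min_le_left _ _)) hu).2 hne⟩)
    (fun S hS hSd => h2 (hSd.trans_le (min_le_right _ _)) hS) s hsJ hs

theorem hasDerivWithinAt_iff_forall_abs {f : ℝ → ℝ} {v s₀ : ℝ} {K : Set ℝ} :
    HasDerivWithinAt f v K s₀ ↔
      ∀ η > 0, ∀ᶠ s in 𝓝[K] s₀, |f s - f s₀ - v * (s - s₀)| ≤ η * |s - s₀| := by
  rw [hasDerivWithinAt_iff_isLittleO, Asymptotics.isLittleO_iff]
  simp only [Real.norm_eq_abs, smul_eq_mul, mul_comm v]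

/-- The limit of the derivative is the derivative, off a discrete set. -/
theorem hasDerivWithinAt_of_tendsto_deriv_diff {J B : Set ℝ} (hJ : J.OrdConnected)
    (hB : IsDiscrete B) {f f' : ℝ → ℝ} {s₀ v : ℝ} (hs₀ : s₀ ∈ J \ B)
    (hfc : ContinuousWithinAt f (J \ B) s₀)
    (hf : ∀ᶠ s in 𝓝[J \ B] s₀, s ≠ s₀ → HasDerivWithinAt f (f' s) (J \ B) s)
    (hlim : Tendsto f' (𝓝[(J \ B) \ {s₀}] s₀) (𝓝 v))
    (hjump : ∀ᶠ S in 𝓝[J ∩ B] s₀, ∃ l, Tendsto f (𝓝[J \ B] S) (𝓝 l)) :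
    HasDerivWithinAt f v (J \ B) s₀ := by
  rw [hasDerivWithinAt_iff_forall_abs]
  intro η hη
  -- The function `f u - v u` has a derivative smaller than `η` near `s₀`.
  have := eventually_abs_sub_le_of_hasDerivWithinAt_diff hJ hB (f := fun u => f u - v * u)
    (f' := fun u => f' u - v) (C := η) hs₀
    (hfc.sub (Continuous.continuousWithinAt (by fun_prop))) ?_ ?_ ?_
  · filter_upwards [this] with s hs
    convert hs using 2
    ring
  · filter_upwards [hf] with s hs hne
    convert! (hs hne).sub ((hasDerivWithinAt_id s (J \ B)).const_mul v) using 1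
    simp
  · have h := Metric.tendsto_nhds.1 hlim η hη
    rw [eventually_nhdsWithin_iff] at h ⊢
    filter_upwards [h] with s hs hsJ hne
    exact (hs ⟨hsJ, hne⟩).le
  · filter_upwards [hjump] with S ⟨l, hl⟩
    exact ⟨l - v * S, hl.sub ((Continuous.tendsto (by fun_prop) S).mono_left nhdsWithin_le_nhds)⟩

/-- At a time where `z` and `ζ` vanish and the normal acceleration `a₀` is nonpositive, the energy
`ζ² / 2 - a₀ z` forces `ζ` to have a zero derivative. -/
theorem hasDerivWithinAt_zero_of_energy {J B : Set ℝ} (hJ : J.OrdConnected)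
    (hB : IsDiscrete B) {s₀ a₀ : ℝ} {ζ z a : ℝ → ℝ} (hs₀ : s₀ ∈ J \ B) (ha₀ : a₀ ≤ 0)
    (hz : ∀ s ∈ J \ B, 0 ≤ z s) (hζ0 : ζ s₀ = 0) (hz0 : z s₀ = 0)
    (hζc : ContinuousWithinAt ζ (J \ B) s₀) (hzc : ContinuousWithinAt z (J \ B) s₀)
    (ha : Tendsto a (𝓝[J \ B] s₀) (𝓝 a₀))
    (hE : ∀ᶠ s in 𝓝[J \ B] s₀, s ≠ s₀ →
      ∃ e, HasDerivWithinAt (fun u => ζ u ^ 2 / 2 - a₀ * z u) e (J \ B) s ∧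
        |e| ≤ |ζ s| * |a s - a₀|)
    (hjump : ∀ᶠ S in 𝓝[J ∩ B] s₀,
      ∃ l, Tendsto (fun u => ζ u ^ 2 / 2 - a₀ * z u) (𝓝[J \ B] S) (𝓝 l)) :
    HasDerivWithinAt ζ 0 (J \ B) s₀ := by
  -- As `-a₀ z ≥ 0`, the energy controls `ζ² / 2`. Formally `|(√E)'| = |E'| / (2√E) ≤ |ζ| |a - a₀| /
  -- (2√E) ≤ |a - a₀|`, which tends to zero; so `√E`, hence `ζ`, is `o(|s - s₀|)`.
  set E : ℝ → ℝ := fun u => ζ u ^ 2 / 2 - a₀ * z u with hEdef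
  have hEζ : ∀ s ∈ J \ B, ζ s ^ 2 / 2 ≤ E s := by
    intro s hs
    have := mul_nonneg (neg_nonneg.2 ha₀) (hz s hs)
    simp only [hEdef]; linarith
  have hE0 : E s₀ = 0 := by simp [hEdef, hζ0, hz0]
  have hEc : ContinuousWithinAt E (J \ B) s₀ :=
    ((hζc.pow 2).div_const 2).sub (hzc.const_mul a₀)
  rw [hasDerivWithinAt_iff_forall_abs]
  intro η hη
  have haη := (Metric.tendsto_nhds.1 ha (η / 2) (half_pos hη)).and hE
  rw [eventually_nhdsWithin_iff, Metric.eventually_nhds_iff] at haη hjump ⊢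
  obtain ⟨δ₁, hδ₁, h1⟩ := haη
  obtain ⟨δ₂, hδ₂, h2⟩ := hjump
  have hδ := lt_min hδ₁ hδ₂
  -- The shift by `κ` keeps the square root differentiable where the energy vanishes; afterwards `κ`
  -- tends to zero.
  have hF : ∀ κ > 0, ∀ s ∈ J \ B, |s - s₀| < min δ₁ δ₂ →
      |√(E s + κ) - √(E s₀ + κ)| ≤ η / 2 * |s - s₀| := by
    intro κ hκ
    have hpos : ∀ s ∈ J \ B, 0 < E s + κ := fun s hs => by
      nlinarith [hEζ s hs, sq_nonneg (ζ s)]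
    refine abs_sub_le_of_hasDerivWithinAt_diff_ball hJ hB (f := fun u => √(E u + κ))
      (f' := derivWithin (fun u => √(E u + κ)) (J \ B)) hs₀ (hEc.add_const κ).sqrt ?_ ?_
    · intro s hsJ hsδ hne
      obtain ⟨has, hs⟩ := h1 (hsδ.trans_le (min_le_left _ _)) hsJ
      obtain ⟨e, he, hle⟩ := hs hne
      have h1 := (he.add_const κ).sqrt (hpos s hsJ).ne'
      have hu : |e / (2 * √(E s + κ))| ≤ η / 2 := by
        have hsq : 0 < √(E s + κ) := Real.sqrt_pos.2 (hpos s hsJ)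
        rw [abs_div, abs_of_pos (by positivity : 0 < 2 * √(E s + κ)), div_le_iff₀ (by positivity)]
        have hζ : |ζ s| ≤ 2 * √(E s + κ) := by
          refine abs_le_of_sq_le_sq ?_ (by positivity)
          rw [mul_pow, Real.sq_sqrt (hpos s hsJ).le]
          nlinarith [hEζ s hsJ, sq_nonneg (ζ s)]
        rw [Real.dist_eq] at has
        calc |e| ≤ |ζ s| * |a s - a₀| := hle
          _ ≤ (2 * √(E s + κ)) * (η / 2) := by gcongr
          _ = _ := by ring
      refine ⟨h1.differentiableWithinAt.hasDerivWithinAt, ?_⟩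
      -- Where derivatives are not unique, `derivWithin` takes the default value `0`, which
      -- satisfies the bound.
      by_cases hacc : UniqueDiffWithinAt ℝ (J \ B) s
      · rw [h1.derivWithin hacc]; exact hu
      · rw [derivWithin_zero_of_not_uniqueDiffWithinAt hacc, abs_zero]; positivity
    · intro S hS hSδ
      obtain ⟨l, hl⟩ := h2 (hSδ.trans_le (min_le_right _ _)) hS
      exact ⟨√(l + κ), (hl.add_const κ).sqrt⟩
  refine ⟨min δ₁ δ₂, hδ, fun s hs hsJ => ?_⟩
  have hsE : √(E s) ≤ η / 2 * |s - s₀| := by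
    have hc : ∀ c : ℝ, Tendsto (fun κ => √(c + κ)) (𝓝[>] 0) (𝓝 √c) := fun c => by
      have : Continuous fun κ => √(c + κ) := by fun_prop
      simpa using (this.tendsto 0).mono_left nhdsWithin_le_nhds
    have h := ((hc (E s)).sub (hc (E s₀))).abs
    have h' := le_of_tendsto h (b := η / 2 * |s - s₀|) (by
      filter_upwards [self_mem_nhdsWithin] with κ hκ using hF κ hκ s hsJ hs)
    rw [hE0, Real.sqrt_zero, sub_zero, abs_of_nonneg (Real.sqrt_nonneg _)] at h'
    exact h'
  have hE0' : 0 ≤ E s := le_trans (by positivity) (hEζ s hsJ)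
  rw [hζ0, zero_mul, sub_zero, sub_zero]
  refine abs_le_of_sq_le_sq ?_ (by positivity)
  have := pow_le_pow_left₀ (Real.sqrt_nonneg _) hsE 2
  rw [Real.sq_sqrt hE0'] at this
  nlinarith [hEζ s hsJ, sq_nonneg (η * |s - s₀|)]

/-! ### Limits of Euler schemes -/

section Euler

variable {E F : Type*} [NormedAddCommGroup E] [NormedSpace ℝ E]
  [NormedAddCommGroup F] [NormedSpace ℝ F]

/-- The Euler scheme with step `h` and (step dependent) increment field `Φ h`. -/
def eulerSeq (Φ : ℝ → E → E) (y₀ : E) (h : ℝ) : ℕ → E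
  | 0 => y₀
  | k + 1 => eulerSeq Φ y₀ h k + h • Φ h (eulerSeq Φ y₀ h k)

/-- The step of index `n`. -/
def eulerStep (n : ℕ) : ℝ := 1 / ((n : ℝ) + 1)

/-- The index of the time `s` in the scheme of index `n`. -/
def eulerIndex (n : ℕ) (s : ℝ) : ℕ := ⌊((n : ℝ) + 1) * s⌋₊

theorem eulerStep_pos (n : ℕ) : 0 < eulerStep n := by unfold eulerStep; positivity

theorem eulerStep_tendsto : Tendsto eulerStep (hyperfilter ℕ) (𝓝[>] 0) := by
  have h : Tendsto eulerStep atTop (𝓝[>] 0) :=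
    tendsto_nhdsWithin_iff.2 ⟨tendsto_one_div_add_atTop_nhds_zero_nat,
      Eventually.of_forall eulerStep_pos⟩
  exact h.mono_left (Nat.hyperfilter_le_atTop)

theorem eulerIndex_mono (n : ℕ) {s r : ℝ} (h : s ≤ r) : eulerIndex n s ≤ eulerIndex n r :=
  Nat.floor_mono (by gcongr)

theorem eulerStep_mul_eulerIndex_le (n : ℕ) {s : ℝ} (hs : 0 ≤ s) :
    eulerStep n * eulerIndex n s ≤ s := by
  unfold eulerStep eulerIndex
  have h1 : (⌊((n : ℝ) + 1) * s⌋₊ : ℝ) ≤ ((n : ℝ) + 1) * s := Nat.floor_le (by positivity)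
  have hn : (0 : ℝ) < (n : ℝ) + 1 := by positivity
  rw [one_div, inv_mul_le_iff₀ hn]
  exact h1

theorem lt_eulerStep_mul_eulerIndex (n : ℕ) (s : ℝ) :
    s - eulerStep n < eulerStep n * eulerIndex n s := by
  unfold eulerStep eulerIndex
  have h1 : ((n : ℝ) + 1) * s < (⌊((n : ℝ) + 1) * s⌋₊ : ℝ) + 1 := Nat.lt_floor_add_one _
  have hn : (0 : ℝ) < (n : ℝ) + 1 := by positivity
  rw [one_div, lt_inv_mul_iff₀ hn, mul_sub, mul_inv_cancel₀ hn.ne']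
  linarith

theorem eulerStep_mul_eulerIndex_tendsto {s : ℝ} (hs : 0 ≤ s) :
    Tendsto (fun n => eulerStep n * eulerIndex n s) (hyperfilter ℕ) (𝓝 s) := by
  have h : Tendsto (fun n => s - eulerStep n) (hyperfilter ℕ) (𝓝 s) := by
    simpa using (eulerStep_tendsto.mono_right nhdsWithin_le_nhds).const_sub s
  exact tendsto_of_tendsto_of_tendsto_of_le_of_le h tendsto_const_nhds
    (fun n => (lt_eulerStep_mul_eulerIndex n s).le) (fun n => eulerStep_mul_eulerIndex_le n hs)

theorem norm_eulerSeq_sub_le {Φ : ℝ → E → E} {C : ℝ} (hC : ∀ h u, ‖Φ h u‖ ≤ C) (y₀ : E) {h : ℝ}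
    (hh : 0 ≤ h) {j k : ℕ} (hjk : j ≤ k) :
    ‖eulerSeq Φ y₀ h k - eulerSeq Φ y₀ h j‖ ≤ C * (h * k - h * j) := by
  induction k, hjk using Nat.le_induction with
  | base => simp
  | succ k hk ih =>
    rw [eulerSeq, add_sub_right_comm]
    refine (norm_add_le _ _).trans ?_
    rw [norm_smul, Real.norm_of_nonneg hh]
    have := mul_le_mul_of_nonneg_left (hC h (eulerSeq Φ y₀ h k)) hh
    push_cast
    nlinarith

/-- `y` is the limit of the Euler scheme along the hyperfilter. -/
def IsEulerLimit (Φ : ℝ → E → E) (y₀ : E) (y : ℝ → E) : Prop :=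
  ∀ s, 0 ≤ s → Tendsto (fun n => eulerSeq Φ y₀ (eulerStep n) (eulerIndex n s)) (hyperfilter ℕ)
    (𝓝 (y s))

/-- The iterates at time `s` stay in the compact ball of radius `C s`, so the ultrafilter has a
limit there. Pointwise limits along one ultrafilter replace the extraction of a subsequence by
Arzelà–Ascoli. -/
theorem exists_isEulerLimit [ProperSpace E] {Φ : ℝ → E → E} {C : ℝ}
    (hC : ∀ h u, ‖Φ h u‖ ≤ C) (y₀ : E) : ∃ y, IsEulerLimit Φ y₀ y := by
  have : ∀ s : ℝ, ∃ v, 0 ≤ s →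
      Tendsto (fun n => eulerSeq Φ y₀ (eulerStep n) (eulerIndex n s)) (hyperfilter ℕ) (𝓝 v) := by
    intro s
    by_cases hs : 0 ≤ s
    · obtain ⟨v, -, hv⟩ := (isCompact_closedBall y₀ (C * s)).ultrafilter_le_nhds
        ((hyperfilter ℕ).map fun n => eulerSeq Φ y₀ (eulerStep n) (eulerIndex n s)) (by
          rw [le_principal_iff]
          refine Filter.mem_map.2 (Eventually.of_forall fun n => ?_)
          refine mem_closedBall_iff_norm.2 ?_
          have h := norm_eulerSeq_sub_le hC y₀ (eulerStep_pos n).le (Nat.zero_le (eulerIndex n s))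
          have hC0 : 0 ≤ C := (norm_nonneg _).trans (hC 0 0)
          refine h.trans (mul_le_mul_of_nonneg_left ?_ hC0)
          simpa using eulerStep_mul_eulerIndex_le n hs)
      exact ⟨v, fun _ => hv⟩
    · exact ⟨0, fun h => absurd h hs⟩
  choose y hy using this
  exact ⟨y, hy⟩

variable {Φ : ℝ → E → E} {y₀ : E} {y : ℝ → E}

theorem IsEulerLimit.apply_zero (hy : IsEulerLimit Φ y₀ y) : y 0 = y₀ := by
  refine tendsto_nhds_unique (hy 0 le_rfl) ?_
  simp only [eulerIndex, mul_zero, Nat.floor_zero]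
  exact tendsto_const_nhds

theorem IsEulerLimit.norm_sub_le (hy : IsEulerLimit Φ y₀ y) {C : ℝ} (hC : ∀ h u, ‖Φ h u‖ ≤ C)
    {s r : ℝ} (hs : 0 ≤ s) (hr : 0 ≤ r) : ‖y r - y s‖ ≤ C * |r - s| := by
  have key : ∀ {s r : ℝ}, 0 ≤ s → s ≤ r → ‖y r - y s‖ ≤ C * (r - s) := by
    intro s r hs hsr
    refine le_of_tendsto_of_tendsto ((hy r (hs.trans hsr)).sub (hy s hs)).norm
      (((eulerStep_mul_eulerIndex_tendsto (hs.trans hsr)).sub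
        (eulerStep_mul_eulerIndex_tendsto hs)).const_mul C) (Eventually.of_forall fun n => ?_)
    exact norm_eulerSeq_sub_le hC y₀ (eulerStep_pos n).le (eulerIndex_mono n hsr)
  rcases le_total s r with h | h
  · rw [abs_of_nonneg (sub_nonneg.2 h)]; exact key hs h
  · rw [norm_sub_rev, abs_sub_comm, abs_of_nonneg (sub_nonneg.2 h)]; exact key hr h

/-- All iterates with time close to `s₀` are close to `y s₀`. -/
theorem IsEulerLimit.eventually_near (hy : IsEulerLimit Φ y₀ y) {C : ℝ}
    (hC : ∀ h u, ‖Φ h u‖ ≤ C) {s₀ δ : ℝ} (hs₀ : 0 ≤ s₀) (hδ : 0 < δ) :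
    ∃ ρ > 0, ∀ a b, 0 ≤ a → a ≤ b → |a - s₀| < ρ → |b - s₀| < ρ →
      ∀ᶠ n in hyperfilter ℕ, ∀ k, eulerIndex n a ≤ k → k ≤ eulerIndex n b →
        ‖eulerSeq Φ y₀ (eulerStep n) k - y s₀‖ < δ := by
  have hC0 : 0 ≤ C := (norm_nonneg _).trans (hC 0 0)
  -- Write `ρ` for this radius. The iterate at time `a` is within `δ/4` of `y a`, which is within
  -- `δ/4` of `y s₀`. From `a` to `b` less than `2ρ` elapses, plus at most one step, smaller than
  -- `ρ`: a drift of at most `3Cρ ≤ 3δ/8`.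
  refine ⟨δ / (8 * (C + 1)), by positivity, fun a b ha hab ha' hb' => ?_⟩
  set ρ := δ / (8 * (C + 1)) with hρ
  have hCρ : (C + 1) * ρ = δ / 8 := by rw [hρ]; field_simp
  have hρ0 : 0 < ρ := by positivity
  have hclose := Metric.tendsto_nhds.1 (hy a ha) (δ / 4) (by positivity)
  have hya : ‖y a - y s₀‖ ≤ δ / 4 := by
    refine (hy.norm_sub_le hC hs₀ ha).trans ?_
    nlinarith
  have hstep := (tendsto_order.1 (eulerStep_tendsto.mono_right nhdsWithin_le_nhds)).2
    (ρ) hρ0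
  filter_upwards [hclose, hstep] with n hn hst k hak hkb
  rw [dist_eq_norm] at hn
  have h1 := norm_eulerSeq_sub_le hC y₀ (eulerStep_pos n).le hak
  have h2 : eulerStep n * k - eulerStep n * eulerIndex n a ≤ 3 * ρ := by
    have h3 := eulerStep_mul_eulerIndex_le n (ha.trans hab)
    have h4 := lt_eulerStep_mul_eulerIndex n a
    have h5 : eulerStep n * (k : ℝ) ≤ eulerStep n * eulerIndex n b :=
      mul_le_mul_of_nonneg_left (by exact_mod_cast hkb) (eulerStep_pos n).le
    rw [abs_lt] at ha' hb'
    linarith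
  have h6 : ‖eulerSeq Φ y₀ (eulerStep n) k - eulerSeq Φ y₀ (eulerStep n) (eulerIndex n a)‖
      ≤ 3 * (δ / 8) := by
    nlinarith
  have h7 := norm_add₃_le (a := eulerSeq Φ y₀ (eulerStep n) k -
    eulerSeq Φ y₀ (eulerStep n) (eulerIndex n a))
    (b := eulerSeq Φ y₀ (eulerStep n) (eulerIndex n a) - y a) (c := y a - y s₀)
  rw [sub_add_sub_cancel, sub_add_sub_cancel] at h7
  linarith

/-- The limit of an Euler scheme solves the limit equation, for each linear component of the field
that converges. -/
theorem IsEulerLimit.hasDerivWithinAt (hy : IsEulerLimit Φ y₀ y) {C : ℝ}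
    (hC : ∀ h u, ‖Φ h u‖ ≤ C) (L : E →L[ℝ] F) {s₀ : ℝ} (hs₀ : 0 ≤ s₀) {v : F}
    (hL : Tendsto (fun p : ℝ × E => L (Φ p.1 p.2)) (𝓝[>] 0 ×ˢ 𝓝 (y s₀)) (𝓝 v)) :
    HasDerivWithinAt (fun s => L (y s)) v (Ici 0) s₀ := by
  rw [hasDerivWithinAt_iff_isLittleO, Asymptotics.isLittleO_iff]
  intro η hη
  have h1 := Metric.tendsto_nhds.1 hL η hη
  rw [eventually_prod_iff] at h1
  obtain ⟨pa, hpa, pb, hpb, hab⟩ := h1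
  obtain ⟨δ, hδ, hpb⟩ := Metric.eventually_nhds_iff.1 hpb
  obtain ⟨ρ, hρ, hnear⟩ := hy.eventually_near hC hs₀ hδ
  have main : ∀ a b, 0 ≤ a → a ≤ b → |a - s₀| < ρ → |b - s₀| < ρ →
      ‖L (y b) - L (y a) - (b - a) • v‖ ≤ η * (b - a) := by
    intro a b ha hab' haρ hbρ
    have hb := ha.trans hab'
    have hta := eulerStep_mul_eulerIndex_tendsto ha
    have htb := eulerStep_mul_eulerIndex_tendsto hb
    refine le_of_tendsto_of_tendsto
      (((((L.continuous.tendsto _).comp (hy b hb)).sub ((L.continuous.tendsto _).comp (hy a ha))).sub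
        ((htb.sub hta).smul_const v)).norm) ((htb.sub hta).const_mul η) ?_
    filter_upwards [hnear a b ha hab' haρ hbρ, eulerStep_tendsto.eventually hpa] with n hn hpn
    -- Each increment of the component `L` differs from `h • v` by at most `η h`, and these errors
    -- add up. The other components of the field may be discontinuous.
    have hkey : ∀ k, eulerIndex n a ≤ k → k ≤ eulerIndex n b →
        ‖L (eulerSeq Φ y₀ (eulerStep n) k) - L (eulerSeq Φ y₀ (eulerStep n) (eulerIndex n a))
          - (eulerStep n * k - eulerStep n * eulerIndex n a) • v‖
          ≤ η * (eulerStep n * k - eulerStep n * eulerIndex n a) := by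
      intro k hk
      induction k, hk using Nat.le_induction with
      | base => simp
      | succ k hk ih =>
        intro hkb
        have h2 := ih (by omega)
        have h3 := (hab hpn (hpb (by rw [dist_eq_norm]; exact hn k hk (by omega)))).le
        rw [dist_eq_norm] at h3
        have h4 : L (eulerSeq Φ y₀ (eulerStep n) (k + 1))
            - L (eulerSeq Φ y₀ (eulerStep n) (eulerIndex n a))
            - (eulerStep n * ((k + 1 : ℕ) : ℝ) - eulerStep n * eulerIndex n a) • v
            = (L (eulerSeq Φ y₀ (eulerStep n) k)
              - L (eulerSeq Φ y₀ (eulerStep n) (eulerIndex n a))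
              - (eulerStep n * k - eulerStep n * eulerIndex n a) • v)
              + eulerStep n • (L (Φ (eulerStep n) (eulerSeq Φ y₀ (eulerStep n) k)) - v) := by
          rw [eulerSeq, map_add, map_smul]
          push_cast
          module
        rw [h4]
        refine (norm_add_le _ _).trans ?_
        rw [norm_smul, Real.norm_of_nonneg (eulerStep_pos n).le]
        have h5 := mul_le_mul_of_nonneg_left h3 (eulerStep_pos n).le
        push_cast
        linarith
    exact hkey _ (eulerIndex_mono n hab') le_rfl
  filter_upwards [self_mem_nhdsWithin, mem_nhdsWithin_of_mem_nhds (Metric.ball_mem_nhds s₀ hρ)]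
    with s hs hsρ
  rw [Metric.mem_ball, Real.dist_eq] at hsρ
  have h0 : |s₀ - s₀| < ρ := by simpa using hρ
  rcases le_total s₀ s with h | h
  · have := main s₀ s hs₀ h h0 hsρ
    rwa [Real.norm_of_nonneg (sub_nonneg.2 h)]
  · have := main s s₀ hs h hsρ h0
    rw [Real.norm_of_nonpos (sub_nonpos.2 h), neg_sub]
    convert this using 1
    rw [← norm_neg]
    congr 1
    module

/-- If `z' = ζ` and `ζ' = ± a` with the sign of `z` and `a ≥ α > 0`, discretised in a semi-implicit
way, then `ζ` cannot stay constant: of two successive time intervals, one carries a change of `ζ`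
at rate at least `α`. -/
theorem discrete_nonsticking {z ζ : ℕ → ℝ} {h α : ℝ} (hh : 0 < h) (hα : 0 < α) {K₁ K₂ K₃ : ℕ}
    (h23 : K₂ ≤ K₃)
    (hz : ∀ k, K₁ ≤ k → k < K₃ → z (k + 1) = z k + h * ζ k)
    (hp : ∀ k, K₁ ≤ k → k < K₃ → 0 ≤ z (k + 1) → ζ k + h * α ≤ ζ (k + 1))
    (hn : ∀ k, K₁ ≤ k → k < K₃ → z (k + 1) < 0 → ζ (k + 1) ≤ ζ k - h * α) :
    (K₁ ≤ K₂ → α * (h * K₂ - h * K₁) ≤ |ζ K₂ - ζ K₁|) ∨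
      α * (h * K₃ - h * K₂) ≤ |ζ K₃ - ζ K₂| := by
  have hhα := mul_pos hh hα
  have incr : ∀ {A D : ℕ}, K₁ ≤ A → A ≤ D → D ≤ K₃ →
      (∀ k, A < k → k ≤ D → 0 ≤ z k) → α * (h * D - h * A) ≤ |ζ D - ζ A| := by
    intro A D hKA hAD hDK hs
    refine le_trans ?_ (le_abs_self _)
    induction D, hAD using Nat.le_induction with
    | base => simp
    | succ D hD ih =>
      have h1 := ih (by omega) (fun k hk hk' => hs k hk (by omega))
      have h2 := hp D (by omega) (by omega) (hs (D + 1) (by omega) le_rfl)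
      push_cast
      linarith
  have decr : ∀ {A D : ℕ}, K₁ ≤ A → A ≤ D → D ≤ K₃ →
      (∀ k, A < k → k ≤ D → z k < 0) → α * (h * D - h * A) ≤ |ζ D - ζ A| := by
    intro A D hKA hAD hDK hs
    refine le_trans ?_ (neg_le_abs _)
    induction D, hAD using Nat.le_induction with
    | base => simp
    | succ D hD ih =>
      have h1 := ih (by omega) (fun k hk hk' => hs k hk (by omega))
      have h2 := hn D (by omega) (by omega) (hs (D + 1) (by omega) le_rfl)
      push_cast
      linarith
  by_cases hK : K₁ ≤ K₂
  swap
  · exact Or.inl fun h => absurd h hK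
  -- A downward crossing needs `ζ < 0`. Since the sign is read after the step, `ζ` already decreases
  -- in the step of the crossing and goes on decreasing, so `z` never returns. With the mirror
  -- statement `stayp`, `z` changes sign at most once.
  have stayn : ∀ k, K₁ ≤ k → k < K₃ → 0 ≤ z k → z (k + 1) < 0 →
      ∀ j, k + 1 ≤ j → j ≤ K₃ → z j < 0 ∧ ζ j < 0 := by
    intro k hk hk3 hzk hzk1 j hj
    have e1 := hz k hk hk3
    have hζk : ζ k < 0 := by by_contra hc; push Not at hc; nlinarith
    induction j, hj using Nat.le_induction with
    | base => exact fun _ => ⟨hzk1, by linarith [hn k hk hk3 hzk1]⟩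
    | succ j hj ih =>
      intro hj3
      obtain ⟨i1, i2⟩ := ih (by omega)
      have e2 := hz j (by omega) (by omega)
      have i3 : z (j + 1) < 0 := by nlinarith
      exact ⟨i3, by linarith [hn j (by omega) (by omega) i3]⟩
  have stayp : ∀ k, K₁ ≤ k → k < K₃ → z k < 0 → 0 ≤ z (k + 1) →
      ∀ j, k + 1 ≤ j → j ≤ K₃ → 0 ≤ z j ∧ 0 < ζ j := by
    intro k hk hk3 hzk hzk1 j hj
    have e1 := hz k hk hk3
    have hζk : 0 < ζ k := by by_contra hc; push Not at hc; nlinarith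
    induction j, hj using Nat.le_induction with
    | base => exact fun _ => ⟨hzk1, by linarith [hp k hk hk3 hzk1]⟩
    | succ j hj ih =>
      intro hj3
      obtain ⟨i1, i2⟩ := ih (by omega)
      have e2 := hz j (by omega) (by omega)
      have i3 : 0 ≤ z (j + 1) := by nlinarith
      exact ⟨i3, by linarith [hp j (by omega) (by omega) i3]⟩
  -- If the only sign change occurs before `K₂`, the sign of `z` is constant after `K₂` and `ζ` is
  -- monotone on the second interval; otherwise it is constant on the first one.
  by_cases hchange : ∃ k, K₁ ≤ k ∧ k < K₂ ∧ ((0 ≤ z k ∧ z (k + 1) < 0) ∨ (z k < 0 ∧ 0 ≤ z (k + 1)))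
  · right
    obtain ⟨k, hk1, hk2, ⟨h1, h2⟩ | ⟨h1, h2⟩⟩ := hchange
    · exact decr hK h23 le_rfl fun j hj hj' =>
        (stayn k hk1 (by omega) h1 h2 j (by omega) hj').1
    · exact incr hK h23 le_rfl fun j hj hj' =>
        (stayp k hk1 (by omega) h1 h2 j (by omega) hj').1
  · left
    intro _
    push Not at hchange
    rcases le_or_gt 0 (z K₁) with h0 | h0
    · have hall : ∀ j, K₁ ≤ j → j ≤ K₂ → 0 ≤ z j := by
        intro j hj
        induction j, hj using Nat.le_induction with
        | base => exact fun _ => h0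
        | succ j hj ih => exact fun hj2 => (hchange j hj (by omega)).1 (ih (by omega))
      exact incr le_rfl hK h23 fun j hj hj' => hall j hj.le hj'
    · have hall : ∀ j, K₁ ≤ j → j ≤ K₂ → z j < 0 := by
        intro j hj
        induction j, hj using Nat.le_induction with
        | base => exact fun _ => h0
        | succ j hj ih => exact fun hj2 => (hchange j hj (by omega)).2 (ih (by omega))
      exact decr le_rfl hK h23 fun j hj hj' => hall j hj.le hj'

/-- If `ζ` vanished at three nearby times, then in the limit the discrete statement would give `α (b
- a) ≤ 0` on one of the two intervals. The hypothesis evaluates the sign at `z + hζ`, the value of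
`z` after the step. -/
theorem IsEulerLimit.nonsticking (hy : IsEulerLimit Φ y₀ y) {C : ℝ}
    (hC : ∀ h u, ‖Φ h u‖ ≤ C) (ℓz ℓζ : E →L[ℝ] ℝ) {s₀ α : ℝ} (hs₀ : 0 ≤ s₀) (hα : 0 < α)
    (hloc : ∀ᶠ p : ℝ × E in 𝓝[>] 0 ×ˢ 𝓝 (y s₀), ℓz (Φ p.1 p.2) = ℓζ p.2 ∧
      (0 ≤ ℓz p.2 + p.1 * ℓζ p.2 → α ≤ ℓζ (Φ p.1 p.2)) ∧
      (ℓz p.2 + p.1 * ℓζ p.2 < 0 → ℓζ (Φ p.1 p.2) ≤ -α)) :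
    ∃ ρ > 0, ∀ s₁ s₂ s₃, 0 ≤ s₁ → s₁ < s₂ → s₂ < s₃ → |s₁ - s₀| < ρ → |s₃ - s₀| < ρ →
      ¬ (ℓζ (y s₁) = 0 ∧ ℓζ (y s₂) = 0 ∧ ℓζ (y s₃) = 0) := by
  rw [eventually_prod_iff] at hloc
  obtain ⟨pa, hpa, pb, hpb, hab⟩ := hloc
  obtain ⟨δ, hδ, hpb⟩ := Metric.eventually_nhds_iff.1 hpb
  obtain ⟨ρ, hρ, hnear⟩ := hy.eventually_near hC hs₀ hδ
  refine ⟨ρ, hρ, fun s₁ s₂ s₃ h1 h12 h23 hs1 hs3 ⟨z1, z2, z3⟩ => ?_⟩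
  have h2 : 0 ≤ s₂ := h1.trans h12.le
  have h3 : 0 ≤ s₃ := h2.trans h23.le
  set u : ℕ → ℕ → E := fun n k => eulerSeq Φ y₀ (eulerStep n) k
  have hlim : ∀ s, 0 ≤ s → Tendsto (fun n => ℓζ (u n (eulerIndex n s))) (hyperfilter ℕ)
      (𝓝 (ℓζ (y s))) := fun s hs => (ℓζ.continuous.tendsto _).comp (hy s hs)
  have hdis : ∀ᶠ n in hyperfilter ℕ,
      α * (eulerStep n * eulerIndex n s₂ - eulerStep n * eulerIndex n s₁) ≤
        |ℓζ (u n (eulerIndex n s₂)) - ℓζ (u n (eulerIndex n s₁))| ∨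
      α * (eulerStep n * eulerIndex n s₃ - eulerStep n * eulerIndex n s₂) ≤
        |ℓζ (u n (eulerIndex n s₃)) - ℓζ (u n (eulerIndex n s₂))| := by
    filter_upwards [hnear s₁ s₃ h1 (h12.trans h23).le hs1 hs3, eulerStep_tendsto.eventually hpa]
      with n hn hpn
    have hP := fun k (hk : eulerIndex n s₁ ≤ k) (hk' : k < eulerIndex n s₃) =>
      hab hpn (hpb (by rw [dist_eq_norm]; exact hn k hk hk'.le))
    have hz : ∀ k, eulerIndex n s₁ ≤ k → k < eulerIndex n s₃ →
        ℓz (u n (k + 1)) = ℓz (u n k) + eulerStep n * ℓζ (u n k) := fun k hk hk' => by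
      simp only [u]
      rw [eulerSeq, map_add, map_smul, (hP k hk hk').1, smul_eq_mul]
    have hζ : ∀ k, ℓζ (u n (k + 1)) = ℓζ (u n k) + eulerStep n * ℓζ (Φ (eulerStep n) (u n k)) :=
      fun k => by
        simp only [u]
        rw [eulerSeq, map_add, map_smul, smul_eq_mul]
    have := discrete_nonsticking (z := fun k => ℓz (u n k)) (ζ := fun k => ℓζ (u n k))
      (eulerStep_pos n) hα (eulerIndex_mono n h23.le) hz
      (fun k hk hk' h0 => by
        rw [hζ k]
        have := (hP k hk hk').2.1 (by rw [hz k hk hk'] at h0; exact h0)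
        have := mul_le_mul_of_nonneg_left this (eulerStep_pos n).le
        linarith)
      (fun k hk hk' h0 => by
        rw [hζ k]
        have := (hP k hk hk').2.2 (by rw [hz k hk hk'] at h0; exact h0)
        have := mul_le_mul_of_nonneg_left this (eulerStep_pos n).le
        linarith)
    exact this.imp_left fun h => h (eulerIndex_mono n h12.le)
  have hfin : ∀ {a b : ℝ}, 0 ≤ a → a < b → ℓζ (y a) = 0 → ℓζ (y b) = 0 →
      ¬ ∀ᶠ n in hyperfilter ℕ, α * (eulerStep n * eulerIndex n b - eulerStep n * eulerIndex n a) ≤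
        |ℓζ (u n (eulerIndex n b)) - ℓζ (u n (eulerIndex n a))| := by
    intro a b ha hab' hza hzb hev
    have := le_of_tendsto_of_tendsto
      (((eulerStep_mul_eulerIndex_tendsto (ha.trans hab'.le)).sub
        (eulerStep_mul_eulerIndex_tendsto ha)).const_mul α)
      (((hlim b (ha.trans hab'.le)).sub (hlim a ha)).abs) hev
    rw [hza, hzb, sub_zero, abs_zero] at this
    nlinarith
  -- The interval on which `ζ` moves may depend on `n`; the ultrafilter selects one of the two.
  rcases Ultrafilter.eventually_or.1 hdis with h | h
  · exact hfin h1 h12 z1 z2 h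
  · exact hfin h2 h23 z2 z3 h

end Euler

section Coordinates

variable {d : ℕ} [NeZero d] {M : Type*} [TopologicalSpace M]
  [ChartedSpace (EuclideanHalfSpace d) M] [IsManifold (𝓡∂ d) 2 M]

/-! ### Coordinates on the cotangent bundle -/

theorem coordVec_eq {x₀ x : M} (hx : x ∈ (chartAt (EuclideanHalfSpace d) x₀).source) (i : Fin d) :
    (coordVec x₀ x i : Model d) =
      tangentCoordChange (𝓡∂ d) x₀ x x (EuclideanSpace.single i 1) := by
  unfold coordVec
  rw [TangentBundle.symmL_trivializationAt_eq_core hx]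
  rfl

theorem coordVec_change {x₀ x₁ x : M} (h0 : x ∈ (chartAt (EuclideanHalfSpace d) x₀).source)
    (h1 : x ∈ (chartAt (EuclideanHalfSpace d) x₁).source) (i : Fin d) :
    coordVec x₁ x i = ∑ j, (tangentCoordChange (𝓡∂ d) x₁ x₀ x (EuclideanSpace.single i 1)) j •
      (coordVec x₀ x j : TangentSpace (𝓡∂ d) x) := by
  have h2 : ∀ v : Model d, tangentCoordChange (𝓡∂ d) x₀ x x v =
      ∑ j, v j • (coordVec x₀ x j : Model d) := by
    intro v
    conv_lhs => rw [← (EuclideanSpace.basisFun (Fin d) ℝ).sum_repr v]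
    simp only [map_sum, map_smul, coordVec_eq h0, EuclideanSpace.basisFun_repr,
      EuclideanSpace.basisFun_apply]
    rfl
  refine (coordVec_eq h1 i).trans ?_
  rw [← tangentCoordChange_comp (w := x₁) (x := x₀) (y := x)]
  · exact h2 _
  · simp only [extChartAt_source]; exact ⟨⟨h1, h0⟩, mem_chart_source _ x⟩

/-- Covector components are pairings with the coordinate vectors, which change by the Jacobian from
the chart at `x₁` to that at `x₀`; the components therefore change by its transpose. -/
theorem covecCoord_change {x₀ x₁ x : M} (h0 : x ∈ (chartAt (EuclideanHalfSpace d) x₀).source)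
    (h1 : x ∈ (chartAt (EuclideanHalfSpace d) x₁).source) (ξ : Cotangent d x) :
    covecCoord x₁ x ξ = (tangentCoordChange (𝓡∂ d) x₁ x₀ x).adjoint (covecCoord x₀ x ξ) := by
  ext i
  have : ((tangentCoordChange (𝓡∂ d) x₁ x₀ x).adjoint (covecCoord x₀ x ξ)) i =
      inner ℝ (EuclideanSpace.single i (1 : ℝ))
        ((tangentCoordChange (𝓡∂ d) x₁ x₀ x).adjoint (covecCoord x₀ x ξ)) := by
    rw [EuclideanSpace.inner_single_left]; simp
  rw [this, ContinuousLinearMap.adjoint_inner_right, PiLp.inner_apply]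
  simp only [covecCoord, coordVec_change h0 h1 i]
  rw [map_sum]
  simp [mul_comm]

/-- The points of `T*L` above the domain of the chart at `x₀`. -/
def chartDom (x₀ : M) : Set (Phase d M) :=
  {ρ | Phase.base ρ ∈ (chartAt (EuclideanHalfSpace d) x₀).source}

/-- The range of the coordinates of the chart at `x₀`. -/
def coordTarget (x₀ : M) : Set (LocalPhase d) := {q | q.2.1 ∈ (extChartAt (𝓡∂ d) x₀).target}

/-- The trivialization of the cotangent bundle given by the chart at `x₀`. -/
def cotTriv (x₀ : M) :
    Trivialization (Model d →L[ℝ] ℝ) (π (Model d →L[ℝ] ℝ) (fun x : M => Cotangent d x)) :=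
  trivializationAt (Model d →L[ℝ] ℝ) (fun x : M => Cotangent d x) x₀

theorem cotTriv_source (x₀ : M) : (cotTriv (d := d) x₀).source =
    {v | v.proj ∈ (chartAt (EuclideanHalfSpace d) x₀).source} := by
  unfold cotTriv
  rw [hom_trivializationAt_source]
  ext v
  simp

theorem cotTriv_target (x₀ : M) : (cotTriv (d := d) x₀).target =
    (chartAt (EuclideanHalfSpace d) x₀).source ×ˢ univ := by
  unfold cotTriv
  rw [hom_trivializationAt_target]
  simp

theorem cotTriv_apply_fst (x₀ : M) (v : CotangentBundle d M) :
    (cotTriv x₀ v).1 = v.proj := by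
  unfold cotTriv
  rw [hom_trivializationAt_apply]

theorem cotTriv_apply_snd (x₀ : M) (v : CotangentBundle d M) (i : Fin d) :
    (cotTriv x₀ v).2 (EuclideanSpace.single i 1) = covecCoord x₀ v.proj v.snd i := by
  unfold cotTriv
  rw [hom_trivializationAt_apply]
  simp [covecCoord, coordVec, ContinuousLinearMap.inCoordinates]

theorem isOpen_chartDom (x₀ : M) : IsOpen (chartDom (d := d) x₀) := by
  have : Continuous fun ρ : Phase d M => ρ.2.2.proj :=
    (FiberBundle.continuous_proj (Model d →L[ℝ] ℝ) (fun x : M => Cotangent d x)).comp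
      (continuous_snd.comp continuous_snd)
  exact (chartAt (EuclideanHalfSpace d) x₀).open_source.preimage this

theorem continuous_base : Continuous (Phase.base : Phase d M → M) :=
  (FiberBundle.continuous_proj (Model d →L[ℝ] ℝ) (fun x : M => Cotangent d x)).comp
      (continuous_snd.comp continuous_snd)

theorem mem_chartDom_base (ρ : Phase d M) : ρ ∈ chartDom (Phase.base ρ) :=
  mem_chart_source _ _

theorem coord_mem_coordTarget {x₀ : M} {ρ : Phase d M} (hρ : ρ ∈ chartDom x₀) :
    coord x₀ ρ ∈ coordTarget x₀ :=
  (extChartAt (𝓡∂ d) x₀).map_source (by rw [extChartAt_source]; exact hρ)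

theorem continuousOn_coord (x₀ : M) : ContinuousOn (coord (d := d) x₀) (chartDom x₀) := by
  have h1 : ContinuousOn (fun ρ : Phase d M => cotTriv x₀ ρ.2.2) (chartDom x₀) := by
    refine (cotTriv (d := d) x₀).continuousOn.comp (by fun_prop) ?_
    intro ρ hρ
    rw [cotTriv_source]
    exact hρ
  have h2 : ∀ ρ : Phase d M, coord x₀ ρ = (ρ.1, extChartAt (𝓡∂ d) x₀ (Phase.base ρ), ρ.2.1,
      WithLp.toLp 2 fun i => (cotTriv x₀ ρ.2.2).2 (EuclideanSpace.single i 1)) := by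
    intro ρ
    simp only [cotTriv_apply_snd]
    rfl
  rw [show coord (d := d) x₀ = _ from funext h2]
  have h3 : ContinuousOn (fun ρ : Phase d M => extChartAt (𝓡∂ d) x₀ (Phase.base ρ))
      (chartDom x₀) := by
    refine (continuousOn_extChartAt (I := 𝓡∂ d) x₀).comp continuous_base.continuousOn ?_
    intro ρ hρ
    rw [extChartAt_source]
    exact hρ
  refine continuousOn_fst.prodMk (h3.prodMk ((continuous_fst.comp continuous_snd).continuousOn.prodMk ?_))
  refine (PiLp.continuous_toLp 2 _).comp_continuousOn ?_
  exact continuousOn_pi.2 fun i => (h1.snd).clm_apply continuousOn_const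

/-- The inverse of the coordinates of the chart at `x₀`. -/
def coordInv (x₀ : M) (q : LocalPhase d) : Phase d M :=
  (q.1, q.2.2.1, (cotTriv x₀).toOpenPartialHomeomorph.symm
    ((extChartAt (𝓡∂ d) x₀).symm q.2.1, innerSL ℝ q.2.2.2))

theorem continuousOn_coordInv (x₀ : M) :
    ContinuousOn (coordInv (d := d) x₀) (coordTarget x₀) := by
  refine continuousOn_fst.prodMk (ContinuousOn.prodMk (by fun_prop) ?_)
  refine (cotTriv (d := d) x₀).toOpenPartialHomeomorph.symm.continuousOn.comp
    (ContinuousOn.prodMk ?_ ?_) ?_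
  · exact (continuousOn_extChartAt_symm (I := 𝓡∂ d) x₀).comp (by fun_prop) fun q hq => hq
  · exact ((innerSL ℝ).continuous.comp (by fun_prop)).continuousOn
  · intro q hq
    rw [OpenPartialHomeomorph.symm_source]
    refine (cotTriv_target (d := d) x₀).symm ▸ ⟨?_, mem_univ _⟩
    have := (extChartAt (𝓡∂ d) x₀).map_target hq
    rwa [extChartAt_source] at this

theorem base_coordInv {x₀ : M} {q : LocalPhase d} (hq : q ∈ coordTarget x₀) :
    Phase.base (coordInv x₀ q) = (extChartAt (𝓡∂ d) x₀).symm q.2.1 := by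
  have hx : (extChartAt (𝓡∂ d) x₀).symm q.2.1 ∈ (chartAt (EuclideanHalfSpace d) x₀).source := by
    have := (extChartAt (𝓡∂ d) x₀).map_target hq
    rwa [extChartAt_source] at this
  have h : ((extChartAt (𝓡∂ d) x₀).symm q.2.1, (innerSL ℝ q.2.2.2 : Model d →L[ℝ] ℝ)) ∈
      (cotTriv (d := d) x₀).target := by
    rw [cotTriv_target]; exact ⟨hx, mem_univ _⟩
  exact (cotTriv x₀).proj_symm_apply h

theorem coordInv_mem_chartDom {x₀ : M} {q : LocalPhase d} (hq : q ∈ coordTarget x₀) :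
    coordInv x₀ q ∈ chartDom x₀ := by
  unfold chartDom
  rw [mem_ofPred_eq, base_coordInv hq, ← extChartAt_source (𝓡∂ d)]
  exact (extChartAt (𝓡∂ d) x₀).map_target hq

theorem coord_coordInv {x₀ : M} {q : LocalPhase d} (hq : q ∈ coordTarget x₀) :
    coord x₀ (coordInv x₀ q) = q := by
  have hx : (extChartAt (𝓡∂ d) x₀).symm q.2.1 ∈ (chartAt (EuclideanHalfSpace d) x₀).source := by
    have := (extChartAt (𝓡∂ d) x₀).map_target hq
    rwa [extChartAt_source] at this
  have h : ((extChartAt (𝓡∂ d) x₀).symm q.2.1, (innerSL ℝ q.2.2.2 : Model d →L[ℝ] ℝ)) ∈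
      (cotTriv (d := d) x₀).target := by
    rw [cotTriv_target]; exact ⟨hx, mem_univ _⟩
  have h1 : coord x₀ (coordInv x₀ q) = (q.1,
      extChartAt (𝓡∂ d) x₀ (Phase.base (coordInv x₀ q)), q.2.2.1,
      WithLp.toLp 2 fun i =>
        (cotTriv x₀ (coordInv x₀ q).2.2).2 (EuclideanSpace.single i 1)) := by
    simp only [cotTriv_apply_snd]
    rfl
  rw [h1, base_coordInv hq, (extChartAt (𝓡∂ d) x₀).right_inv hq]
  have h2 : cotTriv x₀ (coordInv x₀ q).2.2 = _ := (cotTriv (d := d) x₀).apply_symm_apply h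
  rw [h2]
  refine Prod.ext rfl (Prod.ext rfl (Prod.ext rfl ?_))
  ext i
  simp [EuclideanSpace.inner_single_right]

theorem coordInv_coord {x₀ : M} {ρ : Phase d M} (hρ : ρ ∈ chartDom x₀) :
    coordInv x₀ (coord x₀ ρ) = ρ := by
  have hs : ρ.2.2 ∈ (cotTriv (d := d) x₀).source := by
    rw [cotTriv_source]; exact hρ
  refine Prod.ext rfl (Prod.ext rfl ?_)
  have h : ((extChartAt (𝓡∂ d) x₀).symm (coord x₀ ρ).2.1,
      (innerSL ℝ (coord x₀ ρ).2.2.2 : Model d →L[ℝ] ℝ)) = cotTriv x₀ ρ.2.2 := by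
    refine Prod.ext ?_ ?_
    · rw [cotTriv_apply_fst]
      exact (extChartAt (𝓡∂ d) x₀).left_inv (by rw [extChartAt_source]; exact hρ)
    · refine ContinuousLinearMap.coe_injective ?_
      refine (EuclideanSpace.basisFun (Fin d) ℝ).toBasis.ext fun i => ?_
      simp only [OrthonormalBasis.coe_toBasis, EuclideanSpace.basisFun_apply,
        ContinuousLinearMap.coe_coe]
      rw [cotTriv_apply_snd, innerSL_apply_apply, EuclideanSpace.inner_single_right]
      simp [coord]
  unfold coordInv
  rw [h]
  exact (cotTriv (d := d) x₀).toOpenPartialHomeomorph.left_inv hs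

theorem coord_injOn (x₀ : M) : InjOn (coord (d := d) x₀) (chartDom x₀) := fun ρ hρ ρ' hρ' h => by
  rw [← coordInv_coord hρ, h, coordInv_coord hρ']

/-- The coordinates form a homeomorphism of `chartDom x₀` onto `coordTarget x₀`, so limits may be
computed in the chart. -/
theorem tendsto_iff_tendsto_coord {α : Type*} {l : Filter α} {γ : α → Phase d M} {x₀ : M}
    {ρ : Phase d M} (hρ : ρ ∈ chartDom x₀) (hγ : ∀ᶠ s in l, γ s ∈ chartDom x₀) :
    Tendsto γ l (𝓝 ρ) ↔ Tendsto (fun s => coord x₀ (γ s)) l (𝓝 (coord x₀ ρ)) := by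
  constructor
  · intro h
    exact ((continuousOn_coord x₀).continuousAt ((isOpen_chartDom x₀).mem_nhds hρ)).tendsto.comp h
  · intro h
    have h1 : Tendsto (fun s => coord x₀ (γ s)) l (𝓝[coordTarget x₀] (coord x₀ ρ)) :=
      tendsto_nhdsWithin_iff.2 ⟨h, hγ.mono fun s hs => coord_mem_coordTarget hs⟩
    have h2 := (continuousOn_coordInv x₀ _ (coord_mem_coordTarget hρ)).tendsto.comp h1
    rw [coordInv_coord hρ] at h2
    exact h2.congr' (hγ.mono fun s hs => coordInv_coord hs)

/-! ### The metric in coordinates -/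

theorem contMDiffOn_metric_coordVec (g : Metric d M) (x₀ : M) (i j : Fin d) :
    ContMDiffOn (𝓡∂ d) 𝓘(ℝ, ℝ) 1 (fun x : M => g.inner x (coordVec x₀ x i) (coordVec x₀ x j))
      (chartAt (EuclideanHalfSpace d) x₀).source := by
  have h2 : IsManifold (𝓡∂ d) (1 + 1) M := by
    rw [one_add_one_eq_two]; infer_instance
  have hb := TangentBundle.contMDiffVectorBundle (I := 𝓡∂ d) (M := M) (n := 1)
  intro x hx
  have hx' : x ∈ (trivializationAt (Model d) (TangentSpace (𝓡∂ d) (M := M)) x₀).baseSet := by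
    simpa using hx
  have hv : ∀ i, ContMDiffAt (𝓡∂ d) ((𝓡∂ d).prod 𝓘(ℝ, Model d)) 1
      (fun x : M => TotalSpace.mk' (Model d) x (coordVec x₀ x i : TangentSpace (𝓡∂ d) x)) x := by
    intro i
    have h1 := (trivializationAt (Model d) (TangentSpace (𝓡∂ d) (M := M)) x₀).contMDiffAt_symmL
      (n := 1) (IB := 𝓡∂ d) hx'
    refine ContMDiffAt.clm_bundle_apply (F₁ := Model d) (E₁ := Bundle.Trivial M (Model d))
      (ϕ := fun x => (trivializationAt (Model d) (TangentSpace (𝓡∂ d) (M := M)) x₀).symmL ℝ x)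
      (v := fun _ => (EuclideanSpace.single i 1 : Model d)) h1 ?_
    exact contMDiffAt_totalSpace.2 ⟨contMDiffAt_id, contMDiffAt_const⟩
  have : ContMDiffAt (𝓡∂ d) ((𝓡∂ d).prod 𝓘(ℝ)) 1
      (fun x ↦ TotalSpace.mk' ℝ (E := Bundle.Trivial M ℝ) x
        (g.inner x (coordVec x₀ x i) (coordVec x₀ x j))) x := by
    apply ContMDiffAt.clm_bundle_apply₂ (F₁ := Model d) (F₂ := Model d)
    · exact g.contMDiff.contMDiffAt
    · exact hv i
    · exact hv j
  simp only [contMDiffAt_totalSpace] at this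
  exact this.2.contMDiffWithinAt

theorem contDiffOn_metricMatrix (g : Metric d M) (x₀ : M) (i j : Fin d) :
    ContDiffOn ℝ 1 (fun y => metricMatrix g x₀ y i j) (extChartAt (𝓡∂ d) x₀).target := by
  have h1 := (contMDiffOn_metric_coordVec g x₀ i j).comp
    (contMDiffOn_extChartAt_symm (I := 𝓡∂ d) (n := 1) x₀) (by
      intro y hy
      rw [mem_preimage, ← extChartAt_source (𝓡∂ d)]
      exact (extChartAt (𝓡∂ d) x₀).map_target hy)
  exact contMDiffOn_iff_contDiffOn.1 h1

theorem bilin_sum {V ι : Type*} [Fintype ι] [AddCommGroup V] [Module ℝ V] [TopologicalSpace V]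
    (b : V →L[ℝ] V →L[ℝ] ℝ) (c e : ι → ℝ) (v : ι → V) :
    b (∑ i, c i • v i) (∑ i, e i • v i) = ∑ i, ∑ j, c i * e j * b (v i) (v j) := by
  simp only [map_sum, map_smul, FunLike.coe_sum, Finset.sum_apply, FunLike.coe_smul,
    Pi.smul_apply, smul_eq_mul, Finset.mul_sum]
  rw [Finset.sum_comm]
  refine Finset.sum_congr rfl fun i _ => Finset.sum_congr rfl fun j _ => ?_
  ring

/-- The matrix is the pullback of the inner product by a linear isomorphism. Positivity makes it
invertible and yields `g^{00} > 0`, by which all the normal quantities are divided. -/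
theorem metricMatrix_posDef (g : Metric d M) (x₀ : M) {y : Model d}
    (hy : y ∈ (extChartAt (𝓡∂ d) x₀).target) : (metricMatrix g x₀ y).PosDef := by
  set x := (extChartAt (𝓡∂ d) x₀).symm y with hxdef
  have hx : x ∈ (trivializationAt (Model d) (TangentSpace (𝓡∂ d) (M := M)) x₀).baseSet := by
    have := (extChartAt (𝓡∂ d) x₀).map_target hy
    rw [extChartAt_source] at this
    rw [TangentBundle.trivializationAt_baseSet]
    exact this
  refine Matrix.PosDef.of_dotProduct_mulVec_pos ?_ fun v hv => ?_
  · ext i j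
    simp only [metricMatrix, Matrix.conjTranspose_apply, Matrix.of_apply, star_trivial]
    exact g.symm _ _ _
  · set e := trivializationAt (Model d) (TangentSpace (𝓡∂ d) (M := M)) x₀
    have hsum : e.symmL ℝ x (WithLp.toLp 2 v) =
        ∑ i, v i • (coordVec x₀ x i : TangentSpace (𝓡∂ d) x) := by
      conv_lhs => rw [← (EuclideanSpace.basisFun (Fin d) ℝ).sum_repr (WithLp.toLp 2 v)]
      simp only [map_sum, map_smul, EuclideanSpace.basisFun_repr, EuclideanSpace.basisFun_apply]
      rfl
    have hne : e.symmL ℝ x (WithLp.toLp 2 v) ≠ 0 := by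
      intro h
      have h2 := e.continuousLinearMapAt_symmL (R := ℝ) hx (WithLp.toLp 2 v)
      rw [h, map_zero] at h2
      exact hv (funext fun i => by simpa using (congrArg (fun w : Model d => w i) h2).symm)
    have := g.pos x _ hne
    rw [hsum] at this
    refine this.trans_eq ((bilin_sum (g.inner x) v v (coordVec x₀ x)).trans ?_)
    simp only [dotProduct, Matrix.mulVec, Finset.mul_sum]
    refine Finset.sum_congr rfl fun i _ => Finset.sum_congr rfl fun j _ => ?_
    simp only [metricMatrix, Matrix.of_apply, Pi.star_apply, star_trivial]
    ring

theorem metricMatrix_extChartAt (g : Metric d M) {x₀ x : M}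
    (hx : x ∈ (chartAt (EuclideanHalfSpace d) x₀).source) (i j : Fin d) :
    metricMatrix g x₀ (extChartAt (𝓡∂ d) x₀ x) i j =
      g.inner x (coordVec x₀ x i) (coordVec x₀ x j) := by
  simp only [metricMatrix, Matrix.of_apply]
  rw [(extChartAt (𝓡∂ d) x₀).left_inv (by rwa [extChartAt_source])]

theorem contDiffOn_det {ι E : Type*} [Fintype ι] [DecidableEq ι] [NormedAddCommGroup E]
    [NormedSpace ℝ E] {A : E → Matrix ι ι ℝ} {U : Set E} {n : WithTop ℕ∞}
    (hA : ∀ i j, ContDiffOn ℝ n (fun y => A y i j) U) : ContDiffOn ℝ n (fun y => (A y).det) U := by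
  simp only [Matrix.det_apply]
  refine ContDiffOn.sum fun σ _ => ContDiffOn.const_smul _ ?_
  exact contDiffOn_prod fun i _ => hA _ _

/-- By Cramer's rule the entries of the inverse are quotients of determinants. -/
theorem contDiffOn_inv {ι E : Type*} [Fintype ι] [DecidableEq ι] [NormedAddCommGroup E]
    [NormedSpace ℝ E] {A : E → Matrix ι ι ℝ} {U : Set E} {n : WithTop ℕ∞}
    (hA : ∀ i j, ContDiffOn ℝ n (fun y => A y i j) U) (hdet : ∀ y ∈ U, (A y).det ≠ 0) (i j : ι) :
    ContDiffOn ℝ n (fun y => (A y)⁻¹ i j) U := by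
  have h : ∀ y, (A y)⁻¹ i j = (A y).det⁻¹ * ((A y).updateRow j (Pi.single i 1)).det := by
    intro y
    rw [Matrix.inv_def, Matrix.smul_apply, Ring.inverse_eq_inv', Matrix.adjugate_apply, smul_eq_mul]
  simp only [h]
  refine ((contDiffOn_det hA).inv hdet).mul (contDiffOn_det fun k l => ?_)
  by_cases hk : k = j
  · subst hk; simp only [Matrix.updateRow_self]; exact contDiffOn_const
  · simp only [Matrix.updateRow_ne hk]; exact hA k l

/-- The coefficients `g^{ij}` of the dual metric in the chart at `x₀`. -/
def dualCoef (g : Metric d M) (x₀ : M) (i j : Fin d) (y : Model d) : ℝ :=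
  (metricMatrix g x₀ y)⁻¹ i j

theorem contDiffOn_dualCoef (g : Metric d M) (x₀ : M) (i j : Fin d) :
    ContDiffOn ℝ 1 (dualCoef g x₀ i j) (extChartAt (𝓡∂ d) x₀).target :=
  contDiffOn_inv (contDiffOn_metricMatrix g x₀)
    (fun _ hy => (metricMatrix_posDef g x₀ hy).det_pos.ne') i j

theorem dualCoef_symm (g : Metric d M) (x₀ : M) {y : Model d}
    (hy : y ∈ (extChartAt (𝓡∂ d) x₀).target) (i j : Fin d) :
    dualCoef g x₀ i j y = dualCoef g x₀ j i y := by
  have := (metricMatrix_posDef g x₀ hy).inv.isHermitian.apply i j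
  simpa [dualCoef] using this.symm

theorem dualCoef_diag_pos (g : Metric d M) (x₀ : M) {y : Model d}
    (hy : y ∈ (extChartAt (𝓡∂ d) x₀).target) (i : Fin d) : 0 < dualCoef g x₀ i i y :=
  (metricMatrix_posDef g x₀ hy).inv.diag_pos

theorem cometric_eq (g : Metric d M) (x₀ : M) (y ξ η : Model d) :
    cometric g x₀ y ξ η = ∑ i, ∑ j, dualCoef g x₀ i j y * ξ i * η j := rfl

theorem cometric_pos (g : Metric d M) (x₀ : M) {y : Model d}
    (hy : y ∈ (extChartAt (𝓡∂ d) x₀).target) {ξ : Model d} (hξ : ξ ≠ 0) :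
    0 < cometric g x₀ y ξ ξ := by
  have := (metricMatrix_posDef g x₀ hy).inv.dotProduct_mulVec_pos (x := fun i => ξ i)
    (fun h => hξ (by ext i; exact congrFun h i))
  refine this.trans_eq ?_
  simp only [cometric_eq, dotProduct, Matrix.mulVec, Finset.mul_sum]
  refine Finset.sum_congr rfl fun i _ => Finset.sum_congr rfl fun j _ => ?_
  simp only [dualCoef, Pi.star_apply, star_trivial]; ring

/-- The dual metric does not depend on the chart. -/
theorem cometric_change (g : Metric d M) {x₀ x₁ x : M}
    (h0 : x ∈ (chartAt (EuclideanHalfSpace d) x₀).source)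
    (h1 : x ∈ (chartAt (EuclideanHalfSpace d) x₁).source) (ξ η : Cotangent d x) :
    cometric g x₁ (extChartAt (𝓡∂ d) x₁ x) (covecCoord x₁ x ξ) (covecCoord x₁ x η) =
      cometric g x₀ (extChartAt (𝓡∂ d) x₀ x) (covecCoord x₀ x ξ) (covecCoord x₀ x η) := by
  set P : Matrix (Fin d) (Fin d) ℝ :=
    Matrix.of fun k i => (tangentCoordChange (𝓡∂ d) x₁ x₀ x (EuclideanSpace.single i 1)) k with hP
  have hs0 : x ∈ (extChartAt (𝓡∂ d) x₀).source := by rwa [extChartAt_source]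
  have hs1 : x ∈ (extChartAt (𝓡∂ d) x₁).source := by rwa [extChartAt_source]
  have hcov : ∀ ζ : Cotangent d x, (fun i => covecCoord x₁ x ζ i) =
      P.transpose.mulVec (fun i => covecCoord x₀ x ζ i) := by
    intro ζ
    ext i
    simp only [covecCoord, coordVec_change h0 h1 i, Matrix.mulVec, dotProduct,
      Matrix.transpose_apply, hP, Matrix.of_apply]
    rw [map_sum]
    simp
  -- With `P` the Jacobian, `G₁ = Pᵀ G₀ P` and `ξ₁ = Pᵀ ξ₀`, so that `ξ₁ᵀ G₁⁻¹ η₁ = ξ₀ᵀ G₀⁻¹ η₀`.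
  have hM : metricMatrix g x₁ (extChartAt (𝓡∂ d) x₁ x) =
      P.transpose * metricMatrix g x₀ (extChartAt (𝓡∂ d) x₀ x) * P := by
    ext i j
    rw [metricMatrix_extChartAt g h1, coordVec_change h0 h1 i, coordVec_change h0 h1 j]
    refine (bilin_sum (g.inner x) _ _ (coordVec x₀ x)).trans ?_
    simp only [Matrix.mul_apply, Matrix.transpose_apply, hP, Matrix.of_apply, Finset.sum_mul,
      ← metricMatrix_extChartAt g h0]
    rw [Finset.sum_comm]
    refine Finset.sum_congr rfl fun k _ => Finset.sum_congr rfl fun l _ => ?_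
    ring
  have hdet : IsUnit P.det := by
    have h := (metricMatrix_posDef g x₁ ((extChartAt (𝓡∂ d) x₁).map_source hs1)).det_pos.ne'
    rw [hM, Matrix.det_mul, Matrix.det_mul] at h
    exact (right_ne_zero_of_mul h).isUnit
  have hform : ∀ (A : Matrix (Fin d) (Fin d) ℝ) (v w : Fin d → ℝ),
      ∑ i, ∑ j, A i j * v i * w j = v ⬝ᵥ A.mulVec w := by
    intro A v w
    simp only [dotProduct, Matrix.mulVec, Finset.mul_sum]
    refine Finset.sum_congr rfl fun i _ => Finset.sum_congr rfl fun j _ => ?_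
    ring
  unfold cometric
  rw [hform _ (fun i => covecCoord x₁ x ξ i) (fun i => covecCoord x₁ x η i),
    hform _ (fun i => covecCoord x₀ x ξ i) (fun i => covecCoord x₀ x η i), hcov, hcov, hM,
    Matrix.mul_inv_rev, Matrix.mul_inv_rev, Matrix.mulVec_mulVec, Matrix.mul_assoc,
    Matrix.mul_assoc, Matrix.nonsing_inv_mul _ (by rwa [Matrix.det_transpose]), Matrix.mul_one,
    Matrix.dotProduct_mulVec, Matrix.mulVec_transpose, Matrix.vecMul_vecMul, ← Matrix.mul_assoc,
    Matrix.mul_nonsing_inv _ hdet, Matrix.one_mul, ← Matrix.dotProduct_mulVec]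

end Coordinates

section HamiltonianFields

variable {d : ℕ} [NeZero d]

/-! ### The symplectic form and Hamiltonian fields -/

/-- The symplectic form of the local phase space. -/
def symp (u v : LocalPhase d) : ℝ :=
  -(u.2.2.1 * v.1) - inner ℝ u.2.2.2 v.2.1 + u.1 * v.2.2.1 + inner ℝ u.2.1 v.2.2.2

theorem symp_self (u : LocalPhase d) : symp u u = 0 := by
  unfold symp
  rw [real_inner_comm u.2.1]
  ring

theorem model_eq_sum (v : Model d) : v = ∑ i, v i • EuclideanSpace.single i (1 : ℝ) := by
  conv_lhs => rw [← (EuclideanSpace.basisFun (Fin d) ℝ).sum_repr v]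
  simp

theorem localPhase_eq_sum (v : LocalPhase d) :
    v = v.1 • ((1, 0, 0, 0) : LocalPhase d)
      + ∑ i, v.2.1 i • ((0, EuclideanSpace.single i 1, 0, 0) : LocalPhase d)
      + v.2.2.1 • ((0, 0, 1, 0) : LocalPhase d)
      + ∑ i, v.2.2.2 i • ((0, 0, 0, EuclideanSpace.single i 1) : LocalPhase d) := by
  have h1 := model_eq_sum v.2.1
  have h2 := model_eq_sum v.2.2.2
  refine Prod.ext ?_ (Prod.ext ?_ (Prod.ext ?_ ?_))
  · simp [Prod.fst_sum]
  · simp only [Prod.snd_add, Prod.fst_add, Prod.snd_sum, Prod.fst_sum, Prod.smul_snd,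
      Prod.smul_fst, smul_zero, Finset.sum_const_zero, zero_add, add_zero]
    exact h1
  · simp [Prod.fst_sum, Prod.snd_sum]
  · simp only [Prod.snd_add, Prod.snd_sum, Prod.smul_snd, smul_zero, Finset.sum_const_zero,
      zero_add]
    exact h2

/-- This is `df = symp (H_f, ·)`, which characterizes `H_f`; invariance under symplectic changes of
coordinates and `H_f f = 0` both come from it. -/
theorem fderivWithin_eq_symp (f : LocalPhase d → ℝ) (q v : LocalPhase d) :
    fderivWithin ℝ f (halfPhase d) q v = symp (hamField f q) v := by
  conv_lhs => rw [localPhase_eq_sum v]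
  simp only [map_add, map_sum, map_smul, smul_eq_mul, symp, hamField, PiLp.inner_apply,
    RCLike.inner_apply, conj_trivial, mul_neg, Finset.sum_neg_distrib]
  ring

theorem symp_single_x (u : LocalPhase d) (i : Fin d) :
    symp u (0, EuclideanSpace.single i 1, 0, 0) = - u.2.2.2 i := by
  simp [symp, EuclideanSpace.inner_single_right]

theorem symp_single_ξ (u : LocalPhase d) (i : Fin d) :
    symp u (0, 0, 0, EuclideanSpace.single i 1) = u.2.1 i := by
  simp [symp, EuclideanSpace.inner_single_right]

/-- Nondegeneracy: the coordinate directions recover every component of the vector. -/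
theorem eq_of_symp {u w : LocalPhase d} (h : ∀ v, symp u v = symp w v) : u = w := by
  refine Prod.ext ?_ (Prod.ext ?_ (Prod.ext ?_ ?_))
  · simpa [symp] using h (0, 0, 1, 0)
  · ext i
    rw [← symp_single_ξ, h, symp_single_ξ]
  · simpa [symp] using h (1, 0, 0, 0)
  · ext i
    have := h (0, EuclideanSpace.single i 1, 0, 0)
    rw [symp_single_x, symp_single_x] at this
    linarith

theorem uniqueDiffOn_halfPhase : UniqueDiffOn ℝ (halfPhase d) := by
  have h : halfPhase d = univ ×ˢ (range (𝓡∂ d) ×ˢ univ) := by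
    ext q
    rw [range_modelWithCornersEuclideanHalfSpace]
    simp [halfPhase]
  rw [h]
  exact uniqueDiffOn_univ.prod ((𝓡∂ d).uniqueDiffOn.prod uniqueDiffOn_univ)

theorem mem_halfPhase {q : LocalPhase d} : q ∈ halfPhase d ↔ 0 ≤ q.2.1 0 := Iff.rfl

theorem hamField_eq_of_hasFDerivWithinAt {f : LocalPhase d → ℝ} {D : LocalPhase d →L[ℝ] ℝ}
    {q : LocalPhase d} (hq : q ∈ halfPhase d) (h : HasFDerivWithinAt f D (halfPhase d) q) :
    hamField f q = (D (0, 0, 1, 0), WithLp.toLp 2 (fun i => D (0, 0, 0, EuclideanSpace.single i 1)),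
      - D (1, 0, 0, 0), WithLp.toLp 2 (fun i => - D (0, EuclideanSpace.single i 1, 0, 0))) := by
  unfold hamField
  rw [h.fderivWithin (uniqueDiffOn_halfPhase q hq)]

/-- The continuous linear functional `x_i`. -/
def projX (i : Fin d) : LocalPhase d →L[ℝ] ℝ :=
  (EuclideanSpace.proj i).comp ((ContinuousLinearMap.fst ℝ (Model d) (ℝ × Model d)).comp
    (ContinuousLinearMap.snd ℝ ℝ (Model d × ℝ × Model d)))

/-- The continuous linear functional `ξ_i`. -/
def projξ (i : Fin d) : LocalPhase d →L[ℝ] ℝ :=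
  (EuclideanSpace.proj i).comp ((ContinuousLinearMap.snd ℝ ℝ (Model d)).comp
    ((ContinuousLinearMap.snd ℝ (Model d) (ℝ × Model d)).comp
    (ContinuousLinearMap.snd ℝ ℝ (Model d × ℝ × Model d))))

/-- The continuous linear functional `τ`. -/
def projτ : LocalPhase d →L[ℝ] ℝ :=
  (ContinuousLinearMap.fst ℝ ℝ (Model d)).comp
    ((ContinuousLinearMap.snd ℝ (Model d) (ℝ × Model d)).comp
    (ContinuousLinearMap.snd ℝ ℝ (Model d × ℝ × Model d)))

/-- The projection to the base point. -/
def projBase : LocalPhase d →L[ℝ] Model d :=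
  (ContinuousLinearMap.fst ℝ (Model d) (ℝ × Model d)).comp
    (ContinuousLinearMap.snd ℝ ℝ (Model d × ℝ × Model d))

@[simp] theorem projX_apply (i : Fin d) (q : LocalPhase d) : projX i q = q.2.1 i := rfl
@[simp] theorem projξ_apply (i : Fin d) (q : LocalPhase d) : projξ i q = q.2.2.2 i := rfl
@[simp] theorem projτ_apply (q : LocalPhase d) : projτ q = q.2.2.1 := rfl
@[simp] theorem projBase_apply (q : LocalPhase d) : projBase q = q.2.1 := rfl

/-- The direction of the normal momentum `ξ_0`. -/
def eξ : LocalPhase d := (0, 0, 0, EuclideanSpace.single 0 1)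

theorem zCoord_hasFDerivWithinAt (q : LocalPhase d) :
    HasFDerivWithinAt (zCoord d) (projX 0) (halfPhase d) q :=
  (projX (d := d) 0).hasFDerivWithinAt

theorem hamField_zCoord {q : LocalPhase d} (hq : q ∈ halfPhase d) :
    hamField (zCoord d) q = -eξ := by
  rw [hamField_eq_of_hasFDerivWithinAt hq (zCoord_hasFDerivWithinAt q)]
  refine Prod.ext ?_ (Prod.ext ?_ (Prod.ext ?_ ?_))
  · simp [eξ]
  · ext i; simp [eξ]
  · simp [eξ]
  · ext i; simp [eξ, eq_comm]

theorem poisson_zCoord {f : LocalPhase d → ℝ} {q : LocalPhase d} (hq : q ∈ halfPhase d) :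
    poisson f (zCoord d) q = (hamField f q).2.1 0 := by
  unfold poisson
  rw [(zCoord_hasFDerivWithinAt q).fderivWithin (uniqueDiffOn_halfPhase q hq)]
  rfl

theorem zCoord_poisson {f : LocalPhase d → ℝ} {q : LocalPhase d} (hq : q ∈ halfPhase d) :
    poisson (zCoord d) f q = - (hamField f q).2.1 0 := by
  unfold poisson
  rw [hamField_zCoord hq, fderivWithin_eq_symp]
  simp [symp, eξ, EuclideanSpace.inner_single_right]

variable {M : Type*} [TopologicalSpace M]
  [ChartedSpace (EuclideanHalfSpace d) M] [IsManifold (𝓡∂ d) 2 M]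

theorem coordTarget_subset (x₀ : M) : coordTarget x₀ ⊆ halfPhase d := by
  intro q hq
  have := extChartAt_target_subset_range (I := 𝓡∂ d) x₀ hq
  rw [range_modelWithCornersEuclideanHalfSpace] at this
  exact this

theorem coordTarget_mem_nhdsWithin {x₀ : M} {q : LocalPhase d} (hq : q ∈ coordTarget x₀) :
    coordTarget x₀ ∈ 𝓝[halfPhase d] q := by
  have h1 := extChartAt_target_mem_nhdsWithin_of_mem (I := 𝓡∂ d) hq
  have h2 : Tendsto (projBase (d := d)) (𝓝[halfPhase d] q) (𝓝[range (𝓡∂ d)] q.2.1) := by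
    refine tendsto_nhdsWithin_iff.2
      ⟨((projBase (d := d)).continuous.tendsto q).mono_left nhdsWithin_le_nhds, ?_⟩
    filter_upwards [self_mem_nhdsWithin] with u hu
    rw [range_modelWithCornersEuclideanHalfSpace]
    exact hu
  exact h2 h1

/-! ### The wave symbol in coordinates -/

/-- The derivative of the coefficient `g^{ij}`. -/
def dualCoefDeriv (g : Metric d M) (x₀ : M) (i j : Fin d) (y : Model d) : Model d →L[ℝ] ℝ :=
  fderivWithin ℝ (dualCoef g x₀ i j) (range (𝓡∂ d)) y

theorem dualCoef_hasFDerivWithinAt (g : Metric d M) (x₀ : M) (i j : Fin d) {y : Model d}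
    (hy : y ∈ (extChartAt (𝓡∂ d) x₀).target) :
    HasFDerivWithinAt (dualCoef g x₀ i j) (dualCoefDeriv g x₀ i j y) (range (𝓡∂ d)) y := by
  have h := (contDiffOn_dualCoef g x₀ i j).differentiableOn one_ne_zero y hy
  exact (h.mono_of_mem_nhdsWithin (extChartAt_target_mem_nhdsWithin_of_mem hy)).hasFDerivWithinAt

theorem continuousOn_dualCoefDeriv (g : Metric d M) (x₀ : M) (i j : Fin d) :
    ContinuousOn (dualCoefDeriv g x₀ i j) (extChartAt (𝓡∂ d) x₀).target := by
  intro y hy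
  have hn := extChartAt_target_mem_nhdsWithin_of_mem (I := 𝓡∂ d) hy
  have h : ContDiffWithinAt ℝ 1 (dualCoef g x₀ i j) (range (𝓡∂ d)) y :=
    (contDiffOn_dualCoef g x₀ i j y hy).mono_of_mem_nhdsWithin hn
  have h2 := h.fderivWithin_right (m := 0) (𝓡∂ d).uniqueDiffOn (by norm_num)
    (extChartAt_target_subset_range x₀ hy)
  exact h2.continuousWithinAt.mono (extChartAt_target_subset_range x₀)

theorem dualCoef_comp_hasFDerivWithinAt (g : Metric d M) (x₀ : M) (i j : Fin d)
    {q : LocalPhase d} (hq : q ∈ coordTarget x₀) :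
    HasFDerivWithinAt (fun u : LocalPhase d => dualCoef g x₀ i j u.2.1)
      ((dualCoefDeriv g x₀ i j q.2.1).comp projBase) (halfPhase d) q := by
  refine (dualCoef_hasFDerivWithinAt g x₀ i j hq).comp q (projBase (d := d)).hasFDerivWithinAt ?_
  intro u hu
  rw [range_modelWithCornersEuclideanHalfSpace]
  exact hu

/-- The derivative of the symbol in coordinates. -/
def symbolDeriv (g : Metric d M) (x₀ : M) (q : LocalPhase d) : LocalPhase d →L[ℝ] ℝ :=
  (-2 * q.2.2.1) • projτ + ∑ i, ∑ j,
    ((q.2.2.2 i * q.2.2.2 j) • (dualCoefDeriv g x₀ i j q.2.1).comp projBase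
      + (dualCoef g x₀ i j q.2.1 * q.2.2.2 j) • projξ i
      + (dualCoef g x₀ i j q.2.1 * q.2.2.2 i) • projξ j)

theorem symbolLoc_hasFDerivWithinAt (g : Metric d M) (x₀ : M) {q : LocalPhase d}
    (hq : q ∈ coordTarget x₀) :
    HasFDerivWithinAt (symbolLoc g x₀) (symbolDeriv g x₀ q) (halfPhase d) q := by
  have h1 : HasFDerivWithinAt (fun u : LocalPhase d => -u.2.2.1 ^ 2)
      ((-2 * q.2.2.1) • projτ) (halfPhase d) q := by
    convert! ((projτ (d := d)).hasFDerivWithinAt.pow 2).neg using 1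
    ext v <;> simp
  have h2 : ∀ i j, HasFDerivWithinAt
      (fun u : LocalPhase d => dualCoef g x₀ i j u.2.1 * u.2.2.2 i * u.2.2.2 j)
      ((q.2.2.2 i * q.2.2.2 j) • (dualCoefDeriv g x₀ i j q.2.1).comp projBase
      + (dualCoef g x₀ i j q.2.1 * q.2.2.2 j) • projξ i
      + (dualCoef g x₀ i j q.2.1 * q.2.2.2 i) • projξ j) (halfPhase d) q := by
    intro i j
    convert! ((dualCoef_comp_hasFDerivWithinAt g x₀ i j hq).mul
      (projξ (d := d) i).hasFDerivWithinAt).mul (projξ (d := d) j).hasFDerivWithinAt using 1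
    simp only [projξ_apply, Pi.mul_apply]
    module
  exact h1.add (HasFDerivWithinAt.fun_sum fun i _ => HasFDerivWithinAt.fun_sum fun j _ => h2 i j)

/-- The Hamiltonian field of the symbol in coordinates. -/
theorem hamField_symbolLoc (g : Metric d M) (x₀ : M) {q : LocalPhase d}
    (hq : q ∈ coordTarget x₀) :
    hamField (symbolLoc g x₀) q = (-2 * q.2.2.1,
      WithLp.toLp 2 (fun i => 2 * ∑ j, dualCoef g x₀ i j q.2.1 * q.2.2.2 j), 0,
      WithLp.toLp 2 (fun k => - ∑ i, ∑ j, q.2.2.2 i * q.2.2.2 j *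
        dualCoefDeriv g x₀ i j q.2.1 (EuclideanSpace.single k 1))) := by
  rw [hamField_eq_of_hasFDerivWithinAt (coordTarget_subset x₀ hq)
    (symbolLoc_hasFDerivWithinAt g x₀ hq)]
  refine Prod.ext ?_ (Prod.ext ?_ (Prod.ext ?_ ?_))
  · simp [symbolDeriv]
  · ext k
    have key : ∀ (G : Fin d → Fin d → ℝ) (ξ : Fin d → ℝ), (∀ i j, G i j = G j i) →
        ∑ i, ∑ j, (G i j * ξ j * (if i = k then 1 else 0) + G i j * ξ i * (if j = k then 1 else 0))
          = 2 * ∑ j, G k j * ξ j := by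
      intro G ξ hG
      simp only [Finset.sum_add_distrib]
      rw [Finset.sum_comm, two_mul]
      simp only [mul_ite, mul_one, mul_zero, Finset.sum_ite_eq', Finset.mem_univ, if_true]
      simp only [hG k]
    refine Eq.trans ?_ (key (fun i j => dualCoef g x₀ i j q.2.1) (fun i => q.2.2.2 i)
      (dualCoef_symm g x₀ hq))
    simp [symbolDeriv]
  · simp [symbolDeriv]
  · ext k
    simp [symbolDeriv]

theorem HpzLoc_eq (g : Metric d M) (x₀ : M) {q : LocalPhase d} (hq : q ∈ coordTarget x₀) :
    HpzLoc g x₀ q = 2 * ∑ j, dualCoef g x₀ 0 j q.2.1 * q.2.2.2 j := by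
  unfold HpzLoc
  rw [poisson_zCoord (coordTarget_subset x₀ hq), hamField_symbolLoc g x₀ hq]

theorem HpzLoc_eq_hamField (g : Metric d M) (x₀ : M) {q : LocalPhase d}
    (hq : q ∈ coordTarget x₀) : HpzLoc g x₀ q = (hamField (symbolLoc g x₀) q).2.1 0 :=
  poisson_zCoord (coordTarget_subset x₀ hq)

/-- The derivative of `H_p z` in coordinates. -/
def HpzDeriv (g : Metric d M) (x₀ : M) (q : LocalPhase d) : LocalPhase d →L[ℝ] ℝ :=
  (2 : ℝ) • ∑ j, (q.2.2.2 j • (dualCoefDeriv g x₀ 0 j q.2.1).comp projBase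
    + dualCoef g x₀ 0 j q.2.1 • projξ j)

/-- `H_p z` contains the metric but not its derivatives, so for a `C¹` metric it can still be
differentiated and `H_p² z` is continuous. -/
theorem HpzLoc_hasFDerivWithinAt (g : Metric d M) (x₀ : M) {q : LocalPhase d}
    (hq : q ∈ coordTarget x₀) :
    HasFDerivWithinAt (HpzLoc g x₀) (HpzDeriv g x₀ q) (halfPhase d) q := by
  have h2 : ∀ j, HasFDerivWithinAt (fun u : LocalPhase d => dualCoef g x₀ 0 j u.2.1 * u.2.2.2 j)
      (q.2.2.2 j • (dualCoefDeriv g x₀ 0 j q.2.1).comp projBase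
        + dualCoef g x₀ 0 j q.2.1 • projξ j) (halfPhase d) q := by
    intro j
    convert! (dualCoef_comp_hasFDerivWithinAt g x₀ 0 j hq).mul
      (projξ (d := d) j).hasFDerivWithinAt using 1
    simp only [projξ_apply]
    module
  refine ((HasFDerivWithinAt.fun_sum fun j _ => h2 j).const_mul 2).congr_of_eventuallyEq ?_
    (HpzLoc_eq g x₀ hq)
  filter_upwards [coordTarget_mem_nhdsWithin hq] with u hu using HpzLoc_eq g x₀ hu

theorem Hp2zLoc_eq (g : Metric d M) (x₀ : M) {q : LocalPhase d} (hq : q ∈ coordTarget x₀) :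
    Hp2zLoc g x₀ q = HpzDeriv g x₀ q (hamField (symbolLoc g x₀) q) := by
  unfold Hp2zLoc poisson
  rw [(HpzLoc_hasFDerivWithinAt g x₀ hq).fderivWithin
    (uniqueDiffOn_halfPhase q (coordTarget_subset x₀ hq))]

theorem HpzDeriv_eξ (g : Metric d M) (x₀ : M) (q : LocalPhase d) :
    HpzDeriv g x₀ q eξ = 2 * dualCoef g x₀ 0 0 q.2.1 := by
  simp [HpzDeriv, eξ]

/-- Here `H_z = -∂_{ξ_0}`, so `H_z p = -H_p z`, and applying `H_z` again gives the second derivative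
of `p` in `ξ_0`. -/
theorem Hz2pLoc_eq (g : Metric d M) (x₀ : M) {q : LocalPhase d} (hq : q ∈ coordTarget x₀) :
    Hz2pLoc g x₀ q = 2 * dualCoef g x₀ 0 0 q.2.1 := by
  have hq' := coordTarget_subset x₀ hq
  have h : HasFDerivWithinAt (poisson (zCoord d) (symbolLoc g x₀)) (-HpzDeriv g x₀ q)
      (halfPhase d) q := by
    refine (HpzLoc_hasFDerivWithinAt g x₀ hq).neg.congr_of_eventuallyEq ?_ ?_
    · filter_upwards [coordTarget_mem_nhdsWithin hq] with u hu
      rw [zCoord_poisson (coordTarget_subset x₀ hu), Pi.neg_apply, HpzLoc_eq_hamField g x₀ hu]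
    · rw [zCoord_poisson hq', Pi.neg_apply, HpzLoc_eq_hamField g x₀ hq]
  unfold Hz2pLoc
  rw [poisson, h.fderivWithin (uniqueDiffOn_halfPhase q hq'), hamField_zCoord hq']
  simp [HpzDeriv_eξ]

theorem dualCoef_zero_pos (g : Metric d M) {x₀ : M} {q : LocalPhase d}
    (hq : q ∈ coordTarget x₀) : 0 < dualCoef g x₀ 0 0 q.2.1 := dualCoef_diag_pos g x₀ hq 0

theorem symbolDeriv_hamField (g : Metric d M) (x₀ : M) {q : LocalPhase d}
    (hq : q ∈ coordTarget x₀) : symbolDeriv g x₀ q (hamField (symbolLoc g x₀) q) = 0 := by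
  rw [← (symbolLoc_hasFDerivWithinAt g x₀ hq).fderivWithin
    (uniqueDiffOn_halfPhase q (coordTarget_subset x₀ hq)), fderivWithin_eq_symp, symp_self]

theorem symbolDeriv_eξ (g : Metric d M) (x₀ : M) {q : LocalPhase d}
    (hq : q ∈ coordTarget x₀) : symbolDeriv g x₀ q eξ = HpzLoc g x₀ q := by
  rw [← (symbolLoc_hasFDerivWithinAt g x₀ hq).fderivWithin
    (uniqueDiffOn_halfPhase q (coordTarget_subset x₀ hq)), fderivWithin_eq_symp, eξ, symp_single_ξ,
    HpzLoc_eq_hamField g x₀ hq]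

@[fun_prop]
theorem continuousOn_dualCoef_comp (g : Metric d M) (x₀ : M) (i j : Fin d) :
    ContinuousOn (fun q : LocalPhase d => dualCoef g x₀ i j q.2.1) (coordTarget x₀) :=
  (contDiffOn_dualCoef g x₀ i j).continuousOn.comp (by fun_prop) fun _ hq => hq

theorem continuousOn_dualCoefDeriv_comp (g : Metric d M) (x₀ : M) (i j : Fin d) :
    ContinuousOn (fun q : LocalPhase d => dualCoefDeriv g x₀ i j q.2.1) (coordTarget x₀) :=
  (continuousOn_dualCoefDeriv g x₀ i j).comp (by fun_prop) fun _ hq => hq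

theorem continuousOn_hamField (g : Metric d M) (x₀ : M) :
    ContinuousOn (hamField (symbolLoc g x₀)) (coordTarget x₀) := by
  refine ContinuousOn.congr ?_ fun q hq => hamField_symbolLoc g x₀ hq
  refine ContinuousOn.prodMk (by fun_prop) (ContinuousOn.prodMk ?_ (ContinuousOn.prodMk
    (by fun_prop) ?_))
  · refine (PiLp.continuous_toLp 2 _).comp_continuousOn (continuousOn_pi.2 fun i => ?_)
    refine continuousOn_const.mul (continuousOn_finsetSum _ fun j _ => ?_)
    exact (continuousOn_dualCoef_comp g x₀ i j).mul (by fun_prop)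
  · refine (PiLp.continuous_toLp 2 _).comp_continuousOn (continuousOn_pi.2 fun k => ?_)
    refine (continuousOn_finsetSum _ fun i _ => continuousOn_finsetSum _ fun j _ => ?_).neg
    exact ContinuousOn.mul (by fun_prop)
      ((continuousOn_dualCoefDeriv_comp g x₀ i j).clm_apply continuousOn_const)

theorem continuousOn_HpzLoc (g : Metric d M) (x₀ : M) :
    ContinuousOn (HpzLoc g x₀) (coordTarget x₀) := fun _ hq =>
  (HpzLoc_hasFDerivWithinAt g x₀ hq).continuousWithinAt.mono (coordTarget_subset x₀)

theorem continuousOn_symbolLoc (g : Metric d M) (x₀ : M) :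
    ContinuousOn (symbolLoc g x₀) (coordTarget x₀) := fun _ hq =>
  (symbolLoc_hasFDerivWithinAt g x₀ hq).continuousWithinAt.mono (coordTarget_subset x₀)

theorem continuousOn_Hp2zLoc (g : Metric d M) (x₀ : M) :
    ContinuousOn (Hp2zLoc g x₀) (coordTarget x₀) := by
  refine ContinuousOn.congr ?_ fun q hq => Hp2zLoc_eq g x₀ hq
  refine ContinuousOn.clm_apply ?_ (continuousOn_hamField g x₀)
  unfold HpzDeriv
  refine ContinuousOn.const_smul (c := (2 : ℝ)) ?_
  refine continuousOn_finsetSum _ fun j _ => ContinuousOn.add ?_ ?_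
  · exact ContinuousOn.smul (f := fun q : LocalPhase d => q.2.2.2 j) (by fun_prop)
      ((continuousOn_dualCoefDeriv_comp g x₀ 0 j).clm_comp continuousOn_const)
  · exact (continuousOn_dualCoef_comp g x₀ 0 j).smul continuousOn_const

/-- The gliding field only changes the normal momentum. -/
theorem glidingLoc_eq (g : Metric d M) (x₀ : M) {q : LocalPhase d} (hq : q ∈ coordTarget x₀) :
    glidingLoc g x₀ q = hamField (symbolLoc g x₀) q
      - (Hp2zLoc g x₀ q / (2 * dualCoef g x₀ 0 0 q.2.1)) • eξ := by
  unfold glidingLoc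
  rw [Hz2pLoc_eq g x₀ hq, hamField_zCoord (coordTarget_subset x₀ hq), smul_neg, sub_eq_add_neg]

theorem add_smul_eξ_mem {x₀ : M} {q : LocalPhase d} (hq : q ∈ coordTarget x₀) (c : ℝ) :
    q + c • eξ ∈ coordTarget x₀ := by
  have : (q + c • eξ (d := d)).2.1 = q.2.1 := by simp [eξ]
  unfold coordTarget
  rw [mem_ofPred_eq, this]
  exact hq

theorem HpzLoc_add (g : Metric d M) {x₀ : M} {q : LocalPhase d} (hq : q ∈ coordTarget x₀)
    (c : ℝ) : HpzLoc g x₀ (q + c • eξ) = HpzLoc g x₀ q + 2 * c * dualCoef g x₀ 0 0 q.2.1 := by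
  rw [HpzLoc_eq g x₀ hq, HpzLoc_eq g x₀ (add_smul_eξ_mem hq c)]
  simp only [eξ, Prod.snd_add, Prod.smul_snd, Prod.fst_add, Prod.smul_fst, smul_zero, add_zero,
    PiLp.add_apply, PiLp.smul_apply, smul_eq_mul, mul_add, Finset.sum_add_distrib,
    PiLp.single_apply, mul_ite, mul_one, mul_zero, Finset.sum_ite_eq', Finset.mem_univ, if_true]
  ring

/-- Along `ξ_0` the symbol is quadratic, with linear coefficient `H_p z` and leading coefficient
`g^{00}`. The reflection picks the other root, `c = -H_p z / g^{00}`. -/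
theorem symbolLoc_add (g : Metric d M) {x₀ : M} {q : LocalPhase d} (hq : q ∈ coordTarget x₀)
    (c : ℝ) : symbolLoc g x₀ (q + c • eξ) =
      symbolLoc g x₀ q + c * HpzLoc g x₀ q + c ^ 2 * dualCoef g x₀ 0 0 q.2.1 := by
  have key : ∀ (G : Fin d → Fin d → ℝ) (ξ : Fin d → ℝ), (∀ i j, G i j = G j i) →
      ∑ i, ∑ j, G i j * (ξ i + if i = 0 then c else 0) * (ξ j + if j = 0 then c else 0)
        = ∑ i, ∑ j, G i j * ξ i * ξ j + c * (2 * ∑ j, G 0 j * ξ j) + c ^ 2 * G 0 0 := by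
    intro G ξ hG
    have h : ∀ i j, G i j * (ξ i + if i = 0 then c else 0) * (ξ j + if j = 0 then c else 0) =
        G i j * ξ i * ξ j + (if i = 0 then c * (G i j * ξ j) else 0)
          + (if j = 0 then c * (G i j * ξ i) else 0)
          + (if i = 0 then if j = 0 then c ^ 2 * G i j else 0 else 0) := by
      intro i j
      split_ifs <;> ring
    simp only [h, Finset.sum_add_distrib, Finset.sum_ite_irrel, Finset.sum_ite_eq',
      Finset.mem_univ, if_true, Finset.sum_const_zero]
    simp only [← Finset.mul_sum, hG 0]
    ring
  rw [HpzLoc_eq g x₀ hq]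
  have := key (fun i j => dualCoef g x₀ i j q.2.1) (fun i => q.2.2.2 i) (dualCoef_symm g x₀ hq)
  simp only [symbolLoc, cometric_eq, eξ, Prod.snd_add, Prod.smul_snd, Prod.fst_add, Prod.smul_fst,
    smul_zero, add_zero, PiLp.add_apply, PiLp.smul_apply, smul_eq_mul, PiLp.single_apply, mul_ite,
    mul_one, mul_zero]
  linarith

end HamiltonianFields

section Curves

variable {d : ℕ} [NeZero d] {M : Type*} [TopologicalSpace M]
  [ChartedSpace (EuclideanHalfSpace d) M] [IsManifold (𝓡∂ d) 2 M]

/-! ### Changes of charts -/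

/-- The change of coordinates from the chart at `x₀` to the chart at `x₁`. -/
def trans (x₀ x₁ : M) : Model d → Model d := extChartAt (𝓡∂ d) x₁ ∘ (extChartAt (𝓡∂ d) x₀).symm

/-- The derivative of the change of coordinates. -/
def transDeriv (x₀ x₁ : M) (y : Model d) : Model d →L[ℝ] Model d :=
  fderivWithin ℝ (trans x₀ x₁) (range (𝓡∂ d)) y

/-- The second derivative of the change of coordinates. -/
def transDeriv2 (x₀ x₁ : M) (y : Model d) : Model d →L[ℝ] Model d →L[ℝ] Model d :=
  fderivWithin ℝ (transDeriv x₀ x₁) (range (𝓡∂ d)) y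

/-- The coordinates in the chart at `x₀` of the points that are also in the domain of the chart
at `x₁`. -/
def overlap (x₀ x₁ : M) : Set (Model d) :=
  (extChartAt (𝓡∂ d) x₀).target ∩
    (extChartAt (𝓡∂ d) x₀).symm ⁻¹' (chartAt (EuclideanHalfSpace d) x₁).source

theorem mem_range_iff {y : Model d} : y ∈ range (𝓡∂ d) ↔ 0 ≤ y 0 := by
  rw [range_modelWithCornersEuclideanHalfSpace]; rfl

theorem overlap_subset_range (x₀ x₁ : M) : overlap x₀ x₁ ⊆ range (𝓡∂ d) :=
  inter_subset_left.trans (extChartAt_target_subset_range x₀)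

theorem overlap_mem_nhdsWithin {x₀ x₁ : M} {y : Model d} (hy : y ∈ overlap x₀ x₁) :
    overlap x₀ x₁ ∈ 𝓝[range (𝓡∂ d)] y := by
  have h1 := extChartAt_target_mem_nhdsWithin_of_mem (I := 𝓡∂ d) hy.1
  have h2 : (extChartAt (𝓡∂ d) x₀).symm ⁻¹' (chartAt (EuclideanHalfSpace d) x₁).source ∈
      𝓝[range (𝓡∂ d)] y := by
    have := (continuousOn_extChartAt_symm (I := 𝓡∂ d) x₀ y hy.1).preimage_mem_nhdsWithin
      ((chartAt (EuclideanHalfSpace d) x₁).open_source.mem_nhds hy.2)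
    exact nhdsWithin_le_of_mem h1 this
  exact inter_mem h1 h2

theorem extChartAt_mem_overlap {x₀ x₁ x : M}
    (h0 : x ∈ (chartAt (EuclideanHalfSpace d) x₀).source)
    (h1 : x ∈ (chartAt (EuclideanHalfSpace d) x₁).source) :
    extChartAt (𝓡∂ d) x₀ x ∈ overlap x₀ x₁ := by
  have hs : x ∈ (extChartAt (𝓡∂ d) x₀).source := by rwa [extChartAt_source]
  refine ⟨(extChartAt (𝓡∂ d) x₀).map_source hs, ?_⟩
  rw [mem_preimage, (extChartAt (𝓡∂ d) x₀).left_inv hs]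
  exact h1

theorem trans_extChartAt {x₀ : M} (x₁ : M) {x : M}
    (h0 : x ∈ (chartAt (EuclideanHalfSpace d) x₀).source) :
    trans x₀ x₁ (extChartAt (𝓡∂ d) x₀ x) = extChartAt (𝓡∂ d) x₁ x := by
  unfold trans
  rw [Function.comp_apply, (extChartAt (𝓡∂ d) x₀).left_inv (by rwa [extChartAt_source])]

theorem trans_mapsTo (x₀ x₁ : M) : 
    MapsTo (trans (d := d) x₀ x₁) (overlap x₀ x₁) (overlap x₁ x₀) := by
  intro y hy
  obtain ⟨x, hx, rfl⟩ : ∃ x ∈ (extChartAt (𝓡∂ d) x₀).source, extChartAt (𝓡∂ d) x₀ x = y :=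
    ⟨_, (extChartAt (𝓡∂ d) x₀).map_target hy.1, (extChartAt (𝓡∂ d) x₀).right_inv hy.1⟩
  have h1 := hy.2
  rw [mem_preimage, (extChartAt (𝓡∂ d) x₀).left_inv hx] at h1
  rw [extChartAt_source] at hx
  rw [trans_extChartAt x₁ hx]
  exact extChartAt_mem_overlap h1 hx

theorem contDiffWithinAt_trans {x₀ x₁ : M} {y : Model d} (hy : y ∈ overlap x₀ x₁) :
    ContDiffWithinAt ℝ 2 (trans x₀ x₁) (range (𝓡∂ d)) y := by
  refine contDiffWithinAt_ext_coord_change (I := 𝓡∂ d) (n := 2) x₁ x₀ ?_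
  rw [PartialEquiv.trans_source, PartialEquiv.symm_source]
  refine ⟨hy.1, ?_⟩
  rw [mem_preimage, extChartAt_source]
  exact hy.2

theorem trans_hasFDerivWithinAt {x₀ x₁ : M} {y : Model d} (hy : y ∈ overlap x₀ x₁) :
    HasFDerivWithinAt (trans x₀ x₁) (transDeriv x₀ x₁ y) (range (𝓡∂ d)) y :=
  ((contDiffWithinAt_trans hy).differentiableWithinAt two_ne_zero).hasFDerivWithinAt

theorem contDiffWithinAt_transDeriv {x₀ x₁ : M} {y : Model d} (hy : y ∈ overlap x₀ x₁) :
    ContDiffWithinAt ℝ 1 (transDeriv x₀ x₁) (range (𝓡∂ d)) y :=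
  (contDiffWithinAt_trans hy).fderivWithin_right (𝓡∂ d).uniqueDiffOn
    (by norm_num) (overlap_subset_range _ _ hy)

theorem transDeriv_hasFDerivWithinAt {x₀ x₁ : M} {y : Model d} (hy : y ∈ overlap x₀ x₁) :
    HasFDerivWithinAt (transDeriv x₀ x₁) (transDeriv2 x₀ x₁ y) (range (𝓡∂ d)) y :=
  ((contDiffWithinAt_transDeriv hy).differentiableWithinAt one_ne_zero).hasFDerivWithinAt

/-- Symmetry of the second derivative up to the boundary, where the half space is the closure of its
interior. This is where the `C²` regularity of the charts enters the symplectic invariance. -/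
theorem transDeriv2_symm {x₀ x₁ : M} {y : Model d} (hy : y ∈ overlap x₀ x₁) (v w : Model d) :
    transDeriv2 x₀ x₁ y v w = transDeriv2 x₀ x₁ y w v := by
  refine (contDiffWithinAt_trans hy).isSymmSndFDerivWithinAt (by simp) (𝓡∂ d).uniqueDiffOn ?_
    (overlap_subset_range _ _ hy) v w
  exact (𝓡∂ d).range_subset_closure_interior (overlap_subset_range _ _ hy)

theorem transDeriv_eq {x₀ x₁ x : M} :
    transDeriv x₀ x₁ (extChartAt (𝓡∂ d) x₀ x) = tangentCoordChange (𝓡∂ d) x₀ x₁ x := rfl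

theorem transDeriv_transDeriv {x₀ x₁ : M} {y : Model d} (hy : y ∈ overlap x₀ x₁) (v : Model d) :
    transDeriv x₁ x₀ (trans x₀ x₁ y) (transDeriv x₀ x₁ y v) = v := by
  obtain ⟨x, hx, rfl⟩ : ∃ x ∈ (extChartAt (𝓡∂ d) x₀).source, extChartAt (𝓡∂ d) x₀ x = y :=
    ⟨_, (extChartAt (𝓡∂ d) x₀).map_target hy.1, (extChartAt (𝓡∂ d) x₀).right_inv hy.1⟩
  have h1 := hy.2
  rw [mem_preimage, (extChartAt (𝓡∂ d) x₀).left_inv hx] at h1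
  rw [trans_extChartAt x₁ (by rwa [extChartAt_source] at hx), transDeriv_eq, transDeriv_eq,
    tangentCoordChange_comp, tangentCoordChange_self hx]
  rw [extChartAt_source] at hx
  simp only [extChartAt_source]
  exact ⟨⟨hx, h1⟩, hx⟩

/-- The change of coordinates of the phase space. -/
def phaseTrans (x₀ x₁ : M) (q : LocalPhase d) : LocalPhase d :=
  (q.1, trans x₀ x₁ q.2.1, q.2.2.1, WithLp.toLp 2 fun i =>
    inner ℝ (transDeriv x₁ x₀ (trans x₀ x₁ q.2.1) (EuclideanSpace.single i 1)) q.2.2.2)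

/-- The phase space above the overlap of two charts. -/
def phaseOverlap (x₀ x₁ : M) : Set (LocalPhase d) := {q | q.2.1 ∈ overlap x₀ x₁}

theorem phaseOverlap_subset (x₀ x₁ : M) : phaseOverlap x₀ x₁ ⊆ coordTarget (d := d) x₀ :=
  fun _ hq => hq.1

theorem projBase_tendsto (q : LocalPhase d) :
    Tendsto (projBase (d := d)) (𝓝[halfPhase d] q) (𝓝[range (𝓡∂ d)] q.2.1) := by
  refine tendsto_nhdsWithin_iff.2
    ⟨((projBase (d := d)).continuous.tendsto q).mono_left nhdsWithin_le_nhds, ?_⟩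
  filter_upwards [self_mem_nhdsWithin] with u hu
  exact mem_range_iff.2 hu

theorem phaseOverlap_mem_nhdsWithin {x₀ x₁ : M} {q : LocalPhase d} (hq : q ∈ phaseOverlap x₀ x₁) :
    phaseOverlap x₀ x₁ ∈ 𝓝[halfPhase d] q :=
  projBase_tendsto q (overlap_mem_nhdsWithin hq)

theorem phaseTrans_mapsTo (x₀ x₁ : M) :
    MapsTo (phaseTrans (d := d) x₀ x₁) (phaseOverlap x₀ x₁) (phaseOverlap x₁ x₀) :=
  fun _ hq => trans_mapsTo x₀ x₁ hq

theorem coord_mem_phaseOverlap {x₀ x₁ : M} {ρ : Phase d M} (h0 : ρ ∈ chartDom x₀)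
    (h1 : ρ ∈ chartDom x₁) : coord x₀ ρ ∈ phaseOverlap x₀ x₁ := extChartAt_mem_overlap h0 h1

theorem coord_eq_phaseTrans {x₀ x₁ : M} {ρ : Phase d M} (h0 : ρ ∈ chartDom x₀)
    (h1 : ρ ∈ chartDom x₁) : coord x₁ ρ = phaseTrans x₀ x₁ (coord x₀ ρ) := by
  have ht := trans_extChartAt x₁ h0
  refine Prod.ext rfl (Prod.ext ht.symm (Prod.ext rfl ?_))
  change covecCoord x₁ ρ.2.2.proj ρ.2.2.snd = WithLp.toLp 2 fun i => inner ℝ (transDeriv x₁ x₀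
    (trans x₀ x₁ (extChartAt (𝓡∂ d) x₀ (Phase.base ρ))) (EuclideanSpace.single i 1))
      (covecCoord x₀ ρ.2.2.proj ρ.2.2.snd)
  rw [ht, covecCoord_change (x := ρ.2.2.proj) h0 h1, transDeriv_eq]
  ext i
  change _ = inner ℝ (tangentCoordChange (𝓡∂ d) x₁ x₀ ρ.2.2.proj (EuclideanSpace.single i 1))
    (covecCoord x₀ ρ.2.2.proj ρ.2.2.snd)
  rw [← ContinuousLinearMap.adjoint_inner_right, EuclideanSpace.inner_single_left]
  simp

theorem exists_coord_eq {x₀ x₁ : M} {q : LocalPhase d} (hq : q ∈ phaseOverlap x₀ x₁) :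
    ∃ ρ : Phase d M, ρ ∈ chartDom x₀ ∧ ρ ∈ chartDom x₁ ∧ coord x₀ ρ = q := by
  refine ⟨coordInv x₀ q, coordInv_mem_chartDom hq.1, ?_, coord_coordInv hq.1⟩
  unfold chartDom
  rw [mem_ofPred_eq, base_coordInv hq.1]
  exact hq.2

/-- The projection to the covector. -/
def projCov : LocalPhase d →L[ℝ] Model d :=
  (ContinuousLinearMap.snd ℝ ℝ (Model d)).comp
    ((ContinuousLinearMap.snd ℝ (Model d) (ℝ × Model d)).comp
      (ContinuousLinearMap.snd ℝ ℝ (Model d × ℝ × Model d)))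

@[simp] theorem projCov_apply (q : LocalPhase d) : projCov q = q.2.2.2 := rfl

/-- The derivative of one component of the change of covectors. -/
def covTransDeriv (x₀ x₁ : M) (q : LocalPhase d) (i : Fin d) : LocalPhase d →L[ℝ] ℝ :=
  (innerSL ℝ (transDeriv x₁ x₀ (trans x₀ x₁ q.2.1) (EuclideanSpace.single i 1))).comp projCov
    + (innerSL ℝ q.2.2.2).comp (((ContinuousLinearMap.apply ℝ (Model d)
        (EuclideanSpace.single i 1)).comp (transDeriv2 x₁ x₀ (trans x₀ x₁ q.2.1))).comp
          ((transDeriv x₀ x₁ q.2.1).comp projBase))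

/-- The derivative of the change of coordinates of the phase space. -/
def phaseTransDeriv (x₀ x₁ : M) (q : LocalPhase d) : LocalPhase d →L[ℝ] LocalPhase d :=
  (ContinuousLinearMap.fst ℝ ℝ (Model d × ℝ × Model d)).prod
    (((transDeriv x₀ x₁ q.2.1).comp projBase).prod (projτ.prod
      ((EuclideanSpace.equiv (Fin d) ℝ).symm.toContinuousLinearMap.comp
        (ContinuousLinearMap.pi (covTransDeriv x₀ x₁ q)))))

theorem phaseTransDeriv_apply (x₀ x₁ : M) (q v : LocalPhase d) :
    phaseTransDeriv x₀ x₁ q v = (v.1, transDeriv x₀ x₁ q.2.1 v.2.1, v.2.2.1, WithLp.toLp 2 fun i =>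
      inner ℝ (transDeriv x₁ x₀ (trans x₀ x₁ q.2.1) (EuclideanSpace.single i 1)) v.2.2.2
        + inner ℝ q.2.2.2 (transDeriv2 x₁ x₀ (trans x₀ x₁ q.2.1)
          (transDeriv x₀ x₁ q.2.1 v.2.1) (EuclideanSpace.single i 1))) := by
  rfl

theorem projBase_mapsTo : MapsTo (projBase (d := d)) (halfPhase d) (range (𝓡∂ d)) :=
  fun _ hu => mem_range_iff.2 hu

theorem trans_comp_hasFDerivWithinAt {x₀ x₁ : M} {q : LocalPhase d}
    (hq : q ∈ phaseOverlap x₀ x₁) :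
    HasFDerivWithinAt (fun u : LocalPhase d => trans x₀ x₁ u.2.1)
      ((transDeriv x₀ x₁ q.2.1).comp projBase) (halfPhase d) q :=
  HasFDerivWithinAt.comp (g := trans x₀ x₁) q (trans_hasFDerivWithinAt hq)
    (projBase (d := d)).hasFDerivWithinAt projBase_mapsTo

theorem transDeriv_comp_hasFDerivWithinAt {x₀ x₁ : M} {q : LocalPhase d}
    (hq : q ∈ phaseOverlap x₀ x₁) :
    HasFDerivWithinAt (fun u : LocalPhase d => transDeriv x₁ x₀ (trans x₀ x₁ u.2.1))
      ((transDeriv2 x₁ x₀ (trans x₀ x₁ q.2.1)).comp ((transDeriv x₀ x₁ q.2.1).comp projBase))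
      (halfPhase d) q := by
  have h1 : HasFDerivWithinAt (fun u : LocalPhase d => transDeriv x₁ x₀ (trans x₀ x₁ u.2.1))
      ((transDeriv2 x₁ x₀ (trans x₀ x₁ q.2.1)).comp ((transDeriv x₀ x₁ q.2.1).comp projBase))
      (phaseOverlap x₀ x₁) q := by
    refine HasFDerivWithinAt.comp (g := transDeriv x₁ x₀) q
      (transDeriv_hasFDerivWithinAt (trans_mapsTo x₀ x₁ hq))
      ((trans_comp_hasFDerivWithinAt hq).mono ?_) ?_
    · exact (phaseOverlap_subset x₀ x₁).trans (coordTarget_subset x₀)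
    · exact fun u hu => overlap_subset_range _ _ (trans_mapsTo x₀ x₁ hu)
  exact h1.mono_of_mem_nhdsWithin (phaseOverlap_mem_nhdsWithin hq)

theorem covTrans_hasFDerivWithinAt {x₀ x₁ : M} {q : LocalPhase d}
    (hq : q ∈ phaseOverlap x₀ x₁) (i : Fin d) :
    HasFDerivWithinAt (fun u : LocalPhase d =>
      inner ℝ (transDeriv x₁ x₀ (trans x₀ x₁ u.2.1) (EuclideanSpace.single i 1)) u.2.2.2)
      (covTransDeriv x₀ x₁ q i) (halfPhase d) q := by
  have hξ : HasFDerivWithinAt (fun u : LocalPhase d => u.2.2.2) projCov (halfPhase d) q :=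
    (projCov (d := d)).hasFDerivWithinAt
  have h1 := ((transDeriv_comp_hasFDerivWithinAt hq).clm_apply (hasFDerivWithinAt_const
    (EuclideanSpace.single i (1 : ℝ)) q (halfPhase d))).inner ℝ hξ
  refine h1.congr_fderiv (ContinuousLinearMap.ext fun v => ?_)
  change _ = inner ℝ (transDeriv x₁ x₀ (trans x₀ x₁ q.2.1) (EuclideanSpace.single i 1)) v.2.2.2
    + inner ℝ q.2.2.2 (transDeriv2 x₁ x₀ (trans x₀ x₁ q.2.1)
          (transDeriv x₀ x₁ q.2.1 v.2.1) (EuclideanSpace.single i 1))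
  simp [fderivInnerCLM_apply, real_inner_comm]

theorem phaseTrans_hasFDerivWithinAt {x₀ x₁ : M} {q : LocalPhase d}
    (hq : q ∈ phaseOverlap x₀ x₁) :
    HasFDerivWithinAt (phaseTrans x₀ x₁) (phaseTransDeriv x₀ x₁ q) (halfPhase d) q := by
  have ht : HasFDerivWithinAt (fun u : LocalPhase d => u.1)
      (ContinuousLinearMap.fst ℝ ℝ (Model d × ℝ × Model d)) (halfPhase d) q :=
    (ContinuousLinearMap.fst ℝ ℝ (Model d × ℝ × Model d)).hasFDerivWithinAt
  have hτ : HasFDerivWithinAt (fun u : LocalPhase d => u.2.2.1) projτ (halfPhase d) q :=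
    (projτ (d := d)).hasFDerivWithinAt
  have hl := (EuclideanSpace.equiv (Fin d) ℝ).symm.comp_hasFDerivWithinAt_iff.2
    (hasFDerivWithinAt_pi.2 fun i => covTrans_hasFDerivWithinAt hq i)
  exact ht.prodMk ((trans_comp_hasFDerivWithinAt hq).prodMk (hτ.prodMk hl))

/-- A change of coordinates is symplectic. -/
theorem symp_phaseTransDeriv {x₀ x₁ : M} {q : LocalPhase d} (hq : q ∈ phaseOverlap x₀ x₁)
    (u v : LocalPhase d) :
    symp (phaseTransDeriv x₀ x₁ q u) (phaseTransDeriv x₀ x₁ q v) = symp u v := by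
  have key : ∀ (K : Model d →L[ℝ] Model d) (ξ w : Model d),
      inner ℝ (WithLp.toLp 2 fun i => inner ℝ (K (EuclideanSpace.single i 1)) ξ : Model d) w
        = inner ℝ (K w) ξ := by
    intro K ξ w
    conv_rhs => rw [model_eq_sum w]
    simp only [map_sum, map_smul, sum_inner, real_inner_smul_left]
    simp [PiLp.inner_apply]
  have split : ∀ w : LocalPhase d, (phaseTransDeriv x₀ x₁ q w).2.2.2 =
      (WithLp.toLp 2 fun i => inner ℝ (transDeriv x₁ x₀ (trans x₀ x₁ q.2.1)
        (EuclideanSpace.single i 1)) w.2.2.2 : Model d)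
      + (WithLp.toLp 2 fun i => inner ℝ (transDeriv2 x₁ x₀ (trans x₀ x₁ q.2.1)
          (transDeriv x₀ x₁ q.2.1 w.2.1) (EuclideanSpace.single i 1)) q.2.2.2 : Model d) := by
    intro w
    rw [phaseTransDeriv_apply]
    ext i
    simp [real_inner_comm]
  have hx : ∀ w : LocalPhase d, (phaseTransDeriv x₀ x₁ q w).2.1 =
      transDeriv x₀ x₁ q.2.1 w.2.1 := fun w => rfl
  have ht : ∀ w : LocalPhase d, (phaseTransDeriv x₀ x₁ q w).1 = w.1 := fun w => rfl
  have hτ : ∀ w : LocalPhase d, (phaseTransDeriv x₀ x₁ q w).2.2.1 = w.2.2.1 := fun w => rfl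
  unfold symp
  -- In the pairing of covectors with base vectors the Jacobian and its inverse cancel; the terms
  -- with second derivatives cancel between `u` and `v` by symmetry.
  rw [ht, ht, hτ, hτ, hx, hx, split, split, real_inner_comm _ (transDeriv x₀ x₁ q.2.1 u.2.1),
    inner_add_left, inner_add_left, key, key, key, key, transDeriv_transDeriv hq,
    transDeriv_transDeriv hq, transDeriv2_symm (trans_mapsTo x₀ x₁ hq),
    real_inner_comm u.2.2.2 v.2.1]
  ring

/-- A map preserving a nondegenerate form is injective, hence surjective in finite dimension. -/
theorem phaseTransDeriv_surjective {x₀ x₁ : M} {q : LocalPhase d}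
    (hq : q ∈ phaseOverlap x₀ x₁) : Function.Surjective (phaseTransDeriv x₀ x₁ q) := by
  have hinj : Function.Injective (phaseTransDeriv x₀ x₁ q).toLinearMap := by
    intro u w huw
    refine eq_of_symp fun v => ?_
    rw [← symp_phaseTransDeriv hq u, ← symp_phaseTransDeriv hq w]
    exact congrArg (fun z => symp z _) huw
  exact LinearMap.injective_iff_surjective.1 hinj

/-- Hamiltonian fields do not depend on the coordinates. -/
theorem hamField_phaseTrans {x₀ x₁ : M} {q : LocalPhase d} (hq : q ∈ phaseOverlap x₀ x₁)
    {f₀ f₁ : LocalPhase d → ℝ} (hf : ∀ u ∈ phaseOverlap x₀ x₁, f₀ u = f₁ (phaseTrans x₀ x₁ u))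
    (hd : DifferentiableWithinAt ℝ f₁ (halfPhase d) (phaseTrans x₀ x₁ q)) :
    hamField f₁ (phaseTrans x₀ x₁ q) = phaseTransDeriv x₀ x₁ q (hamField f₀ q) := by
  have hD : HasFDerivWithinAt f₀ ((fderivWithin ℝ f₁ (halfPhase d) (phaseTrans x₀ x₁ q)).comp
      (phaseTransDeriv x₀ x₁ q)) (halfPhase d) q := by
    have h1 : HasFDerivWithinAt (f₁ ∘ phaseTrans x₀ x₁)
        ((fderivWithin ℝ f₁ (halfPhase d) (phaseTrans x₀ x₁ q)).comp (phaseTransDeriv x₀ x₁ q))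
        (phaseOverlap x₀ x₁) q := by
      refine hd.hasFDerivWithinAt.comp q ((phaseTrans_hasFDerivWithinAt hq).mono ?_) ?_
      · exact (phaseOverlap_subset x₀ x₁).trans (coordTarget_subset x₀)
      · exact fun u hu => coordTarget_subset x₁ (phaseTrans_mapsTo x₀ x₁ hu).1
    exact (h1.congr hf (hf q hq)).mono_of_mem_nhdsWithin (phaseOverlap_mem_nhdsWithin hq)
  refine eq_of_symp fun v => ?_
  obtain ⟨w, rfl⟩ := phaseTransDeriv_surjective hq v
  rw [← fderivWithin_eq_symp, symp_phaseTransDeriv hq, ← fderivWithin_eq_symp,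
    hD.fderivWithin (uniqueDiffOn_halfPhase q (coordTarget_subset x₀ hq.1))]
  rfl

theorem symbolLoc_change (g : Metric d M) {x₀ x₁ : M} {ρ : Phase d M} (h0 : ρ ∈ chartDom x₀)
    (h1 : ρ ∈ chartDom x₁) : symbolLoc g x₁ (coord x₁ ρ) = symbolLoc g x₀ (coord x₀ ρ) := by
  unfold symbolLoc
  congr 1
  exact cometric_change g h0 h1 ρ.2.2.snd ρ.2.2.snd

theorem symbolLoc_phaseTrans (g : Metric d M) {x₀ x₁ : M} {q : LocalPhase d}
    (hq : q ∈ phaseOverlap x₀ x₁) : symbolLoc g x₀ q = symbolLoc g x₁ (phaseTrans x₀ x₁ q) := by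
  obtain ⟨ρ, h0, h1, rfl⟩ := exists_coord_eq hq
  rw [← coord_eq_phaseTrans h0 h1, symbolLoc_change g h0 h1]

theorem hamField_symbolLoc_phaseTrans (g : Metric d M) {x₀ x₁ : M} {q : LocalPhase d}
    (hq : q ∈ phaseOverlap x₀ x₁) : hamField (symbolLoc g x₁) (phaseTrans x₀ x₁ q) =
      phaseTransDeriv x₀ x₁ q (hamField (symbolLoc g x₀) q) :=
  hamField_phaseTrans hq (fun _ hu => symbolLoc_phaseTrans g hu)
    (symbolLoc_hasFDerivWithinAt g x₁ (phaseTrans_mapsTo x₀ x₁ hq).1).differentiableWithinAt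

/-! ### The boundary in coordinates -/

/-- Interior points are the same for all charts of a `C²` atlas, and a chart target is relatively
open in the half space. -/
theorem mem_boundary_iff {x₀ x : M} (h0 : x ∈ (chartAt (EuclideanHalfSpace d) x₀).source) :
    x ∈ (𝓡∂ d).boundary M ↔ extChartAt (𝓡∂ d) x₀ x 0 = 0 := by
  have ht : extChartAt (𝓡∂ d) x₀ x ∈ (extChartAt (𝓡∂ d) x₀).target :=
    (extChartAt (𝓡∂ d) x₀).map_source (by rwa [extChartAt_source])
  have h0' : 0 ≤ extChartAt (𝓡∂ d) x₀ x 0 := mem_range_iff.1 (extChartAt_target_subset_range x₀ ht)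
  have h := ModelWithCorners.isInteriorPoint_iff_of_mem_atlas (I := 𝓡∂ d) (n := 2) two_ne_zero
    (chart_mem_atlas (EuclideanHalfSpace d) x₀) h0
  have h2 : extChartAt (𝓡∂ d) x₀ x ∈ interior (extChartAt (𝓡∂ d) x₀).target ↔
      extChartAt (𝓡∂ d) x₀ x ∈ interior (range (𝓡∂ d)) := by
    refine ⟨fun hi => interior_mono (extChartAt_target_subset_range x₀) hi, fun hi => ?_⟩
    rw [mem_interior_iff_mem_nhds] at hi ⊢
    have := extChartAt_target_mem_nhdsWithin_of_mem ht
    rwa [nhdsWithin_eq_nhds.2 hi] at this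
  have h3 : x ∈ (𝓡∂ d).boundary M ↔
      ¬ extChartAt (𝓡∂ d) x₀ x ∈ interior (extChartAt (𝓡∂ d) x₀).target :=
    (ModelWithCorners.isBoundaryPoint_iff_not_isInteriorPoint x).trans h.not
  rw [h3, h2, interior_range_modelWithCornersEuclideanHalfSpace, mem_ofPred_eq]
  exact ⟨fun hx => le_antisymm (not_lt.1 hx) h0', fun hx => not_lt.2 hx.le⟩

theorem mem_boundaryPhase_iff {x₀ : M} {ρ : Phase d M} (h0 : ρ ∈ chartDom x₀) :
    ρ ∈ boundaryPhase ↔ (coord x₀ ρ).2.1 0 = 0 := mem_boundary_iff h0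

theorem trans_zero_iff {x₀ x₁ : M} {y : Model d} (hy : y ∈ overlap x₀ x₁) :
    trans x₀ x₁ y 0 = 0 ↔ y 0 = 0 := by
  obtain ⟨x, hx, rfl⟩ : ∃ x ∈ (extChartAt (𝓡∂ d) x₀).source, extChartAt (𝓡∂ d) x₀ x = y :=
    ⟨_, (extChartAt (𝓡∂ d) x₀).map_target hy.1, (extChartAt (𝓡∂ d) x₀).right_inv hy.1⟩
  have h1 := hy.2
  rw [mem_preimage, (extChartAt (𝓡∂ d) x₀).left_inv hx] at h1
  rw [extChartAt_source] at hx
  rw [trans_extChartAt x₁ hx, ← mem_boundary_iff hx, ← mem_boundary_iff h1]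

theorem line_tendsto {y v : Model d} (hy : y ∈ range (𝓡∂ d)) (hv : 0 ≤ v 0) :
    Tendsto (fun s : ℝ => y + s • v) (𝓝[>] 0) (𝓝[range (𝓡∂ d)] y) := by
  refine tendsto_nhdsWithin_iff.2 ⟨?_, ?_⟩
  · have : Continuous fun s : ℝ => y + s • v := by fun_prop
    simpa using (this.tendsto 0).mono_left nhdsWithin_le_nhds
  · filter_upwards [self_mem_nhdsWithin] with s hs
    rw [mem_range_iff] at hy ⊢
    have := mul_nonneg (mem_Ioi.1 hs).le hv
    simp only [PiLp.add_apply, PiLp.smul_apply, smul_eq_mul]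
    linarith

theorem line_hasDerivWithinAt {F : Type*} [NormedAddCommGroup F] [NormedSpace ℝ F]
    {f : Model d → F} {f' : Model d →L[ℝ] F} {y v : Model d} (hy : y ∈ range (𝓡∂ d))
    (hv : 0 ≤ v 0) (hf : HasFDerivWithinAt f f' (range (𝓡∂ d)) y) :
    HasDerivWithinAt (fun s : ℝ => f (y + s • v)) (f' v) (Ici 0) 0 := by
  have h1 : HasDerivWithinAt (fun s : ℝ => y + s • v) v (Ici 0) 0 := by
    simpa using (((hasDerivAt_id (0 : ℝ)).smul_const v).const_add y).hasDerivWithinAt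
  have h2 := HasFDerivWithinAt.comp_hasDerivWithinAt (0 : ℝ) (l := f) (t := range (𝓡∂ d))
    (by simpa using hf) h1 (fun s hs => by
      rw [mem_range_iff] at hy ⊢
      have := mul_nonneg (mem_Ici.1 hs) hv
      simp only [PiLp.add_apply, PiLp.smul_apply, smul_eq_mul]
      linarith)
  exact h2

/-- A one-sided derivative along a ray that stays in the half space suffices, so identities on the
boundary may be differentiated in tangential directions. -/
theorem eq_zero_of_eventually_line {F : Type*} [NormedAddCommGroup F] [NormedSpace ℝ F]
    {f : Model d → F} {f' : Model d →L[ℝ] F} {y v : Model d} (hy : y ∈ range (𝓡∂ d))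
    (hv : 0 ≤ v 0) (hf : HasFDerivWithinAt f f' (range (𝓡∂ d)) y)
    (h0 : f y = 0) (h : ∀ᶠ s : ℝ in 𝓝[>] 0, f (y + s • v) = 0) : f' v = 0 := by
  have h1 := line_hasDerivWithinAt hy hv hf
  have h2 : HasDerivWithinAt (fun s : ℝ => f (y + s • v)) 0 (Ici 0) 0 := by
    refine (hasDerivWithinAt_const (0 : ℝ) (Ici 0) (0 : F)).congr_of_eventuallyEq ?_ (by simpa)
    rw [← Ioi_insert, nhdsWithin_insert]
    exact eventually_sup.2 ⟨by simpa using h0, h⟩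
  exact (uniqueDiffWithinAt_Ici (0 : ℝ)).eq_deriv _ h1 h2

/-- A change of charts preserves the boundary, so its normal component vanishes along tangential
lines. -/
theorem transDeriv_tangential {x₀ x₁ : M} {y : Model d} (hy : y ∈ overlap x₀ x₁) (hy0 : y 0 = 0)
    {v : Model d} (hv : v 0 = 0) : transDeriv x₀ x₁ y v 0 = 0 := by
  have hR := overlap_subset_range _ _ hy
  refine eq_zero_of_eventually_line (f := fun u => trans x₀ x₁ u 0)
    (f' := (EuclideanSpace.proj 0).comp (transDeriv x₀ x₁ y)) hR hv.ge ?_ ?_ ?_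
  · exact (EuclideanSpace.proj (𝕜 := ℝ) (0 : Fin d)).hasFDerivAt.comp_hasFDerivWithinAt y
      (trans_hasFDerivWithinAt hy)
  · exact (trans_zero_iff hy).2 hy0
  · filter_upwards [line_tendsto hR hv.ge (overlap_mem_nhdsWithin hy)] with s hs
    exact (trans_zero_iff hs).2 (by simp [hy0, hv])

/-- The normal derivative of the change of coordinates. -/
def normalFactor (x₀ x₁ : M) (y : Model d) : ℝ :=
  transDeriv x₀ x₁ y (EuclideanSpace.single 0 1) 0

theorem transDeriv_normal {x₀ x₁ : M} {y : Model d} (hy : y ∈ overlap x₀ x₁) (hy0 : y 0 = 0)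
    (v : Model d) : transDeriv x₀ x₁ y v 0 = normalFactor x₀ x₁ y * v 0 := by
  have h := transDeriv_tangential hy hy0 (v := v - v 0 • EuclideanSpace.single 0 1) (by simp)
  rw [map_sub, map_smul] at h
  simp only [PiLp.sub_apply, PiLp.smul_apply, smul_eq_mul] at h
  unfold normalFactor
  linarith

theorem normalFactor_mul {x₀ x₁ : M} {y : Model d} (hy : y ∈ overlap x₀ x₁) (hy0 : y 0 = 0) :
    normalFactor x₁ x₀ (trans x₀ x₁ y) * normalFactor x₀ x₁ y = 1 := by
  have h := transDeriv_normal (trans_mapsTo x₀ x₁ hy) ((trans_zero_iff hy).2 hy0)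
    (transDeriv x₀ x₁ y (EuclideanSpace.single 0 1))
  rw [transDeriv_transDeriv hy] at h
  simpa [normalFactor] using h.symm

/-- The normal component is `0` on the boundary and nonnegative inside, so its inward derivative is
nonnegative; the inverse change of charts shows that it is not zero. -/
theorem normalFactor_pos {x₀ x₁ : M} {y : Model d} (hy : y ∈ overlap x₀ x₁) (hy0 : y 0 = 0) :
    0 < normalFactor x₀ x₁ y := by
  have hR := overlap_subset_range _ _ hy
  have hne : normalFactor x₀ x₁ y ≠ 0 := right_ne_zero_of_mul_eq_one (normalFactor_mul hy hy0)
  refine lt_of_le_of_ne ?_ hne.symm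
  have h1 := line_hasDerivWithinAt (f := fun u => trans x₀ x₁ u 0)
    (f' := (EuclideanSpace.proj 0).comp (transDeriv x₀ x₁ y)) hR
    (v := EuclideanSpace.single 0 1) (by simp)
    ((EuclideanSpace.proj (𝕜 := ℝ) (0 : Fin d)).hasFDerivAt.comp_hasFDerivWithinAt y
      (trans_hasFDerivWithinAt hy))
  have h2 := hasDerivWithinAt_iff_tendsto_slope.1 h1
  have h4 : Ici (0 : ℝ) \ {0} = Ioi 0 := by
    ext u
    simp [lt_iff_le_and_ne, eq_comm]
  rw [h4] at h2
  refine ge_of_tendsto h2 ?_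
  filter_upwards [self_mem_nhdsWithin, line_tendsto hR (v := EuclideanSpace.single 0 1) (by simp)
    (overlap_mem_nhdsWithin hy)] with s hs hso
  have h3 : 0 ≤ trans x₀ x₁ (y + s • EuclideanSpace.single 0 1) 0 :=
    mem_range_iff.1 (overlap_subset_range _ _ (trans_mapsTo x₀ x₁ hso))
  rw [slope_def_field, sub_zero]
  simp only [zero_smul, add_zero, (trans_zero_iff hy).2 hy0, sub_zero]
  exact div_nonneg h3 (mem_Ioi.1 hs).le

/-- The vanishing of the normal component of the first derivative, on tangential vectors along the
boundary, is differentiated once more. This removes the only term that could make the sign of `H_p²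
z` depend on the chart. -/
theorem transDeriv2_tangential {x₀ x₁ : M} {y : Model d} (hy : y ∈ overlap x₀ x₁) (hy0 : y 0 = 0)
    {v : Model d} (hv : v 0 = 0) : transDeriv2 x₀ x₁ y v v 0 = 0 := by
  have hR := overlap_subset_range _ _ hy
  refine eq_zero_of_eventually_line (f := fun u => transDeriv x₀ x₁ u v 0)
    (f' := (EuclideanSpace.proj 0).comp
      ((ContinuousLinearMap.apply ℝ (Model d) v).comp (transDeriv2 x₀ x₁ y))) hR hv.ge ?_ ?_ ?_
  · exact ((EuclideanSpace.proj (𝕜 := ℝ) (0 : Fin d)).comp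
      (ContinuousLinearMap.apply ℝ (Model d) v)).hasFDerivAt.comp_hasFDerivWithinAt y
        (transDeriv_hasFDerivWithinAt hy)
  · exact transDeriv_tangential hy hy0 hv
  · filter_upwards [line_tendsto hR hv.ge (overlap_mem_nhdsWithin hy)] with s hs
    exact transDeriv_tangential hs (by simp [hy0, hv]) hv

/-! ### Change of coordinates of the boundary data -/

section Change

variable {x₀ x₁ : M} {q : LocalPhase d}

theorem HpzLoc_phaseTrans (g : Metric d M) (hq : q ∈ phaseOverlap x₀ x₁) (hz : q.2.1 0 = 0) :
    HpzLoc g x₁ (phaseTrans x₀ x₁ q) = normalFactor x₀ x₁ q.2.1 * HpzLoc g x₀ q := by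
  rw [HpzLoc_eq_hamField g x₁ (phaseTrans_mapsTo x₀ x₁ hq).1, hamField_symbolLoc_phaseTrans g hq,
    HpzLoc_eq_hamField g x₀ hq.1]
  exact transDeriv_normal hq hz _

theorem differentiableWithinAt_hamField_base (g : Metric d M) (hq : q ∈ coordTarget x₀) :
    DifferentiableWithinAt ℝ (fun u => (hamField (symbolLoc g x₀) u).2.1) (halfPhase d) q := by
  have h1 : DifferentiableWithinAt ℝ (fun u : LocalPhase d => (WithLp.toLp 2 (fun i =>
      2 * ∑ j, dualCoef g x₀ i j u.2.1 * u.2.2.2 j) : Model d)) (halfPhase d) q := by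
    rw [differentiableWithinAt_euclidean]
    intro i
    refine DifferentiableWithinAt.const_mul (DifferentiableWithinAt.fun_sum fun j _ => ?_) 2
    exact (dualCoef_comp_hasFDerivWithinAt g x₀ i j hq).differentiableWithinAt.mul
      (projξ (d := d) j).differentiableAt.differentiableWithinAt
  refine h1.congr_of_eventuallyEq ?_ (by rw [hamField_symbolLoc g x₀ hq])
  filter_upwards [coordTarget_mem_nhdsWithin hq] with u hu
  rw [hamField_symbolLoc g x₀ hu]

/-- Differentiate `H_p z₁ = (Dφ · x')_0` along `H_p`, with `x'` the base velocity and `φ` the change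
of charts. The term with `Dφ` gives the factor `m = normalFactor` times `H_p² z`; the term `D²φ(x',
x')_0` vanishes because `x'` is tangential when `H_p z = 0`. -/
theorem Hp2zLoc_phaseTrans (g : Metric d M) (hq : q ∈ phaseOverlap x₀ x₁) (hz : q.2.1 0 = 0)
    (hζ : HpzLoc g x₀ q = 0) :
    Hp2zLoc g x₁ (phaseTrans x₀ x₁ q) = normalFactor x₀ x₁ q.2.1 * Hp2zLoc g x₀ q := by
  have hq1 := (phaseTrans_mapsTo x₀ x₁ hq).1
  have hU := uniqueDiffOn_halfPhase q (coordTarget_subset x₀ hq.1)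
  obtain ⟨X', hX'⟩ := differentiableWithinAt_hamField_base g hq.1
  have hA : HasFDerivWithinAt (fun u : LocalPhase d => transDeriv x₀ x₁ u.2.1)
      ((transDeriv2 x₀ x₁ q.2.1).comp projBase) (halfPhase d) q :=
    HasFDerivWithinAt.comp (g := transDeriv x₀ x₁) q (transDeriv_hasFDerivWithinAt hq)
      (projBase (d := d)).hasFDerivWithinAt projBase_mapsTo
  have hX0 : ∀ v, X' v 0 = HpzDeriv g x₀ q v := by
    have h1 := (EuclideanSpace.proj (𝕜 := ℝ) (0 : Fin d)).hasFDerivAt.comp_hasFDerivWithinAt q hX'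
    have h2 := (HpzLoc_hasFDerivWithinAt g x₀ hq.1).congr_of_eventuallyEq
      (f₁ := fun u => (hamField (symbolLoc g x₀) u).2.1 0)
      (by filter_upwards [coordTarget_mem_nhdsWithin hq.1] with u hu
          using (HpzLoc_eq_hamField g x₀ hu).symm) (HpzLoc_eq_hamField g x₀ hq.1).symm
    intro v
    exact congrArg (fun L : LocalPhase d →L[ℝ] ℝ => L v) (hU.eq h1 h2)
  have h1 := (EuclideanSpace.proj (𝕜 := ℝ) (0 : Fin d)).hasFDerivAt.comp_hasFDerivWithinAt q
    (hA.clm_apply hX')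
  have h2 : HasFDerivWithinAt (HpzLoc g x₁ ∘ phaseTrans x₀ x₁)
      ((HpzDeriv g x₁ (phaseTrans x₀ x₁ q)).comp (phaseTransDeriv x₀ x₁ q))
      (phaseOverlap x₀ x₁) q :=
    (HpzLoc_hasFDerivWithinAt g x₁ hq1).comp q ((phaseTrans_hasFDerivWithinAt hq).mono
      ((phaseOverlap_subset x₀ x₁).trans (coordTarget_subset x₀)))
      fun u hu => coordTarget_subset x₁ (phaseTrans_mapsTo x₀ x₁ hu).1
  have h3 := (h2.mono_of_mem_nhdsWithin (phaseOverlap_mem_nhdsWithin hq)).congr_of_eventuallyEq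
    (f₁ := fun u => transDeriv x₀ x₁ u.2.1 (hamField (symbolLoc g x₀) u).2.1 0)
    (by
      filter_upwards [phaseOverlap_mem_nhdsWithin hq] with u hu
      rw [Function.comp_apply, HpzLoc_eq_hamField g x₁ (phaseTrans_mapsTo x₀ x₁ hu).1,
        hamField_symbolLoc_phaseTrans g hu]
      rfl)
    (by
      rw [Function.comp_apply, HpzLoc_eq_hamField g x₁ hq1, hamField_symbolLoc_phaseTrans g hq]
      rfl)
  have h4 := congrArg (fun L : LocalPhase d →L[ℝ] ℝ => L (hamField (symbolLoc g x₀) q))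
    (hU.eq h1 h3)
  have h5 : transDeriv x₀ x₁ q.2.1 (X' (hamField (symbolLoc g x₀) q)) 0
      + transDeriv2 x₀ x₁ q.2.1 (hamField (symbolLoc g x₀) q).2.1
        (hamField (symbolLoc g x₀) q).2.1 0
      = HpzDeriv g x₁ (phaseTrans x₀ x₁ q) (phaseTransDeriv x₀ x₁ q
        (hamField (symbolLoc g x₀) q)) := h4
  rw [transDeriv2_tangential hq hz (by rw [← HpzLoc_eq_hamField g x₀ hq.1, hζ]), add_zero,
    transDeriv_normal hq hz, hX0, ← Hp2zLoc_eq g x₀ hq.1, ← hamField_symbolLoc_phaseTrans g hq,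
    ← Hp2zLoc_eq g x₁ hq1] at h5
  exact h5.symm

theorem transDeriv_inner_normal (hq : q ∈ phaseOverlap x₀ x₁) (hz : q.2.1 0 = 0) (c : ℝ)
    (i : Fin d) : inner ℝ (transDeriv x₁ x₀ (trans x₀ x₁ q.2.1) (EuclideanSpace.single i 1))
      (EuclideanSpace.single 0 c) = ((normalFactor x₀ x₁ q.2.1)⁻¹ * c) *
        (EuclideanSpace.single (0 : Fin d) (1 : ℝ) : Model d) i := by
  rw [EuclideanSpace.inner_single_right, transDeriv_normal (trans_mapsTo x₀ x₁ hq)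
    ((trans_zero_iff hq).2 hz), eq_inv_of_mul_eq_one_left (normalFactor_mul hq hz)]
  simp only [PiLp.single_apply, conj_trivial, eq_comm (a := (0 : Fin d))]
  ring

theorem phaseTransDeriv_eξ (hq : q ∈ phaseOverlap x₀ x₁) (hz : q.2.1 0 = 0) :
    phaseTransDeriv x₀ x₁ q eξ = (normalFactor x₀ x₁ q.2.1)⁻¹ • eξ := by
  rw [phaseTransDeriv_apply]
  refine Prod.ext (by simp [eξ]) (Prod.ext (by simp [eξ]) (Prod.ext (by simp [eξ]) ?_))
  ext i
  have := transDeriv_inner_normal hq hz 1 i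
  simp only [eξ, map_zero, this]
  simp

theorem phaseTrans_add (hq : q ∈ phaseOverlap x₀ x₁) (hz : q.2.1 0 = 0) (c : ℝ) :
    phaseTrans x₀ x₁ (q + c • eξ) =
      phaseTrans x₀ x₁ q + ((normalFactor x₀ x₁ q.2.1)⁻¹ * c) • eξ := by
  have hb : (q + c • eξ).2.1 = q.2.1 := by simp [eξ]
  have hξ : (q + c • eξ).2.2.2 = q.2.2.2 + EuclideanSpace.single 0 c := by
    ext i
    simp [eξ, PiLp.single_apply]
  unfold phaseTrans
  rw [hb, hξ]
  refine Prod.ext (by simp [eξ]) (Prod.ext (by simp [eξ]) (Prod.ext (by simp [eξ]) ?_))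
  ext i
  simp only [inner_add_right, transDeriv_inner_normal hq hz c i]
  simp [eξ]

/-- The slope of `H_p z` in `ξ_0` is `2 g^{00}`. Comparing the transformation law of `H_p z` at `q`
and at `q + eξ` gives one factor `m = normalFactor` from `H_p z` and another from the rescaling of
`ξ_0`. -/
theorem dualCoef_phaseTrans (g : Metric d M) (hq : q ∈ phaseOverlap x₀ x₁) (hz : q.2.1 0 = 0) :
    dualCoef g x₁ 0 0 (phaseTrans x₀ x₁ q).2.1 =
      normalFactor x₀ x₁ q.2.1 ^ 2 * dualCoef g x₀ 0 0 q.2.1 := by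
  have hb : (q + (1 : ℝ) • eξ).2.1 = q.2.1 := by simp [eξ]
  have hq' : q + (1 : ℝ) • eξ ∈ phaseOverlap x₀ x₁ := by
    unfold phaseOverlap
    rw [mem_ofPred_eq, hb]
    exact hq
  have h1 := HpzLoc_phaseTrans g hq' (by rw [hb, hz])
  have hm := normalFactor_pos hq hz
  rw [phaseTrans_add hq hz, HpzLoc_add g (phaseTrans_mapsTo x₀ x₁ hq).1, hb, HpzLoc_add g hq.1,
    HpzLoc_phaseTrans g hq hz] at h1
  field_simp at h1
  linarith

open Classical in
/-- The generalized field in the chart at `x₀`. -/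
def genFieldLoc (g : Metric d M) (x₀ : M) (q : LocalPhase d) : LocalPhase d :=
  if q.2.1 0 = 0 ∧ HpzLoc g x₀ q = 0 ∧ Hp2zLoc g x₀ q < 0 then glidingLoc g x₀ q
  else hamField (symbolLoc g x₀) q

/-- In the gliding correction `H_p² z / (2 g^{00})` scales by `m / m²`, where `m = normalFactor`,
and `∂_{ξ_0}` is sent to `m⁻¹ ∂_{ξ_0}`: the correction is invariant. -/
theorem genFieldLoc_phaseTrans (g : Metric d M) (hq : q ∈ phaseOverlap x₀ x₁) :
    genFieldLoc g x₁ (phaseTrans x₀ x₁ q) = phaseTransDeriv x₀ x₁ q (genFieldLoc g x₀ q) := by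
  have hq1 := (phaseTrans_mapsTo x₀ x₁ hq).1
  have hiff : ((phaseTrans x₀ x₁ q).2.1 0 = 0 ∧ HpzLoc g x₁ (phaseTrans x₀ x₁ q) = 0 ∧
      Hp2zLoc g x₁ (phaseTrans x₀ x₁ q) < 0) ↔
      (q.2.1 0 = 0 ∧ HpzLoc g x₀ q = 0 ∧ Hp2zLoc g x₀ q < 0) := by
    refine (and_congr_left' (trans_zero_iff hq)).trans (and_congr_right fun hz => ?_)
    have hm := normalFactor_pos hq hz
    rw [HpzLoc_phaseTrans g hq hz, mul_eq_zero, or_iff_right hm.ne']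
    refine and_congr_right fun hζ => ?_
    rw [Hp2zLoc_phaseTrans g hq hz hζ, mul_neg_iff]
    constructor
    · rintro (h | h)
      · exact h.2
      · exact absurd h.1 hm.not_gt
    · exact fun h => Or.inl ⟨hm, h⟩
  unfold genFieldLoc
  by_cases h : q.2.1 0 = 0 ∧ HpzLoc g x₀ q = 0 ∧ Hp2zLoc g x₀ q < 0
  · have hm := normalFactor_pos hq h.1
    have hG := dualCoef_zero_pos g hq.1
    rw [if_pos (hiff.2 h), if_pos h, glidingLoc_eq g x₁ hq1, glidingLoc_eq g x₀ hq.1, map_sub,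
      map_smul, phaseTransDeriv_eξ hq h.1, hamField_symbolLoc_phaseTrans g hq, smul_smul,
      Hp2zLoc_phaseTrans g hq h.1 h.2.1, dualCoef_phaseTrans g hq h.1]
    congr 2
    field_simp
  · rw [if_neg (hiff.not.2 h), if_neg h, hamField_symbolLoc_phaseTrans g hq]

end Change

/-! ### The regions of `T*L` in a chart -/

section Regions

variable {x₀ : M} {ρ : Phase d M}

theorem mem_charSet_iff (g : Metric d M) (h0 : ρ ∈ chartDom x₀) :
    ρ ∈ charSet g ↔ symbolLoc g x₀ (coord x₀ ρ) = 0 := by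
  rw [symbolLoc_change g (mem_chartDom_base ρ) h0]
  rfl

theorem exists_Hpz_eq (g : Metric d M) (h0 : ρ ∈ chartDom x₀) (hb : ρ ∈ boundaryPhase) :
    ∃ m > 0, HpzLoc g x₀ (coord x₀ ρ) = m * Hpz g ρ := by
  have hq := coord_mem_phaseOverlap (mem_chartDom_base ρ) h0
  have hz := (mem_boundaryPhase_iff (mem_chartDom_base ρ)).1 hb
  refine ⟨_, normalFactor_pos hq hz, ?_⟩
  rw [coord_eq_phaseTrans (mem_chartDom_base ρ) h0, HpzLoc_phaseTrans g hq hz]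
  rfl

theorem mem_hypPlus_iff (g : Metric d M) (h0 : ρ ∈ chartDom x₀) :
    ρ ∈ hypPlus g ↔ (coord x₀ ρ).2.1 0 = 0 ∧ symbolLoc g x₀ (coord x₀ ρ) = 0 ∧
      0 < HpzLoc g x₀ (coord x₀ ρ) := by
  rw [← mem_boundaryPhase_iff h0, ← mem_charSet_iff g h0]
  refine and_congr_right fun hb => and_congr_right fun _ => ?_
  obtain ⟨m, hm, h⟩ := exists_Hpz_eq g h0 hb
  rw [h, mul_pos_iff_of_pos_left hm]

theorem mem_hypMinus_iff (g : Metric d M) (h0 : ρ ∈ chartDom x₀) :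
    ρ ∈ hypMinus g ↔ (coord x₀ ρ).2.1 0 = 0 ∧ symbolLoc g x₀ (coord x₀ ρ) = 0 ∧
      HpzLoc g x₀ (coord x₀ ρ) < 0 := by
  rw [← mem_boundaryPhase_iff h0, ← mem_charSet_iff g h0]
  refine and_congr_right fun hb => and_congr_right fun _ => ?_
  obtain ⟨m, hm, h⟩ := exists_Hpz_eq g h0 hb
  rw [h]
  exact ⟨fun h => mul_neg_of_pos_of_neg hm h, fun h => by
    by_contra hc
    exact absurd (mul_nonneg hm.le (not_lt.1 hc)) (not_le.2 h)⟩

theorem genField_eq (g : Metric d M) (hρ : ρ ∈ charSet g) :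
    genField g ρ = genFieldLoc g (Phase.base ρ) (coord (Phase.base ρ) ρ) := by
  have hiff : ρ ∈ gliding g ↔ ((coord (Phase.base ρ) ρ).2.1 0 = 0 ∧
      HpzLoc g (Phase.base ρ) (coord (Phase.base ρ) ρ) = 0 ∧
      Hp2zLoc g (Phase.base ρ) (coord (Phase.base ρ) ρ) < 0) := by
    rw [← mem_boundaryPhase_iff (mem_chartDom_base ρ)]
    exact ⟨fun h => ⟨h.1.1, h.1.2.2, h.2⟩, fun h => ⟨⟨h.1, hρ, h.2.1⟩, h.2.2⟩⟩
  unfold genField genFieldLoc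
  by_cases h : ρ ∈ gliding g
  · rw [if_pos h, if_pos (hiff.1 h)]
  · rw [if_neg h, if_neg (hiff.not.1 h)]

theorem hasDerivWithinAt_coord_change {x₁ : M} {γ : ℝ → Phase d M} {A : Set ℝ} {s : ℝ}
    {v : LocalPhase d} (h0 : γ s ∈ chartDom x₀) (h1 : γ s ∈ chartDom x₁)
    (hc : ContinuousWithinAt γ A s)
    (hd : HasDerivWithinAt (fun r => coord x₀ (γ r)) v A s) :
    HasDerivWithinAt (fun r => coord x₁ (γ r))
      (phaseTransDeriv x₀ x₁ (coord x₀ (γ s)) v) A s := by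
  have hq := coord_mem_phaseOverlap h0 h1
  have hev : ∀ᶠ r in 𝓝[A] s, γ r ∈ chartDom x₀ ∧ γ r ∈ chartDom x₁ :=
    (hc.eventually ((isOpen_chartDom x₀).mem_nhds h0)).and
      (hc.eventually ((isOpen_chartDom x₁).mem_nhds h1))
  have hev' : A ∩ {r | γ r ∈ chartDom x₀} ∈ 𝓝[A] s :=
    inter_mem self_mem_nhdsWithin (hev.mono fun r hr => hr.1)
  have h2 : HasDerivWithinAt (phaseTrans x₀ x₁ ∘ fun r => coord x₀ (γ r))
      (phaseTransDeriv x₀ x₁ (coord x₀ (γ s)) v) (A ∩ {r | γ r ∈ chartDom x₀}) s :=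
    (phaseTrans_hasFDerivWithinAt hq).comp_hasDerivWithinAt s (hd.mono inter_subset_left)
      fun r hr => coordTarget_subset x₀ (coord_mem_coordTarget hr.2)
  refine (h2.mono_of_mem_nhdsWithin hev').congr_of_eventuallyEq ?_ (coord_eq_phaseTrans h0 h1)
  filter_upwards [hev] with r hr using coord_eq_phaseTrans hr.1 hr.2

/-- The equation of a generalized bicharacteristic may be written in any chart. -/
theorem hasDerivWithinAt_coord_iff (g : Metric d M) {γ : ℝ → Phase d M} {A : Set ℝ} {s : ℝ}
    (h0 : γ s ∈ chartDom x₀) (hγ : γ s ∈ charSet g)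
    (hc : ContinuousWithinAt γ A s) :
    HasDerivWithinAt (fun r => coord (Phase.base (γ s)) (γ r)) (genField g (γ s)) A s ↔
      HasDerivWithinAt (fun r => coord x₀ (γ r)) (genFieldLoc g x₀ (coord x₀ (γ s))) A s := by
  have hb := mem_chartDom_base (γ s)
  rw [genField_eq g hγ]
  constructor
  · intro h
    have := hasDerivWithinAt_coord_change hb h0 hc h
    rwa [← genFieldLoc_phaseTrans g (coord_mem_phaseOverlap hb h0),
      ← coord_eq_phaseTrans hb h0] at this
  · intro h
    have := hasDerivWithinAt_coord_change h0 hb hc h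
    rwa [← genFieldLoc_phaseTrans g (coord_mem_phaseOverlap h0 hb),
      ← coord_eq_phaseTrans h0 hb] at this

theorem covecCoord_sub (x₀ x : M) (ξ η : Cotangent d x) :
    covecCoord x₀ x (ξ - η) = covecCoord x₀ x ξ - covecCoord x₀ x η := by
  ext i
  rfl

theorem covecCoord_smul (x₀ x : M) (c : ℝ) (ξ : Cotangent d x) :
    covecCoord x₀ x (c • ξ) = c • covecCoord x₀ x ξ := by
  ext i
  rfl

theorem covecCoord_dz (x : M) : covecCoord x x (dz x) = EuclideanSpace.single (0 : Fin d) 1 := by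
  ext i
  have h : (trivializationAt (Model d) (TangentSpace (𝓡∂ d) (M := M)) x).continuousLinearMapAt ℝ x
      (coordVec x x i) = EuclideanSpace.single i 1 :=
    (trivializationAt (Model d) (TangentSpace (𝓡∂ d) (M := M)) x).continuousLinearMapAt_symmL
      (FiberBundle.mem_baseSet_trivializationAt' x) _
  change (trivializationAt (Model d) (TangentSpace (𝓡∂ d) (M := M)) x).continuousLinearMapAt ℝ x
      (coordVec x x i) 0 = _
  rw [h]
  simp [PiLp.single_apply, eq_comm]

theorem cometric_smul_right (g : Metric d M) (x₀ : M) (y ξ η : Model d) (c : ℝ) :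
    cometric g x₀ y ξ (c • η) = c * cometric g x₀ y ξ η := by
  unfold cometric
  simp only [Finset.mul_sum, PiLp.smul_apply, smul_eq_mul]
  exact Finset.sum_congr rfl fun i _ => Finset.sum_congr rfl fun j _ => by ring

/-- With `G = g^{00} = g*(dz, dz)` one has `n* = dz / √G` and `g*(ξ, dz) = H_p z / 2`, so `2 g*(ξ,
n*) n* = (H_p z / G) dz`. -/
theorem coord_reflection_base (g : Metric d M) (ρ : Phase d M) :
    coord (Phase.base ρ) (reflection g ρ) = coord (Phase.base ρ) ρ
      - (Hpz g ρ / dualCoef g (Phase.base ρ) 0 0 (coord (Phase.base ρ) ρ).2.1) • eξ := by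
  have hq := coord_mem_coordTarget (mem_chartDom_base ρ)
  obtain ⟨t, τ, x, ξ⟩ := ρ
  set ρ : Phase d M := (t, τ, ⟨x, ξ⟩) with hρ
  change coord x ρ ∈ coordTarget x at hq
  change coord x (reflection g ρ) = coord x ρ - (Hpz g ρ / dualCoef g x 0 0 (coord x ρ).2.1) • eξ
  set G := dualCoef g x 0 0 (coord x ρ).2.1 with hGdef
  have hG : 0 < G := dualCoef_zero_pos g hq
  have h1 : dualInner g x (dz x) (dz x) = G := by
    unfold dualInner
    rw [covecCoord_dz, cometric_eq]
    simp [PiLp.single_apply, hGdef, coord]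
    rfl
  have h2 : dualInner g x ξ (dz x) = Hpz g ρ / 2 := by
    unfold Hpz
    change _ = HpzLoc g x (coord x ρ) / 2
    rw [HpzLoc_eq g x hq]
    unfold dualInner
    rw [covecCoord_dz, cometric_eq, mul_div_cancel_left₀ _ two_ne_zero]
    simp only [PiLp.single_apply, mul_ite, mul_one, mul_zero, Finset.sum_ite_eq', Finset.mem_univ,
      if_true]
    refine Finset.sum_congr rfl fun i _ => ?_
    rw [dualCoef_symm g x hq 0 i]
    rfl
  have h3 : dualInner g x ξ (conormal g x) = (Real.sqrt G)⁻¹ * (Hpz g ρ / 2) := by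
    rw [← h2]
    unfold conormal dualInner
    rw [covecCoord_smul, cometric_smul_right]
    congr 3
  refine Prod.ext (by simp [eξ, coord, reflection]) (Prod.ext (by simp [eξ, coord, reflection])
    (Prod.ext (by simp [eξ, coord, reflection]) ?_))
  change covecCoord x x (ξ - (2 * dualInner g x ξ (conormal g x)) • conormal g x)
    = covecCoord x x ξ - (Hpz g ρ / G) • EuclideanSpace.single 0 1
  rw [covecCoord_sub, covecCoord_smul, h3]
  unfold conormal
  rw [covecCoord_smul, covecCoord_dz, h1, smul_smul]
  congr 2
  have := Real.mul_self_sqrt hG.le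
  have h4 : Real.sqrt G ≠ 0 := (Real.sqrt_pos.2 hG).ne'
  nth_rw 3 [← this]
  field_simp

theorem base_reflection (g : Metric d M) (ρ : Phase d M) :
    Phase.base (reflection g ρ) = Phase.base ρ := rfl

/-- The reflection in the chart at `x₀`. -/
theorem coord_reflection (g : Metric d M) (h0 : ρ ∈ chartDom x₀) (hb : ρ ∈ boundaryPhase) :
    coord x₀ (reflection g ρ) = coord x₀ ρ
      - (HpzLoc g x₀ (coord x₀ ρ) / dualCoef g x₀ 0 0 (coord x₀ ρ).2.1) • eξ := by
  have hρ := mem_chartDom_base ρ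
  have hq := coord_mem_phaseOverlap hρ h0
  have hz := (mem_boundaryPhase_iff hρ).1 hb
  have hm := normalFactor_pos hq hz
  have hG := dualCoef_zero_pos g hq.1
  rw [coord_eq_phaseTrans (x₀ := Phase.base ρ) (ρ := reflection g ρ) hρ h0,
    coord_reflection_base, sub_eq_add_neg, ← neg_smul, phaseTrans_add hq hz,
    coord_eq_phaseTrans hρ h0, HpzLoc_phaseTrans g hq hz, dualCoef_phaseTrans g hq hz,
    sub_eq_add_neg _ (_ • eξ), ← neg_smul]
  congr 2
  change _ * -(HpzLoc g _ _ / _) = _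
  field_simp

end Regions

/-! ### The normal velocity as a coordinate -/

@[simp] theorem eξ_time : (eξ (d := d)).1 = 0 := rfl
@[simp] theorem eξ_base : (eξ (d := d)).2.1 = 0 := rfl
@[simp] theorem eξ_tau : (eξ (d := d)).2.2.1 = 0 := rfl
@[simp] theorem eξ_cov_zero : (eξ (d := d)).2.2.2 0 = 1 := by simp [eξ]
theorem eξ_cov_of_ne {i : Fin d} (hi : i ≠ 0) : (eξ (d := d)).2.2.2 i = 0 := by
  simp [eξ, hi]

theorem add_smul_eξ_base (q : LocalPhase d) (c : ℝ) : (q + c • eξ).2.1 = q.2.1 := by simp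

/-- The point whose coordinates other than `ξ_0` are those of `u`, and where `H_p z` is the
component of index `0` of the covector of `u`. -/
def unstraighten (g : Metric d M) (x₀ : M) (u : LocalPhase d) : LocalPhase d :=
  u + ((u.2.2.2 0 - HpzLoc g x₀ u) / (2 * dualCoef g x₀ 0 0 u.2.1)) • eξ

/-- Replace `ξ_0` by the value of `H_p z`. -/
def straighten (g : Metric d M) (x₀ : M) (q : LocalPhase d) : LocalPhase d :=
  q + (HpzLoc g x₀ q - q.2.2.2 0) • eξ

section Straighten

variable (g : Metric d M) {x₀ : M} {u q : LocalPhase d}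

theorem unstraighten_base : (unstraighten g x₀ u).2.1 = u.2.1 := add_smul_eξ_base _ _

theorem straighten_base : (straighten g x₀ q).2.1 = q.2.1 := add_smul_eξ_base _ _

theorem unstraighten_mem (hu : u ∈ coordTarget x₀) : unstraighten g x₀ u ∈ coordTarget x₀ :=
  add_smul_eξ_mem hu _

theorem straighten_mem (hq : q ∈ coordTarget x₀) : straighten g x₀ q ∈ coordTarget x₀ :=
  add_smul_eξ_mem hq _

theorem HpzLoc_unstraighten (hu : u ∈ coordTarget x₀) :
    HpzLoc g x₀ (unstraighten g x₀ u) = u.2.2.2 0 := by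
  have hG := dualCoef_zero_pos g hu
  rw [unstraighten, HpzLoc_add g hu]
  field_simp
  ring

theorem straighten_cov_zero : (straighten g x₀ q).2.2.2 0 = HpzLoc g x₀ q := by
  simp [straighten]

theorem unstraighten_add (hu : u ∈ coordTarget x₀) (c : ℝ) :
    unstraighten g x₀ (u + c • eξ) =
      unstraighten g x₀ u + (c / (2 * dualCoef g x₀ 0 0 u.2.1)) • eξ := by
  have hG := dualCoef_zero_pos g hu
  unfold unstraighten
  rw [HpzLoc_add g hu, add_smul_eξ_base, add_assoc, add_assoc, ← add_smul, ← add_smul]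
  congr 2
  simp only [Prod.snd_add, Prod.smul_snd, PiLp.add_apply, PiLp.smul_apply, eξ_cov_zero,
    smul_eq_mul]
  field_simp
  ring

theorem unstraighten_straighten (hq : q ∈ coordTarget x₀) :
    unstraighten g x₀ (straighten g x₀ q) = q := by
  have hG := dualCoef_zero_pos g hq
  rw [straighten, unstraighten_add g hq, unstraighten, add_assoc, ← add_smul]
  convert add_zero q
  rw [← add_div]
  simp

/-- With `ζ = H_p z` as coordinate, `p` is `ζ² / (4 g^{00})` plus a function of the other
coordinates. It is even in `ζ`, which is why the two copies of the half space can be glued. -/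
theorem symbolLoc_unstraighten_add (hu : u ∈ coordTarget x₀) (c : ℝ) :
    symbolLoc g x₀ (unstraighten g x₀ (u + c • eξ)) = symbolLoc g x₀ (unstraighten g x₀ u)
      + (2 * c * u.2.2.2 0 + c ^ 2) / (4 * dualCoef g x₀ 0 0 u.2.1) := by
  have hG := dualCoef_zero_pos g hu
  rw [unstraighten_add g hu, symbolLoc_add g (unstraighten_mem g hu), HpzLoc_unstraighten g hu,
    unstraighten_base]
  field_simp
  ring

/-- Only the shape of the derivative matters, the identity plus a multiple of `eξ`: the multiple is
found later from the derivative of `H_p z`. -/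
theorem hasFDerivWithinAt_unstraighten (hu : u ∈ coordTarget x₀) :
    ∃ l : LocalPhase d →L[ℝ] ℝ, HasFDerivWithinAt (unstraighten g x₀)
      (ContinuousLinearMap.id ℝ _ + l.smulRight eξ) (halfPhase d) u := by
  have hG := dualCoef_zero_pos g hu
  have h1 : DifferentiableWithinAt ℝ (fun v : LocalPhase d =>
      (v.2.2.2 0 - HpzLoc g x₀ v) / (2 * dualCoef g x₀ 0 0 v.2.1)) (halfPhase d) u := by
    have h2 : DifferentiableWithinAt ℝ (fun v : LocalPhase d => v.2.2.2 0) (halfPhase d) u :=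
      (projξ (d := d) 0).differentiableAt.differentiableWithinAt
    have h3 := (dualCoef_comp_hasFDerivWithinAt g x₀ 0 0 hu).differentiableWithinAt.const_mul (2 : ℝ)
    have h4 := h2.sub (HpzLoc_hasFDerivWithinAt g x₀ hu).differentiableWithinAt
    simp only [div_eq_mul_inv]
    exact h4.mul (h3.inv (by positivity))
  exact ⟨_, (hasFDerivWithinAt_id _ _).add (h1.hasFDerivWithinAt.smul_const eξ)⟩

theorem continuousOn_unstraighten : ContinuousOn (unstraighten g x₀) (coordTarget x₀) := by
  intro u hu
  obtain ⟨l, hl⟩ := hasFDerivWithinAt_unstraighten g hu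
  exact hl.continuousWithinAt.mono (coordTarget_subset x₀)

/-- The field `H_p` at `q` with the component along `ξ_0` replaced by `b`. -/
def straightField (g : Metric d M) (x₀ : M) (b : ℝ) (q : LocalPhase d) : LocalPhase d :=
  hamField (symbolLoc g x₀) q + (b - (hamField (symbolLoc g x₀) q).2.2.2 0) • eξ

/-- The field `H_p` corrected so that the normal acceleration is `b`. -/
theorem hasDerivWithinAt_unstraighten {r : ℝ → LocalPhase d} {A : Set ℝ} {s b : ℝ}
    (hr : ∀ v ∈ A, r v ∈ coordTarget x₀) (hs : s ∈ A)
    (hd : HasDerivWithinAt r (straightField g x₀ b (unstraighten g x₀ (r s))) A s) :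
    HasDerivWithinAt (fun v => unstraighten g x₀ (r v))
      (hamField (symbolLoc g x₀) (unstraighten g x₀ (r s))
        + ((b - Hp2zLoc g x₀ (unstraighten g x₀ (r s))) /
          (2 * dualCoef g x₀ 0 0 (r s).2.1)) • eξ) A s := by
  obtain ⟨l, hl⟩ := hasFDerivWithinAt_unstraighten g (hr s hs)
  have hmaps : MapsTo r A (halfPhase d) := fun v hv => coordTarget_subset x₀ (hr v hv)
  have h1 := hl.comp_hasDerivWithinAt s hd hmaps
  set q := unstraighten g x₀ (r s) with hq
  have hqm : q ∈ coordTarget x₀ := unstraighten_mem g (hr s hs)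
  have hG := dualCoef_zero_pos g (hr s hs)
  by_cases hA : UniqueDiffWithinAt ℝ A s
  -- The derivative is `H_p + c eξ` with `c` unknown. Since `H_p z` of the curve has derivative `b`
  -- by construction, uniqueness of derivatives fixes `c`. At a point that is not an accumulation
  -- point of `A` every vector is a derivative.
  · obtain ⟨c, hc⟩ : ∃ c : ℝ, (ContinuousLinearMap.id ℝ (LocalPhase d) + l.smulRight eξ :
        LocalPhase d →L[ℝ] LocalPhase d) (straightField g x₀ b q) = hamField (symbolLoc g x₀) q + c • eξ := by
      refine ⟨b - (hamField (symbolLoc g x₀) q).2.2.2 0 + l (straightField g x₀ b q), ?_⟩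
      rw [add_smul, ← add_assoc]
      rfl
    rw [hc] at h1
    have h2 : HasDerivWithinAt (HpzLoc g x₀ ∘ (unstraighten g x₀ ∘ r))
        (HpzDeriv g x₀ q (hamField (symbolLoc g x₀) q + c • eξ)) A s :=
      (HpzLoc_hasFDerivWithinAt g x₀ hqm).comp_hasDerivWithinAt s h1
        fun v hv => coordTarget_subset x₀ (unstraighten_mem g (hr v hv))
    have h3 : HasDerivWithinAt (HpzLoc g x₀ ∘ (unstraighten g x₀ ∘ r)) b A s := by
      have h4 := (projξ (d := d) 0).hasFDerivAt.comp_hasDerivWithinAt s hd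
      have h5 : projξ 0 (straightField g x₀ b q) = b := by simp [straightField]
      rw [h5] at h4
      refine h4.congr (fun v hv => ?_) ?_
      · exact HpzLoc_unstraighten g (hr v hv)
      · exact HpzLoc_unstraighten g (hr s hs)
    have h4 := hA.eq_deriv _ h2 h3
    rw [map_add, map_smul, ← Hp2zLoc_eq g x₀ hqm, HpzDeriv_eξ, unstraighten_base,
      smul_eq_mul] at h4
    convert! h1 using 3
    rw [div_eq_iff (by positivity)]
    linarith
  · exact HasFDerivWithinAt.of_not_accPt (uniqueDiffWithinAt_iff_accPt.not.1 hA)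

/-- The normal acceleration of a generalized bicharacteristic. -/
def normalAccel (g : Metric d M) (x₀ : M) (q : LocalPhase d) : ℝ :=
  open Classical in
  if q.2.1 0 = 0 ∧ HpzLoc g x₀ q = 0 ∧ Hp2zLoc g x₀ q < 0 then 0 else Hp2zLoc g x₀ q

theorem genFieldLoc_eq (hq : q ∈ coordTarget x₀) :
    genFieldLoc g x₀ q = hamField (symbolLoc g x₀) q
      + ((normalAccel g x₀ q - Hp2zLoc g x₀ q) / (2 * dualCoef g x₀ 0 0 q.2.1)) • eξ := by
  unfold genFieldLoc normalAccel
  split_ifs with h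
  · rw [glidingLoc_eq g x₀ hq, sub_eq_add_neg, ← neg_smul, zero_sub, neg_div]
  · simp

theorem HpzDeriv_genFieldLoc (hq : q ∈ coordTarget x₀) :
    HpzDeriv g x₀ q (genFieldLoc g x₀ q) = normalAccel g x₀ q := by
  have hG := dualCoef_zero_pos g hq
  rw [genFieldLoc_eq g hq, map_add, map_smul, ← Hp2zLoc_eq g x₀ hq, HpzDeriv_eξ, smul_eq_mul,
    div_mul_cancel₀ _ (by positivity)]
  ring

/-- The correction is along `∂_{ξ_0}`, where `dp` equals `H_p z`, and this is zero at gliding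
points. Hence generalized bicharacteristics stay on `Char p`. -/
theorem symbolDeriv_genFieldLoc (hq : q ∈ coordTarget x₀) :
    symbolDeriv g x₀ q (genFieldLoc g x₀ q) = 0 := by
  rw [genFieldLoc_eq g hq, map_add, map_smul, symbolDeriv_hamField g x₀ hq, symbolDeriv_eξ g x₀ hq,
    zero_add, smul_eq_mul]
  unfold normalAccel
  split_ifs with h
  · rw [h.2.1, mul_zero]
  · simp

theorem genFieldLoc_time (hq : q ∈ coordTarget x₀) : (genFieldLoc g x₀ q).1 = -2 * q.2.2.1 := by
  rw [genFieldLoc_eq g hq, hamField_symbolLoc g x₀ hq]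
  simp

theorem genFieldLoc_tau (hq : q ∈ coordTarget x₀) : (genFieldLoc g x₀ q).2.2.1 = 0 := by
  rw [genFieldLoc_eq g hq, hamField_symbolLoc g x₀ hq]
  simp

theorem genFieldLoc_base (hq : q ∈ coordTarget x₀) :
    (genFieldLoc g x₀ q).2.1 = (hamField (symbolLoc g x₀) q).2.1 := by
  rw [genFieldLoc_eq g hq, add_smul_eξ_base]

end Straighten

/-! ### Generalized bicharacteristics from their coordinates in one chart -/

theorem hasDerivWithinAt_localPhase {r : ℝ → LocalPhase d} {v : LocalPhase d} {A : Set ℝ} {s : ℝ}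
    (ht : HasDerivWithinAt (fun u => (r u).1) v.1 A s)
    (hx : ∀ i, HasDerivWithinAt (fun u => (r u).2.1 i) (v.2.1 i) A s)
    (hτ : HasDerivWithinAt (fun u => (r u).2.2.1) v.2.2.1 A s)
    (hξ : ∀ i, HasDerivWithinAt (fun u => (r u).2.2.2 i) (v.2.2.2 i) A s) :
    HasDerivWithinAt r v A s := by
  have hx' : HasDerivWithinAt (fun u => (r u).2.1) v.2.1 A s :=
    hasFDerivWithinAt_euclidean.2 fun i => by
      convert! (hx i).hasFDerivWithinAt using 1
  have hξ' : HasDerivWithinAt (fun u => (r u).2.2.2) v.2.2.2 A s :=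
    hasFDerivWithinAt_euclidean.2 fun i => by
      convert! (hξ i).hasFDerivWithinAt using 1
  exact ht.prodMk (hx'.prodMk (hτ.prodMk hξ'))

theorem tendsto_phase_unique [T2Space M] {α : Type*} {l : Filter α} [l.NeBot] {γ : α → Phase d M}
    {ρ ρ' : Phase d M} (h : Tendsto γ l (𝓝 ρ)) (h' : Tendsto γ l (𝓝 ρ')) : ρ = ρ' := by
  have hb : Phase.base ρ = Phase.base ρ' :=
    tendsto_nhds_unique ((continuous_base.tendsto ρ).comp h) ((continuous_base.tendsto ρ').comp h')
  have h0 := mem_chartDom_base ρ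
  have h0' : ρ' ∈ chartDom (Phase.base ρ) := by
    rw [hb]
    exact mem_chartDom_base ρ'
  refine coord_injOn _ h0 h0' (tendsto_nhds_unique (l := l)
    (f := fun a => coord (Phase.base ρ) (γ a)) ?_ ?_)
  · exact ((continuousOn_coord _).continuousAt ((isOpen_chartDom _).mem_nhds h0)).tendsto.comp h
  · exact ((continuousOn_coord _).continuousAt ((isOpen_chartDom _).mem_nhds h0')).tendsto.comp h'

/-- A generalized bicharacteristic from its coordinates in one chart. -/
theorem isGenBichar_of_coord [T2Space M] (g : Metric d M) {x₀ : M} {J B : Set ℝ}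
    {q : ℝ → LocalPhase d} (hJ : J.OrdConnected) (hJ' : J.Nontrivial) (hBJ : B ⊆ J)
    (hB : IsDiscrete B) (hq : ∀ s ∈ J \ B, q s ∈ coordTarget x₀)
    (hp : ∀ s ∈ J \ B, symbolLoc g x₀ (q s) = 0)
    (hh : ∀ s ∈ J \ B, (q s).2.1 0 = 0 → HpzLoc g x₀ (q s) = 0)
    (hd : ∀ s ∈ J \ B, HasDerivWithinAt q (genFieldLoc g x₀ (q s)) (J \ B) s)
    (hS : ∀ S ∈ B, (∀ᶠ s in 𝓝[J \ B] S, (q s).2.1 0 ≠ 0) ∧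
      ∃ q₁ ∈ coordTarget x₀, q₁.2.1 0 = 0 ∧ symbolLoc g x₀ q₁ = 0 ∧ HpzLoc g x₀ q₁ < 0 ∧
        Tendsto q (𝓝[(J \ B) ∩ Iio S] S) (𝓝 q₁) ∧
        Tendsto q (𝓝[(J \ B) ∩ Ioi S] S)
          (𝓝 (q₁ - (HpzLoc g x₀ q₁ / dualCoef g x₀ 0 0 q₁.2.1) • eξ))) :
    IsGenBichar g J B (fun s => coordInv x₀ (q s)) := by
  have hdom : ∀ s ∈ J \ B, coordInv x₀ (q s) ∈ chartDom x₀ :=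
    fun s hs => coordInv_mem_chartDom (hq s hs)
  have hco : ∀ s ∈ J \ B, coord x₀ (coordInv x₀ (q s)) = q s := fun s hs => coord_coordInv (hq s hs)
  have hch : ∀ s ∈ J \ B, coordInv x₀ (q s) ∈ charSet g := fun s hs => by
    rw [mem_charSet_iff g (hdom s hs), hco s hs]
    exact hp s hs
  have hc : ∀ s ∈ J \ B, ContinuousWithinAt (fun s => coordInv x₀ (q s)) (J \ B) s := fun s hs =>
    (continuousOn_coordInv x₀ (q s) (hq s hs)).comp (hd s hs).continuousWithinAt hq
  have hlim : ∀ {S : ℝ} {T : Set ℝ} {w : LocalPhase d}, w ∈ coordTarget x₀ →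
      Tendsto q (𝓝[(J \ B) ∩ T] S) (𝓝 w) →
      Tendsto (fun s => coordInv x₀ (q s)) (𝓝[(J \ B) ∩ T] S) (𝓝 (coordInv x₀ w)) := by
    intro S T w hw h
    refine (continuousOn_coordInv x₀ w hw).tendsto.comp (tendsto_nhdsWithin_iff.2 ⟨h, ?_⟩)
    filter_upwards [self_mem_nhdsWithin] with s hs using hq s hs.1
  -- The jump prescribed in coordinates is the intrinsic involution `Σ`.
  have hrefl : ∀ {w : LocalPhase d}, w ∈ coordTarget x₀ → w.2.1 0 = 0 →
      coordInv x₀ (w - (HpzLoc g x₀ w / dualCoef g x₀ 0 0 w.2.1) • eξ) =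
        reflection g (coordInv x₀ w) := by
    intro w hw hw0
    have hw1 := coordInv_mem_chartDom hw
    refine coord_injOn x₀ ?_ (show reflection g (coordInv x₀ w) ∈ chartDom x₀ from hw1) ?_
    · refine coordInv_mem_chartDom ?_
      rw [sub_eq_add_neg, ← neg_smul]
      exact add_smul_eξ_mem hw _
    · rw [coord_reflection g hw1 ((mem_boundaryPhase_iff hw1).2 (by rwa [coord_coordInv hw])),
        coord_coordInv hw, coord_coordInv]
      rw [sub_eq_add_neg, ← neg_smul]
      exact add_smul_eξ_mem hw _
  refine ⟨hJ, hJ', hBJ, hB, hch, ?_, hc, ?_, ?_, ?_, ?_, ?_⟩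
  · intro s hs hmem
    rcases hmem with h | h
    · rw [mem_hypPlus_iff g (hdom s hs), hco s hs] at h
      exact h.2.2.ne' (hh s hs h.1)
    · rw [mem_hypMinus_iff g (hdom s hs), hco s hs] at h
      exact h.2.2.ne (hh s hs h.1)
  · intro s hs
    refine (hasDerivWithinAt_coord_iff (γ := fun s => coordInv x₀ (q s)) g (hdom s hs) (hch s hs)
      (hc s hs)).2 ?_
    rw [hco s hs]
    exact (hd s hs).congr hco (hco s hs)
  · intro S hSB
    filter_upwards [(hS S hSB).1, self_mem_nhdsWithin] with s hs hsJ
    rwa [mem_boundaryPhase_iff (hdom s hsJ), hco s hsJ]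
  · intro S hSB _
    obtain ⟨-, q₁, h1, h2, h3, h4, h5, -⟩ := hS S hSB
    refine ⟨_, ?_, hlim h1 h5⟩
    rw [mem_hypMinus_iff g (coordInv_mem_chartDom h1), coord_coordInv h1]
    exact ⟨h2, h3, h4⟩
  · intro S hSB _
    obtain ⟨-, q₁, h1, h2, h3, h4, -, h5⟩ := hS S hSB
    have hG := dualCoef_zero_pos g h1
    have h6 := add_smul_eξ_mem h1 (-(HpzLoc g x₀ q₁ / dualCoef g x₀ 0 0 q₁.2.1))
    rw [sub_eq_add_neg, ← neg_smul] at h5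
    refine ⟨_, ?_, hlim h6 h5⟩
    rw [mem_hypPlus_iff g (coordInv_mem_chartDom h6), coord_coordInv h6, add_smul_eξ_base,
      HpzLoc_add g h1, symbolLoc_add g h1]
    refine ⟨h2, ?_, ?_⟩
    · rw [h3]
      field_simp
      ring
    · have : HpzLoc g x₀ q₁ + 2 * -(HpzLoc g x₀ q₁ / dualCoef g x₀ 0 0 q₁.2.1) *
          dualCoef g x₀ 0 0 q₁.2.1 = - HpzLoc g x₀ q₁ := by
        field_simp
        ring
      rw [this]
      linarith
  · rintro S hSB ⟨ε, hε, hsub⟩ ρ₁ ρ₂ hρ₁ hρ₂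
    obtain ⟨-, q₁, h1, h2, h3, h4, h5, h6⟩ := hS S hSB
    have : (𝓝[(J \ B) ∩ Iio S] S).NeBot := nhdsWithin_diff_Iio_neBot hJ hB (s := S - ε)
      (hsub ⟨le_rfl, by linarith⟩) (hBJ hSB) (by linarith)
    have : (𝓝[(J \ B) ∩ Ioi S] S).NeBot := nhdsWithin_diff_Ioi_neBot hJ hB (s := S + ε)
      (hsub ⟨by linarith, le_rfl⟩) (hBJ hSB) (by linarith)
    have e1 := tendsto_phase_unique hρ₁ (hlim h1 h5)
    have h7 : q₁ - (HpzLoc g x₀ q₁ / dualCoef g x₀ 0 0 q₁.2.1) • eξ ∈ coordTarget x₀ := by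
      rw [sub_eq_add_neg, ← neg_smul]
      exact add_smul_eξ_mem h1 _
    have e2 := tendsto_phase_unique hρ₂ (hlim h7 h6)
    rw [e2, e1, hrefl h1 h2]

/-! ### The doubled phase space

The reflections at the boundary become continuous if the half space is doubled: in the second copy
the normal coordinate and the normal velocity change their signs. -/

/-- The direction of the normal coordinate. -/
def ex : LocalPhase d := (0, EuclideanSpace.single 0 1, 0, 0)

@[simp] theorem ex_time : (ex (d := d)).1 = 0 := rfl
@[simp] theorem ex_tau : (ex (d := d)).2.2.1 = 0 := rfl
@[simp] theorem ex_cov : (ex (d := d)).2.2.2 = 0 := rfl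
@[simp] theorem ex_base_zero : (ex (d := d)).2.1 0 = 1 := by simp [ex]
theorem ex_base_of_ne {i : Fin d} (hi : i ≠ 0) : (ex (d := d)).2.1 i = 0 := by
  simp [ex, hi]

/-- The sign, with value `1` at `0`. -/
def sgn (z : ℝ) : ℝ := if 0 ≤ z then 1 else -1

theorem sgn_of_nonneg {z : ℝ} (h : 0 ≤ z) : sgn z = 1 := if_pos h
theorem sgn_of_neg {z : ℝ} (h : z < 0) : sgn z = -1 := if_neg (not_le.2 h)
theorem sgn_mul_self (z : ℝ) : sgn z * sgn z = 1 := by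
  unfold sgn; split_ifs <;> norm_num
theorem abs_sgn (z : ℝ) : |sgn z| = 1 := by
  unfold sgn; split_ifs <;> norm_num
theorem sgn_mul_eq_abs (z : ℝ) : sgn z * z = |z| := by
  rcases le_or_gt 0 z with h | h
  · rw [sgn_of_nonneg h, abs_of_nonneg h, one_mul]
  · rw [sgn_of_neg h, abs_of_neg h, neg_one_mul]
theorem sgn_eventually {z : ℝ} (hz : z ≠ 0) : ∀ᶠ w in 𝓝 z, sgn w = sgn z := by
  rcases lt_or_gt_of_ne hz with h | h
  · filter_upwards [gt_mem_nhds h] with w hw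
    rw [sgn_of_neg h, sgn_of_neg hw]
  · filter_upwards [lt_mem_nhds h] with w hw
    rw [sgn_of_nonneg h.le, sgn_of_nonneg hw.le]

/-- Fold the normal coordinate and multiply the normal velocity by `e`. -/
def foldAt (e : ℝ) (y : LocalPhase d) : LocalPhase d :=
  y + (|y.2.1 0| - y.2.1 0) • ex + ((e - 1) * y.2.2.2 0) • eξ

/-- The projection of the doubled phase space. -/
def fold (y : LocalPhase d) : LocalPhase d := foldAt (sgn (y.2.1 0)) y

section Fold

variable (e : ℝ) (y : LocalPhase d)

@[simp] theorem foldAt_time : (foldAt e y).1 = y.1 := by simp [foldAt]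
@[simp] theorem foldAt_tau : (foldAt e y).2.2.1 = y.2.2.1 := by simp [foldAt]
@[simp] theorem foldAt_base_zero : (foldAt e y).2.1 0 = |y.2.1 0| := by simp [foldAt]
@[simp] theorem foldAt_cov_zero : (foldAt e y).2.2.2 0 = e * y.2.2.2 0 := by
  simp [foldAt]
  ring
theorem foldAt_base_of_ne {i : Fin d} (hi : i ≠ 0) : (foldAt e y).2.1 i = y.2.1 i := by
  simp [foldAt, ex_base_of_ne hi]
theorem foldAt_cov_of_ne {i : Fin d} (hi : i ≠ 0) : (foldAt e y).2.2.2 i = y.2.2.2 i := by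
  simp [foldAt, eξ_cov_of_ne hi]

theorem foldAt_eq_add (e' : ℝ) : foldAt e' y = foldAt e y + ((e' - e) * y.2.2.2 0) • eξ := by
  unfold foldAt
  module

theorem foldAt_mem_halfPhase : foldAt e y ∈ halfPhase d := by
  rw [mem_halfPhase, foldAt_base_zero]
  exact abs_nonneg _

theorem continuous_foldAt : Continuous (foldAt (d := d) e) := by
  have h1 : Continuous fun y : LocalPhase d => y.2.1 0 := by fun_prop
  have h2 : Continuous fun y : LocalPhase d => y.2.2.2 0 := by fun_prop
  exact (continuous_id.add ((h1.abs.sub h1).smul continuous_const)).add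
    ((continuous_const.mul h2).smul continuous_const)

theorem fold_of_nonneg {y : LocalPhase d} (h : 0 ≤ y.2.1 0) : fold y = y := by
  unfold fold foldAt
  rw [sgn_of_nonneg h, abs_of_nonneg h]
  simp

/-- The projection agrees at each point with one of two continuous branches, so a limit common to
both is its limit. -/
theorem tendsto_fold_of_branches {X : Type*} [TopologicalSpace X] {f : LocalPhase d → X}
    {l : Filter (LocalPhase d)} {c : X} (h1 : Tendsto (fun y => f (foldAt 1 y)) l (𝓝 c))
    (h2 : Tendsto (fun y => f (foldAt (-1) y)) l (𝓝 c)) :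
    Tendsto (fun y => f (fold y)) l (𝓝 c) := by
  classical
  have h : (fun y : LocalPhase d => f (fold y)) =
      fun y => if 0 ≤ y.2.1 0 then f (foldAt 1 y) else f (foldAt (-1) y) := by
    funext y
    unfold fold sgn
    split_ifs <;> rfl
  rw [h]
  exact Tendsto.if' h1 h2

/-- The points where the projection is continuous. -/
def IsRegular (y : LocalPhase d) : Prop := y.2.1 0 ≠ 0 ∨ y.2.2.2 0 = 0

theorem IsRegular.tendsto_fold {y : LocalPhase d} (h : IsRegular y) :
    Tendsto fold (𝓝 y) (𝓝 (fold y)) := by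
  rcases h with h | h
  · refine ((continuous_foldAt (sgn (y.2.1 0))).tendsto y).congr' ?_
    have h1 : Continuous fun y : LocalPhase d => y.2.1 0 := by fun_prop
    filter_upwards [(h1.tendsto y).eventually (sgn_eventually h)] with u hu
    unfold fold
    rw [hu]
  · have he : ∀ e, foldAt e y = fold y := fun e => by
      unfold fold
      rw [foldAt_eq_add (sgn (y.2.1 0)) y e, h]
      simp
    refine tendsto_fold_of_branches (f := fun u => u) ?_ ?_
    · rw [← he 1]
      exact (continuous_foldAt 1).tendsto y
    · rw [← he (-1)]
      exact (continuous_foldAt (-1)).tendsto y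

/-- The domain of the chart at `x₀` in the doubled phase space. -/
def foldDom (x₀ : M) : Set (LocalPhase d) := {y | foldAt 1 y ∈ coordTarget x₀}

theorem foldAt_mem {x₀ : M} {y : LocalPhase d} (hy : y ∈ foldDom x₀) :
    foldAt e y ∈ coordTarget x₀ := by
  rw [foldAt_eq_add 1 y e]
  exact add_smul_eξ_mem hy _

theorem fold_mem {x₀ : M} {y : LocalPhase d} (hy : y ∈ foldDom x₀) : fold y ∈ coordTarget x₀ :=
  foldAt_mem _ hy

theorem isOpen_foldDom (x₀ : M) : IsOpen (foldDom (d := d) x₀) := by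
  rw [isOpen_iff_mem_nhds]
  intro y hy
  have h : Tendsto (foldAt (d := d) 1) (𝓝 y) (𝓝[halfPhase d] (foldAt 1 y)) :=
    tendsto_nhdsWithin_iff.2 ⟨(continuous_foldAt 1).tendsto y,
      Eventually.of_forall fun u => foldAt_mem_halfPhase 1 u⟩
  exact h (coordTarget_mem_nhdsWithin hy)

end Fold

/-! ### The field on the doubled phase space -/

/-- The field `H_p` in the coordinates where the normal velocity replaces `ξ_0`. -/
def velocityField (g : Metric d M) (x₀ : M) (u : LocalPhase d) : LocalPhase d :=
  straightField g x₀ (Hp2zLoc g x₀ (unstraighten g x₀ u)) (unstraighten g x₀ u)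

section Field

variable (g : Metric d M) {x₀ : M}

theorem velocityField_cov_zero (u : LocalPhase d) :
    (velocityField g x₀ u).2.2.2 0 = Hp2zLoc g x₀ (unstraighten g x₀ u) := by
  simp [velocityField, straightField]

theorem continuousOn_velocityField : ContinuousOn (velocityField g x₀) (coordTarget x₀) := by
  have hS := continuousOn_unstraighten g (x₀ := x₀)
  have hm : MapsTo (unstraighten g x₀) (coordTarget x₀) (coordTarget x₀) :=
    fun u hu => unstraighten_mem g hu
  have hH := (continuousOn_hamField g x₀).comp hS hm
  have ha := (continuousOn_Hp2zLoc g x₀).comp hS hm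
  have hp := (projξ (d := d) 0).continuous.comp_continuousOn hH
  exact hH.add ((ha.sub hp).smul continuousOn_const)

/-- The field of the explicit scheme on the doubled phase space. The sign in the equation of the
normal velocity is taken after the step. -/
def doubledField (x₀ : M) (h : ℝ) (y : LocalPhase d) : LocalPhase d :=
  velocityField g x₀ (fold y) + (y.2.2.2 0 - (velocityField g x₀ (fold y)).2.1 0) • ex
    + ((sgn (y.2.1 0 + h * y.2.2.2 0) - 1) * (velocityField g x₀ (fold y)).2.2.2 0) • eξ

theorem doubledField_base_zero (h : ℝ) (y : LocalPhase d) :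
    (doubledField g x₀ h y).2.1 0 = y.2.2.2 0 := by
  simp [doubledField]

theorem doubledField_cov_zero (h : ℝ) (y : LocalPhase d) :
    (doubledField g x₀ h y).2.2.2 0 = sgn (y.2.1 0 + h * y.2.2.2 0) *
      Hp2zLoc g x₀ (unstraighten g x₀ (fold y)) := by
  simp [doubledField, velocityField_cov_zero]
  ring

theorem doubledField_apply {L : LocalPhase d →L[ℝ] ℝ} (h1 : L ex = 0) (h2 : L eξ = 0) (h : ℝ)
    (y : LocalPhase d) : L (doubledField g x₀ h y) = L (velocityField g x₀ (fold y)) := by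
  simp [doubledField, h1, h2]

/-- The field jumps at `z = 0`, but it is built from two continuous branches, bounded on the ball,
and from signs; the bound is uniform in the step `h`. -/
theorem exists_doubledField_bound {y₀ : LocalPhase d} {r : ℝ}
    (hr : Metric.closedBall y₀ r ⊆ foldDom x₀) :
    ∃ C, ∀ h, ∀ y ∈ Metric.closedBall y₀ r, ‖doubledField g x₀ h y‖ ≤ C := by
  have hbd : ∀ e : ℝ, ∃ C, ∀ y ∈ Metric.closedBall y₀ r, ‖velocityField g x₀ (foldAt e y)‖ ≤ C :=
    fun e => (isCompact_closedBall y₀ r).exists_bound_of_continuousOn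
      ((continuousOn_velocityField g).comp (continuous_foldAt e).continuousOn
        fun y hy => foldAt_mem e (hr hy))
  obtain ⟨C₁, hC₁⟩ := hbd 1
  obtain ⟨C₂, hC₂⟩ := hbd (-1)
  obtain ⟨C₃, hC₃⟩ := (isCompact_closedBall y₀ r).exists_bound_of_continuousOn
    (f := fun y : LocalPhase d => y.2.2.2 0) (by fun_prop)
  have hx := (projX (d := d) 0).le_opNorm
  have hξ := (projξ (d := d) 0).le_opNorm
  set C := max C₁ C₂ with hCdef
  refine ⟨C + (C₃ + ‖projX (d := d) 0‖ * C) * ‖ex (d := d)‖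
    + (2 * (‖projξ (d := d) 0‖ * C)) * ‖eξ (d := d)‖, fun h y hy => ?_⟩
  have hW : ‖velocityField g x₀ (fold y)‖ ≤ C := by
    unfold fold sgn
    split_ifs
    · exact (hC₁ y hy).trans (le_max_left _ _)
    · exact (hC₂ y hy).trans (le_max_right _ _)
  unfold doubledField
  refine (norm_add₃_le).trans (add_le_add (add_le_add hW ?_) ?_)
  · rw [norm_smul]
    refine mul_le_mul_of_nonneg_right ((norm_sub_le _ _).trans (add_le_add (hC₃ y hy) ?_))
      (norm_nonneg _)
    exact (hx _).trans (mul_le_mul_of_nonneg_left hW (norm_nonneg _))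
  · rw [norm_smul, norm_mul]
    refine mul_le_mul_of_nonneg_right (mul_le_mul ?_ ?_ (norm_nonneg _) (by norm_num))
      (norm_nonneg _)
    · rw [Real.norm_eq_abs]
      refine (abs_sub _ _).trans ?_
      rw [abs_sgn, abs_one]
      norm_num
    · exact (hξ _).trans (mul_le_mul_of_nonneg_left hW (norm_nonneg _))

/-- A solution of the equation of generalized bicharacteristics on the doubled phase space. -/
structure IsDoubledSol (x₀ : M) (ε : ℝ) (y : ℝ → LocalPhase d) : Prop where
  mem : ∀ s ∈ Icc 0 ε, y s ∈ foldDom x₀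
  lipschitz : ∃ C, ∀ s ∈ Icc 0 ε, ∀ r ∈ Icc 0 ε, ‖y r - y s‖ ≤ C * |r - s|
  base_zero : ∀ s ∈ Icc 0 ε,
    HasDerivWithinAt (fun r => (y r).2.1 0) ((y s).2.2.2 0) (Icc 0 ε) s
  -- The projection is discontinuous where `z = 0` and `ζ ≠ 0`; these times become reflection times,
  -- and the equation for the components other than `z` is not needed there.
  apply : ∀ s ∈ Icc 0 ε, IsRegular (y s) → ∀ L : LocalPhase d →L[ℝ] ℝ, L ex = 0 → L eξ = 0 →
    HasDerivWithinAt (fun r => L (y r)) (L (velocityField g x₀ (fold (y s)))) (Icc 0 ε) s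
  cov_zero : ∀ s ∈ Icc 0 ε, (y s).2.1 0 ≠ 0 → HasDerivWithinAt (fun r => (y r).2.2.2 0)
    (sgn ((y s).2.1 0) * Hp2zLoc g x₀ (unstraighten g x₀ (fold (y s)))) (Icc 0 ε) s
  nonsticking : ∀ s ∈ Icc 0 ε, (y s).2.1 0 = 0 → (y s).2.2.2 0 = 0 →
    0 < Hp2zLoc g x₀ (unstraighten g x₀ (fold (y s))) →
    ∃ ρ > 0, ∀ s₁ s₂ s₃, s₁ ∈ Icc 0 ε → s₁ < s₂ → s₂ < s₃ → |s₁ - s| < ρ → |s₃ - s| < ρ →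
      ¬ ((y s₁).2.2.2 0 = 0 ∧ (y s₂).2.2.2 0 = 0 ∧ (y s₃).2.2.2 0 = 0)

/-- The limit of the Euler scheme is identified component by component: `z' = ζ` is exact in the
scheme, the tangential components converge at regular points, and the normal velocity does where `z
≠ 0`. -/
theorem exists_isDoubledSol {y₀ : LocalPhase d} (hy₀ : y₀ ∈ foldDom x₀) :
    ∃ ε > 0, ∃ y, IsDoubledSol g x₀ ε y ∧ y 0 = y₀ := by
  classical
  obtain ⟨r, hr, hball⟩ := Metric.nhds_basis_closedBall.mem_iff.1
    ((isOpen_foldDom x₀).mem_nhds hy₀)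
  obtain ⟨C, hC⟩ := exists_doubledField_bound g hball
  -- Cut off to zero outside the ball, the field is bounded everywhere. The choice of `ε` makes `C ε
  -- < r`, so the limit never leaves the ball on `[0, ε]`.
  set Φ : ℝ → LocalPhase d → LocalPhase d := fun h y =>
    if y ∈ Metric.closedBall y₀ r then doubledField g x₀ h y else 0 with hΦ
  have hC0 : 0 ≤ C := (norm_nonneg _).trans (hC 0 y₀ (Metric.mem_closedBall_self hr.le))
  have hΦC : ∀ h u, ‖Φ h u‖ ≤ C := by
    intro h u
    simp only [hΦ]
    split_ifs with hu
    · exact hC h u hu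
    · simpa using hC0
  obtain ⟨y, hy⟩ := exists_isEulerLimit hΦC y₀
  set ε := r / (2 * (C + 1)) with hε
  have hε0 : 0 < ε := by positivity
  have hCε : C * ε < r := by
    have : (C + 1) * ε = r / 2 := by rw [hε]; field_simp
    nlinarith
  have hin : ∀ s ∈ Icc 0 ε, ‖y s - y₀‖ < r := by
    intro s hs
    have := hy.norm_sub_le hΦC le_rfl hs.1
    rw [hy.apply_zero, sub_zero, abs_of_nonneg hs.1] at this
    exact this.trans_lt ((mul_le_mul_of_nonneg_left hs.2 hC0).trans_lt hCε)
  have hmem : ∀ s ∈ Icc 0 ε, y s ∈ foldDom x₀ := fun s hs =>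
    hball (mem_closedBall_iff_norm.2 (hin s hs).le)
  have hev : ∀ s ∈ Icc 0 ε, ∀ᶠ p : ℝ × LocalPhase d in 𝓝[>] 0 ×ˢ 𝓝 (y s),
      Φ p.1 p.2 = doubledField g x₀ p.1 p.2 := by
    intro s hs
    have h1 : ∀ᶠ u in 𝓝 (y s), u ∈ Metric.closedBall y₀ r := by
      filter_upwards [Metric.isOpen_ball.mem_nhds (mem_ball_iff_norm.2 (hin s hs))] with u hu
      exact Metric.ball_subset_closedBall hu
    filter_upwards [h1.prod_inr (𝓝[>] (0 : ℝ))] with p hp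
    simp only [hΦ]
    rw [if_pos hp]
  have hsnd : ∀ s, Tendsto (fun p : ℝ × LocalPhase d => p.2) (𝓝[>] 0 ×ˢ 𝓝 (y s)) (𝓝 (y s)) :=
    fun s => tendsto_snd
  have hfst : ∀ s, Tendsto (fun p : ℝ × LocalPhase d => p.1) (𝓝[>] 0 ×ˢ 𝓝 (y s)) (𝓝 0) :=
    fun s => tendsto_fst.mono_right nhdsWithin_le_nhds
  have hx0 : ∀ s, Tendsto (fun p : ℝ × LocalPhase d => p.2.2.1 0) (𝓝[>] 0 ×ˢ 𝓝 (y s))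
      (𝓝 ((y s).2.1 0)) := fun s => ((projX (d := d) 0).continuous.tendsto _).comp (hsnd s)
  have hξ0 : ∀ s, Tendsto (fun p : ℝ × LocalPhase d => p.2.2.2.2 0) (𝓝[>] 0 ×ˢ 𝓝 (y s))
      (𝓝 ((y s).2.2.2 0)) := fun s => ((projξ (d := d) 0).continuous.tendsto _).comp (hsnd s)
  have hW : ∀ s ∈ Icc 0 ε, IsRegular (y s) →
      Tendsto (fun p : ℝ × LocalPhase d => velocityField g x₀ (fold p.2)) (𝓝[>] 0 ×ˢ 𝓝 (y s))
        (𝓝 (velocityField g x₀ (fold (y s)))) := by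
    intro s hs hreg
    refine ((continuousOn_velocityField g) _ (fold_mem (hmem s hs))).tendsto.comp ?_
    refine tendsto_nhdsWithin_iff.2 ⟨hreg.tendsto_fold.comp (hsnd s), ?_⟩
    filter_upwards [(hsnd s).eventually ((isOpen_foldDom x₀).mem_nhds (hmem s hs))] with p hp
    exact fold_mem hp
  have ha : ∀ s ∈ Icc 0 ε, IsRegular (y s) →
      Tendsto (fun p : ℝ × LocalPhase d => Hp2zLoc g x₀ (unstraighten g x₀ (fold p.2)))
        (𝓝[>] 0 ×ˢ 𝓝 (y s)) (𝓝 (Hp2zLoc g x₀ (unstraighten g x₀ (fold (y s))))) := by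
    intro s hs hreg
    have := ((projξ (d := d) 0).continuous.tendsto _).comp (hW s hs hreg)
    simpa only [Function.comp_def, projξ_apply, velocityField_cov_zero] using this
  have hsub : Icc 0 ε ⊆ Ici 0 := fun s hs => hs.1
  refine ⟨ε, hε0, y, ⟨hmem, ⟨C, fun s hs t ht => hy.norm_sub_le hΦC hs.1 ht.1⟩, ?_, ?_, ?_, ?_⟩,
    hy.apply_zero⟩
  · intro s hs
    refine (hy.hasDerivWithinAt hΦC (projX 0) hs.1 ?_).mono hsub
    refine (hξ0 s).congr' ?_
    filter_upwards [hev s hs] with p hp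
    rw [hp, projX_apply, doubledField_base_zero]
  · intro s hs hreg L h1 h2
    refine (hy.hasDerivWithinAt hΦC L hs.1 ?_).mono hsub
    refine ((L.continuous.tendsto _).comp (hW s hs hreg)).congr' ?_
    filter_upwards [hev s hs] with p hp
    rw [hp, doubledField_apply g h1 h2, Function.comp_apply]
  · intro s hs hne
    refine (hy.hasDerivWithinAt hΦC (projξ 0) hs.1 ?_).mono hsub
    have h1 : Tendsto (fun p : ℝ × LocalPhase d => p.2.2.1 0 + p.1 * p.2.2.2.2 0)
        (𝓝[>] 0 ×ˢ 𝓝 (y s)) (𝓝 ((y s).2.1 0)) := by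
      simpa using (hx0 s).add ((hfst s).mul (hξ0 s))
    refine ((ha s hs (Or.inl hne)).const_mul (sgn ((y s).2.1 0))).congr' ?_
    filter_upwards [hev s hs, h1.eventually (sgn_eventually hne)] with p hp hp1
    rw [hp, projξ_apply, doubledField_cov_zero, hp1]
  · intro s hs hz hζ hpos
    -- By continuity of `H_p² z` at this regular point, half of its value bounds the acceleration
    -- from below on both copies nearby.
    obtain ⟨ρ, hρ, hns⟩ := hy.nonsticking hΦC (projX 0) (projξ 0) hs.1 (half_pos hpos) (by
      filter_upwards [hev s hs, (ha s hs (Or.inr hζ)).eventually (lt_mem_nhds (half_lt_self hpos))]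
        with p hp hp1
      rw [hp, projX_apply, projξ_apply, doubledField_base_zero, projξ_apply, doubledField_cov_zero,
        projX_apply]
      refine ⟨rfl, fun h => ?_, fun h => ?_⟩
      · rw [sgn_of_nonneg h, one_mul]
        exact hp1.le
      · rw [sgn_of_neg h]
        linarith)
    exact ⟨ρ, hρ, fun s₁ s₂ s₃ h1 => hns s₁ s₂ s₃ h1.1⟩

end Field

/-! ### From solutions on the doubled space to generalized bicharacteristics -/

/-- The two branches differ by the sign of the normal velocity, in which the symbol is even. -/
theorem symbolLoc_foldAt (g : Metric d M) {x₀ : M} {y : LocalPhase d} (hy : y ∈ foldDom x₀)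
    {e : ℝ} (he : e * e = 1) : symbolLoc g x₀ (unstraighten g x₀ (foldAt e y)) =
      symbolLoc g x₀ (unstraighten g x₀ (foldAt 1 y)) := by
  have h : 2 * ((e - 1) * y.2.2.2 0) * (foldAt 1 y).2.2.2 0 + ((e - 1) * y.2.2.2 0) ^ 2 = 0 := by
    rw [foldAt_cov_zero]
    linear_combination (y.2.2.2 0 ^ 2) * he
  rw [foldAt_eq_add 1 y e, symbolLoc_unstraighten_add g hy, h]
  simp

/-- By Rolle four zeros of `f` would enclose three zeros of `f'`. It is applied to `f = z` and `f' =
ζ`, to show that a curve touches the boundary finitely often near a glancing point with `H_p² z >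
0`. -/
theorem finite_zeros_of_deriv {a b : ℝ} {f f' : ℝ → ℝ}
    (hf : ∀ s ∈ Icc a b, HasDerivWithinAt f (f' s) (Icc a b) s) {s ρ : ℝ}
    (h : ∀ s₁ s₂ s₃, s₁ ∈ Icc a b → s₁ < s₂ → s₂ < s₃ → |s₁ - s| < ρ → |s₃ - s| < ρ →
      ¬ (f' s₁ = 0 ∧ f' s₂ = 0 ∧ f' s₃ = 0)) :
    {t | t ∈ Icc a b ∧ |t - s| < ρ ∧ f t = 0}.Finite := by
  by_contra hinf
  obtain ⟨T, hT, hcard⟩ := Set.Infinite.exists_subset_card_eq hinf 4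
  set t := T.orderEmbOfFin hcard with ht
  have hmem : ∀ i, t i ∈ Icc a b ∧ |t i - s| < ρ ∧ f (t i) = 0 :=
    fun i => hT (T.orderEmbOfFin_mem hcard i)
  have rolle : ∀ i j, i < j → ∃ c ∈ Ioo (t i) (t j), f' c = 0 := by
    intro i j hij
    have hlt : t i < t j := t.strictMono hij
    have hsub : Icc (t i) (t j) ⊆ Icc a b := Icc_subset_Icc (hmem i).1.1 (hmem j).1.2
    refine exists_hasDerivAt_eq_zero (f := f) hlt (fun u hu => ?_) ?_ fun u hu => ?_
    · exact ((hf u (hsub hu)).continuousWithinAt).mono hsub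
    · rw [(hmem i).2.2, (hmem j).2.2]
    · exact (hf u (hsub (Ioo_subset_Icc_self hu))).hasDerivAt
        (Icc_mem_nhds ((hmem i).1.1.trans_lt hu.1) (hu.2.trans_le (hmem j).1.2))
  obtain ⟨c₁, h1, z1⟩ := rolle 0 1 (by decide)
  obtain ⟨c₂, h2, z2⟩ := rolle 1 2 (by decide)
  obtain ⟨c₃, h3, z3⟩ := rolle 2 3 (by decide)
  have m0 := hmem 0
  have m3 := hmem 3
  have a0 := abs_lt.1 m0.2.1
  have a3 := abs_lt.1 m3.2.1
  have o1 : t 1 < t 2 := t.strictMono (by decide)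
  refine h c₁ c₂ c₃ ⟨m0.1.1.trans h1.1.le, ?_⟩ (h1.2.trans h2.1) (h2.2.trans h3.1) ?_ ?_
    ⟨z1, z2, z3⟩
  · linarith [h1.2, h2.1, h2.2, h3.1, h3.2, m3.1.2]
  · rw [abs_lt]
    constructor <;> linarith [h1.1, h1.2, h2.1, h2.2, h3.1, h3.2]
  · rw [abs_lt]
    constructor <;> linarith [h1.1, h1.2, h2.1, h2.2, h3.1, h3.2]

/-- The times of reflection of a solution on the doubled phase space. -/
def jumpSet (ε : ℝ) (y : ℝ → LocalPhase d) : Set ℝ :=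
  {s | s ∈ Icc 0 ε ∧ (y s).2.1 0 = 0 ∧ (y s).2.2.2 0 ≠ 0}

theorem mem_diff_jumpSet {ε : ℝ} {y : ℝ → LocalPhase d} {s : ℝ} :
    s ∈ Icc 0 ε \ jumpSet ε y ↔ s ∈ Icc 0 ε ∧ IsRegular (y s) := by
  unfold jumpSet IsRegular
  rw [Set.mem_sdiff, mem_ofPred_eq]
  tauto

namespace IsDoubledSol

variable {g : Metric d M} {x₀ : M} {ε : ℝ} {y : ℝ → LocalPhase d}

theorem continuousOn (h : IsDoubledSol g x₀ ε y) : ContinuousOn y (Icc 0 ε) := by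
  obtain ⟨C, hC⟩ := h.lipschitz
  refine (LipschitzOnWith.of_dist_le_mul (K := (max C 0).toNNReal) fun r hr s hs => ?_).continuousOn
  rw [dist_eq_norm, Real.dist_eq, Real.coe_toNNReal _ (le_max_right _ _)]
  exact (hC s hs r hr).trans (mul_le_mul_of_nonneg_right (le_max_left _ _) (abs_nonneg _))

theorem continuousWithinAt_base (h : IsDoubledSol g x₀ ε y) {s : ℝ} (hs : s ∈ Icc 0 ε) :
    ContinuousWithinAt (fun r => (y r).2.1 0) (Icc 0 ε) s := (h.base_zero s hs).continuousWithinAt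

theorem continuousWithinAt_cov (h : IsDoubledSol g x₀ ε y) {s : ℝ} (hs : s ∈ Icc 0 ε) :
    ContinuousWithinAt (fun r => (y r).2.2.2 0) (Icc 0 ε) s :=
  (projξ (d := d) 0).continuous.continuousAt.comp_continuousWithinAt (h.continuousOn s hs)

theorem sgn_eventually_of_ne (h : IsDoubledSol g x₀ ε y) {s : ℝ} (hs : s ∈ Icc 0 ε)
    (hz : (y s).2.1 0 ≠ 0) : ∀ᶠ r in 𝓝[Icc 0 ε] s, sgn ((y r).2.1 0) = sgn ((y s).2.1 0) :=
  (h.continuousWithinAt_base hs).eventually (sgn_eventually hz)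

theorem continuousWithinAt_fold (h : IsDoubledSol g x₀ ε y) {s : ℝ} (hs : s ∈ Icc 0 ε)
    (hr : IsRegular (y s)) : ContinuousWithinAt (fun r => fold (y r)) (Icc 0 ε) s :=
  hr.tendsto_fold.comp (h.continuousOn s hs)

theorem continuousWithinAt_comp (h : IsDoubledSol g x₀ ε y) {X : Type*} [TopologicalSpace X]
    {f : LocalPhase d → X} (hf : ContinuousOn f (coordTarget x₀)) {s : ℝ} (hs : s ∈ Icc 0 ε)
    (hr : IsRegular (y s)) :
    ContinuousWithinAt (fun r => f (unstraighten g x₀ (fold (y r)))) (Icc 0 ε) s :=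
  ContinuousWithinAt.comp (g := f ∘ unstraighten g x₀) (t := coordTarget x₀)
    ((hf.comp (continuousOn_unstraighten g) fun _ hu => unstraighten_mem g hu) _
      (fold_mem (h.mem s hs)))
    (h.continuousWithinAt_fold hs hr) fun r hr => fold_mem (h.mem r hr)

/-- At a regular time with `z = 0` also `z' = ζ = 0`, so the corner of the absolute value does no
harm. -/
theorem hasDerivWithinAt_abs (h : IsDoubledSol g x₀ ε y) {s : ℝ} (hs : s ∈ Icc 0 ε)
    (hr : IsRegular (y s)) : HasDerivWithinAt (fun r => |(y r).2.1 0|)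
      (sgn ((y s).2.1 0) * (y s).2.2.2 0) (Icc 0 ε) s := by
  by_cases hz : (y s).2.1 0 = 0
  · have hη := hr.resolve_left (not_not.2 hz)
    have h1 := h.base_zero s hs
    rw [hη] at h1 ⊢
    rw [mul_zero, hasDerivWithinAt_iff_forall_abs]
    rw [hasDerivWithinAt_iff_forall_abs] at h1
    intro κ hκ
    filter_upwards [h1 κ hκ] with r hr
    simpa [hz] using hr
  · refine ((h.base_zero s hs).const_mul (sgn ((y s).2.1 0))).congr_of_eventuallyEq ?_ ?_
    · filter_upwards [h.sgn_eventually_of_ne hs hz] with r hr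
      rw [← hr, sgn_mul_eq_abs]
    · rw [sgn_mul_eq_abs]

theorem hasDerivWithinAt_velocity_of_ne (h : IsDoubledSol g x₀ ε y) {s : ℝ} (hs : s ∈ Icc 0 ε)
    (hz : (y s).2.1 0 ≠ 0) : HasDerivWithinAt (fun r => sgn ((y r).2.1 0) * (y r).2.2.2 0)
      (Hp2zLoc g x₀ (unstraighten g x₀ (fold (y s)))) (Icc 0 ε) s := by
  have h1 := (h.cov_zero s hs hz).const_mul (sgn ((y s).2.1 0))
  rw [← mul_assoc, sgn_mul_self, one_mul] at h1
  refine h1.congr_of_eventuallyEq ?_ rfl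
  filter_upwards [h.sgn_eventually_of_ne hs hz] with r hr
  rw [hr]

/-- Where `ζ ≠ 0` the curve crosses `z = 0` transversally. This isolates the jump times and tells
which copy is occupied before and after. -/
theorem sgn_eventually (h : IsDoubledSol g x₀ ε y) {S : ℝ} (hS : S ∈ jumpSet ε y) :
    ∀ᶠ s in 𝓝[Icc 0 ε \ {S}] S, (y s).2.1 0 ≠ 0 ∧
      sgn ((y s).2.1 0) = sgn (s - S) * sgn ((y S).2.2.2 0) := by
  have h1 := hasDerivWithinAt_iff_tendsto_slope.1 (h.base_zero S hS.1)
  have h2 := (h1.const_mul ((y S).2.2.2 0)).eventually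
    (lt_mem_nhds (mul_self_pos.2 hS.2.2))
  filter_upwards [h2, self_mem_nhdsWithin] with s hs hsS
  have hne : s - S ≠ 0 := sub_ne_zero.2 hsS.2
  rw [slope_def_field, hS.2.1, sub_zero, ← mul_div_assoc] at hs
  have h3 : (y s).2.1 0 ≠ 0 := by
    rintro h0
    rw [h0] at hs
    simp at hs
  refine ⟨h3, ?_⟩
  rcases lt_or_gt_of_ne hne with ha | ha
  · have hm := (div_pos_iff.1 hs).resolve_left fun hc => hc.2.not_gt ha
    rcases lt_or_gt_of_ne h3 with hb | hb
    · have : 0 < (y S).2.2.2 0 := pos_of_mul_neg_left hm.1 hb.le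
      rw [sgn_of_neg hb, sgn_of_neg ha, sgn_of_nonneg this.le]; norm_num
    · have : (y S).2.2.2 0 < 0 := neg_of_mul_neg_left hm.1 hb.le
      rw [sgn_of_nonneg hb.le, sgn_of_neg ha, sgn_of_neg this]; norm_num
  · have hm := (div_pos_iff.1 hs).resolve_right fun hc => hc.2.not_gt ha
    rcases lt_or_gt_of_ne h3 with hb | hb
    · have : (y S).2.2.2 0 < 0 := neg_of_mul_pos_left hm.1 hb.le
      rw [sgn_of_neg hb, sgn_of_nonneg ha.le, sgn_of_neg this]; norm_num
    · have : 0 < (y S).2.2.2 0 := pos_of_mul_pos_left hm.1 hb.le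
      rw [sgn_of_nonneg hb.le, sgn_of_nonneg ha.le, sgn_of_nonneg this.le]; norm_num

theorem isDiscrete_jumpSet (h : IsDoubledSol g x₀ ε y) : IsDiscrete (jumpSet ε y) := by
  rw [isDiscrete_iff_nhdsNE]
  intro S hS
  rw [← disjoint_iff, disjoint_principal_right]
  have h1 := h.sgn_eventually hS
  rw [eventually_nhdsWithin_iff] at h1
  filter_upwards [nhdsWithin_le_nhds h1, self_mem_nhdsWithin] with s hs hne hsB
  exact (hs ⟨hsB.1, hne⟩).1 hsB.2.1

/-- The square of a Lipschitz function is quadratically small at a zero. It provides the derivative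
of the energy at boundary times where that of `ζ` is not yet known. -/
theorem hasDerivWithinAt_sq (h : IsDoubledSol g x₀ ε y) {s : ℝ} (hs : s ∈ Icc 0 ε)
    (hη : (y s).2.2.2 0 = 0) :
    HasDerivWithinAt (fun r => (y r).2.2.2 0 ^ 2) 0 (Icc 0 ε) s := by
  obtain ⟨C, hC⟩ := h.lipschitz
  have hCn : ∀ r ∈ Icc 0 ε, |(y r).2.2.2 0| ≤ ‖projξ (d := d) 0‖ * max C 0 * |r - s| := by
    intro r hr
    have h1 := (projξ (d := d) 0).le_opNorm (y r - y s)
    rw [map_sub, projξ_apply, projξ_apply, hη, sub_zero, Real.norm_eq_abs] at h1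
    refine h1.trans ?_
    rw [mul_assoc]
    exact mul_le_mul_of_nonneg_left ((hC s hs r hr).trans
      (mul_le_mul_of_nonneg_right (le_max_left _ _) (abs_nonneg _))) (norm_nonneg _)
  set K := ‖projξ (d := d) 0‖ * max C 0 with hK
  have hK0 : 0 ≤ K := mul_nonneg (norm_nonneg _) (le_max_right _ _)
  rw [hasDerivWithinAt_iff_forall_abs]
  intro κ hκ
  have hδ : ∀ᶠ r in 𝓝[Icc 0 ε] s, |r - s| < κ / (K ^ 2 + 1) :=
    nhdsWithin_le_nhds (Metric.ball_mem_nhds s (by positivity))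
  filter_upwards [hδ, self_mem_nhdsWithin] with r hr hrJ
  have h1 := hCn r hrJ
  have h2 : |(y r).2.2.2 0| ^ 2 ≤ (K * |r - s|) ^ 2 := pow_le_pow_left₀ (abs_nonneg _) h1 2
  rw [lt_div_iff₀ (by positivity)] at hr
  rw [hη, zero_mul, sub_zero, zero_pow two_ne_zero, sub_zero, abs_pow]
  nlinarith [abs_nonneg (r - s)]

/-- The normal velocity is differentiable, with the normal acceleration as derivative. -/
theorem hasDerivWithinAt_velocity (h : IsDoubledSol g x₀ ε y) {s : ℝ}
    (hs : s ∈ Icc 0 ε \ jumpSet ε y) :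
    HasDerivWithinAt (fun r => sgn ((y r).2.1 0) * (y r).2.2.2 0)
      (normalAccel g x₀ (unstraighten g x₀ (fold (y s)))) (Icc 0 ε \ jumpSet ε y) s := by
  obtain ⟨hsJ, hreg⟩ := mem_diff_jumpSet.1 hs
  have hsub : Icc 0 ε \ jumpSet ε y ⊆ Icc 0 ε := sdiff_subset
  have hbase : (unstraighten g x₀ (fold (y s))).2.1 0 = |(y s).2.1 0| := by
    rw [unstraighten_base, fold, foldAt_base_zero]
  by_cases hz : (y s).2.1 0 = 0
  swap
  · have : normalAccel g x₀ (unstraighten g x₀ (fold (y s))) =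
        Hp2zLoc g x₀ (unstraighten g x₀ (fold (y s))) := by
      unfold normalAccel
      rw [if_neg]
      rw [hbase, abs_eq_zero]
      exact fun hc => hz hc.1
    rw [this]
    exact (h.hasDerivWithinAt_velocity_of_ne hsJ hz).mono hsub
  have hη := hreg.resolve_left (not_not.2 hz)
  have hac := h.continuousWithinAt_comp (continuousOn_Hp2zLoc g x₀) hsJ hreg
  have hcv : ContinuousWithinAt (fun r => sgn ((y r).2.1 0) * (y r).2.2.2 0)
      (Icc 0 ε \ jumpSet ε y) s := by
    have := ((projξ (d := d) 0).continuous.continuousAt.comp_continuousWithinAt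
      (h.continuousWithinAt_fold hsJ hreg)).mono hsub
    refine this.congr (fun r _ => ?_) ?_ <;> simp [fold]
  rcases le_or_gt (Hp2zLoc g x₀ (unstraighten g x₀ (fold (y s)))) 0 with ha | ha
  -- For `a₀ ≤ 0` the acceleration is `0`, by gliding if `a₀ < 0` and because it equals `a₀` if `a₀
  -- = 0`. The energy argument proves this value; the energy contains `ζ` only through its square
  -- and is continuous at the jumps.
  · have : normalAccel g x₀ (unstraighten g x₀ (fold (y s))) = 0 := by
      unfold normalAccel
      split_ifs with hc
      · rfl
      · rw [hbase, HpzLoc_unstraighten g (fold_mem (h.mem s hsJ)), fold, foldAt_cov_zero, hz, hη]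
          at hc
        simp only [abs_zero, mul_zero, true_and, not_lt] at hc
        rw [fold, hz] at ha ⊢
        exact le_antisymm ha hc
    rw [this]
    set a₀ := Hp2zLoc g x₀ (unstraighten g x₀ (fold (y s))) with ha₀
    have hEeq : (fun u => (sgn ((y u).2.1 0) * (y u).2.2.2 0) ^ 2 / 2 - a₀ * |(y u).2.1 0|) =
        fun u => (y u).2.2.2 0 ^ 2 / 2 - a₀ * |(y u).2.1 0| := by
      funext u
      rw [mul_pow, sq (sgn _), sgn_mul_self, one_mul]
    refine hasDerivWithinAt_zero_of_energy ordConnected_Icc h.isDiscrete_jumpSet (a₀ := a₀)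
      (z := fun r => |(y r).2.1 0|)
      (a := fun r => Hp2zLoc g x₀ (unstraighten g x₀ (fold (y r)))) hs ha
      (fun r _ => abs_nonneg _) (by rw [hη, mul_zero]) (by simp [hz]) hcv
      ((h.continuousWithinAt_base hsJ).abs.mono hsub) (hac.tendsto.mono_left
        (nhdsWithin_mono _ hsub)) ?_ ?_
    · filter_upwards [self_mem_nhdsWithin] with r hr _
      obtain ⟨hrJ, hrreg⟩ := mem_diff_jumpSet.1 hr
      have habs := (h.hasDerivWithinAt_abs hrJ hrreg).mono hsub
      by_cases hzr : (y r).2.1 0 = 0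
      · have hηr := hrreg.resolve_left (not_not.2 hzr)
        refine ⟨0, ?_, by rw [abs_zero]; positivity⟩
        rw [hEeq]
        have := (((h.hasDerivWithinAt_sq hrJ hηr).mono hsub).div_const 2).sub (habs.const_mul a₀)
        rw [hηr] at this
        convert! this using 1
        simp
      · refine ⟨_, (((((h.hasDerivWithinAt_velocity_of_ne hrJ hzr).mono hsub).pow 2).div_const 2).sub
          (habs.const_mul a₀)), le_of_eq ?_⟩
        rw [← abs_mul]
        congr 1
        simp
        ring
    · filter_upwards [self_mem_nhdsWithin] with S hS
      rw [hEeq]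
      have hSJ := hS.2.1
      exact ⟨_, ((((h.continuousWithinAt_cov hSJ).pow 2).div_const 2).sub
        (continuousWithinAt_const.mul (h.continuousWithinAt_base hSJ).abs)).tendsto.mono_left
          (nhdsWithin_mono _ hsub)⟩
  · have : normalAccel g x₀ (unstraighten g x₀ (fold (y s))) =
        Hp2zLoc g x₀ (unstraighten g x₀ (fold (y s))) := by
      unfold normalAccel
      rw [if_neg]
      exact fun hc => hc.2.2.not_gt ha
    rw [this]
    -- For `H_p² z > 0` nonsticking leaves finitely many zeros of `z` nearby, hence none close to
    -- `s` except `s`. There the equation with `z ≠ 0` holds, and the derivative passes to the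
    -- limit.
    obtain ⟨ρ, hρ, hns⟩ := h.nonsticking s hsJ hz hη ha
    have hfin := finite_zeros_of_deriv h.base_zero hns
    have hev : ∀ᶠ r in 𝓝 s, r ∈ Icc 0 ε → r ≠ s → (y r).2.1 0 ≠ 0 := by
      have h1 := (hfin.subset (sdiff_subset (t := {s}))).isClosed.isOpen_compl.mem_nhds
        (show s ∉ {t | t ∈ Icc 0 ε ∧ |t - s| < ρ ∧ (y t).2.1 0 = 0} \ {s} from fun hc => hc.2 rfl)
      filter_upwards [h1, Metric.ball_mem_nhds s hρ] with r hr1 hr2 hrJ hne hzr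
      exact hr1 ⟨⟨hrJ, hr2, hzr⟩, hne⟩
    refine hasDerivWithinAt_of_tendsto_deriv_diff ordConnected_Icc h.isDiscrete_jumpSet hs hcv
      (f' := fun r => Hp2zLoc g x₀ (unstraighten g x₀ (fold (y r)))) ?_ ?_ ?_
    · filter_upwards [nhdsWithin_le_nhds hev, self_mem_nhdsWithin] with r hr hrJ hne
      exact (h.hasDerivWithinAt_velocity_of_ne hrJ.1 (hr hrJ.1 hne)).mono hsub
    · exact hac.tendsto.mono_left (nhdsWithin_mono _ (sdiff_subset.trans hsub))
    · filter_upwards [nhdsWithin_le_nhds hev, self_mem_nhdsWithin] with S hS hSB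
      refine absurd hSB.2.2.1 (hS hSB.1 ?_)
      rintro rfl
      exact hs.2 hSB.2

theorem hasDerivWithinAt_fold (h : IsDoubledSol g x₀ ε y) {s : ℝ}
    (hs : s ∈ Icc 0 ε \ jumpSet ε y) :
    HasDerivWithinAt (fun r => fold (y r))
      (straightField g x₀ (normalAccel g x₀ (unstraighten g x₀ (fold (y s))))
        (unstraighten g x₀ (fold (y s)))) (Icc 0 ε \ jumpSet ε y) s := by
  obtain ⟨hsJ, hreg⟩ := mem_diff_jumpSet.1 hs
  have hsub : Icc 0 ε \ jumpSet ε y ⊆ Icc 0 ε := sdiff_subset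
  have hL := fun L h1 h2 => (h.apply s hsJ hreg L h1 h2).mono hsub
  have hm := fold_mem (h.mem s hsJ)
  refine hasDerivWithinAt_localPhase ?_ (fun i => ?_) ?_ fun i => ?_
  · have := hL (ContinuousLinearMap.fst ℝ ℝ _) rfl rfl
    simpa [fold, velocityField, straightField] using this
  · by_cases hi : i = 0
    · subst hi
      have h1 := (h.hasDerivWithinAt_abs hsJ hreg).mono hsub
      have h2 : (straightField g x₀ (normalAccel g x₀ (unstraighten g x₀ (fold (y s))))
          (unstraighten g x₀ (fold (y s)))).2.1 0 = sgn ((y s).2.1 0) * (y s).2.2.2 0 := by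
        have h3 := HpzLoc_unstraighten g hm
        rw [HpzLoc_eq_hamField g x₀ (unstraighten_mem g hm)] at h3
        unfold straightField
        rw [add_smul_eξ_base, h3, fold, foldAt_cov_zero]
      rw [h2]
      refine h1.congr (fun r _ => ?_) ?_ <;> rw [fold, foldAt_base_zero]
    · have := hL (projX i) (ex_base_of_ne hi) (by simp)
      convert! this using 1
      · funext r
        rw [fold, foldAt_base_of_ne _ _ hi, projX_apply]
      · simp [velocityField, straightField]
  · have := hL projτ rfl rfl
    simpa [fold, velocityField, straightField] using this
  · by_cases hi : i = 0
    · subst hi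
      have h1 := h.hasDerivWithinAt_velocity hs
      convert! h1 using 1
      · funext r
        rw [fold, foldAt_cov_zero]
      · simp [straightField]
    · have := hL (projξ i) (by simp) (eξ_cov_of_ne hi)
      convert! this using 1
      · funext r
        rw [fold, foldAt_cov_of_ne _ _ hi, projξ_apply]
      · simp [velocityField, straightField, eξ_cov_of_ne hi]

theorem hasDerivWithinAt (h : IsDoubledSol g x₀ ε y) {s : ℝ} (hs : s ∈ Icc 0 ε \ jumpSet ε y) :
    HasDerivWithinAt (fun r => unstraighten g x₀ (fold (y r)))
      (genFieldLoc g x₀ (unstraighten g x₀ (fold (y s)))) (Icc 0 ε \ jumpSet ε y) s := by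
  have h1 := hasDerivWithinAt_unstraighten g (fun v hv => fold_mem (h.mem v hv.1)) hs
    (h.hasDerivWithinAt_fold hs)
  rw [genFieldLoc_eq g (unstraighten_mem g (fold_mem (h.mem s hs.1))), unstraighten_base]
  exact h1

/-- The symbol is continuous along the curve even at jumps, because both branches give it the same
limit. -/
theorem tendsto_symbolLoc (h : IsDoubledSol g x₀ ε y) {S : ℝ} (hS : S ∈ Icc 0 ε) :
    Tendsto (fun r => symbolLoc g x₀ (unstraighten g x₀ (fold (y r)))) (𝓝[Icc 0 ε] S)
      (𝓝 (symbolLoc g x₀ (unstraighten g x₀ (foldAt 1 (y S))))) := by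
  have hf : ContinuousOn (fun u => symbolLoc g x₀ (unstraighten g x₀ u)) (coordTarget x₀) :=
    (continuousOn_symbolLoc g x₀).comp (continuousOn_unstraighten g)
      fun u hu => unstraighten_mem g hu
  have hb : ∀ e, Tendsto (fun u => symbolLoc g x₀ (unstraighten g x₀ (foldAt e u))) (𝓝 (y S))
      (𝓝 (symbolLoc g x₀ (unstraighten g x₀ (foldAt e (y S))))) := by
    intro e
    refine (hf _ (foldAt_mem e (h.mem S hS))).tendsto.comp (tendsto_nhdsWithin_iff.2
      ⟨(continuous_foldAt e).tendsto _, ?_⟩)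
    filter_upwards [(isOpen_foldDom x₀).mem_nhds (h.mem S hS)] with u hu using foldAt_mem e hu
  have h2 := hb (-1)
  rw [symbolLoc_foldAt g (h.mem S hS) (by norm_num)] at h2
  exact (tendsto_fold_of_branches (f := fun u => symbolLoc g x₀ (unstraighten g x₀ u)) (hb 1)
    h2).comp (h.continuousOn S hS)

theorem symbolLoc_eq_zero (h : IsDoubledSol g x₀ ε y) (hε : 0 < ε)
    (h0 : symbolLoc g x₀ (unstraighten g x₀ (fold (y 0))) = 0) {s : ℝ}
    (hs : s ∈ Icc 0 ε \ jumpSet ε y) :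
    symbolLoc g x₀ (unstraighten g x₀ (fold (y s))) = 0 := by
  have hsub : Icc 0 ε \ jumpSet ε y ⊆ Icc 0 ε := sdiff_subset
  have hq : ∀ r ∈ Icc 0 ε, unstraighten g x₀ (fold (y r)) ∈ coordTarget x₀ :=
    fun r hr => unstraighten_mem g (fold_mem (h.mem r hr))
  have hd : ∀ r ∈ Icc 0 ε \ jumpSet ε y,
      HasDerivWithinAt (fun r => symbolLoc g x₀ (unstraighten g x₀ (fold (y r)))) 0
        (Icc 0 ε \ jumpSet ε y) r := by
    intro r hr
    have := (symbolLoc_hasFDerivWithinAt g x₀ (hq r hr.1)).comp_hasDerivWithinAt r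
      (h.hasDerivWithinAt hr) fun v hv => coordTarget_subset x₀ (hq v hv.1)
    rwa [symbolDeriv_genFieldLoc g (hq r hr.1)] at this
  have hconst : ∀ r ∈ Icc 0 ε \ jumpSet ε y, symbolLoc g x₀ (unstraighten g x₀ (fold (y r))) =
      symbolLoc g x₀ (unstraighten g x₀ (fold (y s))) := by
    intro r hr
    have := abs_sub_le_of_hasDerivWithinAt_diff ordConnected_Icc h.isDiscrete_jumpSet
      (f := fun r => symbolLoc g x₀ (unstraighten g x₀ (fold (y r)))) (f' := fun _ => 0) (C := 0)
      hd (by simp) (fun S hS => ⟨_, (h.tendsto_symbolLoc hS.1).mono_left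
        (nhdsWithin_mono _ hsub)⟩) hs hr
    rw [zero_mul] at this
    exact sub_eq_zero.1 (abs_nonpos_iff.1 this)
  -- Time `0` may itself be a jump, so the constant value of the symbol is compared with the initial
  -- one through a limit from the right.
  have hne : (𝓝[(Icc 0 ε \ jumpSet ε y) ∩ Ioi 0] (0 : ℝ)).NeBot :=
    nhdsWithin_diff_Ioi_neBot ordConnected_Icc h.isDiscrete_jumpSet (s := ε) ⟨hε.le, le_rfl⟩
      ⟨le_rfl, hε.le⟩ hε
  have hl := (h.tendsto_symbolLoc (S := 0) ⟨le_rfl, hε.le⟩).mono_left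
    (nhdsWithin_mono (0 : ℝ) ((inter_subset_left (t := Ioi 0)).trans hsub))
  rw [← symbolLoc_foldAt g (h.mem 0 ⟨le_rfl, hε.le⟩) (sgn_mul_self ((y 0).2.1 0))] at hl
  have hl2 : Tendsto (fun r => symbolLoc g x₀ (unstraighten g x₀ (fold (y r))))
      (𝓝[(Icc 0 ε \ jumpSet ε y) ∩ Ioi 0] (0 : ℝ))
      (𝓝 (symbolLoc g x₀ (unstraighten g x₀ (fold (y s))))) := by
    refine tendsto_const_nhds.congr' ?_
    filter_upwards [self_mem_nhdsWithin] with r hr using (hconst r hr.1).symm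
  rw [tendsto_nhds_unique hl2 hl]
  exact h0

theorem tendsto_of_sgn (h : IsDoubledSol g x₀ ε y) {S e : ℝ} (hS : S ∈ Icc 0 ε) {T : Set ℝ}
    (hT : T ⊆ Icc 0 ε) (he : ∀ᶠ s in 𝓝[T] S, sgn ((y s).2.1 0) = e) :
    Tendsto (fun r => unstraighten g x₀ (fold (y r))) (𝓝[T] S)
      (𝓝 (unstraighten g x₀ (foldAt e (y S)))) := by
  have h1 : Tendsto (fun r => foldAt e (y r)) (𝓝[T] S) (𝓝[coordTarget x₀] (foldAt e (y S))) := by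
    refine tendsto_nhdsWithin_iff.2 ⟨((continuous_foldAt e).tendsto _).comp
      ((h.continuousOn S hS).tendsto.mono_left (nhdsWithin_mono _ hT)), ?_⟩
    filter_upwards [self_mem_nhdsWithin] with r hr using foldAt_mem e (h.mem r (hT hr))
  refine ((continuousOn_unstraighten g _ (foldAt_mem e (h.mem S hS))).tendsto.comp h1).congr' ?_
  filter_upwards [he] with r hr
  rw [fold, hr, Function.comp_apply]

theorem isGenBichar [T2Space M] (h : IsDoubledSol g x₀ ε y) (hε : 0 < ε)
    (h0 : symbolLoc g x₀ (unstraighten g x₀ (fold (y 0))) = 0) :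
    IsGenBichar g (Icc 0 ε) (jumpSet ε y)
      (fun s => coordInv x₀ (unstraighten g x₀ (fold (y s)))) := by
  have hsub : Icc 0 ε \ jumpSet ε y ⊆ Icc 0 ε := sdiff_subset
  refine isGenBichar_of_coord g ordConnected_Icc ?_ (fun s hs => hs.1) h.isDiscrete_jumpSet
    (fun s hs => unstraighten_mem g (fold_mem (h.mem s hs.1)))
    (fun s hs => h.symbolLoc_eq_zero hε h0 hs) ?_ (fun s hs => h.hasDerivWithinAt hs) ?_
  · exact ⟨0, ⟨le_rfl, hε.le⟩, ε, ⟨hε.le, le_rfl⟩, hε.ne⟩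
  · intro s hs hz
    obtain ⟨hsJ, hreg⟩ := mem_diff_jumpSet.1 hs
    rw [unstraighten_base, fold, foldAt_base_zero, abs_eq_zero] at hz
    rw [HpzLoc_unstraighten g (fold_mem (h.mem s hsJ)), fold, foldAt_cov_zero,
      hreg.resolve_left (not_not.2 hz), mul_zero]
  · intro S hS
    have hm := h.mem S hS.1
    have hd : Icc 0 ε \ jumpSet ε y ⊆ Icc 0 ε \ {S} := by
      rintro r ⟨hr, hrB⟩
      refine ⟨hr, ?_⟩
      rintro rfl
      exact hrB hS
    have hev := (h.sgn_eventually hS).filter_mono (nhdsWithin_mono S hd)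
    -- The curve is on the copy of sign `-e` before `S` and of sign `e` after. Once folded, the
    -- normal velocity arrives as `-|ζ|` and leaves as `|ζ|`.
    set e := sgn ((y S).2.2.2 0) with he
    have hee : e * e = 1 := sgn_mul_self _
    have hpos : 0 < e * (y S).2.2.2 0 := by
      rw [sgn_mul_eq_abs]
      exact abs_pos.2 hS.2.2
    have hmm := foldAt_mem (-e) hm
    have hG := dualCoef_zero_pos g hmm
    have hS0 : symbolLoc g x₀ (unstraighten g x₀ (foldAt 1 (y S))) = 0 := by
      have hne : (𝓝[Icc 0 ε \ jumpSet ε y] S).NeBot := by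
        rcases hS.1.1.eq_or_lt with h1 | h1
        · have := nhdsWithin_diff_Ioi_neBot ordConnected_Icc h.isDiscrete_jumpSet (s := ε)
            ⟨hε.le, le_rfl⟩ hS.1 (h1 ▸ hε)
          exact this.mono (nhdsWithin_mono _ inter_subset_left)
        · have := nhdsWithin_diff_Iio_neBot ordConnected_Icc h.isDiscrete_jumpSet (s := 0)
            ⟨le_rfl, hε.le⟩ hS.1 h1
          exact this.mono (nhdsWithin_mono _ inter_subset_left)
      refine tendsto_nhds_unique ((h.tendsto_symbolLoc hS.1).mono_left (nhdsWithin_mono _ hsub))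
        (tendsto_const_nhds.congr' ?_)
      filter_upwards [self_mem_nhdsWithin] with r hr using (h.symbolLoc_eq_zero hε h0 hr).symm
    refine ⟨?_, unstraighten g x₀ (foldAt (-e) (y S)), unstraighten_mem g hmm, ?_, ?_, ?_, ?_, ?_⟩
    · filter_upwards [hev] with s hs
      rw [unstraighten_base, fold, foldAt_base_zero]
      exact abs_ne_zero.2 hs.1
    · rw [unstraighten_base, foldAt_base_zero, hS.2.1, abs_zero]
    · rw [symbolLoc_foldAt g hm (by rw [neg_mul_neg, hee]), hS0]
    · rw [HpzLoc_unstraighten g hmm, foldAt_cov_zero]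
      linarith
    · refine h.tendsto_of_sgn hS.1 (inter_subset_left.trans hsub) ?_
      filter_upwards [hev.filter_mono (nhdsWithin_mono _ inter_subset_left), self_mem_nhdsWithin]
        with s hs hsS
      rw [hs.2, sgn_of_neg (sub_neg.2 hsS.2), neg_one_mul]
    · have h1 := h.tendsto_of_sgn (e := e) hS.1
        ((inter_subset_left (s := Icc 0 ε \ jumpSet ε y) (t := Ioi S)).trans hsub) (by
          filter_upwards [hev.filter_mono (nhdsWithin_mono _ inter_subset_left),
            self_mem_nhdsWithin] with s hs hsS
          rw [hs.2, sgn_of_nonneg (sub_pos.2 hsS.2).le, one_mul])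
      convert! h1 using 2
      rw [foldAt_eq_add (-e) (y S) e, unstraighten_add g hmm, HpzLoc_unstraighten g hmm,
        unstraighten_base, foldAt_cov_zero, sub_eq_add_neg, ← neg_smul]
      congr 2
      field_simp
      ring

end IsDoubledSol

/-- Local existence of generalized bicharacteristics, forward in time. -/
theorem exists_local_forward [T2Space M] (g : Metric d M) {ρ₀ : Phase d M} (hρ : ρ₀ ∈ charSet g)
    (hm : ρ₀ ∉ hypMinus g) :
    ∃ ε > 0, ∃ (B : Set ℝ) (γ : ℝ → Phase d M), IsGenBichar g (Icc 0 ε) B γ ∧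
      (ρ₀ ∉ hypPlus g → 0 ∉ B ∧ γ 0 = ρ₀) ∧
      (ρ₀ ∈ hypPlus g → 0 ∈ B ∧ Tendsto γ (𝓝[(Icc 0 ε \ B) ∩ Ioi 0] 0) (𝓝 ρ₀)) := by
  set x₀ := Phase.base ρ₀ with hx₀
  have hd : ρ₀ ∈ chartDom x₀ := mem_chartDom_base ρ₀
  have hq := coord_mem_coordTarget hd
  set q₀ := coord x₀ ρ₀ with hq₀
  -- The start is on the first copy. A point of `ℋ⁺` enters it at once, with time `0` as a jump;
  -- from a point of `ℋ⁻` the curve would pass to the second copy and start at the reflected point,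
  -- whence its exclusion.
  set y₀ := straighten g x₀ q₀ with hy₀
  have hy0m : y₀ ∈ coordTarget x₀ := straighten_mem g hq
  have hnn : 0 ≤ y₀.2.1 0 := coordTarget_subset x₀ hy0m
  have hfold : fold y₀ = y₀ := fold_of_nonneg hnn
  have hf1 : foldAt 1 y₀ = y₀ := by
    rw [← sgn_of_nonneg hnn]
    exact hfold
  have hz : y₀.2.1 0 = q₀.2.1 0 := by rw [hy₀, straighten_base]
  have hζ : y₀.2.2.2 0 = HpzLoc g x₀ q₀ := straighten_cov_zero g
  have hp : symbolLoc g x₀ q₀ = 0 := (mem_charSet_iff g hd).1 hρ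
  obtain ⟨ε, hε, y, hy, h0⟩ := exists_isDoubledSol g (y₀ := y₀) (x₀ := x₀) (by
    unfold foldDom
    rw [mem_ofPred_eq, hf1]
    exact hy0m)
  have h0J : (0 : ℝ) ∈ Icc 0 ε := ⟨le_rfl, hε.le⟩
  refine ⟨ε, hε, jumpSet ε y, _, hy.isGenBichar hε (by
    rw [h0, hfold, unstraighten_straighten g hq, hp]), fun hpl => ⟨fun hB => ?_, ?_⟩,
    fun hpl => ?_⟩
  · have h1 := hB.2.1
    have h2 := hB.2.2
    rw [h0, hz] at h1
    rw [h0, hζ] at h2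
    rcases lt_or_gt_of_ne h2 with h3 | h3
    · exact hm ((mem_hypMinus_iff g hd).2 ⟨h1, hp, h3⟩)
    · exact hpl ((mem_hypPlus_iff g hd).2 ⟨h1, hp, h3⟩)
  · rw [h0, hfold, unstraighten_straighten g hq, coordInv_coord hd]
  · obtain ⟨h1, -, h3⟩ := (mem_hypPlus_iff g hd).1 hpl
    have hB : (0 : ℝ) ∈ jumpSet ε y := ⟨h0J, by rw [h0, hz, h1], by rw [h0, hζ]; exact h3.ne'⟩
    refine ⟨hB, ?_⟩
    have hsub : (Icc 0 ε \ jumpSet ε y) ∩ Ioi 0 ⊆ Icc 0 ε \ {0} :=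
      fun r hr => ⟨hr.1.1, hr.2.ne'⟩
    have h4 := hy.tendsto_of_sgn (e := 1) (T := (Icc 0 ε \ jumpSet ε y) ∩ Ioi 0) h0J
      (hsub.trans sdiff_subset) (by
        filter_upwards [(hy.sgn_eventually hB).filter_mono (nhdsWithin_mono _ hsub),
          self_mem_nhdsWithin] with s hs hs0
        rw [hs.2, sgn_of_nonneg (by simpa using hs0.2.le), h0, hζ, sgn_of_nonneg h3.le, one_mul])
    rw [h0, hf1, unstraighten_straighten g hq] at h4
    have h5 : Tendsto (fun r => unstraighten g x₀ (fold (y r)))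
        (𝓝[(Icc 0 ε \ jumpSet ε y) ∩ Ioi 0] 0) (𝓝[coordTarget x₀] q₀) := by
      refine tendsto_nhdsWithin_iff.2 ⟨h4, ?_⟩
      filter_upwards [self_mem_nhdsWithin] with r hr
      exact unstraighten_mem g (fold_mem (hy.mem r hr.1.1))
    have h6 := (continuousOn_coordInv x₀ q₀ hq).tendsto.comp h5
    rwa [coordInv_coord hd] at h6

/-! ### Localization of the definition -/

/-- The conditions in the definition of a generalized bicharacteristic at the time `s`. -/
structure GenBicharAt (g : Metric d M) (J B : Set ℝ) (γ : ℝ → Phase d M) (s : ℝ) : Prop where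
  isolated : s ∈ B → ∀ᶠ r in 𝓝[≠] s, r ∉ B
  mem_char : s ∉ B → γ s ∈ charSet g
  notMem_hyp : s ∉ B → γ s ∉ hyp g
  continuousWithinAt : s ∉ B → ContinuousWithinAt γ (J \ B) s
  hasDeriv : s ∉ B →
    HasDerivWithinAt (fun r => coord (Phase.base (γ s)) (γ r)) (genField g (γ s)) (J \ B) s
  interior_near : s ∈ B → ∀ᶠ r in 𝓝[J \ B] s, γ r ∉ boundaryPhase
  limit_left : s ∈ B → (∃ ε > 0, Icc (s - ε) s ⊆ J) →
    ∃ ρ ∈ hypMinus g, Tendsto γ (𝓝[(J \ B) ∩ Iio s] s) (𝓝 ρ)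
  limit_right : s ∈ B → (∃ ε > 0, Icc s (s + ε) ⊆ J) →
    ∃ ρ ∈ hypPlus g, Tendsto γ (𝓝[(J \ B) ∩ Ioi s] s) (𝓝 ρ)
  reflect : s ∈ B → (∃ ε > 0, Icc (s - ε) (s + ε) ⊆ J) →
    ∀ ρ₁ ρ₂ : Phase d M, Tendsto γ (𝓝[(J \ B) ∩ Iio s] s) (𝓝 ρ₁) →
      Tendsto γ (𝓝[(J \ B) ∩ Ioi s] s) (𝓝 ρ₂) → ρ₂ = reflection g ρ₁

theorem eventually_notMem_of_isDiscrete {B : Set ℝ} (hB : IsDiscrete B) {s : ℝ} (hs : s ∈ B) :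
    ∀ᶠ r in 𝓝[≠] s, r ∉ B := by
  have h := isDiscrete_iff_nhdsNE.1 hB s hs
  rwa [← disjoint_iff, disjoint_principal_right] at h

/-- Apart from the shape of `J` and `B ⊆ J`, the definition is a condition at each time, depending
only on germs; gluing and unions of chains rely on this. -/
theorem isGenBichar_iff (g : Metric d M) {J B : Set ℝ} {γ : ℝ → Phase d M} :
    IsGenBichar g J B γ ↔ J.OrdConnected ∧ J.Nontrivial ∧ B ⊆ J ∧
      ∀ s ∈ J, GenBicharAt g J B γ s := by
  constructor
  · intro h
    refine ⟨h.ordConnected, h.nontrivial, h.subset, fun s hs => ⟨?_, ?_, ?_, ?_, ?_, ?_, ?_, ?_, ?_⟩⟩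
    · exact fun hB => eventually_notMem_of_isDiscrete h.discrete hB
    · exact fun hB => h.mem_char s ⟨hs, hB⟩
    · exact fun hB => h.notMem_hyp s ⟨hs, hB⟩
    · exact fun hB => h.continuousWithinAt s ⟨hs, hB⟩
    · exact fun hB => h.hasDeriv s ⟨hs, hB⟩
    · exact h.interior_near s
    · exact h.limit_left s
    · exact h.limit_right s
    · exact h.reflect s
  · rintro ⟨h1, h2, h3, h⟩
    refine ⟨h1, h2, h3, ?_, fun s hs => (h s hs.1).mem_char hs.2,
      fun s hs => (h s hs.1).notMem_hyp hs.2, fun s hs => (h s hs.1).continuousWithinAt hs.2,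
      fun s hs => (h s hs.1).hasDeriv hs.2, fun S hS => (h S (h3 hS)).interior_near hS,
      fun S hS => (h S (h3 hS)).limit_left hS, fun S hS => (h S (h3 hS)).limit_right hS,
      fun S hS => (h S (h3 hS)).reflect hS⟩
    rw [isDiscrete_iff_nhdsNE]
    intro S hS
    rw [← disjoint_iff, disjoint_principal_right]
    exact (h S (h3 hS)).isolated hS

theorem IsGenBichar.at {g : Metric d M} {J B : Set ℝ} {γ : ℝ → Phase d M}
    (h : IsGenBichar g J B γ) {s : ℝ} (hs : s ∈ J) : GenBicharAt g J B γ s :=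
  ((isGenBichar_iff g).1 h).2.2.2 s hs

theorem exists_Icc_subset_of_inter {J J' U : Set ℝ} {s : ℝ} (hU : U ∈ 𝓝 s) (hJ : J ∩ U = J' ∩ U) :
    ((∃ ε > 0, Icc (s - ε) s ⊆ J) → ∃ ε > 0, Icc (s - ε) s ⊆ J') ∧
    ((∃ ε > 0, Icc s (s + ε) ⊆ J) → ∃ ε > 0, Icc s (s + ε) ⊆ J') ∧
    ((∃ ε > 0, Icc (s - ε) (s + ε) ⊆ J) → ∃ ε > 0, Icc (s - ε) (s + ε) ⊆ J') := by
  obtain ⟨δ, hδ, hball⟩ := Metric.mem_nhds_iff.1 hU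
  have key : ∀ r, |r - s| < δ → r ∈ J → r ∈ J' := fun r hr hrJ =>
    ((Set.ext_iff.1 hJ r).1 ⟨hrJ, hball hr⟩).1
  refine ⟨?_, ?_, ?_⟩ <;> rintro ⟨ε, hε, hsub⟩ <;>
    refine ⟨min ε (δ / 2), by positivity, fun r hr => key r ?_ (hsub ⟨?_, ?_⟩)⟩ <;>
    have h1 := min_le_left ε (δ / 2) <;> have h2 := min_le_right ε (δ / 2) <;>
    first
      | (rw [abs_lt]; constructor <;> linarith [hr.1, hr.2])
      | linarith [hr.1, hr.2]

/-- The conditions at `s` only depend on the germ at `s`. -/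
theorem GenBicharAt.congr {g : Metric d M} {J B J' B' : Set ℝ} {γ γ' : ℝ → Phase d M} {s : ℝ}
    (h : GenBicharAt g J B γ s) {U : Set ℝ} (hU : U ∈ 𝓝 s) (hs : s ∈ J) (hJ : J ∩ U = J' ∩ U)
    (hB : B ∩ U = B' ∩ U) (hγ : EqOn γ γ' ((J \ B) ∩ U)) : GenBicharAt g J' B' γ' s := by
  have hsU : s ∈ U := mem_of_mem_nhds hU
  have hsB : s ∈ B ↔ s ∈ B' :=
    ⟨fun hx => ((Set.ext_iff.1 hB s).1 ⟨hx, hsU⟩).1, fun hx => ((Set.ext_iff.1 hB s).2 ⟨hx, hsU⟩).1⟩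
  have hset : (J \ B) ∩ U = (J' \ B') ∩ U := by
    ext r
    have h1 := Set.ext_iff.1 hJ r
    have h2 := Set.ext_iff.1 hB r
    simp only [mem_inter_iff, Set.mem_sdiff] at h1 h2 ⊢
    tauto
  have hnh : ∀ T, 𝓝[(J \ B) ∩ T] s = 𝓝[(J' \ B') ∩ T] s := fun T =>
    nhdsWithin_eq_nhdsWithin' hU (by rw [inter_right_comm, hset, inter_right_comm])
  have hn : 𝓝[J \ B] s = 𝓝[J' \ B'] s := nhdsWithin_eq_nhdsWithin' hU hset
  have hee : ∀ T, γ =ᶠ[𝓝[(J \ B) ∩ T] s] γ' := by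
    intro T
    filter_upwards [self_mem_nhdsWithin, nhdsWithin_le_nhds hU] with r hr hrU
    exact hγ ⟨hr.1, hrU⟩
  have hee' : γ =ᶠ[𝓝[J \ B] s] γ' := by
    filter_upwards [self_mem_nhdsWithin, nhdsWithin_le_nhds hU] with r hr hrU
    exact hγ ⟨hr, hrU⟩
  have hval : s ∉ B → γ s = γ' s := fun hsB => hγ ⟨⟨hs, hsB⟩, hsU⟩
  have hIcc := exists_Icc_subset_of_inter hU hJ.symm
  refine ⟨?_, ?_, ?_, ?_, ?_, ?_, ?_, ?_, ?_⟩
  · intro hx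
    filter_upwards [h.isolated (hsB.2 hx), nhdsWithin_le_nhds hU] with r hr hrU hrB
    exact hr ((Set.ext_iff.1 hB r).2 ⟨hrB, hrU⟩).1
  · intro hx
    rw [← hval (hsB.not.2 hx)]
    exact h.mem_char (hsB.not.2 hx)
  · intro hx
    rw [← hval (hsB.not.2 hx)]
    exact h.notMem_hyp (hsB.not.2 hx)
  · intro hx
    have h1 := h.continuousWithinAt (hsB.not.2 hx)
    unfold ContinuousWithinAt at h1 ⊢
    rw [← hn, ← hval (hsB.not.2 hx)]
    exact h1.congr' hee'
  · intro hx
    have h1 := h.hasDeriv (hsB.not.2 hx)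
    rw [← hval (hsB.not.2 hx)]
    have h2 : HasDerivWithinAt (fun r => coord (Phase.base (γ s)) (γ' r)) (genField g (γ s))
        (J \ B) s := by
      refine h1.congr_of_eventuallyEq (hee'.symm.fun_comp (coord (Phase.base (γ s)))) ?_
      rw [hval (hsB.not.2 hx)]
    exact (hasDerivWithinAt_congr_set' (y := s + 1) (by
      have : (J \ B : Set ℝ) =ᶠ[𝓝 s] (J' \ B' : Set ℝ) := by
        filter_upwards [hU] with r hr
        have := Set.ext_iff.1 hset r
        simp only [mem_inter_iff, hr, and_true] at this
        exact propext this
      exact this.filter_mono nhdsWithin_le_nhds)).1 h2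
  · intro hx
    rw [← hn]
    filter_upwards [h.interior_near (hsB.2 hx), hee'] with r hr1 hr2
    rwa [← hr2]
  · intro hx hε
    obtain ⟨ρ, hρ, ht⟩ := h.limit_left (hsB.2 hx) (hIcc.1 hε)
    exact ⟨ρ, hρ, (hnh _) ▸ ht.congr' (hee _)⟩
  · intro hx hε
    obtain ⟨ρ, hρ, ht⟩ := h.limit_right (hsB.2 hx) (hIcc.2.1 hε)
    exact ⟨ρ, hρ, (hnh _) ▸ ht.congr' (hee _)⟩
  · intro hx hε ρ₁ ρ₂ h1 h2
    refine h.reflect (hsB.2 hx) (hIcc.2.2 hε) ρ₁ ρ₂ ?_ ?_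
    · rw [← hnh] at h1
      exact h1.congr' (hee _).symm
    · rw [← hnh] at h2
      exact h2.congr' (hee _).symm

/-! ### Gluing -/

section Glue

variable {g : Metric d M} {J₁ J₂ B₁ B₂ : Set ℝ} {γ₁ γ₂ : ℝ → Phase d M} {b : ℝ}

/-- The concatenation of two curves at the time `b`. -/
def glue (b : ℝ) (γ₁ γ₂ : ℝ → Phase d M) (s : ℝ) : Phase d M := if s ≤ b then γ₁ s else γ₂ s

/-- Away from `b` the germ is that of one piece. At a regular `b` the two values agree, hence so do
the fields and the one-sided derivatives; at a jump only the reflection law links the pieces. -/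
theorem isGenBichar_glue (h₁ : IsGenBichar g J₁ B₁ γ₁) (h₂ : IsGenBichar g J₂ B₂ γ₂)
    (hb₁ : b ∈ J₁) (hb₂ : b ∈ J₂) (hle : ∀ s ∈ J₁, s ≤ b) (hge : ∀ s ∈ J₂, b ≤ s)
    (hB : b ∈ B₁ ↔ b ∈ B₂) (hval : b ∉ B₁ → γ₁ b = γ₂ b)
    (hrefl : b ∈ B₁ → ∀ ρ₁ ρ₂ : Phase d M, Tendsto γ₁ (𝓝[(J₁ \ B₁) ∩ Iio b] b) (𝓝 ρ₁) →
      Tendsto γ₂ (𝓝[(J₂ \ B₂) ∩ Ioi b] b) (𝓝 ρ₂) → ρ₂ = reflection g ρ₁) :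
    IsGenBichar g (J₁ ∪ J₂) (B₁ ∪ B₂) (glue b γ₁ γ₂) := by
  have hs₁ : ∀ {s}, s ∈ B₁ → s ≤ b := fun hs => hle _ (h₁.subset hs)
  have hs₂ : ∀ {s}, s ∈ B₂ → b ≤ s := fun hs => hge _ (h₂.subset hs)
  have hdiff : (J₁ ∪ J₂) \ (B₁ ∪ B₂) = (J₁ \ B₁) ∪ (J₂ \ B₂) := by
    ext s
    simp only [Set.mem_sdiff, mem_union, not_or]
    constructor
    · rintro ⟨h | h, h1, h2⟩
      · exact Or.inl ⟨h, h1⟩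
      · exact Or.inr ⟨h, h2⟩
    · rintro (⟨h, h1⟩ | ⟨h, h1⟩)
      · refine ⟨Or.inl h, h1, fun h2 => ?_⟩
        have : s = b := le_antisymm (hle s h) (hs₂ h2)
        subst this
        exact h1 (hB.2 h2)
      · refine ⟨Or.inr h, fun h2 => ?_, h1⟩
        have : s = b := le_antisymm (hs₁ h2) (hge s h)
        subst this
        exact h1 (hB.1 h2)
  have hg₁ : ∀ {s}, s ≤ b → glue b γ₁ γ₂ s = γ₁ s := fun hs => if_pos hs
  have hg₂' : ∀ {s}, b < s → glue b γ₁ γ₂ s = γ₂ s := fun hs => if_neg (not_le.2 hs)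
  have hg₂ : ∀ s ∈ J₂ \ B₂, glue b γ₁ γ₂ s = γ₂ s := by
    intro s hs
    rcases (hge s hs.1).eq_or_lt with h | h
    · subst h
      rw [hg₁ le_rfl, hval (hB.not.2 hs.2)]
    · exact hg₂' h
  -- The one-sided limits of a piece at `b` are only granted if its interval has room on that side,
  -- which nontriviality ensures.
  obtain ⟨c₁, hc₁, hc₁b⟩ : ∃ c ∈ J₁, c < b := by
    obtain ⟨u, hu, v, hv, huv⟩ := h₁.nontrivial
    rcases lt_or_gt_of_ne huv with h | h
    · exact ⟨u, hu, h.trans_le (hle v hv)⟩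
    · exact ⟨v, hv, h.trans_le (hle u hu)⟩
  obtain ⟨c₂, hc₂, hc₂b⟩ : ∃ c ∈ J₂, b < c := by
    obtain ⟨u, hu, v, hv, huv⟩ := h₂.nontrivial
    rcases lt_or_gt_of_ne huv with h | h
    · exact ⟨v, hv, (hge u hu).trans_lt h⟩
    · exact ⟨u, hu, (hge v hv).trans_lt h⟩
  have hoc : (J₁ ∪ J₂).OrdConnected := by
    refine ordConnected_of_Ioo fun u hu v hv huv s hs => ?_
    rcases hu with hu | hu <;> rcases hv with hv | hv
    · exact Or.inl (h₁.ordConnected.out hu hv ⟨hs.1.le, hs.2.le⟩)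
    · rcases le_total s b with h | h
      · exact Or.inl (h₁.ordConnected.out hu hb₁ ⟨hs.1.le, h⟩)
      · exact Or.inr (h₂.ordConnected.out hb₂ hv ⟨h, hs.2.le⟩)
    · exact absurd ((hge u hu).trans_lt (hs.1.trans hs.2)) (hle v hv).not_gt
    · exact Or.inr (h₂.ordConnected.out hu hv ⟨hs.1.le, hs.2.le⟩)
  refine (isGenBichar_iff g).2 ⟨hoc, h₁.nontrivial.mono subset_union_left,
    union_subset_union h₁.subset h₂.subset, fun s hs => ?_⟩
  rcases lt_trichotomy s b with hsb | hsb | hsb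
  · have hsJ : s ∈ J₁ := hs.resolve_right fun h => (hge s h).not_gt hsb
    refine (h₁.at hsJ).congr (U := Iio b) (Iio_mem_nhds hsb) hsJ ?_ ?_ ?_
    · ext r
      simp only [mem_inter_iff, mem_union, mem_Iio]
      exact ⟨fun h => ⟨Or.inl h.1, h.2⟩,
        fun h => ⟨h.1.resolve_right fun hr => (hge r hr).not_gt h.2, h.2⟩⟩
    · ext r
      simp only [mem_inter_iff, mem_union, mem_Iio]
      exact ⟨fun h => ⟨Or.inl h.1, h.2⟩,
        fun h => ⟨h.1.resolve_right fun hr => (hs₂ hr).not_gt h.2, h.2⟩⟩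
    · exact fun r hr => (hg₁ hr.2.le).symm
  · subst hsb
    have hP₁ := h₁.at hb₁
    have hP₂ := h₂.at hb₂
    have hl : ((J₁ ∪ J₂) \ (B₁ ∪ B₂)) ∩ Iio s = (J₁ \ B₁) ∩ Iio s := by
      rw [hdiff, union_inter_distrib_right]
      refine union_eq_left.2 fun r hr => absurd (hge r hr.1.1) (not_le.2 hr.2)
    have hr : ((J₁ ∪ J₂) \ (B₁ ∪ B₂)) ∩ Ioi s = (J₂ \ B₂) ∩ Ioi s := by
      rw [hdiff, union_inter_distrib_right]
      refine union_eq_right.2 fun r hr => absurd (hle r hr.1.1) (not_le.2 hr.2)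
    have hB' : s ∈ B₁ ∪ B₂ ↔ s ∈ B₁ := by rw [mem_union, ← hB, or_self]
    have el : glue s γ₁ γ₂ =ᶠ[𝓝[(J₁ \ B₁) ∩ Iio s] s] γ₁ := by
      filter_upwards [self_mem_nhdsWithin] with r hr using hg₁ hr.2.le
    have er : glue s γ₁ γ₂ =ᶠ[𝓝[(J₂ \ B₂) ∩ Ioi s] s] γ₂ := by
      filter_upwards [self_mem_nhdsWithin] with r hr using hg₂' hr.2
    refine ⟨?_, ?_, ?_, ?_, ?_, ?_, ?_, ?_, ?_⟩
    · intro hx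
      filter_upwards [hP₁.isolated (hB'.1 hx), hP₂.isolated (hB.1 (hB'.1 hx))] with r hr1 hr2 hr3
      exact hr3.elim hr1 hr2
    · rw [hB', hg₁ le_rfl]
      exact hP₁.mem_char
    · rw [hB', hg₁ le_rfl]
      exact hP₁.notMem_hyp
    · rw [hB']
      intro hx
      rw [hdiff]
      refine ContinuousWithinAt.union ?_ ?_
      · exact (hP₁.continuousWithinAt hx).congr (fun r hr => hg₁ (hle r hr.1)) (hg₁ le_rfl)
      · exact (hP₂.continuousWithinAt (hB.not.1 hx)).congr hg₂ (hg₂ s ⟨hb₂, hB.not.1 hx⟩)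
    · rw [hB']
      intro hx
      rw [hdiff]
      refine HasDerivWithinAt.union ?_ ?_
      · rw [hg₁ le_rfl]
        refine (hP₁.hasDeriv hx).congr (fun r hr => ?_) ?_
        · rw [hg₁ (hle r hr.1)]
        · rw [hg₁ le_rfl]
      · rw [hg₂ s ⟨hb₂, hB.not.1 hx⟩]
        refine (hP₂.hasDeriv (hB.not.1 hx)).congr (fun r hr => ?_) ?_
        · rw [hg₂ r hr]
        · rw [hg₂ s ⟨hb₂, hB.not.1 hx⟩]
    · rw [hB']
      intro hx
      rw [hdiff, nhdsWithin_union, eventually_sup]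
      constructor
      · filter_upwards [hP₁.interior_near hx, self_mem_nhdsWithin] with r hr1 hr2
        rwa [hg₁ (hle r hr2.1)]
      · filter_upwards [hP₂.interior_near (hB.1 hx), self_mem_nhdsWithin] with r hr1 hr2
        rwa [hg₂ r hr2]
    · rw [hB', hl]
      intro hx _
      obtain ⟨ρ, hρ, ht⟩ := hP₁.limit_left hx ⟨s - c₁, by linarith, by
        rw [sub_sub_cancel]
        exact h₁.ordConnected.out hc₁ hb₁⟩
      exact ⟨ρ, hρ, ht.congr' el.symm⟩
    · rw [hB', hr]
      intro hx _
      obtain ⟨ρ, hρ, ht⟩ := hP₂.limit_right (hB.1 hx) ⟨c₂ - s, by linarith, by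
        rw [add_sub_cancel]
        exact h₂.ordConnected.out hb₂ hc₂⟩
      exact ⟨ρ, hρ, ht.congr' er.symm⟩
    · rw [hB', hl, hr]
      intro hx _ ρ₁ ρ₂ t1 t2
      exact hrefl hx ρ₁ ρ₂ (t1.congr' el) (t2.congr' er)
  · have hsJ : s ∈ J₂ := hs.resolve_left fun h => (hle s h).not_gt hsb
    refine (h₂.at hsJ).congr (U := Ioi b) (Ioi_mem_nhds hsb) hsJ ?_ ?_ ?_
    · ext r
      simp only [mem_inter_iff, mem_union, mem_Ioi]
      exact ⟨fun h => ⟨Or.inr h.1, h.2⟩,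
        fun h => ⟨h.1.resolve_left fun hr => (hle r hr).not_gt h.2, h.2⟩⟩
    · ext r
      simp only [mem_inter_iff, mem_union, mem_Ioi]
      exact ⟨fun h => ⟨Or.inr h.1, h.2⟩,
        fun h => ⟨h.1.resolve_left fun hr => (hs₁ hr).not_gt h.2, h.2⟩⟩
    · exact fun r hr => (hg₂' hr.2).symm

end Glue

/-! ### Translation of the parameter -/

theorem map_nhdsWithin_homeomorph (φ : ℝ ≃ₜ ℝ) (A : Set ℝ) (s : ℝ) :
    map φ (𝓝[φ ⁻¹' A] s) = 𝓝[A] (φ s) :=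
  φ.isOpenEmbedding.map_nhdsWithin_preimage_eq A s

theorem isDiscrete_preimage (φ : ℝ ≃ₜ ℝ) {B : Set ℝ} (hB : IsDiscrete B) :
    IsDiscrete (φ ⁻¹' B) := by
  rw [isDiscrete_iff_nhdsNE]
  intro S hS
  rw [← disjoint_iff, disjoint_principal_right]
  have h1 := eventually_notMem_of_isDiscrete hB (show φ S ∈ B from hS)
  rw [← map_nhdsWithin_homeomorph, eventually_map] at h1
  have h2 : φ ⁻¹' {φ S}ᶜ = {S}ᶜ := by
    ext r
    simp
  rwa [h2] at h1

theorem IsGenBichar.translate {g : Metric d M} {J B : Set ℝ} {γ : ℝ → Phase d M}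
    (h : IsGenBichar g J B γ) (c : ℝ) :
    IsGenBichar g ((fun s => s + c) ⁻¹' J) ((fun s => s + c) ⁻¹' B) (fun s => γ (s + c)) := by
  set φ := Homeomorph.addRight c with hφ
  have hφs : ∀ s, φ s = s + c := fun s => rfl
  have hlim : ∀ {S : ℝ} {A : Set ℝ} {ρ : Phase d M}, Tendsto γ (𝓝[A] (S + c)) (𝓝 ρ) ↔
      Tendsto (fun s => γ (s + c)) (𝓝[(fun s => s + c) ⁻¹' A] S) (𝓝 ρ) := by
    intro S A ρ
    have := map_nhdsWithin_homeomorph φ A S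
    rw [← hφs, ← this, tendsto_map'_iff]
    rfl
  have hI : ∀ {J : Set ℝ} {u v : ℝ}, Icc u v ⊆ (fun s => s + c) ⁻¹' J →
      Icc (u + c) (v + c) ⊆ J := by
    intro J u v hs r hr
    have := hs (show r - c ∈ Icc u v from ⟨by linarith [hr.1], by linarith [hr.2]⟩)
    rwa [mem_preimage, sub_add_cancel] at this
  have hIio : ∀ S, (fun s => s + c) ⁻¹' Iio (S + c) = Iio S := fun S => by ext; simp
  have hIoi : ∀ S, (fun s => s + c) ⁻¹' Ioi (S + c) = Ioi S := fun S => by ext; simp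
  refine ⟨?_, ?_, fun s hs => h.subset hs, isDiscrete_preimage φ h.discrete,
    fun s hs => h.mem_char _ hs, fun s hs => h.notMem_hyp _ hs,
    fun s hs => hlim.1 (h.continuousWithinAt _ hs), ?_, ?_, ?_, ?_, ?_⟩
  · exact h.ordConnected.preimage_mono fun u v huv => by simpa using huv
  · obtain ⟨u, hu, v, hv, huv⟩ := h.nontrivial
    exact ⟨u - c, by simpa, v - c, by simpa, by simpa⟩
  · intro s hs
    have h1 := h.hasDeriv _ hs
    have h2 : HasDerivWithinAt (fun r : ℝ => r + c) 1 ((fun s => s + c) ⁻¹' (J \ B)) s :=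
      ((hasDerivAt_id s).add_const c).hasDerivWithinAt
    have h3 := HasDerivWithinAt.scomp s h1 h2 (fun r hr => hr)
    rw [one_smul] at h3
    exact h3
  · intro S hS
    have h1 : ∀ᶠ s in 𝓝[J \ B] (φ S), γ s ∉ boundaryPhase := h.interior_near _ hS
    rw [← map_nhdsWithin_homeomorph, eventually_map] at h1
    exact h1
  · rintro S hS ⟨ε, hε, hsub⟩
    obtain ⟨ρ, hρ, ht⟩ := h.limit_left _ hS ⟨ε, hε, by
      have := hI hsub
      rwa [sub_add_eq_add_sub] at this⟩
    rw [hlim, preimage_inter, hIio] at ht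
    exact ⟨ρ, hρ, ht⟩
  · rintro S hS ⟨ε, hε, hsub⟩
    obtain ⟨ρ, hρ, ht⟩ := h.limit_right _ hS ⟨ε, hε, by
      have := hI hsub
      rwa [add_right_comm] at this⟩
    rw [hlim, preimage_inter, hIoi] at ht
    exact ⟨ρ, hρ, ht⟩
  · rintro S hS ⟨ε, hε, hsub⟩ ρ₁ ρ₂ h1 h2
    refine h.reflect _ hS ⟨ε, hε, by
      have := hI hsub
      rwa [add_right_comm, sub_add_eq_add_sub] at this⟩ ρ₁ ρ₂ ?_ ?_
    · rw [hlim, preimage_inter, hIio]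
      exact h1
    · rw [hlim, preimage_inter, hIoi]
      exact h2

/-! ### Reversal of time -/

/-- The change of sign of the momenta in coordinates. -/
def reverseLoc : LocalPhase d →L[ℝ] LocalPhase d :=
  (ContinuousLinearMap.fst ℝ ℝ (Model d × ℝ × Model d)).prod
    (projBase.prod ((-projτ).prod (-projCov)))

theorem reverseLoc_apply (q : LocalPhase d) : reverseLoc q = (q.1, q.2.1, -q.2.2.1, -q.2.2.2) := rfl

theorem reverseLoc_eξ : reverseLoc (eξ (d := d)) = -eξ := by
  simp [reverseLoc_apply, eξ]

section ReverseLoc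

variable (g : Metric d M) {x₀ : M} {q : LocalPhase d}

theorem reverseLoc_mem (hq : q ∈ coordTarget x₀) : reverseLoc q ∈ coordTarget x₀ := hq

theorem symbolLoc_reverseLoc : symbolLoc g x₀ (reverseLoc q) = symbolLoc g x₀ q := by
  simp [symbolLoc, reverseLoc_apply, cometric_eq]

/-- The symbol is even in the momenta, so its momentum derivatives are odd and its position
derivatives even. Changing the sign of the momenta therefore reverses the flow. -/
theorem hamField_reverseLoc (hq : q ∈ coordTarget x₀) :
    hamField (symbolLoc g x₀) (reverseLoc q) = -reverseLoc (hamField (symbolLoc g x₀) q) := by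
  rw [hamField_symbolLoc g x₀ hq, hamField_symbolLoc g x₀ (reverseLoc_mem hq), reverseLoc_apply,
    reverseLoc_apply]
  refine Prod.ext (by simp) (Prod.ext ?_ (Prod.ext (by simp) ?_))
  · ext i
    simp
  · ext i
    simp

theorem HpzLoc_reverseLoc (hq : q ∈ coordTarget x₀) :
    HpzLoc g x₀ (reverseLoc q) = -HpzLoc g x₀ q := by
  rw [HpzLoc_eq_hamField g x₀ hq, HpzLoc_eq_hamField g x₀ (reverseLoc_mem hq),
    hamField_reverseLoc g hq]
  rfl

theorem Hp2zLoc_reverseLoc (hq : q ∈ coordTarget x₀) :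
    Hp2zLoc g x₀ (reverseLoc q) = Hp2zLoc g x₀ q := by
  rw [Hp2zLoc_eq g x₀ hq, Hp2zLoc_eq g x₀ (reverseLoc_mem hq), hamField_reverseLoc g hq]
  simp [HpzDeriv, reverseLoc_apply]

theorem genFieldLoc_reverseLoc (hq : q ∈ coordTarget x₀) :
    genFieldLoc g x₀ (reverseLoc q) = -reverseLoc (genFieldLoc g x₀ q) := by
  have hn : normalAccel g x₀ (reverseLoc q) = normalAccel g x₀ q := by
    unfold normalAccel
    simp only [HpzLoc_reverseLoc g hq, Hp2zLoc_reverseLoc g hq, neg_eq_zero]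
    rfl
  rw [genFieldLoc_eq g hq, genFieldLoc_eq g (reverseLoc_mem hq), hn, Hp2zLoc_reverseLoc g hq,
    hamField_reverseLoc g hq, map_add, map_smul, reverseLoc_eξ, neg_add, smul_neg, neg_neg]
  rfl

end ReverseLoc

/-- The change of sign of the momenta. -/
def reverse (ρ : Phase d M) : Phase d M := (ρ.1, -ρ.2.1, ⟨ρ.2.2.proj, -ρ.2.2.snd⟩)

section Reverse

variable (g : Metric d M) {ρ : Phase d M}

theorem reverse_reverse (ρ : Phase d M) : reverse (reverse ρ) = ρ := by
  obtain ⟨t, τ, x, ξ⟩ := ρ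
  change ((t, - -τ, ⟨x, - -ξ⟩) : Phase d M) = (t, τ, ⟨x, ξ⟩)
  rw [neg_neg, neg_neg]

theorem base_reverse (ρ : Phase d M) : Phase.base (reverse ρ) = Phase.base ρ := rfl

theorem coord_reverse (x₀ : M) (ρ : Phase d M) : coord x₀ (reverse ρ) = reverseLoc (coord x₀ ρ) := by
  refine Prod.ext rfl (Prod.ext rfl (Prod.ext rfl ?_))
  change covecCoord x₀ ρ.2.2.proj (-ρ.2.2.snd) = -covecCoord x₀ ρ.2.2.proj ρ.2.2.snd
  ext i
  rfl

theorem reverse_mem_charSet : reverse ρ ∈ charSet g ↔ ρ ∈ charSet g := by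
  have h := mem_chartDom_base ρ
  rw [mem_charSet_iff g h, mem_charSet_iff (ρ := reverse ρ) g h, coord_reverse, symbolLoc_reverseLoc]

theorem Hpz_reverse (ρ : Phase d M) : Hpz g (reverse ρ) = -Hpz g ρ := by
  unfold Hpz
  rw [base_reverse, coord_reverse, HpzLoc_reverseLoc g (coord_mem_coordTarget (mem_chartDom_base ρ))]

theorem reverse_mem_hypPlus : reverse ρ ∈ hypPlus g ↔ ρ ∈ hypMinus g := by
  change reverse ρ ∈ boundaryPhase ∧ reverse ρ ∈ charSet g ∧ 0 < Hpz g (reverse ρ) ↔ _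
  rw [reverse_mem_charSet, Hpz_reverse, neg_pos]
  rfl

theorem reverse_mem_hypMinus : reverse ρ ∈ hypMinus g ↔ ρ ∈ hypPlus g := by
  rw [← reverse_mem_hypPlus, reverse_reverse]

theorem reverse_mem_hyp : reverse ρ ∈ hyp g ↔ ρ ∈ hyp g := by
  unfold hyp
  rw [mem_union, mem_union, reverse_mem_hypPlus, reverse_mem_hypMinus, or_comm]

theorem genField_reverse (h : ρ ∈ charSet g) :
    genField g (reverse ρ) = -reverseLoc (genField g ρ) := by
  rw [genField_eq g h, genField_eq g ((reverse_mem_charSet g).2 h), base_reverse, coord_reverse,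
    genFieldLoc_reverseLoc g (coord_mem_coordTarget (mem_chartDom_base ρ))]

theorem continuous_reverse : Continuous (reverse : Phase d M → Phase d M) := by
  rw [continuous_iff_continuousAt]
  intro ρ
  have h := mem_chartDom_base ρ
  have hev : ∀ᶠ ρ' in 𝓝 ρ, ρ' ∈ chartDom (Phase.base ρ) := (isOpen_chartDom _).mem_nhds h
  refine (tendsto_iff_tendsto_coord (γ := reverse) (x₀ := Phase.base ρ) (ρ := reverse ρ) h hev).2 ?_
  simp only [coord_reverse]
  exact (reverseLoc.continuous.tendsto _).comp
    ((tendsto_iff_tendsto_coord (γ := fun ρ' => ρ') h hev).1 tendsto_id)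

theorem reflection_reverse (ρ : Phase d M) : reflection g (reverse ρ) = reverse (reflection g ρ) := by
  have h := mem_chartDom_base ρ
  refine coord_injOn (Phase.base ρ) (show reflection g (reverse ρ) ∈ _ from h)
    (show reverse (reflection g ρ) ∈ _ from h) ?_
  have h1 := coord_reflection_base g (reverse ρ)
  rw [base_reverse, coord_reverse, Hpz_reverse] at h1
  rw [h1, coord_reverse, coord_reflection_base, map_sub, map_smul, reverseLoc_eξ, neg_div, neg_smul,
    smul_neg]
  rfl

theorem Hpz_reflection (ρ : Phase d M) : Hpz g (reflection g ρ) = -Hpz g ρ := by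
  have hq := coord_mem_coordTarget (mem_chartDom_base ρ)
  have hG := dualCoef_zero_pos g hq
  unfold Hpz
  rw [base_reflection, coord_reflection_base, sub_eq_add_neg, ← neg_smul, HpzLoc_add g hq]
  unfold Hpz
  field_simp
  ring

theorem reflection_mem_charSet (h : ρ ∈ charSet g) : reflection g ρ ∈ charSet g := by
  have hd := mem_chartDom_base ρ
  have hq := coord_mem_coordTarget hd
  have hG := dualCoef_zero_pos g hq
  rw [mem_charSet_iff g hd] at h
  rw [mem_charSet_iff (ρ := reflection g ρ) g hd, coord_reflection_base, sub_eq_add_neg, ← neg_smul,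
    symbolLoc_add g hq, h]
  unfold Hpz
  field_simp
  ring

theorem reflection_mem_hypPlus (h : ρ ∈ hypMinus g) : reflection g ρ ∈ hypPlus g :=
  ⟨h.1, reflection_mem_charSet g h.2.1, by rw [Hpz_reflection]; linarith [h.2.2]⟩

theorem reflection_mem_hypMinus (h : ρ ∈ hypPlus g) : reflection g ρ ∈ hypMinus g :=
  ⟨h.1, reflection_mem_charSet g h.2.1, by rw [Hpz_reflection]; linarith [h.2.2]⟩

theorem reflection_reflection (ρ : Phase d M) : reflection g (reflection g ρ) = ρ := by
  have h := mem_chartDom_base ρ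
  refine coord_injOn (Phase.base ρ) (show reflection g (reflection g ρ) ∈ _ from h) h ?_
  have h1 := coord_reflection_base g (reflection g ρ)
  rw [base_reflection, coord_reflection_base] at h1
  have hb : ∀ c : ℝ, (coord (Phase.base ρ) ρ - c • eξ).2.1 = (coord (Phase.base ρ) ρ).2.1 := by simp
  rw [h1, Hpz_reflection, hb, neg_div, neg_smul, sub_neg_eq_add, sub_add_cancel]

/-- The field changes sign, which the substitution `s ↦ -s` compensates. Left and right limits are
exchanged together with `ℋ⁺` and `ℋ⁻`, and the reflection law persists because `Σ` is an involution
that commutes with the reversal. -/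
theorem IsGenBichar.reverse {g : Metric d M} {J B : Set ℝ} {γ : ℝ → Phase d M}
    (h : IsGenBichar g J B γ) :
    IsGenBichar g (Neg.neg ⁻¹' J) (Neg.neg ⁻¹' B) (fun s => GenBichar.reverse (γ (-s))) := by
  set φ := Homeomorph.neg ℝ with hφ
  have hφs : ∀ s, φ s = -s := fun s => rfl
  have hlim : ∀ {S : ℝ} {A : Set ℝ} {ρ : Phase d M}, Tendsto γ (𝓝[A] (-S)) (𝓝 ρ) ↔
      Tendsto (fun s => GenBichar.reverse (γ (-s))) (𝓝[Neg.neg ⁻¹' A] S)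
        (𝓝 (GenBichar.reverse ρ)) := by
    intro S A ρ
    have h1 := map_nhdsWithin_homeomorph φ A S
    rw [← hφs, ← h1, tendsto_map'_iff]
    constructor
    · exact fun h2 => (continuous_reverse.tendsto ρ).comp h2
    · intro h2
      have h3 := (continuous_reverse.tendsto (GenBichar.reverse ρ)).comp h2
      rw [reverse_reverse] at h3
      refine h3.congr fun s => ?_
      simp only [Function.comp_apply, reverse_reverse]
      rfl
  have hI : ∀ {J : Set ℝ} {u v : ℝ}, Icc u v ⊆ Neg.neg ⁻¹' J → Icc (-v) (-u) ⊆ J := by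
    intro J u v hs r hr
    have := hs (show -r ∈ Icc u v from ⟨by linarith [hr.2], by linarith [hr.1]⟩)
    rwa [mem_preimage, neg_neg] at this
  have hIio : ∀ S : ℝ, Neg.neg ⁻¹' Iio (-S) = Ioi S := fun S => by ext; simp
  have hIoi : ∀ S : ℝ, Neg.neg ⁻¹' Ioi (-S) = Iio S := fun S => by ext; simp
  refine ⟨?_, ?_, fun s hs => h.subset hs, isDiscrete_preimage φ h.discrete,
    fun s hs => (reverse_mem_charSet g).2 (h.mem_char _ hs),
    fun s hs => (reverse_mem_hyp g).not.2 (h.notMem_hyp _ hs),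
    fun s hs => hlim.1 (h.continuousWithinAt _ hs), ?_, ?_, ?_, ?_, ?_⟩
  · exact h.ordConnected.preimage_anti fun u v huv => neg_le_neg huv
  · obtain ⟨u, hu, v, hv, huv⟩ := h.nontrivial
    exact ⟨-u, by simpa, -v, by simpa, by simpa⟩
  · intro s hs
    have h1 := h.hasDeriv _ hs
    have h2 : HasDerivWithinAt (fun r : ℝ => -r) (-1) (Neg.neg ⁻¹' (J \ B)) s :=
      (hasDerivAt_neg s).hasDerivWithinAt
    have h3 := HasDerivWithinAt.scomp s h1 h2 (fun r hr => hr)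
    have h4 := (reverseLoc (d := d)).hasFDerivAt.comp_hasDerivWithinAt s h3
    simp only [coord_reverse, base_reverse]
    rw [genField_reverse g (h.mem_char _ hs), ← map_neg, ← neg_one_smul ℝ (genField g _)]
    exact h4
  · intro S hS
    have h1 := h.interior_near _ hS
    rw [← hφs, ← map_nhdsWithin_homeomorph, eventually_map] at h1
    exact h1
  · rintro S hS ⟨ε, hε, hsub⟩
    obtain ⟨ρ, hρ, ht⟩ := h.limit_right _ hS ⟨ε, hε, by
      have := hI hsub
      rwa [neg_sub, sub_eq_neg_add] at this⟩
    rw [hlim, preimage_inter, hIoi] at ht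
    exact ⟨_, (reverse_mem_hypMinus g).2 hρ, ht⟩
  · rintro S hS ⟨ε, hε, hsub⟩
    obtain ⟨ρ, hρ, ht⟩ := h.limit_left _ hS ⟨ε, hε, by
      have := hI hsub
      rwa [neg_add, ← sub_eq_add_neg] at this⟩
    rw [hlim, preimage_inter, hIio] at ht
    exact ⟨_, (reverse_mem_hypPlus g).2 hρ, ht⟩
  · rintro S hS ⟨ε, hε, hsub⟩ ρ₁ ρ₂ h1 h2
    have h3 := h.reflect _ hS ⟨ε, hε, by
      have := hI hsub
      rwa [neg_add, ← sub_eq_add_neg, neg_sub, sub_eq_neg_add ε] at this⟩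
      (GenBichar.reverse ρ₂) (GenBichar.reverse ρ₁) ?_ ?_
    · rw [reflection_reverse] at h3
      have h4 := congrArg GenBichar.reverse h3
      rw [reverse_reverse, reverse_reverse] at h4
      rw [h4, reflection_reflection]
    · rw [hlim, preimage_inter, hIio, reverse_reverse]
      exact h2
    · rw [hlim, preimage_inter, hIoi, reverse_reverse]
      exact h1

end Reverse

/-! ### Extension to a maximal generalized bicharacteristic -/

/-- The data of a generalized bicharacteristic. -/
structure Curve (g : Metric d M) where
  /-- The interval. -/
  J : Set ℝ
  /-- The jump times. -/
  B : Set ℝ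
  /-- The curve. -/
  γ : ℝ → Phase d M
  isGenBichar : IsGenBichar g J B γ

/-- The relation of extension. -/
def Curve.Ext {g : Metric d M} (a b : Curve g) : Prop :=
  a.J ⊆ b.J ∧ b.B ∩ a.J = a.B ∧ EqOn b.γ a.γ (a.J \ a.B)

namespace Curve

variable {g : Metric d M}

theorem Ext.refl (a : Curve g) : a.Ext a :=
  ⟨subset_rfl, inter_eq_left.2 a.isGenBichar.subset, fun _ _ => rfl⟩

theorem Ext.diff_subset {a b : Curve g} (h : a.Ext b) : a.J \ a.B ⊆ b.J \ b.B :=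
  fun _ hs => ⟨h.1 hs.1, fun hb => hs.2 (h.2.1 ▸ ⟨hb, hs.1⟩)⟩

theorem Ext.trans {a b c : Curve g} (h : a.Ext b) (h' : b.Ext c) : a.Ext c := by
  refine ⟨h.1.trans h'.1, ?_, fun s hs => ?_⟩
  · rw [← h.2.1, ← h'.2.1, inter_assoc, inter_eq_right.2 h.1]
  · rw [h'.2.2 (h.diff_subset hs), h.2.2 hs]

/-- A chain of generalized bicharacteristics has an upper bound. -/
theorem exists_upperBound {c : Set (Curve g)} (hc : IsChain Ext c) (hne : c.Nonempty) :
    ∃ u : Curve g, ∀ a ∈ c, a.Ext u := by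
  classical
  have hdir : ∀ a ∈ c, ∀ b ∈ c, ∃ e ∈ c, a.Ext e ∧ b.Ext e := by
    intro a ha b hb
    by_cases hab : a = b
    · subst hab
      exact ⟨a, ha, Ext.refl a, Ext.refl a⟩
    · rcases hc ha hb hab with h | h
      · exact ⟨b, hb, h, Ext.refl b⟩
      · exact ⟨a, ha, Ext.refl a, h⟩
  set J : Set ℝ := {s | ∃ a ∈ c, s ∈ a.J} with hJ
  set B : Set ℝ := {s | ∃ a ∈ c, s ∈ a.B} with hB
  obtain ⟨a₀, ha₀⟩ := hne
  -- Members of a chain may disagree at jump times, where values are irrelevant; elsewhere the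
  -- choice of the member does not matter.
  set γ : ℝ → Phase d M := fun s =>
    if h : ∃ a ∈ c, s ∈ a.J then h.choose.γ s else a₀.γ s with hγ
  have hsubJ : ∀ a ∈ c, a.J ⊆ J := fun a ha s hs => ⟨a, ha, hs⟩
  have hBJ : ∀ a ∈ c, B ∩ a.J = a.B := by
    intro a ha
    ext s
    constructor
    · rintro ⟨⟨b, hb, hsb⟩, hs⟩
      obtain ⟨e, -, hae, hbe⟩ := hdir a ha b hb
      have : s ∈ e.B := (hbe.2.1 ▸ hsb : s ∈ e.B ∩ b.J).1
      exact hae.2.1 ▸ ⟨this, hs⟩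
    · exact fun hs => ⟨⟨a, ha, hs⟩, a.isGenBichar.subset hs⟩
  have hval : ∀ a ∈ c, EqOn γ a.γ (a.J \ a.B) := by
    intro a ha s hs
    have hex : ∃ a ∈ c, s ∈ a.J := ⟨a, ha, hs.1⟩
    have h1 := hex.choose_spec
    simp only [hγ]
    rw [dif_pos hex]
    obtain ⟨e, -, hae, hbe⟩ := hdir a ha _ h1.1
    have h2 : s ∉ hex.choose.B := by
      intro hs2
      have : s ∈ e.B := (hbe.2.1 ▸ hs2 : s ∈ e.B ∩ _).1
      exact hs.2 (hae.2.1 ▸ ⟨this, hs.1⟩)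
    rw [← hae.2.2 hs, ← hbe.2.2 ⟨h1.2, h2⟩]
  have hgen : IsGenBichar g J B γ := by
    refine (isGenBichar_iff g).2 ⟨?_, a₀.isGenBichar.nontrivial.mono (hsubJ a₀ ha₀), ?_, ?_⟩
    · refine ordConnected_of_Ioo ?_
      rintro u ⟨a, ha, hu⟩ v ⟨b, hb, hv⟩ - s hs
      obtain ⟨e, he, hae, hbe⟩ := hdir a ha b hb
      exact ⟨e, he, e.isGenBichar.ordConnected.out (hae.1 hu) (hbe.1 hv) ⟨hs.1.le, hs.2.le⟩⟩
    · rintro s ⟨a, ha, hs⟩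
      exact ⟨a, ha, a.isGenBichar.subset hs⟩
    · intro s hsJ
      -- A time may be an endpoint of the intervals of some members, so members filling a right and
      -- a left neighbourhood of `s` within `J` are found separately and then dominated by one.
      have hr : ∃ e ∈ c, s ∈ e.J ∧ ∃ δ > 0, ∀ r ∈ J, s ≤ r → r < s + δ → r ∈ e.J := by
        obtain ⟨a, ha, hsa⟩ := hsJ
        by_cases hex : ∃ t ∈ J, s < t
        · obtain ⟨t, ⟨b, hb, htb⟩, hst⟩ := hex
          obtain ⟨e, he, hae, hbe⟩ := hdir a ha b hb
          refine ⟨e, he, hae.1 hsa, t - s, sub_pos.2 hst, fun r _ hr1 hr2 => ?_⟩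
          exact e.isGenBichar.ordConnected.out (hae.1 hsa) (hbe.1 htb) ⟨hr1, by linarith⟩
        · push Not at hex
          refine ⟨a, ha, hsa, 1, one_pos, fun r hrJ hr1 _ => ?_⟩
          rwa [le_antisymm (hex r hrJ) hr1]
      have hl : ∃ e ∈ c, s ∈ e.J ∧ ∃ δ > 0, ∀ r ∈ J, r ≤ s → s - δ < r → r ∈ e.J := by
        obtain ⟨a, ha, hsa⟩ := hsJ
        by_cases hex : ∃ t ∈ J, t < s
        · obtain ⟨t, ⟨b, hb, htb⟩, hst⟩ := hex
          obtain ⟨e, he, hae, hbe⟩ := hdir a ha b hb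
          refine ⟨e, he, hae.1 hsa, s - t, sub_pos.2 hst, fun r _ hr1 hr2 => ?_⟩
          exact e.isGenBichar.ordConnected.out (hbe.1 htb) (hae.1 hsa) ⟨by linarith, hr1⟩
        · push Not at hex
          refine ⟨a, ha, hsa, 1, one_pos, fun r hrJ hr1 _ => ?_⟩
          rwa [le_antisymm hr1 (hex r hrJ)]
      obtain ⟨e₁, he₁, hs₁, δ₁, hδ₁, h₁⟩ := hr
      obtain ⟨e₂, he₂, hs₂, δ₂, hδ₂, h₂⟩ := hl
      obtain ⟨e, he, h1e, h2e⟩ := hdir e₁ he₁ e₂ he₂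
      refine (e.isGenBichar.at (h1e.1 hs₁)).congr (U := Ioo (s - δ₂) (s + δ₁))
        (Ioo_mem_nhds (by linarith) (by linarith)) (h1e.1 hs₁) ?_ ?_ ?_
      · ext r
        refine ⟨fun hr => ⟨hsubJ e he hr.1, hr.2⟩, fun hr => ⟨?_, hr.2⟩⟩
        rcases le_total r s with h | h
        · exact h2e.1 (h₂ r hr.1 h hr.2.1)
        · exact h1e.1 (h₁ r hr.1 h hr.2.2)
      · ext r
        refine ⟨fun hr => ⟨⟨e, he, hr.1⟩, hr.2⟩, fun hr => ⟨?_, hr.2⟩⟩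
        have hrJ : r ∈ J := by
          obtain ⟨b, hb, hrb⟩ := hr.1
          exact ⟨b, hb, b.isGenBichar.subset hrb⟩
        rw [← hBJ e he]
        refine ⟨hr.1, ?_⟩
        rcases le_total r s with h | h
        · exact h2e.1 (h₂ r hrJ h hr.2.1)
        · exact h1e.1 (h₁ r hrJ h hr.2.2)
      · exact fun r hr => (hval e he hr.1).symm
  exact ⟨⟨J, B, γ, hgen⟩, fun a ha => ⟨hsubJ a ha, hBJ a ha, hval a ha⟩⟩

end Curve

/-- Every generalized bicharacteristic extends to a maximal one. -/
theorem IsGenBichar.exists_maximal {g : Metric d M} {J B : Set ℝ} {γ : ℝ → Phase d M}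
    (h : IsGenBichar g J B γ) : ∃ J' B' γ', IsMaximalGenBichar g J' B' γ' ∧ J ⊆ J' ∧
      B' ∩ J = B ∧ EqOn γ' γ (J \ B) := by
  set a₀ : Curve g := ⟨J, B, γ, h⟩ with ha₀
  obtain ⟨m, hm⟩ := exists_maximal_of_chains_bounded
    (α := {a : Curve g // a₀.Ext a}) (r := fun a b => a.1.Ext b.1) (fun c hc => by
      rcases c.eq_empty_or_nonempty with rfl | hne
      · exact ⟨⟨a₀, Curve.Ext.refl a₀⟩, by simp⟩
      · obtain ⟨u, hu⟩ := Curve.exists_upperBound (c := Subtype.val '' c) (by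
          rintro _ ⟨a, ha, rfl⟩ _ ⟨b, hb, rfl⟩ hab
          exact hc ha hb fun e => hab (congrArg _ e)) (hne.image _)
        obtain ⟨a, ha⟩ := hne
        exact ⟨⟨u, a.2.trans (hu _ ⟨a, ha, rfl⟩)⟩, fun b hb => hu _ ⟨b, hb, rfl⟩⟩)
    (fun h1 h2 => h1.trans h2)
  refine ⟨m.1.J, m.1.B, m.1.γ, ⟨m.1.isGenBichar, fun J' B' γ' h' hJ hB hγ => ?_⟩, m.2⟩
  have hext : m.1.Ext ⟨J', B', γ', h'⟩ := ⟨hJ, hB, hγ⟩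
  exact subset_antisymm (hm ⟨⟨J', B', γ', h'⟩, m.2.trans hext⟩ hext).1 hJ

/-! ### Limits at the jumps and the conserved quantities -/

theorem nhdsWithin_diff_eq {A : Set ℝ} {S : ℝ} (hS : S ∉ A) :
    𝓝[A] S = 𝓝[A ∩ Iio S] S ⊔ 𝓝[A ∩ Ioi S] S := by
  rw [← nhdsWithin_union]
  congr 1
  ext r
  simp only [mem_union, mem_inter_iff, mem_Iio, mem_Ioi]
  constructor
  · intro hr
    have : r ≠ S := fun h => hS (h ▸ hr)
    rcases lt_or_gt_of_ne this with h | h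
    · exact Or.inl ⟨hr, h⟩
    · exact Or.inr ⟨hr, h⟩
  · rintro (h | h) <;> exact h.1

namespace IsGenBichar

variable {g : Metric d M} {J B : Set ℝ} {γ : ℝ → Phase d M}

/-- If `S` is an endpoint of `J`, the filter on the missing side is trivial and every point is a
limit; taking the reflected one makes the statement uniform. -/
theorem exists_limits (h : IsGenBichar g J B γ) {S : ℝ} (hS : S ∈ B) :
    ∃ ρ ∈ hypMinus g, Tendsto γ (𝓝[(J \ B) ∩ Iio S] S) (𝓝 ρ) ∧
      Tendsto γ (𝓝[(J \ B) ∩ Ioi S] S) (𝓝 (reflection g ρ)) := by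
  have hSJ := h.subset hS
  have hl : ∀ {u : ℝ}, u ∈ J → u < S → ∃ ε > 0, Icc (S - ε) S ⊆ J := fun {u} hu huS =>
    ⟨S - u, sub_pos.2 huS, by rw [sub_sub_cancel]; exact h.ordConnected.out hu hSJ⟩
  have hr : ∀ {u : ℝ}, u ∈ J → S < u → ∃ ε > 0, Icc S (S + ε) ⊆ J := fun {u} hu huS =>
    ⟨u - S, sub_pos.2 huS, by rw [add_sub_cancel]; exact h.ordConnected.out hSJ hu⟩
  by_cases hL : ∃ u ∈ J, u < S
  · obtain ⟨u, hu, huS⟩ := hL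
    obtain ⟨ρ₁, hρ₁, t1⟩ := h.limit_left S hS (hl hu huS)
    refine ⟨ρ₁, hρ₁, t1, ?_⟩
    by_cases hR : ∃ v ∈ J, S < v
    · obtain ⟨v, hv, hvS⟩ := hR
      obtain ⟨ρ₂, hρ₂, t2⟩ := h.limit_right S hS (hr hv hvS)
      rw [← h.reflect S hS ⟨min (S - u) (v - S), lt_min (sub_pos.2 huS) (sub_pos.2 hvS), ?_⟩ ρ₁ ρ₂
        t1 t2]
      · exact t2
      · refine (Icc_subset_Icc ?_ ?_).trans (h.ordConnected.out hu hv)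
        · linarith [min_le_left (S - u) (v - S)]
        · linarith [min_le_right (S - u) (v - S)]
    · push Not at hR
      have : (J \ B) ∩ Ioi S = ∅ :=
        eq_empty_of_forall_notMem fun r hr => (hR r hr.1.1).not_gt hr.2
      rw [this, nhdsWithin_empty]
      exact tendsto_bot
  · push Not at hL
    obtain ⟨v, hv, hvS⟩ : ∃ v ∈ J, S < v := by
      obtain ⟨u, hu, v, hv, huv⟩ := h.nontrivial
      rcases lt_or_gt_of_ne huv with h1 | h1
      · exact ⟨v, hv, (hL u hu).trans_lt h1⟩
      · exact ⟨u, hu, (hL v hv).trans_lt h1⟩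
    obtain ⟨ρ₂, hρ₂, t2⟩ := h.limit_right S hS (hr hv hvS)
    refine ⟨reflection g ρ₂, reflection_mem_hypMinus g hρ₂, ?_, by rwa [reflection_reflection]⟩
    have : (J \ B) ∩ Iio S = ∅ :=
      eq_empty_of_forall_notMem fun r hr => (hL r hr.1.1).not_gt hr.2
    rw [this, nhdsWithin_empty]
    exact tendsto_bot

/-- A continuous quantity that `Σ` preserves has a two-sided limit at each jump, which is what the
mean value inequality asks for. -/
theorem tendsto_of_reflection (h : IsGenBichar g J B γ) {X : Type*} [TopologicalSpace X]
    {F : Phase d M → X} (hF : Continuous F) (hr : ∀ ρ, F (reflection g ρ) = F ρ) {S : ℝ}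
    (hS : S ∈ J ∩ B) : ∃ l, Tendsto (fun s => F (γ s)) (𝓝[J \ B] S) (𝓝 l) := by
  obtain ⟨ρ, -, h1, h2⟩ := h.exists_limits hS.2
  refine ⟨F ρ, ?_⟩
  rw [nhdsWithin_diff_eq (fun hc => hc.2 hS.2), tendsto_sup]
  refine ⟨(hF.tendsto ρ).comp h1, ?_⟩
  have := (hF.tendsto _).comp h2
  rwa [hr] at this

theorem hasDerivWithinAt_tau (h : IsGenBichar g J B γ) {s : ℝ} (hs : s ∈ J \ B) :
    HasDerivWithinAt (fun r => (γ r).tau) 0 (J \ B) s := by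
  have h1 := (projτ (d := d)).hasFDerivAt.comp_hasDerivWithinAt s (h.hasDeriv s hs)
  rw [genField_eq g (h.mem_char s hs), projτ_apply,
    genFieldLoc_tau g (coord_mem_coordTarget (mem_chartDom_base _))] at h1
  exact h1

theorem hasDerivWithinAt_time (h : IsGenBichar g J B γ) {s : ℝ} (hs : s ∈ J \ B) :
    HasDerivWithinAt (fun r => (γ r).time) (-2 * (γ s).tau) (J \ B) s := by
  have h1 := (ContinuousLinearMap.fst ℝ ℝ (Model d × ℝ × Model d)).hasFDerivAt.comp_hasDerivWithinAt
    s (h.hasDeriv s hs)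
  rw [genField_eq g (h.mem_char s hs), ContinuousLinearMap.coe_fst',
    genFieldLoc_time g (coord_mem_coordTarget (mem_chartDom_base _))] at h1
  exact h1

/-- The component `τ` is constant. -/
theorem tau_eq (h : IsGenBichar g J B γ) {s r : ℝ} (hs : s ∈ J \ B) (hr : r ∈ J \ B) :
    (γ r).tau = (γ s).tau := by
  have := abs_sub_le_of_hasDerivWithinAt_diff h.ordConnected h.discrete
    (f := fun r => (γ r).tau) (f' := fun _ => 0) (C := 0) (fun u hu => h.hasDerivWithinAt_tau hu)
    (by simp) (fun S hS => h.tendsto_of_reflection (F := Phase.tau)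
      (continuous_fst.comp continuous_snd) (fun _ => rfl) hS) hs hr
  rw [zero_mul] at this
  exact sub_eq_zero.1 (abs_nonpos_iff.1 this)

/-- The time is an affine function of the parameter. -/
theorem time_eq (h : IsGenBichar g J B γ) {s r : ℝ} (hs : s ∈ J \ B) (hr : r ∈ J \ B) :
    (γ r).time = (γ s).time - 2 * (γ s).tau * (r - s) := by
  have := abs_sub_le_of_hasDerivWithinAt_diff h.ordConnected h.discrete
    (f := fun r => (γ r).time + 2 * (γ s).tau * r) (f' := fun _ => 0) (C := 0) (fun u hu => ?_)
    (by simp) (fun S hS => ?_) hs hr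
  · rw [zero_mul] at this
    linarith [sub_eq_zero.1 (abs_nonpos_iff.1 this)]
  · have h1 := (h.hasDerivWithinAt_time hu).add
      ((hasDerivAt_id u).const_mul (2 * (γ s).tau)).hasDerivWithinAt
    rw [h.tau_eq hs hu] at h1
    convert! h1 using 1
    ring
  · obtain ⟨l, hl⟩ := h.tendsto_of_reflection (F := Phase.time) continuous_fst (fun _ => rfl) hS
    exact ⟨_, hl.add (((continuous_const.mul continuous_id).tendsto S).mono_left
      nhdsWithin_le_nhds)⟩

theorem exists_mem_diff (h : IsGenBichar g J B γ) : (J \ B).Nonempty := by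
  obtain ⟨u, hu, v, hv, huv⟩ := h.nontrivial
  rcases lt_or_gt_of_ne huv with h1 | h1
  · have := nhdsWithin_diff_Iio_neBot h.ordConnected h.discrete hu hv h1
    obtain ⟨r, hr⟩ := closure_nonempty_iff.1 ⟨_, mem_closure_iff_nhdsWithin_neBot.2 this⟩
    exact ⟨r, hr.1⟩
  · have := nhdsWithin_diff_Iio_neBot h.ordConnected h.discrete hv hu h1
    obtain ⟨r, hr⟩ := closure_nonempty_iff.1 ⟨_, mem_closure_iff_nhdsWithin_neBot.2 this⟩
    exact ⟨r, hr.1⟩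

end IsGenBichar

/-! ### Curves in a chart -/

/-- The coordinates of a generalized bicharacteristic in the chart at `x₀`. -/
structure IsLocalCurve (g : Metric d M) (x₀ : M) (J B : Set ℝ) (q : ℝ → LocalPhase d) : Prop where
  ordConnected : J.OrdConnected
  discrete : IsDiscrete B
  mem : ∀ s ∈ J \ B, q s ∈ coordTarget x₀
  symbol : ∀ s ∈ J \ B, symbolLoc g x₀ (q s) = 0
  hasDeriv : ∀ s ∈ J \ B, HasDerivWithinAt q (genFieldLoc g x₀ (q s)) (J \ B) s
  jump : ∀ S ∈ J ∩ B, ∃ q₁ ∈ coordTarget x₀, q₁.2.1 0 = 0 ∧ HpzLoc g x₀ q₁ < 0 ∧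
    Tendsto q (𝓝[(J \ B) ∩ Iio S] S) (𝓝 q₁) ∧
    Tendsto q (𝓝[(J \ B) ∩ Ioi S] S)
      (𝓝 (q₁ - (HpzLoc g x₀ q₁ / dualCoef g x₀ 0 0 q₁.2.1) • eξ))

namespace IsLocalCurve

variable {g : Metric d M} {x₀ : M} {J B : Set ℝ} {q : ℝ → LocalPhase d}

/-- A functional that kills `eξ` sees neither the gliding correction nor the reflections, so it
evolves under `H_p` alone. -/
theorem hasDerivWithinAt_apply (h : IsLocalCurve g x₀ J B q) {L : LocalPhase d →L[ℝ] ℝ}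
    (hL : L eξ = 0) {s : ℝ} (hs : s ∈ J \ B) :
    HasDerivWithinAt (fun r => L (q r)) (L (hamField (symbolLoc g x₀) (q s))) (J \ B) s := by
  have h1 := L.hasFDerivAt.comp_hasDerivWithinAt s (h.hasDeriv s hs)
  rw [genFieldLoc_eq g (h.mem s hs), map_add, map_smul, hL, smul_zero, add_zero] at h1
  exact h1

theorem tendsto_apply (h : IsLocalCurve g x₀ J B q) {L : LocalPhase d →L[ℝ] ℝ}
    (hL : L eξ = 0) {S : ℝ} (hS : S ∈ J ∩ B) :
    ∃ l, Tendsto (fun r => L (q r)) (𝓝[J \ B] S) (𝓝 l) := by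
  obtain ⟨q₁, -, -, -, h1, h2⟩ := h.jump S hS
  refine ⟨L q₁, ?_⟩
  rw [nhdsWithin_diff_eq (fun hc => hc.2 hS.2), tendsto_sup]
  refine ⟨(L.continuous.tendsto _).comp h1, ?_⟩
  have := (L.continuous.tendsto _).comp h2
  rwa [map_sub, map_smul, hL, smul_zero, sub_zero] at this

theorem hasDerivWithinAt_velocity (h : IsLocalCurve g x₀ J B q) {s : ℝ} (hs : s ∈ J \ B) :
    HasDerivWithinAt (fun r => HpzLoc g x₀ (q r)) (normalAccel g x₀ (q s)) (J \ B) s := by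
  rw [← HpzDeriv_genFieldLoc g (h.mem s hs)]
  exact (HpzLoc_hasFDerivWithinAt g x₀ (h.mem s hs)).comp_hasDerivWithinAt s (h.hasDeriv s hs)
    fun r hr => coordTarget_subset x₀ (h.mem r hr)

/-- At a reflection the normal velocity always jumps upwards, from `v < 0` to `-v > 0`; lower bounds
on its growth survive the jumps. -/
theorem velocity_jump (h : IsLocalCurve g x₀ J B q) {S : ℝ} (hS : S ∈ J ∩ B) :
    ∃ v < 0, Tendsto (fun r => HpzLoc g x₀ (q r)) (𝓝[(J \ B) ∩ Iio S] S) (𝓝 v) ∧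
      Tendsto (fun r => HpzLoc g x₀ (q r)) (𝓝[(J \ B) ∩ Ioi S] S) (𝓝 (-v)) := by
  obtain ⟨q₁, hq₁, -, hv, h1, h2⟩ := h.jump S hS
  have hG := dualCoef_zero_pos g hq₁
  have key : ∀ {T : Set ℝ} {w : LocalPhase d}, w ∈ coordTarget x₀ →
      Tendsto q (𝓝[(J \ B) ∩ T] S) (𝓝 w) →
      Tendsto (fun r => HpzLoc g x₀ (q r)) (𝓝[(J \ B) ∩ T] S) (𝓝 (HpzLoc g x₀ w)) := by
    intro T w hw ht
    refine (continuousOn_HpzLoc g x₀ w hw).tendsto.comp (tendsto_nhdsWithin_iff.2 ⟨ht, ?_⟩)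
    filter_upwards [self_mem_nhdsWithin] with r hr using h.mem r hr.1
  refine ⟨_, hv, key hq₁ h1, ?_⟩
  rw [sub_eq_add_neg, ← neg_smul] at h2
  have h3 := key (add_smul_eξ_mem hq₁ _) h2
  rw [HpzLoc_add g hq₁] at h3
  convert! h3 using 2
  field_simp
  ring

theorem mono (h : IsLocalCurve g x₀ J B q) (c : ℝ) : IsLocalCurve g x₀ (J ∩ Ioi c) B q := by
  have hsub : (J ∩ Ioi c) \ B ⊆ J \ B := sdiff_subset_sdiff_left inter_subset_left
  refine ⟨h.ordConnected.inter ordConnected_Ioi, h.discrete, fun s hs => h.mem s (hsub hs),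
    fun s hs => h.symbol s (hsub hs), fun s hs => (h.hasDeriv s (hsub hs)).mono hsub,
    fun S hS => ?_⟩
  obtain ⟨q₁, a1, a2, a3, a4, a5⟩ := h.jump S ⟨hS.1.1, hS.2⟩
  exact ⟨q₁, a1, a2, a3, a4.mono_left (nhdsWithin_mono _ (inter_subset_inter_left _ hsub)),
    a5.mono_left (nhdsWithin_mono _ (inter_subset_inter_left _ hsub))⟩

theorem nonneg (h : IsLocalCurve g x₀ J B q) {s : ℝ} (hs : s ∈ J \ B) : 0 ≤ (q s).2.1 0 :=
  coordTarget_subset x₀ (h.mem s hs)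

theorem hasDerivWithinAt_normal (h : IsLocalCurve g x₀ J B q) {s : ℝ} (hs : s ∈ J \ B) :
    HasDerivWithinAt (fun r => (q r).2.1 0) (HpzLoc g x₀ (q s)) (J \ B) s := by
  rw [HpzLoc_eq_hamField g x₀ (h.mem s hs)]
  exact h.hasDerivWithinAt_apply (L := projX 0) (by simp) hs

theorem mono_velocity (h : IsLocalCurve g x₀ J B q) {α : ℝ}
    (hα : ∀ s ∈ J \ B, α ≤ normalAccel g x₀ (q s)) {s r : ℝ} (hs : s ∈ J \ B) (hr : r ∈ J \ B)
    (hsr : s ≤ r) : α * (r - s) ≤ HpzLoc g x₀ (q r) - HpzLoc g x₀ (q s) := by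
  have := sub_le_of_hasDerivWithinAt_diff h.ordConnected h.discrete
    (f := fun r => -HpzLoc g x₀ (q r)) (f' := fun r => -normalAccel g x₀ (q r)) (C := -α)
    (fun u hu => (h.hasDerivWithinAt_velocity hu).neg) (fun u hu => neg_le_neg (hα u hu))
    (fun S hS => by
      obtain ⟨v, hv, h1, h2⟩ := h.velocity_jump hS
      exact ⟨_, _, h1.neg, h2.neg, by linarith⟩) hs hr hsr
  linarith

theorem mono_normal (h : IsLocalCurve g x₀ J B q) {α : ℝ}
    (hα : ∀ s ∈ J \ B, α ≤ HpzLoc g x₀ (q s)) {s r : ℝ} (hs : s ∈ J \ B) (hr : r ∈ J \ B)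
    (hsr : s ≤ r) : α * (r - s) ≤ (q r).2.1 0 - (q s).2.1 0 := by
  have := sub_le_of_hasDerivWithinAt_diff h.ordConnected h.discrete
    (f := fun r => -(q r).2.1 0) (f' := fun r => -HpzLoc g x₀ (q r)) (C := -α)
    (fun u hu => (h.hasDerivWithinAt_normal hu).neg) (fun u hu => neg_le_neg (hα u hu))
    (fun S hS => by
      obtain ⟨l, hl⟩ := h.tendsto_apply (L := projX 0) (by simp) hS
      exact ⟨-l, -l, (hl.mono_left (nhdsWithin_mono _ inter_subset_left)).neg,
        (hl.mono_left (nhdsWithin_mono _ inter_subset_left)).neg, le_rfl⟩) hs hr hsr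
  linarith

theorem anti_normal (h : IsLocalCurve g x₀ J B q) {α : ℝ}
    (hα : ∀ s ∈ J \ B, HpzLoc g x₀ (q s) ≤ α) {s r : ℝ} (hs : s ∈ J \ B) (hr : r ∈ J \ B)
    (hsr : s ≤ r) : (q r).2.1 0 - (q s).2.1 0 ≤ α * (r - s) :=
  sub_le_of_hasDerivWithinAt_diff h.ordConnected h.discrete
    (f := fun r => (q r).2.1 0) (f' := fun r => HpzLoc g x₀ (q r)) (C := α)
    (fun u hu => h.hasDerivWithinAt_normal hu) hα
    (fun S hS => by
      obtain ⟨l, hl⟩ := h.tendsto_apply (L := projX 0) (by simp) hS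
      exact ⟨l, l, hl.mono_left (nhdsWithin_mono _ inter_subset_left),
        hl.mono_left (nhdsWithin_mono _ inter_subset_left), le_rfl⟩) hs hr hsr

end IsLocalCurve

/-! ### Convergence at the end of an interval -/

theorem exists_lt_forall_of_eventually {A : Set ℝ} {b : ℝ} (hA : ∀ s ∈ A, s < b) {P : ℝ → Prop}
    (h : ∀ᶠ s in 𝓝[A] b, P s) : ∃ c < b, ∀ s ∈ A, c < s → P s := by
  rw [eventually_nhdsWithin_iff, Metric.eventually_nhds_iff] at h
  obtain ⟨δ, hδ, h⟩ := h
  refine ⟨b - δ, by linarith, fun s hs hc => h ?_ hs⟩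
  rw [Real.dist_eq, abs_lt]
  constructor <;> linarith [hA s hs]

theorem eventually_of_lt_forall {A : Set ℝ} {b c : ℝ} (hc : c < b) {P : ℝ → Prop}
    (h : ∀ s ∈ A, c < s → P s) : ∀ᶠ s in 𝓝[A] b, P s := by
  filter_upwards [self_mem_nhdsWithin, nhdsWithin_le_nhds (Ioi_mem_nhds hc)] with s hs hcs
  exact h s hs hcs

theorem exists_gt_of_neBot {A : Set ℝ} {b c : ℝ} (hbot : (𝓝[A] b).NeBot) (hc : c < b) :
    ∃ s ∈ A, c < s := by
  obtain ⟨s, hs⟩ := ((eventually_of_lt_forall hc (fun s _ hs => hs)).and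
    self_mem_nhdsWithin : ∀ᶠ s in 𝓝[A] b, c < s ∧ s ∈ A).exists
  exact ⟨s, hs.2, hs.1⟩

theorem exists_tendsto_of_lipschitz {f : ℝ → ℝ} {A : Set ℝ} {C : ℝ}
    (h : ∀ s ∈ A, ∀ r ∈ A, |f r - f s| ≤ C * |r - s|) (b : ℝ) :
    ∃ l, Tendsto f (𝓝[A] b) (𝓝 l) := by
  have h1 : LipschitzOnWith (max C 0).toNNReal f A := LipschitzOnWith.of_dist_le_mul
    fun r hr s hs => by
      rw [Real.dist_eq, Real.dist_eq, Real.coe_toNNReal _ (le_max_right _ _)]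
      exact (h s hs r hr).trans (mul_le_mul_of_nonneg_right (le_max_left _ _) (abs_nonneg _))
  obtain ⟨F, hF, hFeq⟩ := h1.extend_real
  refine ⟨F b, ((hF.continuous.tendsto b).mono_left nhdsWithin_le_nhds).congr' ?_⟩
  filter_upwards [self_mem_nhdsWithin] with s hs using (hFeq hs).symm

theorem tendsto_localPhase {α : Type*} {l : Filter α} {f : α → LocalPhase d} {w : LocalPhase d}
    (ht : Tendsto (fun a => (f a).1) l (𝓝 w.1)) (hx : ∀ i, Tendsto (fun a => (f a).2.1 i) l (𝓝 (w.2.1 i)))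
    (hτ : Tendsto (fun a => (f a).2.2.1) l (𝓝 w.2.2.1))
    (hξ : ∀ i, Tendsto (fun a => (f a).2.2.2 i) l (𝓝 (w.2.2.2 i))) : Tendsto f l (𝓝 w) := by
  have key : ∀ {v : α → Model d} {u : Model d}, (∀ i, Tendsto (fun a => v a i) l (𝓝 (u i))) →
      Tendsto v l (𝓝 u) := by
    intro v u h
    exact ((PiLp.continuous_toLp 2 (fun _ : Fin d => ℝ)).tendsto _).comp (tendsto_pi_nhds.2 h)
  exact ht.prodMk_nhds ((key hx).prodMk_nhds (hτ.prodMk_nhds (key hξ)))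

/-- The projection along the direction of the normal momentum. -/
def dropNormal : LocalPhase d →L[ℝ] LocalPhase d :=
  ContinuousLinearMap.id ℝ _ - (projξ 0).smulRight eξ

theorem dropNormal_apply (q : LocalPhase d) : dropNormal q = q + (-q.2.2.2 0) • eξ := by
  simp [dropNormal, sub_eq_add_neg]

theorem dropNormal_eξ : dropNormal (eξ (d := d)) = 0 := by
  simp [dropNormal_apply]

theorem dropNormal_cov_zero (q : LocalPhase d) : (dropNormal q).2.2.2 0 = 0 := by
  simp [dropNormal_apply]

theorem straighten_eq_dropNormal (g : Metric d M) (x₀ : M) (q : LocalPhase d) :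
    straighten g x₀ q = dropNormal q + HpzLoc g x₀ q • eξ := by
  rw [straighten, dropNormal_apply]
  module

/-- On `Char p` the relation `p = 0`, with `p` of the form `ζ² / (4 g^{00})` plus a function of the
other coordinates, expresses `ζ²` by these coordinates. -/
theorem HpzLoc_sq (g : Metric d M) {x₀ : M} {q : LocalPhase d} (hq : q ∈ coordTarget x₀)
    (hp : symbolLoc g x₀ q = 0) : HpzLoc g x₀ q ^ 2 =
      -(4 * dualCoef g x₀ 0 0 (dropNormal q).2.1 *
        symbolLoc g x₀ (unstraighten g x₀ (dropNormal q))) := by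
  have hm : dropNormal q ∈ coordTarget x₀ := by
    rw [dropNormal_apply]
    exact add_smul_eξ_mem hq _
  have hG := dualCoef_zero_pos g hm
  have h1 := symbolLoc_unstraighten_add g hm (HpzLoc g x₀ q)
  rw [← straighten_eq_dropNormal, unstraighten_straighten g hq, hp, dropNormal_cov_zero] at h1
  field_simp at h1
  linarith

namespace IsLocalCurve

variable {g : Metric d M} {x₀ : M} {J B : Set ℝ} {q : ℝ → LocalPhase d} {b : ℝ}

/-- If `ζ` does not vanish near `b`, the indicator of `ζ < 0` is locally constant off the jumps and
drops at them, so it is nonincreasing: once positive, `ζ` stays positive. -/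
theorem eventually_pos_or_neg (h : IsLocalCurve g x₀ J B q) (hb : ∀ s ∈ J, s < b)
    (hne : ∀ᶠ s in 𝓝[J \ B] b, HpzLoc g x₀ (q s) ≠ 0) :
    (∀ᶠ s in 𝓝[J \ B] b, 0 < HpzLoc g x₀ (q s)) ∨ ∀ᶠ s in 𝓝[J \ B] b, HpzLoc g x₀ (q s) < 0 := by
  obtain ⟨c, hc, hne⟩ := exists_lt_forall_of_eventually (fun s hs => hb s hs.1) hne
  by_cases hex : ∃ s₁ ∈ J \ B, c < s₁ ∧ 0 < HpzLoc g x₀ (q s₁)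
  · obtain ⟨s₁, hs₁, hcs₁, hpos⟩ := hex
    refine Or.inl (eventually_of_lt_forall (hb s₁ hs₁.1) fun r hr hsr => ?_)
    have h' := h.mono c
    set f : ℝ → ℝ := fun s => if HpzLoc g x₀ (q s) < 0 then 1 else 0 with hf
    have f1 : ∀ {s}, HpzLoc g x₀ (q s) < 0 → f s = 1 := fun hs => if_pos hs
    have f0 : ∀ {s}, 0 < HpzLoc g x₀ (q s) → f s = 0 := fun hs => if_neg hs.not_gt
    have h1 := sub_le_of_hasDerivWithinAt_diff h'.ordConnected h'.discrete (f := f)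
      (f' := fun _ => 0) (C := 0) (fun s hs => by
        have hcont := (h'.hasDerivWithinAt_velocity hs).continuousWithinAt
        have hs' : HpzLoc g x₀ (q s) ≠ 0 := hne s ⟨hs.1.1, hs.2⟩ hs.1.2
        refine (hasDerivWithinAt_const s _ (f s)).congr_of_eventuallyEq ?_ rfl
        rcases lt_or_gt_of_ne hs' with h2 | h2
        · filter_upwards [hcont.eventually (gt_mem_nhds h2)] with u hu
          rw [f1 hu, f1 h2]
        · filter_upwards [hcont.eventually (lt_mem_nhds h2)] with u hu
          rw [f0 hu, f0 h2]) (fun _ _ => le_rfl) (fun S hS => by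
        obtain ⟨v, hv, t1, t2⟩ := h'.velocity_jump hS
        refine ⟨1, 0, tendsto_const_nhds.congr' ?_, tendsto_const_nhds.congr' ?_, zero_le_one⟩
        · filter_upwards [t1.eventually (gt_mem_nhds hv)] with u hu using (f1 hu).symm
        · filter_upwards [t2.eventually (lt_mem_nhds (neg_pos.2 hv))] with u hu
            using (f0 hu).symm)
      (s := s₁) (r := r) ⟨⟨hs₁.1, hcs₁⟩, hs₁.2⟩ ⟨⟨hr.1, hcs₁.trans hsr⟩, hr.2⟩ hsr.le
    rw [f0 hpos, zero_mul, sub_zero] at h1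
    rcases lt_or_gt_of_ne (hne r hr (hcs₁.trans hsr)) with h2 | h2
    · rw [f1 h2] at h1
      norm_num at h1
    · exact h2
  · push Not at hex
    exact Or.inr (eventually_of_lt_forall hc fun r hr hcr =>
      lt_of_le_of_ne (hex r hr hcr) (hne r hr hcr))

/-- A curve in a compact part of a chart converges. -/
theorem exists_tendsto (h : IsLocalCurve g x₀ J B q) (hb : ∀ s ∈ J, s < b)
    (hbot : (𝓝[J \ B] b).NeBot) {C : ℝ}
    (hC : ∀ s ∈ J \ B, ‖hamField (symbolLoc g x₀) (q s)‖ ≤ C) {K : Set (Model d)}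
    (hK : IsClosed K) (hKt : K ⊆ (extChartAt (𝓡∂ d) x₀).target) (hqK : ∀ s ∈ J \ B, (q s).2.1 ∈ K) :
    ∃ w ∈ coordTarget x₀, Tendsto q (𝓝[J \ B] b) (𝓝 w) := by
  -- After `ξ_0` is dropped, every linear functional is Lipschitz along the curve, hence converges.
  have hlim : ∀ L : LocalPhase d →L[ℝ] ℝ, ∃ l, Tendsto (fun s => L (dropNormal (q s)))
      (𝓝[J \ B] b) (𝓝 l) := by
    intro L
    set L' := L.comp dropNormal with hL'
    have hLe : L' eξ = 0 := by rw [hL', ContinuousLinearMap.comp_apply, dropNormal_eξ, map_zero]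
    refine exists_tendsto_of_lipschitz (C := ‖L'‖ * C) (fun s hs r hr => ?_) b
    exact abs_sub_le_of_hasDerivWithinAt_diff h.ordConnected h.discrete
      (f := fun s => L' (q s)) (f' := fun s => L' (hamField (symbolLoc g x₀) (q s)))
      (fun u hu => h.hasDerivWithinAt_apply hLe hu)
      (fun u hu => (L'.le_opNorm _).trans (mul_le_mul_of_nonneg_left (hC u hu) (norm_nonneg _)))
      (fun S hS => h.tendsto_apply hLe hS) hs hr
  obtain ⟨lt, hlt⟩ := hlim (ContinuousLinearMap.fst ℝ ℝ _)
  obtain ⟨lτ, hlτ⟩ := hlim projτ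
  choose lx hlx using fun i => hlim (projX i)
  choose lξ hlξ using fun i => hlim (projξ i)
  set w₀ : LocalPhase d := (lt, WithLp.toLp 2 lx, lτ, WithLp.toLp 2 lξ) with hw₀
  have hdrop : Tendsto (fun s => dropNormal (q s)) (𝓝[J \ B] b) (𝓝 w₀) :=
    tendsto_localPhase hlt hlx hlτ hlξ
  have hbase : ∀ s, (dropNormal (q s)).2.1 = (q s).2.1 := fun s => by
    rw [dropNormal_apply, add_smul_eξ_base]
  have hw₀m : w₀ ∈ coordTarget x₀ := by
    refine hKt (hK.mem_of_tendsto (((projBase (d := d)).continuous.tendsto w₀).comp hdrop) ?_)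
    filter_upwards [self_mem_nhdsWithin] with s hs
    rw [Function.comp_apply, projBase_apply, hbase]
    exact hqK s hs
  have hdropm : ∀ s ∈ J \ B, dropNormal (q s) ∈ coordTarget x₀ := fun s hs => by
    rw [dropNormal_apply]
    exact add_smul_eξ_mem (h.mem s hs) _
  have hdrop' : Tendsto (fun s => dropNormal (q s)) (𝓝[J \ B] b) (𝓝[coordTarget x₀] w₀) :=
    tendsto_nhdsWithin_iff.2 ⟨hdrop, by
      filter_upwards [self_mem_nhdsWithin] with s hs using hdropm s hs⟩
  have hcont : ContinuousOn (fun u : LocalPhase d => -(4 * dualCoef g x₀ 0 0 u.2.1 *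
      symbolLoc g x₀ (unstraighten g x₀ u))) (coordTarget x₀) :=
    ((continuousOn_const.mul (continuousOn_dualCoef_comp g x₀ 0 0)).mul
      ((continuousOn_symbolLoc g x₀).comp (continuousOn_unstraighten g)
        fun u hu => unstraighten_mem g hu)).neg
  -- The limit of `ζ²` is read off from the other coordinates; only the sign of `ζ` remains to be
  -- settled.
  have hsq := (hcont w₀ hw₀m).tendsto.comp hdrop'
  set Z := -(4 * dualCoef g x₀ 0 0 w₀.2.1 * symbolLoc g x₀ (unstraighten g x₀ w₀)) with hZ
  have hsq' : Tendsto (fun s => HpzLoc g x₀ (q s) ^ 2) (𝓝[J \ B] b) (𝓝 Z) := by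
    refine hsq.congr' ?_
    filter_upwards [self_mem_nhdsWithin] with s hs
    rw [HpzLoc_sq g (h.mem s hs) (h.symbol s hs), Function.comp_apply]
  have habs : Tendsto (fun s => |HpzLoc g x₀ (q s)|) (𝓝[J \ B] b) (𝓝 (√Z)) := by
    refine ((Real.continuous_sqrt.tendsto Z).comp hsq').congr fun s => ?_
    rw [Function.comp_apply, Real.sqrt_sq_eq_abs]
  obtain ⟨v, hv⟩ : ∃ v, Tendsto (fun s => HpzLoc g x₀ (q s)) (𝓝[J \ B] b) (𝓝 v) := by
    by_cases hZ0 : √Z = 0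
    · rw [hZ0] at habs
      exact ⟨0, (tendsto_zero_iff_abs_tendsto_zero _).2 habs⟩
    · have hpos : 0 < √Z := lt_of_le_of_ne (Real.sqrt_nonneg _) (Ne.symm hZ0)
      have hne : ∀ᶠ s in 𝓝[J \ B] b, HpzLoc g x₀ (q s) ≠ 0 := by
        filter_upwards [habs.eventually (lt_mem_nhds hpos)] with s hs
        exact abs_pos.1 hs
      rcases h.eventually_pos_or_neg hb hne with h1 | h1
      · refine ⟨√Z, habs.congr' ?_⟩
        filter_upwards [h1] with s hs using abs_of_pos hs
      · refine ⟨-√Z, habs.neg.congr' ?_⟩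
        filter_upwards [h1] with s hs
        rw [abs_of_neg hs, neg_neg]
  have hm' := add_smul_eξ_mem hw₀m v
  have hst : Tendsto (fun s => straighten g x₀ (q s)) (𝓝[J \ B] b)
      (𝓝[coordTarget x₀] (w₀ + v • eξ)) := by
    refine tendsto_nhdsWithin_iff.2 ⟨?_, ?_⟩
    · simp only [straighten_eq_dropNormal]
      exact hdrop.add (hv.smul_const eξ)
    · filter_upwards [self_mem_nhdsWithin] with s hs using straighten_mem g (h.mem s hs)
  refine ⟨_, unstraighten_mem g hm', ((continuousOn_unstraighten g _ hm').tendsto.comp hst).congr' ?_⟩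
  filter_upwards [self_mem_nhdsWithin] with s hs
  rw [Function.comp_apply, unstraighten_straighten g (h.mem s hs)]

theorem tendsto_comp (h : IsLocalCurve g x₀ J B q) {w : LocalPhase d} (hw : w ∈ coordTarget x₀)
    (ht : Tendsto q (𝓝[J \ B] b) (𝓝 w)) {X : Type*} [TopologicalSpace X] {f : LocalPhase d → X}
    (hf : ContinuousOn f (coordTarget x₀)) :
    Tendsto (fun s => f (q s)) (𝓝[J \ B] b) (𝓝 (f w)) := by
  refine (hf w hw).tendsto.comp (tendsto_nhdsWithin_iff.2 ⟨ht, ?_⟩)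
  filter_upwards [self_mem_nhdsWithin] with s hs using h.mem s hs

/-- There are no reflections where the normal velocity is negative. -/
theorem notMem_of_velocity_neg (h : IsLocalCurve g x₀ J B q) (hb : ∀ s ∈ J, s < b)
    (hbot : (𝓝[J \ B] b).NeBot) {c : ℝ}
    (hneg : ∀ s ∈ J \ B, c < s → HpzLoc g x₀ (q s) < 0) : ∀ S ∈ J, c < S → S ∉ B := by
  intro S hS hcS hSB
  obtain ⟨v, hv, -, h2⟩ := h.velocity_jump ⟨hS, hSB⟩
  obtain ⟨r, hr, hSr⟩ := exists_gt_of_neBot hbot (hb S hS)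
  have := nhdsWithin_diff_Ioi_neBot h.ordConnected h.discrete hr.1 hS hSr
  have h3 : -v ≤ 0 := by
    refine le_of_tendsto h2 ?_
    filter_upwards [self_mem_nhdsWithin] with u hu
    exact (hneg u hu.1 (hcS.trans hu.2)).le
  linarith

/-- With a positive limit of `ζ`, the coordinate `z` would start nonnegative and grow at a positive
rate up to `b`, so it could not tend to `0`. -/
theorem velocity_limit_nonpos (h : IsLocalCurve g x₀ J B q) (hb : ∀ s ∈ J, s < b)
    (hbot : (𝓝[J \ B] b).NeBot) {w : LocalPhase d} (hw : w ∈ coordTarget x₀)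
    (ht : Tendsto q (𝓝[J \ B] b) (𝓝 w)) (hz : w.2.1 0 = 0) : HpzLoc g x₀ w ≤ 0 := by
  by_contra hpos
  push Not at hpos
  have h1 := h.tendsto_comp hw ht (continuousOn_HpzLoc g x₀)
  obtain ⟨c, hc, hα⟩ := exists_lt_forall_of_eventually (fun s hs => hb s hs.1)
    (h1.eventually (lt_mem_nhds (half_lt_self hpos)))
  obtain ⟨s, hs, hcs⟩ := exists_gt_of_neBot hbot hc
  have h' := h.mono c
  have hz0 : Tendsto (fun s => (q s).2.1 0) (𝓝[J \ B] b) (𝓝 0) := by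
    rw [← hz]
    exact ((projX (d := d) 0).continuous.tendsto w).comp ht
  have h2 : Tendsto (fun r => HpzLoc g x₀ w / 2 * (r - s)) (𝓝[J \ B] b)
      (𝓝 (HpzLoc g x₀ w / 2 * (b - s))) :=
    ((continuous_const.mul (continuous_id.sub continuous_const)).tendsto b).mono_left
      nhdsWithin_le_nhds
  have h3 : HpzLoc g x₀ w / 2 * (b - s) ≤ 0 := by
    refine le_of_tendsto_of_tendsto h2 hz0 (eventually_of_lt_forall (hb s hs.1)
      fun r hr hsr => ?_)
    have h4 := h'.mono_normal (fun u hu => (hα u ⟨hu.1.1, hu.2⟩ hu.1.2).le)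
      ⟨⟨hs.1, hcs⟩, hs.2⟩ ⟨⟨hr.1, hcs.trans hsr⟩, hr.2⟩ hsr.le
    have h5 := h.nonneg hs
    linarith
  have := mul_pos (half_pos hpos) (sub_pos.2 (hb s hs.1))
  linarith

/-- While `ζ < 0` no jump is possible, and a zero of `z` would be followed by negative values. So
`b` can be added as an isolated reflection time, approached through interior points. -/
theorem exists_lt_of_velocity_neg (h : IsLocalCurve g x₀ J B q) (hb : ∀ s ∈ J, s < b)
    (hbot : (𝓝[J \ B] b).NeBot) {w : LocalPhase d} (hw : w ∈ coordTarget x₀)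
    (ht : Tendsto q (𝓝[J \ B] b) (𝓝 w)) (hneg : HpzLoc g x₀ w < 0) :
    ∃ c < b, ∀ s ∈ J, c < s → s ∉ B ∧ (q s).2.1 0 ≠ 0 := by
  have h1 := h.tendsto_comp hw ht (continuousOn_HpzLoc g x₀)
  obtain ⟨c, hc, hα⟩ := exists_lt_forall_of_eventually (fun s hs => hb s hs.1)
    (h1.eventually (gt_mem_nhds (show HpzLoc g x₀ w < HpzLoc g x₀ w / 2 by linarith)))
  have h' := h.mono c
  have hB := h.notMem_of_velocity_neg hb hbot fun s hs hcs => (hα s hs hcs).trans (by linarith)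
  refine ⟨c, hc, fun s hs hcs => ⟨hB s hs hcs, fun hzs => ?_⟩⟩
  obtain ⟨r, hr, hsr⟩ := exists_gt_of_neBot hbot (hb s hs)
  have h4 := h'.anti_normal (fun u hu => (hα u ⟨hu.1.1, hu.2⟩ hu.1.2).le)
    ⟨⟨hs, hcs⟩, hB s hs hcs⟩ ⟨⟨hr.1, hcs.trans hsr⟩, hr.2⟩ hsr.le
  have h5 := h.nonneg hr
  have := mul_neg_of_neg_of_pos (show HpzLoc g x₀ w / 2 < 0 by linarith) (sub_pos.2 hsr)
  linarith

end IsLocalCurve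

/-! ### The derivative at the end of an interval -/

theorem hasDerivWithinAt_insert {E : Type*} [NormedAddCommGroup E] [NormedSpace ℝ E] {f : ℝ → E}
    {v : E} {A : Set ℝ} {s y : ℝ} :
    HasDerivWithinAt f v (insert y A) s ↔ HasDerivWithinAt f v A s :=
  hasFDerivWithinAt_insert

theorem ordConnected_insert_of_neBot {J A : Set ℝ} {b : ℝ} (hJ : J.OrdConnected) (hA : A ⊆ J)
    (hb : ∀ s ∈ J, s < b) (hbot : (𝓝[A] b).NeBot) : (insert b J).OrdConnected := by
  refine ⟨?_⟩
  have key : ∀ u ∈ J, ∀ v, u ≤ v → v ≤ b → v ∈ insert b J := by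
    intro u hu v huv hvb
    rcases hvb.eq_or_lt with rfl | hlt
    · exact mem_insert _ _
    · obtain ⟨s, hs⟩ := ((eventually_of_lt_forall hlt (fun s _ hs => hs)).and
        self_mem_nhdsWithin : ∀ᶠ s in 𝓝[A] b, v < s ∧ s ∈ A).exists
      exact mem_insert_of_mem _ (hJ.out hu (hA hs.2) ⟨huv, hs.1.le⟩)
  rintro u (rfl | hu) w (rfl | hw) v ⟨h1, h2⟩
  · exact Or.inl (le_antisymm h2 h1)
  · exact absurd (hb w hw) (h1.trans h2).not_gt
  · exact key u hu v h1 h2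
  · exact Or.inr (hJ.out hu hw ⟨h1, h2⟩)

theorem insert_inter_of_notMem {J B : Set ℝ} {b : ℝ} (hbB : b ∉ B) :
    insert b J ∩ B = J ∩ B := by
  ext s
  simp only [mem_inter_iff, mem_insert_iff]
  constructor
  · rintro ⟨rfl | h, h'⟩
    · exact absurd h' hbB
    · exact ⟨h, h'⟩
  · exact fun h => ⟨Or.inr h.1, h.2⟩

theorem eventually_ne_of_notMem {A : Set ℝ} {b : ℝ} (hb : b ∉ A) : ∀ᶠ s in 𝓝[A] b, s ≠ b := by
  filter_upwards [self_mem_nhdsWithin] with s hs h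
  exact hb (h ▸ hs)

theorem hasDerivWithinAt_endpoint {J B : Set ℝ} {b v : ℝ} (hJ : (insert b J).OrdConnected)
    (hB : IsDiscrete B) (hbJ : b ∉ J) (hbB : b ∉ B) {f f' : ℝ → ℝ}
    (hfc : Tendsto f (𝓝[J \ B] b) (𝓝 (f b)))
    (hf : ∀ s ∈ J \ B, HasDerivWithinAt f (f' s) (J \ B) s)
    (hlim : Tendsto f' (𝓝[J \ B] b) (𝓝 v))
    (hjump : ∀ᶠ S in 𝓝[J ∩ B] b, ∃ l, Tendsto f (𝓝[J \ B] S) (𝓝 l)) :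
    HasDerivWithinAt f v (J \ B) b := by
  have hins : insert b J \ B = insert b (J \ B) := insert_sdiff_of_notMem _ hbB
  have := hasDerivWithinAt_of_tendsto_deriv_diff hJ hB (f := f) (f' := f') (s₀ := b) (v := v)
    ⟨mem_insert _ _, hbB⟩ ?_ ?_ ?_ ?_
  · rwa [hins, hasDerivWithinAt_insert] at this
  · rw [hins, continuousWithinAt_insert_self]
    exact hfc
  · rw [hins]
    filter_upwards [self_mem_nhdsWithin] with s hs hne
    rw [hasDerivWithinAt_insert]
    exact hf s (hs.resolve_left hne)
  · rwa [hins, insert_sdiff_self_of_notMem (fun h => hbJ h.1)]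
  · rw [insert_inter_of_notMem hbB, hins]
    filter_upwards [hjump, eventually_ne_of_notMem (A := J ∩ B) (fun h => hbB h.2)] with S hS hne
    rwa [nhdsWithin_insert_of_ne hne]

namespace IsLocalCurve

variable {g : Metric d M} {x₀ : M} {J B : Set ℝ} {q : ℝ → LocalPhase d} {b : ℝ}

theorem hasDerivWithinAt_apply_endpoint (h : IsLocalCurve g x₀ J B q) (hb : ∀ s ∈ J, s < b)
    (hbot : (𝓝[J \ B] b).NeBot) (hbB : b ∉ B) (hw : q b ∈ coordTarget x₀)
    (ht : Tendsto q (𝓝[J \ B] b) (𝓝 (q b))) {L : LocalPhase d →L[ℝ] ℝ} (hL : L eξ = 0) :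
    HasDerivWithinAt (fun r => L (q r)) (L (hamField (symbolLoc g x₀) (q b))) (J \ B) b :=
  hasDerivWithinAt_endpoint (ordConnected_insert_of_neBot h.ordConnected sdiff_subset hb hbot)
    h.discrete (fun hbJ => (hb b hbJ).false) hbB ((L.continuous.tendsto _).comp ht)
    (fun s hs => h.hasDerivWithinAt_apply hL hs)
    ((L.continuous.tendsto _).comp (h.tendsto_comp hw ht (continuousOn_hamField g x₀)))
    (by filter_upwards [self_mem_nhdsWithin] with S hS using h.tendsto_apply hL hS)

theorem notMem_of_normal_pos (h : IsLocalCurve g x₀ J B q) (hb : ∀ s ∈ J, s < b)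
    (hbot : (𝓝[J \ B] b).NeBot) {c α : ℝ} (hα : 0 < α)
    (hpos : ∀ s ∈ J \ B, c < s → α ≤ (q s).2.1 0) : ∀ S ∈ J, c < S → S ∉ B := by
  intro S hS hcS hSB
  obtain ⟨q₁, -, hz, -, -, h2⟩ := h.jump S ⟨hS, hSB⟩
  obtain ⟨r, hr, hSr⟩ := exists_gt_of_neBot hbot (hb S hS)
  have := nhdsWithin_diff_Ioi_neBot h.ordConnected h.discrete hr.1 hS hSr
  have h3 := ((projX (d := d) 0).continuous.tendsto _).comp h2
  have h4 := ge_of_tendsto (b := α) h3 (by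
    filter_upwards [self_mem_nhdsWithin] with u hu
    exact hpos u hu.1 (hcS.trans hu.2))
  rw [map_sub, map_smul] at h4
  simp [hz] at h4
  linarith

/-- The counterpart at an endpoint of the analysis on the doubled space. For `z > 0`, or `z = 0`
with `H_p² z > 0`, there are no jumps near `b` and the derivatives converge; for `z = 0` with `H_p²
z ≤ 0` the energy forces a zero derivative. -/
theorem hasDerivWithinAt_velocity_endpoint (h : IsLocalCurve g x₀ J B q) (hb : ∀ s ∈ J, s < b)
    (hbot : (𝓝[J \ B] b).NeBot) (hbB : b ∉ B) (hw : q b ∈ coordTarget x₀)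
    (ht : Tendsto q (𝓝[J \ B] b) (𝓝 (q b)))
    (hg : (q b).2.1 0 = 0 → HpzLoc g x₀ (q b) = 0) :
    HasDerivWithinAt (fun r => HpzLoc g x₀ (q r)) (normalAccel g x₀ (q b)) (J \ B) b := by
  have hJ := ordConnected_insert_of_neBot h.ordConnected sdiff_subset hb hbot
  have hbJ : b ∉ J := fun hbJ => (hb b hbJ).false
  have hins : insert b J \ B = insert b (J \ B) := insert_sdiff_of_notMem _ hbB
  have hζ := h.tendsto_comp hw ht (continuousOn_HpzLoc g x₀)
  have ha := h.tendsto_comp hw ht (continuousOn_Hp2zLoc g x₀)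
  have hz : Tendsto (fun s => (q s).2.1 0) (𝓝[J \ B] b) (𝓝 ((q b).2.1 0)) :=
    ((projX (d := d) 0).continuous.tendsto _).comp ht
  have regular : Hp2zLoc g x₀ (q b) = normalAccel g x₀ (q b) →
      (∀ᶠ s in 𝓝[J \ B] b, normalAccel g x₀ (q s) = Hp2zLoc g x₀ (q s)) →
      (∃ c < b, ∀ S ∈ J, c < S → S ∉ B) →
      HasDerivWithinAt (fun r => HpzLoc g x₀ (q r)) (normalAccel g x₀ (q b)) (J \ B) b := by
    rintro h1 h2 ⟨c, hc, h3⟩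
    refine hasDerivWithinAt_endpoint hJ h.discrete hbJ hbB hζ
      (fun s hs => h.hasDerivWithinAt_velocity hs) ?_ ?_
    · rw [← h1]
      exact ha.congr' (h2.mono fun s hs => hs.symm)
    · filter_upwards [self_mem_nhdsWithin, nhdsWithin_le_nhds (Ioi_mem_nhds hc)] with S hS hcS
      exact absurd hS.2 (h3 S hS.1 hcS)
  by_cases hz0 : (q b).2.1 0 = 0
  swap
  · have hzpos : 0 < (q b).2.1 0 := lt_of_le_of_ne (coordTarget_subset x₀ hw) (Ne.symm hz0)
    have h1 := hz.eventually (lt_mem_nhds (half_lt_self hzpos))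
    refine regular (by simp [normalAccel, hz0]) ?_ ?_
    · filter_upwards [h1] with s hs
      have : (q s).2.1 0 ≠ 0 := by linarith
      simp [normalAccel, this]
    · obtain ⟨c, hc, h2⟩ := exists_lt_forall_of_eventually (fun s hs => hb s hs.1) h1
      exact ⟨c, hc, h.notMem_of_normal_pos hb hbot (half_pos hzpos)
        fun s hs hcs => (h2 s hs hcs).le⟩
  have hζ0 := hg hz0
  rcases lt_or_ge 0 (Hp2zLoc g x₀ (q b)) with hpos | hneg
  · have h1 := ha.eventually (lt_mem_nhds (half_lt_self hpos))
    have h2 : ∀ s, Hp2zLoc g x₀ (q b) / 2 < Hp2zLoc g x₀ (q s) →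
        normalAccel g x₀ (q s) = Hp2zLoc g x₀ (q s) := fun s hs =>
      if_neg fun hc => by linarith [hc.2.2]
    refine regular (h2 b (half_lt_self hpos)).symm (h1.mono h2) ?_
    obtain ⟨c, hc, h3⟩ := exists_lt_forall_of_eventually (fun s hs => hb s hs.1) h1
    refine ⟨c, hc, h.notMem_of_velocity_neg hb hbot fun s hs hcs => ?_⟩
    -- Before `b` the velocity climbs at rate at least half of `H_p² z` and reaches `0` only at `b`;
    -- it is thus negative, which excludes jumps.
    have h4 : Hp2zLoc g x₀ (q b) / 2 * (b - s) ≤ 0 - HpzLoc g x₀ (q s) := by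
      rw [hζ0] at hζ
      refine le_of_tendsto_of_tendsto (b := 𝓝[J \ B] b)
        (f := fun r => Hp2zLoc g x₀ (q b) / 2 * (r - s))
        (((continuous_const.mul (continuous_id.sub continuous_const)).tendsto b).mono_left
          nhdsWithin_le_nhds) (hζ.sub_const _) (eventually_of_lt_forall (hb s hs.1)
            fun r hr hsr => ?_)
      refine (h.mono c).mono_velocity (fun u hu => ?_) ⟨⟨hs.1, hcs⟩, hs.2⟩
        ⟨⟨hr.1, hcs.trans hsr⟩, hr.2⟩ hsr.le
      have h5 := h3 u ⟨hu.1.1, hu.2⟩ hu.1.2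
      rw [h2 u h5]
      exact h5.le
    have := mul_pos (half_pos hpos) (sub_pos.2 (hb s hs.1))
    linarith
  · have hacc : normalAccel g x₀ (q b) = 0 := by
      unfold normalAccel
      split_ifs with hc
      · rfl
      · by_contra hne
        exact hc ⟨hz0, hζ0, lt_of_le_of_ne hneg hne⟩
    have main := hasDerivWithinAt_zero_of_energy hJ h.discrete (s₀ := b)
      (a₀ := Hp2zLoc g x₀ (q b)) (ζ := fun s => HpzLoc g x₀ (q s)) (z := fun s => (q s).2.1 0)
      (a := fun s => Hp2zLoc g x₀ (q s)) ⟨mem_insert _ _, hbB⟩ hneg ?_ hζ0 hz0 ?_ ?_ ?_ ?_ ?_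
    · rwa [hacc, ← hasDerivWithinAt_insert (y := b), ← hins]
    · rintro s ⟨rfl | hs, hsB⟩
      · exact hz0.ge
      · exact h.nonneg ⟨hs, hsB⟩
    · rw [hins, continuousWithinAt_insert_self]
      exact hζ
    · rw [hins, continuousWithinAt_insert_self]
      exact hz
    · rw [hins, nhdsWithin_insert, tendsto_sup]
      exact ⟨tendsto_pure_nhds _ _, ha⟩
    · rw [hins]
      filter_upwards [self_mem_nhdsWithin] with s hs hne
      replace hs := hs.resolve_left hne
      refine ⟨_, hasDerivWithinAt_insert.2 ((((h.hasDerivWithinAt_velocity hs).pow 2).div_const 2).sub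
        ((h.hasDerivWithinAt_normal hs).const_mul (Hp2zLoc g x₀ (q b)))), ?_⟩
      unfold normalAccel
      split_ifs with hc
      · simp [hc.2.1]
      · rw [← abs_mul]
        apply le_of_eq
        congr 1
        push_cast
        ring
    · rw [insert_inter_of_notMem hbB, hins]
      filter_upwards [eventually_ne_of_notMem (A := J ∩ B) (fun h => hbB h.2),
        self_mem_nhdsWithin] with S hne hS
      rw [nhdsWithin_insert_of_ne hne]
      obtain ⟨v, -, t1, t2⟩ := h.velocity_jump hS
      obtain ⟨l, hl⟩ := h.tendsto_apply (L := projX 0) (by simp) hS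
      refine ⟨v ^ 2 / 2 - Hp2zLoc g x₀ (q b) * l, Tendsto.sub ?_ (hl.const_mul _)⟩
      rw [nhdsWithin_diff_eq (fun hc => hc.2 hS.2), tendsto_sup]
      refine ⟨(t1.pow 2).div_const 2, ?_⟩
      have := (t2.pow 2).div_const 2
      rwa [neg_sq] at this

/-- A curve that converges at the end of its interval, to a point that is not hyperbolic, satisfies
the equation there. -/
theorem hasDerivWithinAt_limit (h : IsLocalCurve g x₀ J B q) (hb : ∀ s ∈ J, s < b)
    (hbot : (𝓝[J \ B] b).NeBot) (hbB : b ∉ B) (hw : q b ∈ coordTarget x₀)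
    (ht : Tendsto q (𝓝[J \ B] b) (𝓝 (q b)))
    (hg : (q b).2.1 0 = 0 → HpzLoc g x₀ (q b) = 0) :
    HasDerivWithinAt q (genFieldLoc g x₀ (q b)) (insert b (J \ B)) b := by
  have hmem : ∀ s ∈ insert b (J \ B), q s ∈ coordTarget x₀ := by
    rintro s (rfl | hs)
    · exact hw
    · exact h.mem s hs
  have hL : ∀ L : LocalPhase d →L[ℝ] ℝ, L eξ = 0 →
      HasDerivWithinAt (fun r => L (q r)) (L (hamField (symbolLoc g x₀) (q b)))
        (insert b (J \ B)) b := fun L hL =>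
    hasDerivWithinAt_insert.2 (h.hasDerivWithinAt_apply_endpoint hb hbot hbB hw ht hL)
  have hv := (hasDerivWithinAt_insert (y := b)).2
    (h.hasDerivWithinAt_velocity_endpoint hb hbot hbB hw ht hg)
  -- The derivative of `ξ_0` at the end is accessible only through that of `H_p z`, so the equation
  -- is first proved with `H_p z` in place of `ξ_0`.
  have hst : HasDerivWithinAt (fun s => straighten g x₀ (q s))
      (straightField g x₀ (normalAccel g x₀ (q b)) (q b)) (insert b (J \ B)) b := by
    refine hasDerivWithinAt_localPhase ?_ (fun i => ?_) ?_ (fun i => ?_)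
    · convert! hL (ContinuousLinearMap.fst ℝ ℝ _) (by simp) using 1
      · ext s; simp [straighten]
      · simp [straightField]
    · convert! hL (projX i) (by simp) using 1
      · ext s; simp [straighten]
      · simp [straightField]
    · convert! hL projτ (by simp) using 1
      · ext s; simp [straighten]
      · simp [straightField]
    · by_cases hi : i = 0
      · subst hi
        convert! hv using 1
        · ext s; exact straighten_cov_zero g
        · simp [straightField]
      · convert! hL (projξ i) (by simp [eξ_cov_of_ne hi]) using 1
        · ext s; simp [straighten, eξ_cov_of_ne hi]
        · simp [straightField, eξ_cov_of_ne hi]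
  have h1 := hasDerivWithinAt_unstraighten g (r := fun s => straighten g x₀ (q s))
    (fun s hs => straighten_mem g (hmem s hs)) (mem_insert _ _)
    (b := normalAccel g x₀ (q b)) (by rwa [unstraighten_straighten g hw])
  rw [unstraighten_straighten g hw, straighten_base, ← genFieldLoc_eq g hw] at h1
  exact h1.congr (fun s hs => (unstraighten_straighten g (hmem s hs)).symm)
    (unstraighten_straighten g hw).symm

end IsLocalCurve

/-! ### Bounds on a compact part of a chart -/

theorem cometric_smul (g : Metric d M) (x₀ : M) (y ξ : Model d) (c : ℝ) :
    cometric g x₀ y (c • ξ) (c • ξ) = c ^ 2 * cometric g x₀ y ξ ξ := by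
  simp only [cometric_eq, Finset.mul_sum, PiLp.smul_apply, smul_eq_mul]
  refine Finset.sum_congr rfl fun i _ => Finset.sum_congr rfl fun j _ => ?_
  ring

/-- The minimum of the dual metric over `K` times the unit sphere is positive by compactness;
homogeneity does the rest. -/
theorem exists_mul_sq_le_cometric (g : Metric d M) (x₀ : M) {K : Set (Model d)} (hK : IsCompact K)
    (hKt : K ⊆ (extChartAt (𝓡∂ d) x₀).target) :
    ∃ m > 0, ∀ y ∈ K, ∀ ξ : Model d, m * ‖ξ‖ ^ 2 ≤ cometric g x₀ y ξ ξ := by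
  have hcont : ContinuousOn (fun p : Model d × Model d => cometric g x₀ p.1 p.2 p.2)
      (K ×ˢ Metric.sphere (0 : Model d) 1) := by
    simp only [cometric_eq]
    refine continuousOn_finsetSum _ fun i _ => continuousOn_finsetSum _ fun j _ => ?_
    have h1 : ContinuousOn (fun p : Model d × Model d => dualCoef g x₀ i j p.1)
        (K ×ˢ Metric.sphere (0 : Model d) 1) :=
      (contDiffOn_dualCoef g x₀ i j).continuousOn.comp continuousOn_fst fun p hp => hKt hp.1
    have h2 : Continuous fun p : Model d × Model d => p.2 i := by fun_prop
    have h3 : Continuous fun p : Model d × Model d => p.2 j := by fun_prop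
    exact (h1.mul h2.continuousOn).mul h3.continuousOn
  obtain ⟨m, hm, hle⟩ := (hK.prod (isCompact_sphere (0 : Model d) 1)).exists_forall_le'
    hcont (a := 0) (by
      rintro ⟨y, ξ⟩ ⟨hy, hξ⟩
      refine cometric_pos g x₀ (hKt hy) fun h0 => ?_
      simp only at hξ h0
      simp [h0] at hξ)
  refine ⟨m, hm, fun y hy ξ => ?_⟩
  by_cases hξ : ξ = 0
  · subst hξ
    have := cometric_smul g x₀ y 0 0
    rw [smul_zero] at this
    rw [this]
    simp
  · have hn : ‖ξ‖ ≠ 0 := norm_ne_zero_iff.2 hξ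
    have h1 := hle (y, ‖ξ‖⁻¹ • ξ) ⟨hy, by simp [norm_smul, hn]⟩
    have h2 : ξ = ‖ξ‖ • (‖ξ‖⁻¹ • ξ) := by rw [smul_smul, mul_inv_cancel₀ hn, one_smul]
    have h3 := cometric_smul g x₀ y (‖ξ‖⁻¹ • ξ) ‖ξ‖
    rw [← h2] at h3
    rw [h3, mul_comm]
    exact mul_le_mul_of_nonneg_left h1 (sq_nonneg _)

/-- On `Char p` with `τ = τ₀` the dual metric gives `m ‖ξ‖² ≤ τ₀²`, so all coordinates but `t` are
in a compact set. As the field does not depend on `t`, it is evaluated at `t = 0`. -/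
theorem exists_norm_hamField_le (g : Metric d M) (x₀ : M) {K : Set (Model d)} (hK : IsCompact K)
    (hKt : K ⊆ (extChartAt (𝓡∂ d) x₀).target) (τ₀ : ℝ) :
    ∃ C, ∀ q : LocalPhase d, q.2.1 ∈ K → q.2.2.1 = τ₀ → symbolLoc g x₀ q = 0 →
      ‖hamField (symbolLoc g x₀) q‖ ≤ C := by
  obtain ⟨m, hm, hle⟩ := exists_mul_sq_le_cometric g x₀ hK hKt
  have hcpt : IsCompact (({0} : Set ℝ) ×ˢ (K ×ˢ (({τ₀} : Set ℝ) ×ˢ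
      Metric.closedBall (0 : Model d) (√(τ₀ ^ 2 / m))))) :=
    isCompact_singleton.prod (hK.prod (isCompact_singleton.prod (isCompact_closedBall _ _)))
  obtain ⟨C, hC⟩ := hcpt.exists_bound_of_continuousOn
    ((continuousOn_hamField g x₀).mono fun q hq => hKt hq.2.1)
  refine ⟨C, fun q hy hτ hp => ?_⟩
  have h1 : hamField (symbolLoc g x₀) q = hamField (symbolLoc g x₀) ((0 : ℝ), q.2) := by
    rw [hamField_symbolLoc g x₀ (show q ∈ coordTarget x₀ from hKt hy),
      hamField_symbolLoc g x₀ (show ((0 : ℝ), q.2) ∈ coordTarget x₀ from hKt hy)]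
  rw [h1]
  refine hC _ ⟨rfl, hy, hτ, ?_⟩
  rw [mem_closedBall_zero_iff]
  refine Real.le_sqrt_of_sq_le ?_
  rw [le_div_iff₀ hm, mul_comm]
  have h2 := hle _ hy q.2.2.2
  unfold symbolLoc at hp
  rw [hτ] at hp
  simp only
  linarith

theorem exists_closedBall_subset_target (x₀ : M) : ∃ r > 0,
    Metric.closedBall (extChartAt (𝓡∂ d) x₀ x₀) r ∩ range (𝓡∂ d) ⊆
      (extChartAt (𝓡∂ d) x₀).target := by
  obtain ⟨r, hr, h⟩ := Metric.mem_nhdsWithin_iff.1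
    (extChartAt_target_mem_nhdsWithin (I := 𝓡∂ d) x₀)
  exact ⟨r / 2, half_pos hr, fun y hy =>
    h ⟨Metric.closedBall_subset_ball (half_lt_self hr) hy.1, hy.2⟩⟩

/-- A curve that accumulates at a point is eventually in a compact part of the chart there. -/
theorem IsGenBichar.exists_chart [T2Space M] [CompactSpace M] {g : Metric d M} {J B : Set ℝ}
    {γ : ℝ → Phase d M} (h : IsGenBichar g J B γ) {b : ℝ} (hb : ∀ s ∈ J, s < b)
    (hbot : (𝓝[J \ B] b).NeBot) :
    ∃ (x₀ : M) (K : Set (Model d)), IsCompact K ∧ K ⊆ (extChartAt (𝓡∂ d) x₀).target ∧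
      ∃ c < b, ∀ s ∈ J \ B, c < s → γ s ∈ chartDom x₀ ∧ (coord x₀ (γ s)).2.1 ∈ K := by
  -- A cluster point is all that compactness gives; the bump function below shows that the curve
  -- cannot leave its neighbourhood again and again.
  obtain ⟨x₀, hx₀⟩ := exists_clusterPt_of_compactSpace
    (map (fun s => Phase.base (γ s)) (𝓝[J \ B] b))
  obtain ⟨r, hr, hrt⟩ := exists_closedBall_subset_target (d := d) x₀
  set φ := extChartAt (𝓡∂ d) x₀ with hφ
  set K := Metric.closedBall (φ x₀) r ∩ range (𝓡∂ d) with hKdef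
  have hK : IsCompact K := (isCompact_closedBall _ _).inter_right (𝓡∂ d).isClosed_range
  set KM := φ.symm '' K with hKM
  have hKMc : IsClosed KM :=
    (hK.image_of_continuousOn ((continuousOn_extChartAt_symm x₀).mono hrt)).isClosed
  have hKMs : KM ⊆ φ.source := by
    rintro _ ⟨y, hy, rfl⟩
    exact φ.map_target (hrt hy)
  have hso : IsOpen φ.source := isOpen_extChartAt_source x₀
  -- The bump function, extended by zero, is continuous because the image of the compact set `K` is
  -- closed in the Hausdorff space `M`.
  let χ : ContDiffBump (φ x₀) := ⟨r / 2, r, half_pos hr, half_lt_self hr⟩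
  let F : M → ℝ := fun x => open Classical in if x ∈ φ.source then χ (φ x) else 0
  have hFs : ∀ {x}, x ∈ φ.source → F x = χ (φ x) := fun hx => if_pos hx
  have hFK : ∀ {x}, F x ≠ 0 → x ∈ φ.source ∧ φ x ∈ K := by
    intro x hx
    have hxs : x ∈ φ.source := by
      by_contra hc
      exact hx (if_neg hc)
    rw [hFs hxs] at hx
    refine ⟨hxs, ?_, extChartAt_target_subset_range x₀ (φ.map_source hxs)⟩
    have h1 : φ x ∈ Function.support χ := hx
    rw [χ.support_eq] at h1
    exact Metric.ball_subset_closedBall h1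
  have hF0 : ∀ {x}, x ∉ KM → F x = 0 := by
    intro x hx
    by_contra hc
    obtain ⟨h1, h2⟩ := hFK hc
    exact hx ⟨φ x, h2, φ.left_inv h1⟩
  have hFc : Continuous F := by
    rw [continuous_iff_continuousAt]
    intro x
    by_cases hx : x ∈ KM
    · have h1 : ContinuousAt (fun x => χ (φ x)) x :=
        (χ.contDiff (n := 0)).continuous.continuousAt.comp
          (continuousAt_extChartAt' (by rw [extChartAt_source, ← extChartAt_source (𝓡∂ d)]; exact hKMs hx))
      refine h1.congr ?_
      filter_upwards [hso.mem_nhds (hKMs hx)] with u hu using (hFs hu).symm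
    · refine (continuousAt_const (y := (0 : ℝ))).congr ?_
      filter_upwards [hKMc.isOpen_compl.mem_nhds hx] with u hu using (hF0 hu).symm
  obtain ⟨s₀, hs₀⟩ := h.exists_mem_diff
  obtain ⟨C, hC⟩ := exists_norm_hamField_le g x₀ hK hrt (γ s₀).tau
  obtain ⟨D, hD⟩ := hK.exists_bound_of_continuousOn
    ((χ.contDiff (n := 1)).continuous_fderiv one_ne_zero).continuousOn
  have hbase : Continuous (fun ρ : Phase d M => F (Phase.base ρ)) := hFc.comp continuous_base
  set L : ℝ := max 0 (D * C) with hL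
  have hder : ∀ s ∈ J \ B, ∃ e, HasDerivWithinAt (fun s => F (Phase.base (γ s))) e (J \ B) s ∧
      |e| ≤ L := by
    intro s hs
    have hcont : ContinuousWithinAt (fun s => Phase.base (γ s)) (J \ B) s :=
      continuous_base.continuousAt.comp_continuousWithinAt (h.continuousWithinAt s hs)
    by_cases hx : Phase.base (γ s) ∈ KM
    · have hxs := hKMs hx
      have hdom : γ s ∈ chartDom x₀ := by
        have := hxs
        rw [hφ, extChartAt_source] at this
        exact this
      have hyK : (coord x₀ (γ s)).2.1 ∈ K := by
        obtain ⟨y, hy, hyx⟩ := hx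
        have : φ (Phase.base (γ s)) = y := by rw [← hyx, φ.right_inv (hrt hy)]
        change φ (Phase.base (γ s)) ∈ K
        rwa [this]
      have h1 := (hasDerivWithinAt_coord_iff g hdom (h.mem_char s hs)
        (h.continuousWithinAt s hs)).1 (h.hasDeriv s hs)
      have h2 := (projBase (d := d)).hasFDerivAt.comp_hasDerivWithinAt s h1
      have h3 := (((χ.contDiff (n := 1)).differentiable one_ne_zero)
        ((coord x₀ (γ s)).2.1)).hasFDerivAt.comp_hasDerivWithinAt s h2
      refine ⟨_, h3.congr_of_eventuallyEq ?_ (hFs hxs), (le_max_right _ _).trans' ?_⟩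
      · filter_upwards [hcont.eventually (hso.mem_nhds hxs)] with u hu using hFs hu
      · have h4 := hC (coord x₀ (γ s)) hyK (h.tau_eq hs₀ hs)
          ((mem_charSet_iff g hdom).1 (h.mem_char s hs))
        rw [projBase_apply, genFieldLoc_base g (coord_mem_coordTarget hdom)]
        rw [← Real.norm_eq_abs]
        refine (ContinuousLinearMap.le_opNorm _ _).trans ?_
        refine mul_le_mul (hD _ hyK) (le_trans ?_ h4) (norm_nonneg _)
          ((norm_nonneg _).trans (hD _ hyK))
        exact (norm_fst_le (hamField (symbolLoc g x₀) (coord x₀ (γ s))).2).trans (norm_snd_le _)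
    · refine ⟨0, (hasDerivWithinAt_const s _ (0 : ℝ)).congr_of_eventuallyEq ?_ (hF0 hx), ?_⟩
      · filter_upwards [hcont.eventually (hKMc.isOpen_compl.mem_nhds hx)] with u hu using hF0 hu
      · rw [abs_zero]
        exact le_max_left _ _
  choose! e he heL using hder
  obtain ⟨l, hl⟩ := exists_tendsto_of_lipschitz (f := fun s => F (Phase.base (γ s)))
    (A := J \ B) (C := L) (fun s hs r hr =>
      abs_sub_le_of_hasDerivWithinAt_diff h.ordConnected h.discrete he heL
        (fun S hS => h.tendsto_of_reflection hbase (fun ρ => rfl) hS) hs hr) b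
  have hF1 : F x₀ = 1 := by
    rw [hFs (mem_extChartAt_source x₀)]
    exact χ.one_of_mem_closedBall (Metric.mem_closedBall_self (half_pos hr).le)
  -- Along the curve `F` is Lipschitz and has a limit. The cluster point makes it at least `1/2`
  -- frequently, so the limit is positive and the curve eventually remains in the support, inside
  -- `K`.
  have hfreq : ∃ᶠ s in 𝓝[J \ B] b, 1 / 2 ≤ F (Phase.base (γ s)) := by
    have h1 : ∀ᶠ x in 𝓝 x₀, 1 / 2 ≤ F x :=
      (hFc.continuousAt.eventually (lt_mem_nhds (show 1 / 2 < F x₀ by rw [hF1]; norm_num))).mono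
        fun x hx => le_of_lt hx
    exact frequently_map.1 (hx₀.frequently h1)
  have hl2 : 1 / 2 ≤ l := ge_of_tendsto_of_frequently hl hfreq
  obtain ⟨c, hc, hcF⟩ := exists_lt_forall_of_eventually (fun s hs => hb s hs.1)
    (hl.eventually (lt_mem_nhds (show (0 : ℝ) < l by linarith)))
  refine ⟨x₀, K, hK, hrt, c, hc, fun s hs hcs => ?_⟩
  obtain ⟨h1, h2⟩ := hFK (hcF s hs hcs).ne'
  refine ⟨?_, h2⟩
  rw [hφ, extChartAt_source] at h1
  exact h1

theorem IsGenBichar.isLocalCurve [T2Space M] {g : Metric d M} {J B : Set ℝ}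
    {γ : ℝ → Phase d M} (h : IsGenBichar g J B γ) {b c : ℝ} (hb : ∀ s ∈ J, s < b)
    (hbot : (𝓝[J \ B] b).NeBot) {x₀ : M} {K : Set (Model d)} (hK : IsCompact K)
    (hKt : K ⊆ (extChartAt (𝓡∂ d) x₀).target)
    (hγ : ∀ s ∈ J \ B, c < s → γ s ∈ chartDom x₀ ∧ (coord x₀ (γ s)).2.1 ∈ K) :
    IsLocalCurve g x₀ (J ∩ Ioi c) B (fun s => coord x₀ (γ s)) := by
  have hsub : (J ∩ Ioi c) \ B ⊆ J \ B := sdiff_subset_sdiff_left inter_subset_left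
  have hdom : ∀ s ∈ (J ∩ Ioi c) \ B, γ s ∈ chartDom x₀ := fun s hs => (hγ s (hsub hs) hs.1.2).1
  have hKM : IsClosed ((extChartAt (𝓡∂ d) x₀).symm '' K) :=
    (hK.image_of_continuousOn ((continuousOn_extChartAt_symm x₀).mono hKt)).isClosed
  refine ⟨h.ordConnected.inter ordConnected_Ioi, h.discrete,
    fun s hs => coord_mem_coordTarget (hdom s hs),
    fun s hs => (mem_charSet_iff g (hdom s hs)).1 (h.mem_char s (hsub hs)),
    fun s hs => ((hasDerivWithinAt_coord_iff g (hdom s hs) (h.mem_char s (hsub hs))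
      (h.continuousWithinAt s (hsub hs))).1 (h.hasDeriv s (hsub hs))).mono hsub, ?_⟩
  intro S hS
  obtain ⟨ρ, hρ, t1, t2⟩ := h.exists_limits hS.2
  obtain ⟨r, hr⟩ := ((eventually_of_lt_forall (hb S hS.1.1) (fun s _ hs => hs)).and
    self_mem_nhdsWithin : ∀ᶠ s in 𝓝[J \ B] b, S < s ∧ s ∈ J \ B).exists
  have := nhdsWithin_diff_Ioi_neBot h.ordConnected h.discrete hr.2.1 hS.1.1 hr.1
  -- A jump `S < b` has points of the curve to its right; their bases lie in the closed image of
  -- `K`, and `Σ` does not move the base, so the limits at the jump are in the chart as well.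
  have hρK : Phase.base ρ ∈ (extChartAt (𝓡∂ d) x₀).symm '' K := by
    refine hKM.mem_of_tendsto ((continuous_base.tendsto (reflection g ρ)).comp t2) ?_
    filter_upwards [self_mem_nhdsWithin] with u hu
    have h1 := hγ u hu.1 (lt_trans hS.1.2 hu.2)
    refine ⟨_, h1.2, (extChartAt (𝓡∂ d) x₀).left_inv ?_⟩
    rw [extChartAt_source]
    exact h1.1
  have hρdom : ρ ∈ chartDom x₀ := by
    obtain ⟨y, hy, hyρ⟩ := hρK
    have := (extChartAt (𝓡∂ d) x₀).map_target (hKt hy)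
    rw [hyρ, extChartAt_source] at this
    exact this
  obtain ⟨a1, a2, a3⟩ := (mem_hypMinus_iff g hρdom).1 hρ
  have key : ∀ {T : Set ℝ} {ρ' : Phase d M}, ρ' ∈ chartDom x₀ →
      Tendsto γ (𝓝[(J \ B) ∩ T] S) (𝓝 ρ') →
      Tendsto (fun s => coord x₀ (γ s)) (𝓝[((J ∩ Ioi c) \ B) ∩ T] S) (𝓝 (coord x₀ ρ')) := by
    intro T ρ' hρ' ht
    refine (tendsto_iff_tendsto_coord hρ' ?_).1
      (ht.mono_left (nhdsWithin_mono _ (inter_subset_inter_left _ hsub)))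
    filter_upwards [self_mem_nhdsWithin] with u hu using hdom u hu.1
  refine ⟨coord x₀ ρ, coord_mem_coordTarget hρdom, a1, a3, key hρdom t1, ?_⟩
  rw [← coord_reflection g hρdom hρ.1]
  exact key hρdom t2

theorem IsLocalCurve.congr {g : Metric d M} {x₀ : M} {J B : Set ℝ} {q q' : ℝ → LocalPhase d}
    (h : IsLocalCurve g x₀ J B q) (hq : EqOn q' q (J \ B)) : IsLocalCurve g x₀ J B q' := by
  refine ⟨h.ordConnected, h.discrete, fun s hs => hq hs ▸ h.mem s hs,
    fun s hs => hq hs ▸ h.symbol s hs, fun s hs => ?_, fun S hS => ?_⟩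
  · rw [hq hs]
    exact (h.hasDeriv s hs).congr hq (hq hs)
  · obtain ⟨q₁, a1, a2, a3, a4, a5⟩ := h.jump S hS
    have hev : ∀ T, q =ᶠ[𝓝[(J \ B) ∩ T] S] q' := fun T => by
      filter_upwards [self_mem_nhdsWithin] with u hu using (hq hu.1).symm
    exact ⟨q₁, a1, a2, a3, a4.congr' (hev _), a5.congr' (hev _)⟩

theorem nhdsWithin_inter_Ioi_diff {J B : Set ℝ} {b c : ℝ} (hc : c < b) :
    𝓝[(J ∩ Ioi c) \ B] b = 𝓝[J \ B] b :=
  nhdsWithin_eq_nhdsWithin' (Ioi_mem_nhds hc) (by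
    ext s
    simp only [mem_inter_iff, Set.mem_sdiff, mem_Ioi]
    tauto)

/-- A generalized bicharacteristic extends to the end of its interval. -/
theorem IsGenBichar.exists_insert [T2Space M] [CompactSpace M] {g : Metric d M} {J B : Set ℝ}
    {γ : ℝ → Phase d M} (h : IsGenBichar g J B γ) {b : ℝ} (hb : ∀ s ∈ J, s < b)
    (hbot : (𝓝[J \ B] b).NeBot) :
    ∃ (B' : Set ℝ) (γ' : ℝ → Phase d M), IsGenBichar g (insert b J) B' γ' ∧ B' ∩ J = B ∧
      EqOn γ' γ (J \ B) := by
  obtain ⟨x₀, K, hK, hKt, c, hc, hγ⟩ := h.exists_chart hb hbot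
  have hbJ : b ∉ J := fun hbJ => (hb b hbJ).false
  have hbB : b ∉ B := fun hbB => hbJ (h.subset hbB)
  have hJ' := ordConnected_insert_of_neBot h.ordConnected sdiff_subset hb hbot
  have hnt : (insert b J).Nontrivial := h.nontrivial.mono (subset_insert _ _)
  have hlc := h.isLocalCurve hb hbot hK hKt hγ
  have hb' : ∀ s ∈ J ∩ Ioi c, s < b := fun s hs => hb s hs.1
  have hnh : 𝓝[(J ∩ Ioi c) \ B] b = 𝓝[J \ B] b := nhdsWithin_inter_Ioi_diff hc
  have hbot' : (𝓝[(J ∩ Ioi c) \ B] b).NeBot := hnh ▸ hbot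
  obtain ⟨s₀, hs₀⟩ := h.exists_mem_diff
  obtain ⟨C, hC⟩ := exists_norm_hamField_le g x₀ hK hKt (γ s₀).tau
  have hsub : (J ∩ Ioi c) \ B ⊆ J \ B := sdiff_subset_sdiff_left inter_subset_left
  obtain ⟨w, hw, hqw⟩ := hlc.exists_tendsto hb' hbot'
    (fun s hs => hC _ (hγ s (hsub hs) hs.1.2).2 (h.tau_eq hs₀ (hsub hs)) (hlc.symbol s hs))
    hK.isClosed hKt (fun s hs => (hγ s (hsub hs) hs.1.2).2)
  set ρ := coordInv x₀ w with hρdef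
  have hρ : ρ ∈ chartDom x₀ := coordInv_mem_chartDom hw
  have hcρ : coord x₀ ρ = w := coord_coordInv hw
  have htγ : Tendsto γ (𝓝[J \ B] b) (𝓝 ρ) := by
    rw [tendsto_iff_tendsto_coord hρ (eventually_of_lt_forall hc fun s hs hcs => (hγ s hs hcs).1),
      hcρ, ← hnh]
    exact hqw
  have hpw : symbolLoc g x₀ w = 0 := by
    refine tendsto_nhds_unique (hlc.tendsto_comp hw hqw (continuousOn_symbolLoc g x₀))
      (tendsto_const_nhds.congr' ?_)
    filter_upwards [self_mem_nhdsWithin] with s hs using (hlc.symbol s hs).symm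
  have hchar : ρ ∈ charSet g := (mem_charSet_iff g hρ).2 (by rw [hcρ, hpw])
  by_cases hminus : ρ ∈ hypMinus g
  -- An incoming hyperbolic limit: `b` becomes a reflection time. The interval has no room to its
  -- right, so only the limit from the left has to be provided.
  · obtain ⟨c', hc', hreg⟩ := hlc.exists_lt_of_velocity_neg hb' hbot' hw hqw
      (hcρ ▸ ((mem_hypMinus_iff g hρ).1 hminus).2.2)
    have hset : insert b J \ insert b B = J \ B := by
      ext s
      simp only [Set.mem_sdiff, mem_insert_iff]
      constructor
      · rintro ⟨rfl | h1, h2⟩ <;> tauto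
      · rintro ⟨h1, h2⟩
        exact ⟨Or.inr h1, fun h3 => h3.elim (fun h4 => hbJ (h4 ▸ h1)) h2⟩
    have hright : ¬∃ ε > 0, Icc b (b + ε) ⊆ insert b J := by
      rintro ⟨ε, hε, hI⟩
      rcases hI ⟨by linarith, le_rfl⟩ with h1 | h1
      · linarith
      · linarith [hb _ h1]
    refine ⟨insert b B, γ, (isGenBichar_iff g).2 ⟨hJ', hnt, insert_subset_insert h.subset, ?_⟩,
      ?_, fun s _ => rfl⟩
    · rintro s (rfl | hs)
      · refine ⟨fun _ => ?_, fun hx => absurd (mem_insert _ _) hx,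
          fun hx => absurd (mem_insert _ _) hx, fun hx => absurd (mem_insert _ _) hx,
          fun hx => absurd (mem_insert _ _) hx, fun _ => ?_, fun _ _ => ⟨ρ, hminus, ?_⟩,
          fun _ hx => absurd hx hright, fun _ hx => absurd ?_ hright⟩
        · filter_upwards [self_mem_nhdsWithin,
            nhdsWithin_le_nhds (Ioi_mem_nhds (max_lt hc hc'))] with r hr1 hr2 hr3
          rw [mem_Ioi, max_lt_iff] at hr2
          rcases hr3 with h1 | h1
          · exact hr1 h1
          · exact (hreg r ⟨h.subset h1, hr2.1⟩ hr2.2).1 h1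
        · rw [hset]
          filter_upwards [self_mem_nhdsWithin,
            nhdsWithin_le_nhds (Ioi_mem_nhds (max_lt hc hc'))] with r hr1 hr2
          rw [mem_Ioi, max_lt_iff] at hr2
          rw [mem_boundaryPhase_iff (hγ r hr1 hr2.1).1]
          exact (hreg r ⟨hr1.1, hr2.1⟩ hr2.2).2
        · rw [hset]
          exact htγ.mono_left (nhdsWithin_mono _ inter_subset_left)
        · obtain ⟨ε, hε, hI⟩ := hx
          exact ⟨ε, hε, (Icc_subset_Icc (by linarith) le_rfl).trans hI⟩
      · refine (h.at hs).congr (Iio_mem_nhds (hb s hs)) hs ?_ ?_ (fun r _ => rfl)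
        · rw [insert_inter_of_notMem (by simp)]
        · rw [insert_inter_of_notMem (by simp)]
    · rw [insert_inter_of_notMem hbJ, inter_eq_left.2 h.subset]
  -- Otherwise the limit is not hyperbolic: on the boundary its normal velocity is not positive
  -- since the curve arrives from inside, and not negative by assumption.
  · have hwg : w.2.1 0 = 0 → HpzLoc g x₀ w = 0 := by
      intro hz
      have h1 := hlc.velocity_limit_nonpos hb' hbot' hw hqw hz
      refine le_antisymm h1 (not_lt.1 fun h2 => hminus ?_)
      rw [mem_hypMinus_iff g hρ, hcρ]
      exact ⟨hz, hpw, h2⟩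
    have hplus : ρ ∉ hypPlus g := by
      rw [mem_hypPlus_iff g hρ, hcρ]
      rintro ⟨hz, -, h2⟩
      exact h2.ne' (hwg hz)
    have hins : insert b J \ B = insert b (J \ B) := insert_sdiff_of_notMem _ hbB
    set γ' := Function.update γ b ρ with hγ'
    have hγb : γ' b = ρ := Function.update_self _ _ _
    have heq : EqOn γ' γ (J \ B) := fun s hs => Function.update_of_ne (hb s hs.1).ne _ _
    refine ⟨B, γ', (isGenBichar_iff g).2 ⟨hJ', hnt, h.subset.trans (subset_insert _ _), ?_⟩,
      inter_eq_left.2 h.subset, heq⟩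
    rintro s (rfl | hs)
    · have hcont : ContinuousWithinAt γ' (insert s J \ B) s := by
        rw [hins, continuousWithinAt_insert_self, ContinuousWithinAt, hγb]
        refine htγ.congr' ?_
        filter_upwards [self_mem_nhdsWithin] with u hu using (heq hu).symm
      refine ⟨fun hx => absurd hx hbB, fun _ => hγb ▸ hchar, fun _ => hγb ▸ ?_, fun _ => hcont,
        fun _ => ?_, fun hx => absurd hx hbB, fun hx => absurd hx hbB, fun hx => absurd hx hbB,
        fun hx => absurd hx hbB⟩
      · rintro (h1 | h1)
        · exact hplus h1
        · exact hminus h1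
      · refine (hasDerivWithinAt_coord_iff g (x₀ := x₀) (by rwa [hγb]) (hγb ▸ hchar) hcont).2 ?_
        have hlc' : IsLocalCurve g x₀ (J ∩ Ioi c) B (fun r => coord x₀ (γ' r)) :=
          hlc.congr fun r hr => by simp only [heq (hsub hr)]
        have hd := hlc'.hasDerivWithinAt_limit hb' hbot' hbB (by simpa only [hγb, hcρ] using hw) ?_
          (by simpa only [hγb, hcρ] using hwg)
        · refine hd.mono_of_mem_nhdsWithin ?_
          rw [hins]
          filter_upwards [self_mem_nhdsWithin, nhdsWithin_le_nhds (Ioi_mem_nhds hc)] with u hu hcu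
          exact hu.imp id fun h1 => ⟨⟨h1.1, hcu⟩, h1.2⟩
        · simp only [hγb, hcρ]
          refine hqw.congr' ?_
          filter_upwards [self_mem_nhdsWithin] with u hu
          simp only [heq (hsub hu)]
    · refine (h.at hs).congr (Iio_mem_nhds (hb s hs)) hs ?_ rfl (fun r hr => (heq hr.1).symm)
      rw [insert_inter_of_notMem (by simp)]

/-! ### Maximal curves are global -/

theorem exists_local_forward_at [T2Space M] (g : Metric d M) {ρ₀ : Phase d M}
    (hρ : ρ₀ ∈ charSet g) (hm : ρ₀ ∉ hypMinus g) (b : ℝ) :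
    ∃ ε > 0, ∃ (B : Set ℝ) (γ : ℝ → Phase d M), IsGenBichar g (Icc b (b + ε)) B γ ∧
      (ρ₀ ∉ hypPlus g → b ∉ B ∧ γ b = ρ₀) ∧
      (ρ₀ ∈ hypPlus g → b ∈ B ∧ Tendsto γ (𝓝[(Icc b (b + ε) \ B) ∩ Ioi b] b) (𝓝 ρ₀)) := by
  obtain ⟨ε, hε, B, γ, h, h1, h2⟩ := exists_local_forward g hρ hm
  have hJ : (fun s => s + -b) ⁻¹' Icc 0 ε = Icc b (b + ε) := by
    ext s
    simp only [mem_preimage, mem_Icc]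
    constructor <;> rintro ⟨h1, h2⟩ <;> constructor <;> linarith
  have ht := h.translate (-b)
  rw [hJ] at ht
  refine ⟨ε, hε, _, _, ht, fun hp => ?_, fun hp => ⟨?_, ?_⟩⟩
  · simpa using h1 hp
  · simpa using (h2 hp).1
  · refine (h2 hp).2.comp (tendsto_nhdsWithin_iff.2 ⟨?_, ?_⟩)
    · have : Tendsto (fun s : ℝ => s + -b) (𝓝 b) (𝓝 (b + -b)) :=
        (continuous_id.add continuous_const).tendsto b
      rw [add_neg_cancel] at this
      exact this.mono_left nhdsWithin_le_nhds
    · filter_upwards [self_mem_nhdsWithin] with s hs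
      refine ⟨⟨?_, hs.1.2⟩, ?_⟩
      · have := hs.1.1
        rwa [← hJ] at this
      · have := hs.2
        simp only [mem_Ioi] at this ⊢
        linarith

namespace IsGenBichar

variable {g : Metric d M} {J B : Set ℝ} {γ : ℝ → Phase d M}

/-- At a final time in `J`, a new local curve starts from `γ b`, or from the reflection of the left
limit if `b` is a jump. -/
theorem exists_extension_of_max [T2Space M] (h : IsGenBichar g J B γ) {b : ℝ} (hbJ : b ∈ J)
    (hb : ∀ s ∈ J, s ≤ b) :
    ∃ (J' B' : Set ℝ) (γ' : ℝ → Phase d M), IsGenBichar g J' B' γ' ∧ J ⊆ J' ∧ B' ∩ J = B ∧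
      EqOn γ' γ (J \ B) ∧ J' ≠ J := by
  obtain ⟨u, hu, hub⟩ : ∃ u ∈ J, u < b := by
    obtain ⟨u, hu, v, hv, huv⟩ := h.nontrivial
    rcases lt_or_gt_of_ne huv with h1 | h1
    · exact ⟨u, hu, h1.trans_le (hb v hv)⟩
    · exact ⟨v, hv, h1.trans_le (hb u hu)⟩
  have hbot := nhdsWithin_diff_Iio_neBot h.ordConnected h.discrete hu hbJ hub
  obtain ⟨ε, hε, B₂, γ₂, h₂, hB, hval, hrefl⟩ : ∃ ε > 0, ∃ (B₂ : Set ℝ) (γ₂ : ℝ → Phase d M),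
      IsGenBichar g (Icc b (b + ε)) B₂ γ₂ ∧ (b ∈ B ↔ b ∈ B₂) ∧ (b ∉ B → γ b = γ₂ b) ∧
      (b ∈ B → ∀ ρ₁ ρ₂ : Phase d M, Tendsto γ (𝓝[(J \ B) ∩ Iio b] b) (𝓝 ρ₁) →
        Tendsto γ₂ (𝓝[(Icc b (b + ε) \ B₂) ∩ Ioi b] b) (𝓝 ρ₂) → ρ₂ = reflection g ρ₁) := by
    by_cases hbB : b ∈ B
    · obtain ⟨ρ, hρ, t1, -⟩ := h.exists_limits hbB
      have hp := reflection_mem_hypPlus g hρ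
      obtain ⟨ε, hε, B₂, γ₂, h₂, -, h3⟩ := exists_local_forward_at g hp.2.1
        (fun hm => (hm.2.2.trans hp.2.2).false) b
      obtain ⟨h4, h5⟩ := h3 hp
      refine ⟨ε, hε, B₂, γ₂, h₂, iff_of_true hbB h4, fun hx => absurd hbB hx, ?_⟩
      intro _ ρ₁ ρ₂ t2 t3
      have := nhdsWithin_diff_Ioi_neBot h₂.ordConnected h₂.discrete
        (right_mem_Icc.2 (by linarith : b ≤ b + ε)) (left_mem_Icc.2 (by linarith : b ≤ b + ε))
        (by linarith)
      rw [tendsto_phase_unique t2 t1, tendsto_phase_unique t3 h5]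
    · have hnh := h.notMem_hyp b ⟨hbJ, hbB⟩
      obtain ⟨ε, hε, B₂, γ₂, h₂, h3, -⟩ := exists_local_forward_at g (h.mem_char b ⟨hbJ, hbB⟩)
        (fun hm => hnh (Or.inr hm)) b
      obtain ⟨h4, h5⟩ := h3 fun hp => hnh (Or.inl hp)
      exact ⟨ε, hε, B₂, γ₂, h₂, iff_of_false hbB h4, fun _ => h5.symm, fun hx => absurd hx hbB⟩
  refine ⟨_, _, _, isGenBichar_glue h h₂ hbJ (left_mem_Icc.2 (by linarith)) hb
    (fun s hs => hs.1) hB hval hrefl, subset_union_left, ?_, fun s hs => if_pos (hb s hs.1),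
    fun he => ?_⟩
  · ext s
    constructor
    · rintro ⟨h1 | h1, h2⟩
      · exact h1
      · have : s = b := le_antisymm (hb s h2) (h₂.subset h1).1
        subst this
        exact hB.2 h1
    · exact fun h1 => ⟨Or.inl h1, h.subset h1⟩
  · have : b + ε ∈ J := he ▸ Or.inr (right_mem_Icc.2 (by linarith))
    linarith [hb _ this]

theorem exists_extension [T2Space M] [CompactSpace M] (h : IsGenBichar g J B γ)
    (hJ : BddAbove J) :
    ∃ (J' B' : Set ℝ) (γ' : ℝ → Phase d M), IsGenBichar g J' B' γ' ∧ J ⊆ J' ∧ B' ∩ J = B ∧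
      EqOn γ' γ (J \ B) ∧ J' ≠ J := by
  by_cases hbJ : sSup J ∈ J
  · exact h.exists_extension_of_max hbJ fun s hs => le_csSup hJ hs
  -- If the supremum is not attained, adding it is already a proper extension.
  have hb : ∀ s ∈ J, s < sSup J := fun s hs =>
    lt_of_le_of_ne (le_csSup hJ hs) fun he => hbJ (he ▸ hs)
  have hbot : (𝓝[J \ B] sSup J).NeBot := by
    rw [← mem_closure_iff_nhdsWithin_neBot, Metric.mem_closure_iff]
    intro ε hε
    obtain ⟨u, hu, hub⟩ := exists_lt_of_lt_csSup h.nontrivial.nonempty (sub_lt_self (sSup J) hε)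
    obtain ⟨v, hv, huv⟩ := exists_lt_of_lt_csSup h.nontrivial.nonempty (hb u hu)
    have := nhdsWithin_diff_Iio_neBot h.ordConnected h.discrete hu hv huv
    obtain ⟨r, hr⟩ := ((eventually_of_lt_forall huv (fun s _ hs => hs)).and
      self_mem_nhdsWithin : ∀ᶠ s in 𝓝[(J \ B) ∩ Iio v] v, u < s ∧ s ∈ (J \ B) ∩ Iio v).exists
    refine ⟨r, hr.2.1, ?_⟩
    rw [Real.dist_eq, abs_lt]
    constructor <;> linarith [hb r hr.2.1.1, hr.1]
  obtain ⟨B', γ', h', hB', hγ'⟩ := h.exists_insert hb hbot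
  refine ⟨_, B', γ', h', subset_insert _ _, hB', hγ', fun he => hbJ ?_⟩
  rw [← Set.ext_iff.1 he]
  exact mem_insert _ _

end IsGenBichar

namespace IsMaximalGenBichar

variable {g : Metric d M} {J B : Set ℝ} {γ : ℝ → Phase d M}

theorem reverse (h : IsMaximalGenBichar g J B γ) :
    IsMaximalGenBichar g (Neg.neg ⁻¹' J) (Neg.neg ⁻¹' B) (fun s => GenBichar.reverse (γ (-s))) := by
  refine ⟨h.1.reverse, fun J' B' γ' h' hJ hB hγ => ?_⟩
  have h1 := h.2 _ _ _ h'.reverse (fun s hs => hJ (by simpa using hs)) ?_ ?_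
  · rw [← h1]
    ext s
    simp
  · ext s
    have := Set.ext_iff.1 hB (-s)
    simpa using this
  · intro s hs
    have := hγ (x := -s) (by simpa using hs)
    simp only [this, neg_neg, reverse_reverse]

theorem not_bddAbove [T2Space M] [CompactSpace M] (h : IsMaximalGenBichar g J B γ) :
    ¬BddAbove J := fun hJ => by
  obtain ⟨J', B', γ', h', h1, h2, h3, h4⟩ := h.1.exists_extension hJ
  exact h4 (h.2 J' B' γ' h' h1 h2 h3)

/-- A maximal generalized bicharacteristic is defined on the whole line. -/
theorem eq_univ [T2Space M] [CompactSpace M] (h : IsMaximalGenBichar g J B γ) : J = univ := by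
  refine eq_univ_of_forall fun s => ?_
  obtain ⟨v, hv, hsv⟩ := not_bddAbove_iff.1 h.not_bddAbove s
  obtain ⟨u, hu, hsu⟩ := not_bddAbove_iff.1 h.reverse.not_bddAbove (-s)
  exact h.1.ordConnected.out hu hv ⟨by linarith, hsv.le⟩

end IsMaximalGenBichar

theorem exists_maximal_forward [T2Space M] [CompactSpace M] (g : Metric d M) {ρ₀ : Phase d M}
    (hρ : ρ₀ ∈ charSet g) (hm : ρ₀ ∉ hypMinus g) :
    ∃ (B : Set ℝ) (γ : ℝ → Phase d M), IsMaximalGenBichar g univ B γ ∧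
      (ρ₀ ∉ hypPlus g → 0 ∉ B ∧ γ 0 = ρ₀) ∧
      (ρ₀ ∈ hypPlus g → 0 ∈ B ∧ Tendsto γ (𝓝[(univ \ B) ∩ Ioi 0] 0) (𝓝 ρ₀)) := by
  obtain ⟨ε, hε, B, γ, h, h1, h2⟩ := exists_local_forward g hρ hm
  obtain ⟨J', B', γ', h', hJ, hB, hγ⟩ := h.exists_maximal
  obtain rfl := h'.eq_univ
  have h0 : (0 : ℝ) ∈ Icc 0 ε := left_mem_Icc.2 hε.le
  have hmem : ∀ {s}, s ∈ Icc 0 ε → (s ∈ B' ↔ s ∈ B) := fun {s} hs => by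
    rw [← hB, mem_inter_iff, and_iff_left hs]
  refine ⟨B', γ', h', fun hp => ?_, fun hp => ⟨(hmem h0).2 (h2 hp).1, ?_⟩⟩
  · obtain ⟨h3, h4⟩ := h1 hp
    exact ⟨fun hx => h3 ((hmem h0).1 hx), by rw [hγ ⟨h0, h3⟩, h4]⟩
  · have hset : 𝓝[(univ \ B') ∩ Ioi 0] (0 : ℝ) = 𝓝[(Icc 0 ε \ B) ∩ Ioi 0] 0 := by
      refine nhdsWithin_eq_nhdsWithin' (Iio_mem_nhds hε) ?_
      ext s
      simp only [mem_inter_iff, Set.mem_sdiff, mem_univ, true_and, mem_Ioi, mem_Iio]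
      constructor
      · rintro ⟨⟨a1, a2⟩, a3⟩
        have hs : s ∈ Icc 0 ε := ⟨a2.le, a3.le⟩
        exact ⟨⟨⟨hs, fun hx => a1 ((hmem hs).2 hx)⟩, a2⟩, a3⟩
      · rintro ⟨⟨⟨a0, a1⟩, a2⟩, a3⟩
        exact ⟨⟨fun hx => a1 ((hmem a0).1 hx), a2⟩, a3⟩
    rw [hset]
    refine (h2 hp).2.congr' ?_
    filter_upwards [self_mem_nhdsWithin] with s hs using (hγ hs.1).symm

end Curves

end GenBichar

end

/-! ### The theorem -/

theorem mainTheorem2 {d : ℕ} [NeZero d] {M : Type*} [TopologicalSpace M] [T2Space M]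
    [CompactSpace M] [ConnectedSpace M] [ChartedSpace (EuclideanHalfSpace d) M]
    [IsManifold (𝓡∂ d) 2 M] (g : GenBichar.Metric d M) :
    (∀ (J B : Set ℝ) (γ : ℝ → GenBichar.Phase d M), GenBichar.IsMaximalGenBichar g J B γ →
      J = Set.univ ∧
      ∃ τ₀ : ℝ, (∀ s ∈ J \ B, (γ s).tau = τ₀) ∧
        (τ₀ ≠ 0 → ∃ t : ℝ → ℝ, Continuous t ∧ (∀ s ∈ J \ B, t s = (γ s).time) ∧
          Set.range t = Set.univ)) ∧
    (∀ ρ₀ ∈ GenBichar.charSet g, ∃ (B : Set ℝ) (γ : ℝ → GenBichar.Phase d M),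
      GenBichar.IsMaximalGenBichar g Set.univ B γ ∧
      (ρ₀ ∉ GenBichar.hyp g → 0 ∉ B ∧ γ 0 = ρ₀) ∧
      (ρ₀ ∈ GenBichar.hypPlus g →
        0 ∈ B ∧ Filter.Tendsto γ (𝓝[(Set.univ \ B) ∩ Set.Ioi 0] 0) (𝓝 ρ₀)) ∧
      (ρ₀ ∈ GenBichar.hypMinus g →
        0 ∈ B ∧ Filter.Tendsto γ (𝓝[(Set.univ \ B) ∩ Set.Iio 0] 0) (𝓝 ρ₀))) := by
  refine ⟨fun J B γ h => ⟨h.eq_univ, ?_⟩, fun ρ₀ hρ => ?_⟩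
  · obtain ⟨s₀, hs₀⟩ := h.1.exists_mem_diff
    refine ⟨(γ s₀).tau, fun s hs => h.1.tau_eq hs₀ hs, fun hτ =>
      ⟨fun s => (γ s₀).time - 2 * (γ s₀).tau * (s - s₀), by fun_prop,
        fun s hs => (h.1.time_eq hs₀ hs).symm, eq_univ_of_forall fun y => ?_⟩⟩
    -- The solution of the affine equation `t = y`, available since `τ ≠ 0`.
    refine ⟨s₀ - (y - (γ s₀).time) / (2 * (γ s₀).tau), ?_⟩
    field_simp
    ring
  · by_cases hm : ρ₀ ∈ GenBichar.hypMinus g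
    -- A point of `ℋ⁻` is the left limit at time `0` of the reversal of a curve that starts, in the
    -- sense of right limits, at the reversed point of `ℋ⁺`.
    · have hp : GenBichar.reverse ρ₀ ∈ GenBichar.hypPlus g :=
        (GenBichar.reverse_mem_hypPlus g).2 hm
      obtain ⟨B, γ, h, -, h2⟩ := GenBichar.exists_maximal_forward g hp.2.1
        (fun hm' => (hm'.2.2.trans hp.2.2).false)
      obtain ⟨h3, h4⟩ := h2 hp
      refine ⟨Neg.neg ⁻¹' B, fun s => GenBichar.reverse (γ (-s)), by simpa using h.reverse,
        fun hh => absurd (Or.inr hm) hh, fun hp' => absurd (hm.2.2.trans hp'.2.2) (lt_irrefl _),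
        fun _ => ⟨by simpa using h3, ?_⟩⟩
      have h5 := (GenBichar.continuous_reverse.tendsto _).comp h4
      rw [GenBichar.reverse_reverse] at h5
      refine h5.comp (tendsto_nhdsWithin_iff.2 ⟨?_, ?_⟩)
      · have : Tendsto (fun s : ℝ => -s) (𝓝 0) (𝓝 (-0)) := continuous_neg.tendsto 0
        rw [neg_zero] at this
        exact this.mono_left nhdsWithin_le_nhds
      · filter_upwards [self_mem_nhdsWithin] with s hs
        exact ⟨⟨mem_univ _, hs.1.2⟩, mem_Ioi.2 (neg_pos.2 (mem_Iio.1 hs.2))⟩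
    · obtain ⟨B, γ, h, h1, h2⟩ := GenBichar.exists_maximal_forward g hρ hm
      exact ⟨B, γ, h, fun hh => h1 fun hp => hh (Or.inl hp), h2, fun hm' => absurd hm' hm⟩
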